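/- Let $\Bbbk$ be a field and $n\ge 1$. Let $A=A_n^!$ be the path algebra of the quiver with vertices $1,\dots,n$ and arrows $(i|i-1)$ from $i-1$ to $i$ and $(i-1|i)$ from $i$ to $i-1$ ($2\le i\le n$), modulo the relations $(i|i-1|i)=(i|i+1|i)$ for $1\le i\le n-1$, where $(1|0|1)=0$; here $(i_r|\cdots|i_1)=(i_r|i_{r-1})\cdots(i_2|i_1)$ and $(i)$ is the idempotent of the vertex $i$. Grade $A$ by path length. $\mathrm{HH}^m(A)$ is the cohomology of the complex of cochains $A^{\otimes m}\to A$, and $\mathrm{HH}^{m,j}(A)\subseteq \mathrm{HH}^m(A)$ is the subspace of classes of cocycles that raise the path-length degree by $j$; then $\mathrm{HH}^m(A)=\bigoplus_{j\in\mathbb Z}\mathrm{HH}^{m,j}(A)$. Write $M\langle r\rangle$ for the shift $(M\langle r\rangle)_d=M_{d-r}$. (1) There is a graded projective resolution of $A$ as an $A$-bimodule $$0\to\bigoplus_{i=1}^{n-1}A(i)\otimes(i)A\langle2\rangle\xrightarrow{f_2}\bigoplus_{i=2}^{n}A(i)\otimes(i-1)A\langle1\rangle\oplus\bigoplus_{i=2}^{n}A(i-1)\otimes(i)A\langle1\rangle\xrightarrow{f_1}\bigoplus_{i=1}^nA(i)\otimes(i)A\xrightarrow{\varepsilon}A\to0$$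 where $\varepsilon((i)\otimes(i))=(i)$, $$f_1((i)\otimes(i-1))=(i|i-1)\otimes(i-1)-(i)\otimes(i|i-1),\qquad f_1((i-1)\otimes(i))=(i-1|i)\otimes(i)-(i-1)\otimes(i-1|i),$$ $$f_2((i)\otimes(i))=(i|i+1)\otimes(i)+(i)\otimes(i+1|i)-(i)\otimes(i-1|i)-(i|i-1)\otimes(i),$$ the last two terms being absent for $i=1$. (2) $\mathrm{HH}^m(A)=0$ for $m\ge3$. (3) $\mathrm{HH}^0(A)$, which is the center of $A$, is isomorphic as a graded algebra to $\Bbbk[c]/(c^n)$, where $c=(2|1|2)+\cdots+(n|n-1|n)$ has degree $2$; so $\mathrm{HH}^{0,2j}(A)\cong\Bbbk$ for $0\le j\le n-1$, and all other $\mathrm{HH}^{0,j}(A)$ are zero. (4) $\mathrm{HH}^{1,j}(A)\cong\Bbbk$ for $j=0,2,\dots,2(n-2)$ (for no $j$ if $n=1$), and $\mathrm{HH}^{1,j}(A)=0$ for all other $j$. (5) $\mathrm{HH}^{2,-2}(A)\cong\Bbbk^{n-1}$ and $\mathrm{HH}^{2,j}(A)=0$ for $j\ne-2$. (6) For $2\le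 i\le n$ there is a Hochschild $2$-cocycle $\mu_i$ of $A$ of internal degree $-2$ that vanishes when one of its arguments is a vertex and whose values on pairs of arrows are $\mu_i((i|i-1)\otimes(i-1|i))=-(i)$, $\mu_i((i-1|i)\otimes(i|i-1))=-(i-1)$, and zero on all other pairs. For every choice of such cocycles, the classes of $\mu_2,\dots,\mu_n$ form a basis of $\mathrm{HH}^2(A)$. (7) These cocycles realize the deformation of $A$ to $W(n,1)$. Here $W(n,1)$ is the $\Bbbk$-algebra with generators $y_1,\dots,y_{n+1}$, $\psi_1,\dots,\psi_n$, $e_1,\dots,e_{n+1}$ ($e_p$ corresponding to the sequence of $n$ letters $\mathfrak r$ and one letter $\mathfrak b$ with $\mathfrak b$ in position $p$) and relations: the $e_p$ are orthogonal idempotents with sum $1$; $y_je_p=e_py_j$; $y_jy_l=y_ly_j$; $\psi_je_p=e_{s_j(p)}\psi_j$ with $s_j=(j\;j+1)$; $\psi_je_p=0$ if $p\notin\{j,j+1\}$; $\psi_j\psi_le_p=\psi_l\psi_je_p$ if $|j-l|>1$; $(\psi_je_p)(y_le_p)=(y_le_{s_j(p)})(\psi_je_p)$ if $l\ne j,j+1$;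 $\psi_jy_je_p=y_{j+1}\psi_je_p$ and $y_j\psi_je_p=\psi_jy_{j+1}e_p$; $\psi_j^2e_j=(y_j-y_{j+1})e_j$ and $\psi_j^2e_{j+1}=(y_{j+1}-y_j)e_{j+1}$; $\psi_j\psi_{j+1}\psi_je_p=\psi_{j+1}\psi_j\psi_{j+1}e_p$; $e_1=0$. Let $x_l\in W(n,1)$ ($1\le l\le n$) be the sum over $p$ of $y_re_p$, where $r$ is the position of the $l$-th letter $\mathfrak r$. The $x_l$ are central, and there are a surjective algebra homomorphism $\pi\colon W(n,1)\to A$ with kernel $(x_1,\dots,x_n)$ and $\pi(e_{v+1})=(v)$ for $1\le v\le n$, $\pi(\psi_ie_i)=(i|i-1)$, $\pi(\psi_ie_{i+1})=(i-1|i)$ for $2\le i\le n$, a linear section $s$ of $\pi$ such that $\Bbbk[x_1,\dots,x_n]\otimes A\to W(n,1)$, $f\otimes a\mapsto f\,s(a)$, is bijective, and bilinear maps $\mu_1,\dots,\mu_n\colon A\times A\to A$ such that $$s(a)s(b)\equiv s(ab)+\sum_{l=1}^nx_l\,s(\mu_l(a,b))\pmod{(x_1,\dots,x_n)^2}\qquad(a,b\in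 A),$$ where $\mu_2,\dots,\mu_n$ are cocycles as in (6). -/

import Mathlib

open scoped TensorProduct
open MulOpposite

noncomputable section

namespace RedottedWebster

universe u v

/-! ## Hochschild cohomology through the bar cochain complex -/

section Hochschild

variable (k : Type u) [Field k] (A : Type v) [Ring A] [Algebra k A]

/-- Hochschild `m`-cochains of `A` with coefficients in `A`: the `k`-linear maps `A^{⊗ m} → A`. -/
abbrev Cochain (m : ℕ) : Type v := MultilinearMap k (fun _ : Fin m => A) A

instance cochainAddCommGroup (m : ℕ) : AddCommGroup (Cochain k A m) :=
  MultilinearMap.instAddCommGroup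

variable {k A}

theorem contractNth_update {m : ℕ} (i : Fin m) (g : Fin (m + 1) → A) (t : Fin (m + 1)) :
    ∃ (s : Fin m) (L : A →ₗ[k] A), ∀ x : A,
      Fin.contractNth i.castSucc (· * ·) (Function.update g t x) =
        Function.update (Fin.contractNth i.castSucc (· * ·) g) s (L x) := by
  rcases lt_trichotomy t.val i.val with h | h | h
  · refine ⟨⟨t.val, by omega⟩, LinearMap.id, fun x => ?_⟩
    funext l
    simp only [Fin.contractNth, Function.update_apply, Fin.ext_iff, Fin.val_castSucc,
      Fin.val_succ, LinearMap.id_apply]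
    split_ifs <;> first | rfl | omega
  · refine ⟨i, LinearMap.mulRight k (g i.succ), fun x => ?_⟩
    funext l
    simp only [Fin.contractNth, Function.update_apply, Fin.ext_iff, Fin.val_castSucc,
      Fin.val_succ, LinearMap.mulRight_apply]
    split_ifs <;> first | rfl | omega | (congr 2; apply Fin.ext; simp; omega)
  · by_cases h' : t.val = i.val + 1
    · refine ⟨i, LinearMap.mulLeft k (g i.castSucc), fun x => ?_⟩
      funext l
      simp only [Fin.contractNth, Function.update_apply, Fin.ext_iff, Fin.val_castSucc,
        Fin.val_succ, LinearMap.mulLeft_apply]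
      split_ifs <;> first | rfl | omega | (congr 2; apply Fin.ext; simp; omega)
    · refine ⟨⟨t.val - 1, by omega⟩, LinearMap.id, fun x => ?_⟩
      funext l
      simp only [Fin.contractNth, Function.update_apply, Fin.ext_iff, Fin.val_castSucc,
        Fin.val_succ, LinearMap.id_apply]
      split_ifs <;> first | rfl | omega

/-- The cochain `(a₀, …, a_m) ↦ f (a₀, …, a_i a_{i+1}, …, a_m)`. -/
def contractCochain {m : ℕ} (f : Cochain k A m) (i : Fin m) : Cochain k A (m + 1) :=
  MultilinearMap.mk' (fun g => f (Fin.contractNth i.castSucc (· * ·) g))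
    (fun g t x y => by
      obtain ⟨s, L, h⟩ := contractNth_update (k := k) i g t
      simp only [h, map_add, MultilinearMap.map_update_add])
    (fun g t c x => by
      obtain ⟨s, L, h⟩ := contractNth_update (k := k) i g t
      simp only [h, map_smul, MultilinearMap.map_update_smul])

/-- The cochain `(a₀, …, a_m) ↦ a₀ f (a₁, …, a_m)`. -/
def leftCochain {m : ℕ} (f : Cochain k A m) : Cochain k A (m + 1) :=
  LinearMap.uncurryLeft (M := fun _ : Fin (m + 1) => A)
    { toFun := fun a => (LinearMap.mulLeft k a).compMultilinearMap f
      map_add' := fun a b => by ext g; simp [add_mul]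
      map_smul' := fun c a => by ext g; simp }

/-- The cochain `(a₀, …, a_m) ↦ f (a₀, …, a_{m-1}) a_m`. -/
def rightCochain {m : ℕ} (f : Cochain k A m) : Cochain k A (m + 1) :=
  MultilinearMap.uncurryRight (M := fun _ : Fin (m + 1) => A)
    ((LinearMap.mul k A).compMultilinearMap f)

theorem contractCochain_apply {m : ℕ} (f : Cochain k A m) (i : Fin m) (g : Fin (m + 1) → A) :
    contractCochain f i g = f (Fin.contractNth i.castSucc (· * ·) g) := rfl

theorem leftCochain_apply {m : ℕ} (f : Cochain k A m) (g : Fin (m + 1) → A) :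
    leftCochain f g = g 0 * f (Fin.tail g) := rfl

theorem rightCochain_apply {m : ℕ} (f : Cochain k A m) (g : Fin (m + 1) → A) :
    rightCochain f g = f (Fin.init g) * g (Fin.last m) := rfl

variable (k A)

/-- The Hochschild differential
`(d f)(a₀, …, a_m) = a₀ f(a₁, …, a_m) + ∑_{i<m} (-1)^{i+1} f(a₀, …, a_i a_{i+1}, …, a_m)
  + (-1)^{m+1} f(a₀, …, a_{m-1}) a_m`. -/
def hochschildD (m : ℕ) : Cochain k A m →ₗ[k] Cochain k A (m + 1) where
  toFun f := leftCochain f + ∑ i : Fin m, (-1 : k) ^ (i.val + 1) • contractCochain f i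
    + (-1 : k) ^ (m + 1) • rightCochain f
  map_add' f g := by
    ext a
    simp only [add_apply, sum_apply, smul_apply,
      contractCochain_apply, leftCochain_apply, rightCochain_apply, mul_add, add_mul, smul_add,
      Finset.sum_add_distrib]
    abel
  map_smul' c f := by
    ext a
    simp only [add_apply, sum_apply, smul_apply,
      contractCochain_apply, leftCochain_apply, rightCochain_apply, mul_smul_comm, smul_mul_assoc,
      smul_add, Finset.smul_sum, RingHom.id_apply]
    simp only [smul_comm c]

/-- Hochschild cocycles. -/
def cocycles (m : ℕ) : Submodule k (Cochain k A m) := LinearMap.ker (hochschildD k A m)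

/-- Hochschild coboundaries. -/
def coboundaries : (m : ℕ) → Submodule k (Cochain k A m)
  | 0 => ⊥
  | m + 1 => LinearMap.range (hochschildD k A m)

/-- Hochschild cohomology `HH^m(A) = HH^m(A, A)`. -/
abbrev HH (m : ℕ) : Type v :=
  (cocycles k A m) ⧸ (coboundaries k A m).submoduleOf (cocycles k A m)

variable {k A}

/-- The class of a cocycle. -/
def HH.mk {m : ℕ} (f : Cochain k A m) (hf : f ∈ cocycles k A m) : HH k A m :=
  Submodule.Quotient.mk ⟨f, hf⟩

/-- Cochains of internal degree `j` with respect to a family `𝒜` of graded pieces of `A`: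
they send `𝒜 d₁ × ⋯ × 𝒜 d_m` into `𝒜 (d₁ + ⋯ + d_m + j)`. -/
def homogeneousCochains (𝒜 : ℤ → Submodule k A) (m : ℕ) (j : ℤ) : Submodule k (Cochain k A m) where
  carrier := {f | ∀ (d : Fin m → ℤ) (a : Fin m → A), (∀ i, a i ∈ 𝒜 (d i)) →
    f a ∈ 𝒜 (∑ i, d i + j)}
  zero_mem' := fun _ _ _ => Submodule.zero_mem _
  add_mem' := fun hf hg d a h => Submodule.add_mem _ (hf d a h) (hg d a h)
  smul_mem' := fun c _ hf d a h => Submodule.smul_mem _ c (hf d a h)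

/-- `HH^{m,j}`: the subspace of `HH^m` of the classes of homogeneous cocycles of
internal degree `j`. -/
def HHgr (𝒜 : ℤ → Submodule k A) (m : ℕ) (j : ℤ) : Submodule k (HH k A m) :=
  ((homogeneousCochains 𝒜 m j).submoduleOf (cocycles k A m)).map
    ((coboundaries k A m).submoduleOf (cocycles k A m)).mkQ

variable (k A)

theorem mem_cocycles_zero (f : Cochain k A 0) :
    f ∈ cocycles k A 0 ↔ f 0 ∈ Subalgebra.center k A := by
  rw [Subalgebra.mem_center_iff, cocycles, LinearMap.mem_ker]
  have key : ∀ g : Fin 1 → A, hochschildD k A 0 f g = g 0 * f 0 - f 0 * g 0 := by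
    intro g
    have h1 : Fin.tail g = 0 := Subsingleton.elim _ _
    have h2 : Fin.init g = 0 := Subsingleton.elim _ _
    simp [hochschildD, leftCochain_apply, rightCochain_apply, h1, h2, sub_eq_add_neg]
  constructor
  · intro h a
    have := key (fun _ => a)
    rw [h] at this
    exact sub_eq_zero.mp this.symm
  · intro h
    ext g
    rw [key, h]
    simp

/-- `HH^0(A)` is the center of `A`, through `[f] ↦ f()`; the product of `HH^0(A)` (the cup product
`(f ⌣ g)() = f() g()`) is the product of the center. -/
def HHzeroEquiv : HH k A 0 ≃ₗ[k] Subalgebra.center k A :=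
  (Submodule.quotEquivOfEqBot _ (by
    simp [coboundaries, Submodule.submoduleOf])).trans
  { toFun := fun f => ⟨f.1 0, (mem_cocycles_zero k A f.1).1 f.2⟩
    map_add' := fun _ _ => rfl
    map_smul' := fun _ _ => rfl
    invFun := fun z => ⟨MultilinearMap.constOfIsEmpty k _ z.1, (mem_cocycles_zero k A _).2 z.2⟩
    left_inv := fun f => by
      apply Subtype.ext
      ext g
      have : g = 0 := Subsingleton.elim _ _
      subst this
      rfl
    right_inv := fun _ => rfl }

end Hochschild

/-! ## The algebra `A_n^!` -/

section Algebra

variable (k : Type u) [Field k] (n : ℕ)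

/-- Lower vertex of the `i`-th pair of neighbouring vertices (vertices are numbered from `0`). -/
def lo {n : ℕ} (i : Fin (n - 1)) : Fin n := ⟨i.val, by omega⟩

/-- Upper vertex of the `i`-th pair of neighbouring vertices. -/
def hi {n : ℕ} (i : Fin (n - 1)) : Fin n := ⟨i.val + 1, by omega⟩

/-- Vertices and arrows of the quiver: `up i` is the arrow `(hi i | lo i)` from `lo i` to `hi i`
and `down i` is the arrow `(lo i | hi i)` from `hi i` to `lo i`. -/
inductive AGen (n : ℕ) : Type
  | vertex (i : Fin n) : AGen n
  | up (i : Fin (n - 1)) : AGen n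
  | down (i : Fin (n - 1)) : AGen n

namespace AGen

variable {n}

/-- The vertex, as an element of the free algebra. -/
abbrev e (i : Fin n) : FreeAlgebra k (AGen n) := FreeAlgebra.ι k (vertex i)
/-- The arrow `(hi i | lo i)`, as an element of the free algebra. -/
abbrev a (i : Fin (n - 1)) : FreeAlgebra k (AGen n) := FreeAlgebra.ι k (up i)
/-- The arrow `(lo i | hi i)`, as an element of the free algebra. -/
abbrev b (i : Fin (n - 1)) : FreeAlgebra k (AGen n) := FreeAlgebra.ι k (down i)

end AGen

/-- The relations of the path algebra (the first seven: vertices are orthogonal idempotents with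
sum `1`, and each arrow has its target on the left and its source on the right), together with the
relations `(i|i-1|i) = (i|i+1|i)` at all vertices except the last one, where `(i|i-1|i)` is `0`
at the first vertex. -/
inductive ARel : FreeAlgebra k (AGen n) → FreeAlgebra k (AGen n) → Prop
  | idem (i : Fin n) : ARel (AGen.e k i * AGen.e k i) (AGen.e k i)
  | orth (i j : Fin n) (h : i ≠ j) : ARel (AGen.e k i * AGen.e k j) 0
  | one : ARel (∑ i : Fin n, AGen.e k i) 1
  | up_target (i : Fin (n - 1)) : ARel (AGen.e k (hi i) * AGen.a k i) (AGen.a k i)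
  | up_source (i : Fin (n - 1)) : ARel (AGen.a k i * AGen.e k (lo i)) (AGen.a k i)
  | down_target (i : Fin (n - 1)) : ARel (AGen.e k (lo i) * AGen.b k i) (AGen.b k i)
  | down_source (i : Fin (n - 1)) : ARel (AGen.b k i * AGen.e k (hi i)) (AGen.b k i)
  | loop_first (i : Fin (n - 1)) (h : i.val = 0) : ARel (AGen.b k i * AGen.a k i) 0
  | loop (i j : Fin (n - 1)) (h : i.val + 1 = j.val) :
      ARel (AGen.a k i * AGen.b k i) (AGen.b k j * AGen.a k j)

/-- The algebra `A_n^!`. -/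
def AShriek : Type u := RingQuot (ARel k n)

instance : Ring (AShriek k n) := inferInstanceAs (Ring (RingQuot (ARel k n)))

instance : Algebra k (AShriek k n) := inferInstanceAs (Algebra k (RingQuot (ARel k n)))

/-- The quotient map onto `A_n^!`. -/
def AShriek.mk : FreeAlgebra k (AGen n) →ₐ[k] AShriek k n := RingQuot.mkAlgHom k (ARel k n)

variable {n}

/-- The idempotent `(i)`. -/
def vert (i : Fin n) : AShriek k n := AShriek.mk k n (AGen.e k i)

/-- The arrow `(hi i | lo i)`. -/
def up (i : Fin (n - 1)) : AShriek k n := AShriek.mk k n (AGen.a k i)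

/-- The arrow `(lo i | hi i)`. -/
def down (i : Fin (n - 1)) : AShriek k n := AShriek.mk k n (AGen.b k i)

variable (n)

/-- The span of the vertices. -/
def vertSpan : Submodule k (AShriek k n) := Submodule.span k (Set.range (vert k))

/-- The span of the arrows. -/
def arrowSpan : Submodule k (AShriek k n) :=
  Submodule.span k (Set.range (up k) ∪ Set.range (down k))

/-- The grading of `A_n^!` by path length: in degree `d ≥ 0` the span of the paths of length `d`,
in negative degrees `0`. -/
def pathGrading (d : ℤ) : Submodule k (AShriek k n) :=
  if 0 ≤ d then vertSpan k n * arrowSpan k n ^ d.toNat else ⊥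

/-- The element `c = (2|1|2) + ⋯ + (n|n-1|n)`. -/
def centralC : AShriek k n := ∑ i : Fin (n - 1), up k i * down k i

end Algebra

/-! ## Bimodules over `A_n^!` and the terms of the resolution -/

section Bimodules

variable (k : Type u) [Field k] (n : ℕ)

/-- The enveloping algebra; `A`-bimodules (with central action of `k`) are its left modules. -/
abbrev Env : Type u := AShriek k n ⊗[k] (AShriek k n)ᵐᵒᵖ

/-- `A_n^!` as a bimodule over itself, `(a ⊗ b) • x = a x b`. -/
instance envModule : Module (Env k n) (AShriek k n) :=
  instModuleTensorProductMop k (AShriek k n)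

theorem env_smul (a b x : AShriek k n) : ((a ⊗ₜ[k] op b : Env k n) • x) = a * x * b := by
  change TensorProduct.Algebra.moduleAux _ _ = _
  simp [TensorProduct.Algebra.moduleAux, ← mul_assoc]

variable {n}

/-- The bimodule `A(i) ⊗ (j)A`, inside the free bimodule `A ⊗ A` of rank one. Left multiplication
in the enveloping algebra is the outer bimodule structure `a · (x ⊗ y) · b = a x ⊗ y b`. -/
def bimod (i j : Fin n) : Submodule (Env k n) (Env k n) :=
  Submodule.span (Env k n) {vert k i ⊗ₜ[k] op (vert k j)}

/-- The generator `(i) ⊗ (j)` of `A(i) ⊗ (j)A`. -/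
def gen (i j : Fin n) : bimod k i j :=
  ⟨vert k i ⊗ₜ[k] op (vert k j), Submodule.mem_span_singleton_self _⟩

variable (n)

/-- `⨁_{i=1}^n A(i) ⊗ (i)A`. -/
abbrev P0 : Type u := (i : Fin n) → bimod k i i

/-- `⨁_{i=2}^n A(i) ⊗ (i-1)A ⊕ ⨁_{i=2}^n A(i-1) ⊗ (i)A`. -/
abbrev P1 : Type u :=
  ((i : Fin (n - 1)) → bimod k (hi i) (lo i)) × ((i : Fin (n - 1)) → bimod k (lo i) (hi i))

/-- `⨁_{i=1}^{n-1} A(i) ⊗ (i)A`. -/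
abbrev P2 : Type u := (i : Fin (n - 1)) → bimod k (lo i) (lo i)

/-- The (unshifted) internal grading of `A ⊗ A`. -/
def envGrading (d : ℤ) : Submodule k (Env k n) :=
  Submodule.span k {z | ∃ (s t : ℤ) (a b : AShriek k n), s + t = d ∧
    a ∈ pathGrading k n s ∧ b ∈ pathGrading k n t ∧ z = a ⊗ₜ[k] op b}

variable {n}

/-- The element `(i) ⊗ (i)` of `P0`. -/
def gen0 (i : Fin n) : P0 k n := Pi.single i (gen k i i)

/-- The element `(i) ⊗ (i-1)` of `P1`, where `i = hi p`, `i - 1 = lo p`. -/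
def genUp (p : Fin (n - 1)) : P1 k n := (Pi.single p (gen k (hi p) (lo p)), 0)

/-- The element `(i-1) ⊗ (i)` of `P1`, where `i = hi p`, `i - 1 = lo p`. -/
def genDown (p : Fin (n - 1)) : P1 k n := (0, Pi.single p (gen k (lo p) (hi p)))

/-- The element `(i) ⊗ (i)` of `P2`, where `i = lo p`. -/
def gen2 (p : Fin (n - 1)) : P2 k n := Pi.single p (gen k (lo p) (lo p))

/-- `a ⊗ 1`, which acts on a bimodule as left multiplication by `a`. -/
def actL (a : AShriek k n) : Env k n := a ⊗ₜ[k] 1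

/-- `1 ⊗ b`, which acts on a bimodule as right multiplication by `b`. -/
def actR (b : AShriek k n) : Env k n := 1 ⊗ₜ[k] op b

/-- The value of `f₂` on the generator `(i) ⊗ (i)`, `i = lo p`:
`(i|i+1) ⊗ (i) + (i) ⊗ (i+1|i) - (i) ⊗ (i-1|i) - (i|i-1) ⊗ (i)`, where the last two terms are
absent at the first vertex. The vertex `i - 1` is `lo q` and `i` is `hi q` for the `q` with
`q + 1 = p`. -/
def f2value (p : Fin (n - 1)) : P1 k n :=
  actL k (down k p) • genUp k p + actR k (up k p) • genDown k p
    - ∑ q : Fin (n - 1), if q.val + 1 = p.val then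
        actR k (down k q) • genUp k q + actL k (up k q) • genDown k q else 0

/-- The cocycle condition and normalization that single out `μ_i` (with `i = hi p`) up to
coboundaries: it is a `2`-cocycle of internal degree `-2` which vanishes when one argument is a
vertex, sends `(i|i-1) ⊗ (i-1|i)` to `-(i)` and `(i-1|i) ⊗ (i|i-1)` to `-(i-1)`, and sends all
other pairs of arrows to `0`. -/
structure IsMu (p : Fin (n - 1)) (μ : Cochain k (AShriek k n) 2) : Prop where
  cocycle : μ ∈ cocycles k (AShriek k n) 2
  degree : μ ∈ homogeneousCochains (pathGrading k n) 2 (-2)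
  vert_left : ∀ i x, μ ![vert k i, x] = 0
  vert_right : ∀ i x, μ ![x, vert k i] = 0
  up_down : ∀ q r, μ ![up k q, down k r] = if q = p ∧ r = p then -vert k (hi p) else 0
  down_up : ∀ q r, μ ![down k q, up k r] = if q = p ∧ r = p then -vert k (lo p) else 0
  up_up : ∀ q r, μ ![up k q, up k r] = 0
  down_down : ∀ q r, μ ![down k q, down k r] = 0

end Bimodules

/-! ## The algebra `W(n,1)` -/

section Webster

variable (k : Type u) [Field k] (n : ℕ)

/-- Generators of `W(n,1)`. A sequence with `n` red entries and one black entry is given by the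
position `p : Fin (n + 1)` of the black entry (positions are numbered from `0`). -/
inductive WGen (n : ℕ) : Type
  | idem (p : Fin (n + 1)) : WGen n
  | dot (j : Fin (n + 1)) : WGen n
  | cross (j : Fin n) : WGen n

namespace WGen

variable {n}

/-- The idempotent `e(𝐢)` of the sequence with black entry in position `p`. -/
abbrev e (p : Fin (n + 1)) : FreeAlgebra k (WGen n) := FreeAlgebra.ι k (idem p)
/-- The dot `y_j`. -/
abbrev y (j : Fin (n + 1)) : FreeAlgebra k (WGen n) := FreeAlgebra.ι k (dot j)
/-- The crossing `ψ_j` of the strands in positions `j` and `j + 1`. -/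
abbrev ψ (j : Fin n) : FreeAlgebra k (WGen n) := FreeAlgebra.ι k (cross j)

end WGen

open WGen in
/-- The relations of `W(n,1)`. -/
inductive WRel : FreeAlgebra k (WGen n) → FreeAlgebra k (WGen n) → Prop
  | idem (p : Fin (n + 1)) : WRel (e k p * e k p) (e k p)
  | orth (p q : Fin (n + 1)) (h : p ≠ q) : WRel (e k p * e k q) 0
  | one : WRel (∑ p : Fin (n + 1), e k p) 1
  | dot_idem (j p : Fin (n + 1)) : WRel (y k j * e k p) (e k p * y k j)
  | cross_idem (j : Fin n) (p : Fin (n + 1)) :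
      WRel (ψ k j * e k p) (e k (Equiv.swap j.castSucc j.succ p) * ψ k j)
  | cross_red_red (j : Fin n) (p : Fin (n + 1)) (h : p ≠ j.castSucc) (h' : p ≠ j.succ) :
      WRel (ψ k j * e k p) 0
  | cross_cross (j l : Fin n) (p : Fin (n + 1)) (h : j.val + 1 < l.val ∨ l.val + 1 < j.val) :
      WRel (ψ k j * ψ k l * e k p) (ψ k l * ψ k j * e k p)
  | cross_dot_far (j : Fin n) (l p : Fin (n + 1)) (h : l ≠ j.castSucc) (h' : l ≠ j.succ) :
      WRel ((ψ k j * e k p) * (y k l * e k p))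
        ((y k l * e k (Equiv.swap j.castSucc j.succ p)) * (ψ k j * e k p))
  | dot_dot (j l : Fin (n + 1)) : WRel (y k j * y k l) (y k l * y k j)
  | cross_dot (j : Fin n) (p : Fin (n + 1)) :
      WRel (ψ k j * y k j.castSucc * e k p) (y k j.succ * ψ k j * e k p)
  | dot_cross (j : Fin n) (p : Fin (n + 1)) :
      WRel (y k j.castSucc * ψ k j * e k p) (ψ k j * y k j.succ * e k p)
  | cross_sq_black_red (j : Fin n) :
      WRel (ψ k j * ψ k j * e k j.castSucc) ((y k j.castSucc - y k j.succ) * e k j.castSucc)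
  | cross_sq_red_black (j : Fin n) :
      WRel (ψ k j * ψ k j * e k j.succ) ((-y k j.castSucc + y k j.succ) * e k j.succ)
  | braid (j l : Fin n) (p : Fin (n + 1)) (h : j.val + 1 = l.val) :
      WRel (ψ k j * ψ k l * ψ k j * e k p) (ψ k l * ψ k j * ψ k l * e k p)
  | cyclotomic : WRel (e k 0) 0

/-- The algebra `W(n,1)`. -/
def Web : Type u := RingQuot (WRel k n)

instance : Ring (Web k n) := inferInstanceAs (Ring (RingQuot (WRel k n)))

instance : Algebra k (Web k n) := inferInstanceAs (Algebra k (RingQuot (WRel k n)))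

/-- The quotient map onto `W(n,1)`. -/
def Web.mk : FreeAlgebra k (WGen n) →ₐ[k] Web k n := RingQuot.mkAlgHom k (WRel k n)

variable {n}

/-- The idempotent of `W(n,1)` with black strand in position `p`. -/
def wIdem (p : Fin (n + 1)) : Web k n := Web.mk k n (WGen.e k p)

/-- The dot `y_j` of `W(n,1)`. -/
def wDot (j : Fin (n + 1)) : Web k n := Web.mk k n (WGen.y k j)

/-- The crossing `ψ_j` of `W(n,1)`. -/
def wCross (j : Fin n) : Web k n := Web.mk k n (WGen.ψ k j)

/-- The element `x_l`, a dot on the `l`-th red strand; if the black entry is in position `p`, the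
`l`-th red entry is in position `p.succAbove l`. -/
def wX (l : Fin n) : Web k n := ∑ p : Fin (n + 1), wDot k (p.succAbove l) * wIdem k p

/-- The element `x_1^{α_1} ⋯ x_n^{α_n}`. -/
def wMonomial (α : Fin n →₀ ℕ) : Web k n := (List.ofFn fun l => wX k l ^ α l).prod

/-- `W(n,1)` is a deformation of `A_n^!` over `k[x_1, …, x_n]` with first order part
`x_1 μ_1 + ⋯ + x_n μ_n`: the `x_l` are central; setting them to `0` gives `A_n^!` (through `π`,
under which the vertex `v` is the idempotent with black strand to the right of the `v`-th red
strand and the arrows are the crossings); the linear section `s` of `π` identifies `W(n,1)` with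
`k[x_1, …, x_n] ⊗ A_n^!`; and modulo the square of the ideal `(x_1, …, x_n)` the product is
`s(a) s(b) = s(ab) + x_1 s(μ_1(a, b)) + ⋯ + x_n s(μ_n(a, b))`. -/
structure IsDeformation (π : Web k n →ₐ[k] AShriek k n) (s : AShriek k n →ₗ[k] Web k n)
    (μ : Fin n → Cochain k (AShriek k n) 2) : Prop where
  central : ∀ (l : Fin n) (w : Web k n), wX k l * w = w * wX k l
  pi_idem : ∀ v : Fin n, π (wIdem k v.succ) = vert k v
  pi_cross_up : ∀ p : Fin (n - 1), π (wCross k (hi p) * wIdem k (lo p).succ) = up k p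
  pi_cross_down : ∀ p : Fin (n - 1), π (wCross k (hi p) * wIdem k (hi p).succ) = down k p
  pi_surjective : Function.Surjective π
  pi_ker : ∀ w : Web k n, π w = 0 ↔ w ∈ Ideal.span (Set.range (wX (n := n) k))
  pi_s : ∀ a, π (s a) = a
  s_free : Function.Bijective (fun F : (Fin n →₀ ℕ) →₀ AShriek k n =>
    F.sum fun α a => wMonomial k α * s a)
  first_order : ∀ a b, s a * s b - s (a * b) - ∑ l : Fin n, wX k l * s (μ l ![a, b]) ∈
    Ideal.span {w : Web k n | ∃ i j : Fin n, w = wX k i * wX k j}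

end Webster

end RedottedWebster

end

/-!
In `A = A_n^!` a path that goes up and then down can be rewritten as one that goes first down and
then up, so `A` is spanned by the *valleys* `valley x l y`: down from `l + y` to `l`, then up to
`l + x`. They are independent because `A` acts on the functions on the climbs (`climbRep`), and this
basis (`valleyBasis`) carries all computations in `A`. Paths that contain a
step down can be divided, on either side, by an arrow down (`divL`, `divR`).

*The resolution.* Its terms are finitely generated projective bimodules, given by generators at
vertices and arrows and coordinates in the enveloping algebra. It is contractible as a complex of right modules: the homotopies `h₀`, `h₁` of
`VertexResolution` are given on valleys by recursion on their length (`homotopy_zero`,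
`homotopy_one`, `homotopy_two`). Together with right linearity they give exactness, and they also
give `HH^m(A) = 0` for `m ≥ 3`, without a comparison of resolutions: a `3`-cocycle with coefficients
in any bimodule is pushed along the resolution and back by the contractions
(`threeAcyclic_of_resolution`), and currying the last variable reduces degree `m + 1` with
coefficients in `N` to degree `m` with coefficients in `Hom(A, N)` (`acyclic_of_threeAcyclic`).

*Low degrees.* For `m ≤ 2` there are linear functionals on cochains that vanish on coboundaries,
detect coboundaries among the cocycles, and are dual to explicit homogeneous cocycles; this
determines `HH^m(A)` with its grading (`HH_zero_dualBasis`, `HH_one_dualBasis`,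
`HH_two_dualBasis`). The cocycles are the powers of `c` for `m = 0`, the powers of `c` times the
derivation that counts upward arrows for `m = 1`, and the `μ_i` for `m = 2`. In degree two the
functionals record the constant terms of the values on the defining relations. If they vanish, the
square-zero extension of `A` by the cocycle splits, since lifts of the generators can be corrected
so as to satisfy the relations (`twoCocycle_coboundary`).

*The deformation.* After elimination of the idempotent `e_1` and of the dots on the black strand,
`W(n,1)` has the presentation `WRep`: the vertices and arrows of `A`, central elements `x_l`, and
loop relations deformed by differences of the `x_l`. Setting `x_l = 0` gives `A`. A degree argument
shows that polynomials in the `x_l` times lifts of valleys span `W(n,1)` (`iSup_webSpan`); they are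
independent by a triangular system of equations for the matrix entries of the representations
`fromRep` on polynomial-valued functions on the vertices `r, …, n - 1`
(`freeMap_pathSection_injective`). Hence `W(n,1)` is free over `k[x_1, …, x_n]` on the lifts of the
valleys. The cochain `deformCochain l` takes `(a, b)` to the coefficient of `x_l` in `s(a) s(b)`; it
is a cocycle because `W(n,1)` is associative (`firstCoef_mul`), and it has degree `-2` because `x_l`
has degree `2`. The section lifts a loop of length two that goes down first by the path plus a
multiple of `x_l`, that is, by a dot on the black strand; this normalization produces the values
required of the `μ_i` on pairs of arrows (`isMu_deformCochain`).
-/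

open scoped TensorProduct
open MulOpposite

noncomputable section

namespace RedottedWebster

universe u v

/-! ### Quotients of free algebras -/

section Generators

variable {k : Type u} [Field k] {X : Type v} {B : Type*} [Ring B] [Algebra k B]

theorem mul_mem_of_generators (φ : FreeAlgebra k X →ₐ[k] B) (hφ : Function.Surjective φ)
    (S : Submodule k B) (h : ∀ x, ∀ s ∈ S, φ (FreeAlgebra.ι k x) * s ∈ S) (b : B) :
    ∀ s ∈ S, b * s ∈ S := by
  obtain ⟨a, rfl⟩ := hφ b
  induction a using FreeAlgebra.induction with
  | grade0 r => intro s hs; rw [AlgHom.commutes, ← Algebra.smul_def]; exact S.smul_mem _ hs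
  | grade1 x => exact h x
  | mul a b iha ihb => intro s hs; rw [map_mul, mul_assoc]; exact iha _ (ihb _ hs)
  | add a b iha ihb =>
    intro s hs; rw [map_add, add_mul]; exact S.add_mem (iha _ hs) (ihb _ hs)

theorem commute_of_generators (φ : FreeAlgebra k X →ₐ[k] B) (hφ : Function.Surjective φ)
    (z : B) (h : ∀ x, z * φ (FreeAlgebra.ι k x) = φ (FreeAlgebra.ι k x) * z) (b : B) :
    z * b = b * z := by
  obtain ⟨a, rfl⟩ := hφ b
  induction a using FreeAlgebra.induction with
  | grade0 r => rw [AlgHom.commutes, Algebra.commutes]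
  | grade1 x => exact h x
  | mul a b iha ihb => rw [map_mul, ← mul_assoc, iha, mul_assoc, ihb, mul_assoc]
  | add a b iha ihb => rw [map_add, mul_add, add_mul, iha, ihb]

end Generators

/-! ### Presentation of `A_n^!` -/

section Presentation

variable {k : Type u} [Field k] {n : ℕ} {B : Type v} [Ring B] [Algebra k B]

/-- Elements of an algebra that satisfy the defining relations of `A_n^!`. -/
structure ARep (e : Fin n → B) (a b : Fin (n - 1) → B) : Prop where
  idem : ∀ i, e i * e i = e i
  orth : ∀ i j, i ≠ j → e i * e j = 0
  one : ∑ i, e i = 1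
  up_target : ∀ i, e (hi i) * a i = a i
  up_source : ∀ i, a i * e (lo i) = a i
  down_target : ∀ i, e (lo i) * b i = b i
  down_source : ∀ i, b i * e (hi i) = b i
  loop_first : ∀ i, i.val = 0 → b i * a i = 0
  loop : ∀ i j, i.val + 1 = j.val → a i * b i = b j * a j

theorem AShriek.mk_surjective : Function.Surjective (AShriek.mk k n) :=
  RingQuot.mkAlgHom_surjective k _

theorem AShriek.mk_rel {x y : FreeAlgebra k (AGen n)} (h : ARel k n x y) :
    AShriek.mk k n x = AShriek.mk k n y := RingQuot.mkAlgHom_rel k h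

variable (k n) in
theorem aRep_self : ARep (vert k (n := n)) (up k) (down k) where
  idem i := by simpa [vert, up, down] using AShriek.mk_rel (ARel.idem (k := k) i)
  orth i j h := by simpa [vert, up, down] using AShriek.mk_rel (ARel.orth (k := k) i j h)
  one := by simpa [vert, up, down] using AShriek.mk_rel (ARel.one (k := k) (n := n))
  up_target i := by simpa [vert, up, down] using AShriek.mk_rel (ARel.up_target (k := k) i)
  up_source i := by simpa [vert, up, down] using AShriek.mk_rel (ARel.up_source (k := k) i)
  down_target i := by simpa [vert, up, down] using AShriek.mk_rel (ARel.down_target (k := k) i)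
  down_source i := by simpa [vert, up, down] using AShriek.mk_rel (ARel.down_source (k := k) i)
  loop_first i h := by simpa [vert, up, down] using AShriek.mk_rel (ARel.loop_first (k := k) i h)
  loop i j h := by simpa [vert, up, down] using AShriek.mk_rel (ARel.loop (k := k) i j h)

/-- The values of an algebra homomorphism on the generators. -/
def aGenMap (e : Fin n → B) (a b : Fin (n - 1) → B) : AGen n → B
  | AGen.vertex i => e i
  | AGen.up i => a i
  | AGen.down i => b i

/-- The homomorphism out of `A_n^!` with given values on vertices and arrows. -/
def ARep.lift {e : Fin n → B} {a b : Fin (n - 1) → B} (h : ARep e a b) :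
    AShriek k n →ₐ[k] B :=
  RingQuot.liftAlgHom k ⟨FreeAlgebra.lift k (aGenMap e a b), by
    intro x y r
    induction r with
    | idem i => simpa [aGenMap] using h.idem i
    | orth i j hij => simpa [aGenMap] using h.orth i j hij
    | one => simpa [aGenMap] using h.one
    | up_target i => simpa [aGenMap] using h.up_target i
    | up_source i => simpa [aGenMap] using h.up_source i
    | down_target i => simpa [aGenMap] using h.down_target i
    | down_source i => simpa [aGenMap] using h.down_source i
    | loop_first i hi => simpa [aGenMap] using h.loop_first i hi
    | loop i j hij => simpa [aGenMap] using h.loop i j hij⟩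

theorem ARep.lift_mk {e : Fin n → B} {a b : Fin (n - 1) → B} (h : ARep e a b)
    (x : FreeAlgebra k (AGen n)) :
    h.lift (AShriek.mk k n x) = FreeAlgebra.lift k (aGenMap e a b) x :=
  RingQuot.liftAlgHom_mkAlgHom_apply k _ _ _

@[simp] theorem ARep.lift_vert {e : Fin n → B} {a b : Fin (n - 1) → B}
    (h : ARep e a b) (i : Fin n) : h.lift (vert k i) = e i := by
  rw [vert, h.lift_mk, FreeAlgebra.lift_ι_apply, aGenMap]

@[simp] theorem ARep.lift_up {e : Fin n → B} {a b : Fin (n - 1) → B}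
    (h : ARep e a b) (i : Fin (n - 1)) : h.lift (up k i) = a i := by
  rw [up, h.lift_mk, FreeAlgebra.lift_ι_apply, aGenMap]

@[simp] theorem ARep.lift_down {e : Fin n → B} {a b : Fin (n - 1) → B}
    (h : ARep e a b) (i : Fin (n - 1)) : h.lift (down k i) = b i := by
  rw [down, h.lift_mk, FreeAlgebra.lift_ι_apply, aGenMap]

theorem AShriek.mul_mem_of_arrows (S : Submodule k (AShriek k n))
    (he : ∀ i, ∀ s ∈ S, vert k i * s ∈ S) (hu : ∀ i, ∀ s ∈ S, up k i * s ∈ S)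
    (hd : ∀ i, ∀ s ∈ S, down k i * s ∈ S) (a : AShriek k n) : ∀ s ∈ S, a * s ∈ S :=
  mul_mem_of_generators (AShriek.mk k n) AShriek.mk_surjective S
    (fun x => by cases x <;> [exact he _; exact hu _; exact hd _]) a

theorem AShriek.commute_of_arrows (z : AShriek k n) (he : ∀ i, z * vert k i = vert k i * z)
    (hu : ∀ i, z * up k i = up k i * z) (hd : ∀ i, z * down k i = down k i * z)
    (a : AShriek k n) : z * a = a * z :=
  commute_of_generators (AShriek.mk k n) AShriek.mk_surjective z
    (fun x => by cases x <;> [exact he _; exact hu _; exact hd _]) a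

theorem AShriek.algHom_ext {f g : AShriek k n →ₐ[k] B} (he : ∀ i, f (vert k i) = g (vert k i))
    (hu : ∀ i, f (up k i) = g (up k i)) (hd : ∀ i, f (down k i) = g (down k i)) : f = g := by
  have : f.comp (AShriek.mk k n) = g.comp (AShriek.mk k n) := by
    apply FreeAlgebra.hom_ext
    funext x
    cases x <;> [exact he _; exact hu _; exact hd _]
  ext a
  obtain ⟨x, rfl⟩ := AShriek.mk_surjective a
  exact DFunLike.congr_fun this x

end Presentation

/-! ### Paths and the basis of `A_n^!` -/

section Paths

variable (k : Type u) [Field k] (n : ℕ)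

/-- The idempotent of the vertex `i`; zero if there is no such vertex. -/
def eN (i : ℕ) : AShriek k n := if h : i < n then vert k ⟨i, h⟩ else 0

/-- The arrow from `i` to `i + 1`; zero if there is no such arrow. -/
def uN (i : ℕ) : AShriek k n := if h : i + 1 < n then up k ⟨i, by omega⟩ else 0

/-- The arrow from `i + 1` to `i`; zero if there is no such arrow. -/
def dN (i : ℕ) : AShriek k n := if h : i + 1 < n then down k ⟨i, by omega⟩ else 0

variable {n}

theorem eN_val (i : Fin n) : eN k n i = vert k i := by simp [eN]
theorem uN_val (i : Fin (n - 1)) : uN k n i = up k i := by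
  have : i.val + 1 < n := by omega
  simp [uN, this]
theorem dN_val (i : Fin (n - 1)) : dN k n i = down k i := by
  have : i.val + 1 < n := by omega
  simp [dN, this]

variable (n)

theorem eN_of_le {i : ℕ} (h : n ≤ i) : eN k n i = 0 := by simp [eN, h]
theorem uN_of_le {i : ℕ} (h : n ≤ i + 1) : uN k n i = 0 := by simp [uN, h]
theorem dN_of_le {i : ℕ} (h : n ≤ i + 1) : dN k n i = 0 := by simp [dN, h]

@[simp] theorem eN_mul_self (i : ℕ) : eN k n i * eN k n i = eN k n i := by
  unfold eN; split_ifs <;> simp [(aRep_self k n).idem]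

theorem eN_mul_of_ne {i j : ℕ} (h : i ≠ j) : eN k n i * eN k n j = 0 := by
  unfold eN; split_ifs <;> try simp
  exact (aRep_self k n).orth _ _ (by simpa using h)

theorem eN_mul (i j : ℕ) : eN k n i * eN k n j = if i = j then eN k n j else 0 := by
  split_ifs with h
  · rw [h, eN_mul_self]
  · exact eN_mul_of_ne k n h

theorem sum_eN : ∑ i ∈ Finset.range n, eN k n i = 1 := by
  rw [Finset.sum_range, ← (aRep_self k n).one]
  exact Finset.sum_congr rfl fun i _ => eN_val k i

@[simp] theorem eN_mul_uN (i : ℕ) : eN k n (i + 1) * uN k n i = uN k n i := by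
  unfold uN eN; split_ifs <;> try simp
  exact (aRep_self k n).up_target ⟨i, by omega⟩
@[simp] theorem uN_mul_eN (i : ℕ) : uN k n i * eN k n i = uN k n i := by
  unfold uN eN; split_ifs <;> first | omega | try simp
  exact (aRep_self k n).up_source ⟨i, by omega⟩
@[simp] theorem eN_mul_dN (i : ℕ) : eN k n i * dN k n i = dN k n i := by
  unfold dN eN; split_ifs <;> first | omega | try simp
  exact (aRep_self k n).down_target ⟨i, by omega⟩
@[simp] theorem dN_mul_eN (i : ℕ) : dN k n i * eN k n (i + 1) = dN k n i := by
  unfold dN eN; split_ifs <;> try simp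
  exact (aRep_self k n).down_source ⟨i, by omega⟩

theorem dN_mul_uN_zero : dN k n 0 * uN k n 0 = 0 := by
  unfold dN uN; split_ifs <;> try simp
  exact (aRep_self k n).loop_first _ rfl

theorem dN_mul_uN_succ (i : ℕ) (h : i + 2 < n) :
    dN k n (i + 1) * uN k n (i + 1) = uN k n i * dN k n i := by
  have h' : i + 1 < n := by omega
  simp only [dN, uN, h, h', dif_pos]
  exact ((aRep_self k n).loop _ _ rfl).symm

theorem uN_mul_eN_of_ne {i j : ℕ} (h : i ≠ j) : uN k n i * eN k n j = 0 := by
  rw [← uN_mul_eN, mul_assoc, eN_mul_of_ne k n h, mul_zero]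
theorem dN_mul_eN_of_ne {i j : ℕ} (h : i + 1 ≠ j) : dN k n i * eN k n j = 0 := by
  rw [← dN_mul_eN, mul_assoc, eN_mul_of_ne k n h, mul_zero]
theorem eN_mul_dN_of_ne {i j : ℕ} (h : j ≠ i) : eN k n j * dN k n i = 0 := by
  rw [← eN_mul_dN, ← mul_assoc, eN_mul_of_ne k n h, zero_mul]

/-- The path that goes up from `l` to `l + x`. -/
def upPath : ℕ → ℕ → AShriek k n
  | 0, l => eN k n l
  | x + 1, l => uN k n (l + x) * upPath x l

/-- The path that goes down from `l + y` to `l`. -/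
def downPath : ℕ → ℕ → AShriek k n
  | 0, l => eN k n l
  | y + 1, l => downPath y l * dN k n (l + y)

/-- The path that goes down from `l + y` to `l` and then up to `l + x`. These paths form a basis
of `A_n^!`. -/
def valley (x l y : ℕ) : AShriek k n := upPath k n x l * downPath k n y l

@[simp] theorem upPath_mul_eN (x l : ℕ) : upPath k n x l * eN k n l = upPath k n x l := by
  induction x with
  | zero => simp [upPath]
  | succ x ih => simp [upPath, mul_assoc, ih]

@[simp] theorem eN_mul_downPath (y l : ℕ) : eN k n l * downPath k n y l = downPath k n y l := by
  induction y with
  | zero => simp [downPath]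
  | succ y ih => simp [downPath, ← mul_assoc, ih]

@[simp] theorem eN_mul_upPath (x l : ℕ) : eN k n (l + x) * upPath k n x l = upPath k n x l := by
  cases x with
  | zero => simp [upPath]
  | succ x => rw [upPath, ← mul_assoc, ← add_assoc, eN_mul_uN]

@[simp] theorem downPath_mul_eN (y l : ℕ) :
    downPath k n y l * eN k n (l + y) = downPath k n y l := by
  cases y with
  | zero => simp [downPath]
  | succ y => rw [downPath, mul_assoc, ← add_assoc, dN_mul_eN]

theorem upPath_succ' (x l : ℕ) : upPath k n (x + 1) l = upPath k n x (l + 1) * uN k n l := by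
  induction x with
  | zero => simp [upPath]
  | succ x ih => rw [upPath, ih, upPath, mul_assoc]; congr 2; omega

theorem downPath_succ' (y l : ℕ) :
    downPath k n (y + 1) l = dN k n l * downPath k n y (l + 1) := by
  induction y with
  | zero => simp [downPath]
  | succ y ih => rw [downPath, ih, downPath, mul_assoc]; congr 3; omega

@[simp] theorem valley_zero_zero (l : ℕ) : valley k n 0 l 0 = eN k n l := by
  simp [valley, upPath, downPath]

theorem valley_y_zero (x l : ℕ) : valley k n x l 0 = upPath k n x l := by
  simp [valley, downPath]

theorem valley_x_zero (y l : ℕ) : valley k n 0 l y = downPath k n y l := by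
  simp [valley, upPath]

@[simp] theorem eN_mul_valley (x l y : ℕ) :
    eN k n (l + x) * valley k n x l y = valley k n x l y := by
  rw [valley, ← mul_assoc, eN_mul_upPath]

@[simp] theorem valley_mul_eN (x l y : ℕ) :
    valley k n x l y * eN k n (l + y) = valley k n x l y := by
  rw [valley, mul_assoc, downPath_mul_eN]

theorem eN_mul_valley' (i x l y : ℕ) :
    eN k n i * valley k n x l y = if i = l + x then valley k n x l y else 0 := by
  rw [← eN_mul_valley, ← mul_assoc, eN_mul]
  split_ifs <;> simp

theorem valley_mul_eN' (i x l y : ℕ) :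
    valley k n x l y * eN k n i = if l + y = i then valley k n x l y else 0 := by
  rw [← valley_mul_eN, mul_assoc, eN_mul]
  split_ifs with h
  · rw [h]
  · simp

theorem valley_of_le_left {x l y : ℕ} (h : n ≤ l + x) : valley k n x l y = 0 := by
  rw [← eN_mul_valley, eN_of_le k n h, zero_mul]

theorem valley_of_le_right {x l y : ℕ} (h : n ≤ l + y) : valley k n x l y = 0 := by
  rw [← valley_mul_eN, eN_of_le k n h, mul_zero]

theorem uN_mul_valley (x l y : ℕ) :
    uN k n (l + x) * valley k n x l y = valley k n (x + 1) l y := by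
  rw [valley, valley, upPath, mul_assoc]

theorem valley_mul_dN (x l y : ℕ) :
    valley k n x l y * dN k n (l + y) = valley k n x l (y + 1) := by
  rw [valley, valley, downPath, mul_assoc]

/-- A step down commutes with a climb, at the price of starting the climb one vertex lower. -/
theorem dN_mul_upPath (x l : ℕ) (h : l + x + 1 < n) :
    dN k n (l + x) * upPath k n x (l + 1) = upPath k n x l * dN k n l := by
  induction x with
  | zero => simp [upPath]
  | succ x ih =>
    rw [upPath, upPath, ← mul_assoc, mul_assoc _ _ (dN k n l), ← ih (by omega), ← mul_assoc]
    congr 1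
    have := dN_mul_uN_succ k n (l + x) (by omega)
    convert this using 3 <;> omega

theorem dN_mul_valley (x l y : ℕ) (h : l + x + 1 < n) :
    dN k n (l + x) * valley k n x (l + 1) y = valley k n x l (y + 1) := by
  rw [valley, valley, ← mul_assoc, dN_mul_upPath k n x l h, downPath_succ', mul_assoc]

theorem dN_mul_upPath_zero (x : ℕ) : dN k n x * upPath k n (x + 1) 0 = 0 := by
  induction x with
  | zero => simp [upPath, dN_mul_uN_zero]
  | succ x ih =>
    by_cases h : x + 2 < n
    · rw [upPath, ← mul_assoc, zero_add, dN_mul_uN_succ k n x h, mul_assoc, ih, mul_zero]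
    · rw [dN_of_le k n (by omega), zero_mul]

theorem dN_mul_valley_zero (x y : ℕ) : dN k n x * valley k n (x + 1) 0 y = 0 := by
  rw [valley, ← mul_assoc, dN_mul_upPath_zero, zero_mul]

theorem uN_mul_valley_of_ne {i x l y : ℕ} (h : i ≠ l + x) :
    uN k n i * valley k n x l y = 0 := by
  rw [← eN_mul_valley, ← mul_assoc, uN_mul_eN_of_ne k n h, zero_mul]

theorem dN_mul_valley_of_ne {i x l y : ℕ} (h : i + 1 ≠ l + x) :
    dN k n i * valley k n x l y = 0 := by
  rw [← eN_mul_valley, ← mul_assoc, dN_mul_eN_of_ne k n h, zero_mul]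

/-! The representation of `A_n^!` that separates the paths `valley x l y`. -/

/-- The index set of the basis: `⟨l, x, y⟩` stands for `valley x l y`. -/
abbrev ValleyIdx : Type := Σ l : Fin n, Fin (n - l) × Fin (n - l)

/-- Pairs `(x, l)` with `l + x` a vertex: the paths that only go up. -/
abbrev ClimbIdx : Type := {p : ℕ × ℕ // p.1 + p.2 < n}

/-- The action of a vertex on functions on the climbs. -/
def climbE (q : ℕ) : Module.End k (ClimbIdx n → k) where
  toFun f p := if q = p.1.1 + p.1.2 then f p else 0
  map_add' f g := by ext p; simp; split_ifs <;> simp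
  map_smul' c f := by ext p; simp

/-- The action of an upward arrow on functions on the climbs. -/
def climbU (q : ℕ) : Module.End k (ClimbIdx n → k) where
  toFun f p := if h : q + 1 = p.1.1 + p.1.2 ∧ 0 < p.1.1 then
    f ⟨(p.1.1 - 1, p.1.2), by have := p.2; simp only; omega⟩ else 0
  map_add' f g := by ext p; simp; split_ifs <;> simp
  map_smul' c f := by ext p; simp

/-- The action of a downward arrow on functions on the climbs. -/
def climbD (q : ℕ) : Module.End k (ClimbIdx n → k) where
  toFun f p := if h : q = p.1.1 + p.1.2 ∧ q + 1 < n then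
    f ⟨(p.1.1, p.1.2 + 1), by simp only; omega⟩ else 0
  map_add' f g := by ext p; simp; split_ifs <;> simp
  map_smul' c f := by ext p; simp

theorem climb_aRep : ARep (B := Module.End k (ClimbIdx n → k))
    (fun i : Fin n => climbE k n i) (fun i : Fin (n - 1) => climbU k n i)
    (fun i : Fin (n - 1) => climbD k n i) where
  idem i := by ext f p; simp [climbE]; intro h h'; exact absurd h' h
  orth i j h := by
    ext f p; simp only [climbE, Module.End.mul_apply, LinearMap.coe_mk, AddHom.coe_mk]
    have : i.val ≠ j.val := fun h' => h (Fin.ext h')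
    split_ifs <;> first | omega | rfl
  one := by
    ext f p
    simp only [climbE, LinearMap.sum_apply, LinearMap.coe_mk, AddHom.coe_mk, Finset.sum_apply,
      Module.End.one_apply]
    rw [Finset.sum_eq_single ⟨p.1.1 + p.1.2, p.2⟩] <;> simp
    intro b h h'; exact absurd (Fin.ext h') h
  up_target i := by
    ext f p; simp only [climbE, climbU, hi, Module.End.mul_apply, LinearMap.coe_mk, AddHom.coe_mk]
    split_ifs <;> first | omega | rfl | simp_all
  up_source i := by
    ext f p; simp only [climbE, climbU, lo, Module.End.mul_apply, LinearMap.coe_mk, AddHom.coe_mk]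
    split_ifs <;> first | omega | rfl | simp_all
  down_target i := by
    ext f p; simp only [climbE, climbD, lo, Module.End.mul_apply, LinearMap.coe_mk, AddHom.coe_mk]
    split_ifs <;> first | omega | rfl | simp_all
  down_source i := by
    ext f p; simp only [climbE, climbD, hi, Module.End.mul_apply, LinearMap.coe_mk, AddHom.coe_mk]
    split_ifs <;> first | omega | rfl | simp_all
  loop_first i h := by
    ext f p; simp only [climbU, climbD, Module.End.mul_apply, LinearMap.coe_mk, AddHom.coe_mk]
    split_ifs <;> first | omega | rfl
  loop i j h := by
    ext f p
    have := j.2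
    simp only [climbU, climbD, Module.End.mul_apply, LinearMap.coe_mk, AddHom.coe_mk]
    split_ifs <;> first | omega | rfl

/-- The representation of `A_n^!` on the functions on the climbs. -/
def climbRep : AShriek k n →ₐ[k] Module.End k (ClimbIdx n → k) := (climb_aRep k n).lift

variable {k n} in
theorem climbRep_eN {i : ℕ} (h : i < n) : climbRep k n (eN k n i) = climbE k n i := by
  simp [eN, h, climbRep]
variable {k n} in
theorem climbRep_uN {i : ℕ} (h : i + 1 < n) : climbRep k n (uN k n i) = climbU k n i := by
  simp [uN, h, climbRep]
variable {k n} in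
theorem climbRep_dN {i : ℕ} (h : i + 1 < n) : climbRep k n (dN k n i) = climbD k n i := by
  simp [dN, h, climbRep]

theorem climbRep_downPath (y l : ℕ) (h : l + y < n) (f : ClimbIdx n → k) (p : ClimbIdx n) :
    climbRep k n (downPath k n y l) f p = if h' : l = p.1.1 + p.1.2 then
      f ⟨(p.1.1, p.1.2 + y), by simp only; omega⟩ else 0 := by
  induction y generalizing f with
  | zero =>
    rw [downPath, climbRep_eN (by omega)]
    simp [climbE]
  | succ y ih =>
    rw [downPath, map_mul, Module.End.mul_apply, ih (by omega), climbRep_dN (by omega)]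
    simp only [climbD, LinearMap.coe_mk, AddHom.coe_mk]
    split_ifs <;> first | omega | rfl

theorem climbRep_upPath (x l : ℕ) (h : l + x < n) (f : ClimbIdx n → k) (p : ClimbIdx n) :
    climbRep k n (upPath k n x l) f p = if h' : l + x = p.1.1 + p.1.2 ∧ x ≤ p.1.1 then
      f ⟨(p.1.1 - x, p.1.2), by simp only; omega⟩ else 0 := by
  induction x generalizing p with
  | zero =>
    rw [upPath, climbRep_eN (by omega)]
    simp [climbE]
  | succ x ih =>
    rw [upPath, map_mul, Module.End.mul_apply, climbRep_uN (by omega)]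
    simp only [climbU, LinearMap.coe_mk, AddHom.coe_mk]
    simp only [ih (by omega)]
    split_ifs <;> first | omega | rfl | skip
    congr 3; omega

/-- The coefficient of `valley x l y` in the basis of valleys: apply the element to the trivial
path at `l + y` and read off the coefficient of the climb from `l` to `l + x`. -/
def valleyCoef (t : ValleyIdx n) : AShriek k n →ₗ[k] k where
  toFun a := climbRep k n a (Pi.single ⟨(0, t.1 + t.2.2), by have := t.2.2.2; simp only; omega⟩ 1)
    ⟨(t.2.1, t.1), by have := t.2.1.2; simp only; omega⟩
  map_add' a b := by simp
  map_smul' c a := by simp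

/-- The basis path with index `t`. -/
def valleyVec (t : ValleyIdx n) : AShriek k n := valley k n t.2.1 t.1 t.2.2

theorem valleyCoef_valleyVec (t t' : ValleyIdx n) :
    valleyCoef k n t (valleyVec k n t') = if t = t' then 1 else 0 := by
  obtain ⟨l, x, y⟩ := t
  obtain ⟨l', x', y'⟩ := t'
  simp only [valleyCoef, valleyVec, valley, map_mul, Module.End.mul_apply, LinearMap.coe_mk,
    AddHom.coe_mk]
  rw [climbRep_upPath k n _ _ (by omega)]
  simp only [climbRep_downPath k n _ _ (show l'.val + y'.val < n by omega), Pi.single_apply,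
    Subtype.mk.injEq, Prod.mk.injEq]
  by_cases hl : l = l'
  · subst hl
    simp only [Sigma.mk.injEq, heq_eq_eq, true_and, Prod.mk.injEq, Fin.ext_iff]
    split_ifs <;> first | omega | rfl
  · rw [if_neg (fun h => hl (congrArg Sigma.fst h))]
    replace hl : l.val ≠ l'.val := fun h => hl (Fin.ext h)
    split_ifs <;> first | omega | rfl

theorem span_valleyVec : Submodule.span k (Set.range (valleyVec k n)) = ⊤ := by
  set S := Submodule.span k (Set.range (valleyVec k n)) with hS
  have mem : ∀ x l y, valley k n x l y ∈ S := by
    intro x l y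
    by_cases h : l + x < n ∧ l + y < n
    · exact Submodule.subset_span ⟨⟨⟨l, by omega⟩, ⟨x, by simp only; omega⟩,
        ⟨y, by simp only; omega⟩⟩, rfl⟩
    · by_cases h' : l + x < n
      · rw [valley_of_le_right k n (by omega)]; exact S.zero_mem
      · rw [valley_of_le_left k n (by omega)]; exact S.zero_mem
  have key : ∀ a : AShriek k n, (∀ x l y, a * valley k n x l y ∈ S) → ∀ s ∈ S, a * s ∈ S := by
    intro a ha s hs
    induction hs using Submodule.span_induction with
    | mem z hz => obtain ⟨t, rfl⟩ := hz; exact ha _ _ _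
    | zero => simp
    | add x y _ _ hx hy => rw [mul_add]; exact S.add_mem hx hy
    | smul c x _ hx => rw [mul_smul_comm]; exact S.smul_mem _ hx
  rw [eq_top_iff]
  intro a _
  rw [← mul_one a]
  refine AShriek.mul_mem_of_arrows S (fun i => key _ fun x l y => ?_) (fun i => key _ fun x l y => ?_)
    (fun i => key _ fun x l y => ?_) a 1 ?_
  · rw [← eN_val, eN_mul_valley']
    split_ifs <;> [exact mem _ _ _; exact S.zero_mem]
  · rw [← uN_val]
    by_cases h : i.val = l + x
    · rw [h, uN_mul_valley]; exact mem _ _ _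
    · rw [uN_mul_valley_of_ne k n h]; exact S.zero_mem
  · rw [← dN_val]
    by_cases h : i.val + 1 = l + x
    · rcases l with _ | l
      · obtain rfl : x = i.val + 1 := by omega
        rw [dN_mul_valley_zero]; exact S.zero_mem
      · have : i.val = l + x := by omega
        rw [this, dN_mul_valley k n _ _ _ (by omega)]; exact mem _ _ _
    · rw [dN_mul_valley_of_ne k n h]; exact S.zero_mem
  · rw [← sum_eN]
    refine S.sum_mem fun i _ => ?_
    rw [← valley_zero_zero]; exact mem _ _ _

/-- The basis of `A_n^!` that consists of the paths going first down and then up. -/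
def valleyBasis : Module.Basis (ValleyIdx n) k (AShriek k n) :=
  Module.Basis.mk (v := valleyVec k n) (by
    rw [Fintype.linearIndependent_iff]
    intro g hg t
    have := congrArg (valleyCoef k n t) hg
    simpa [map_sum, valleyCoef_valleyVec] using this) (span_valleyVec k n).ge

@[simp] theorem valleyBasis_apply (t : ValleyIdx n) : valleyBasis k n t = valleyVec k n t := by
  simp [valleyBasis]

end Paths

/-! ### Graded spaces with a dual basis -/

section GradedDualBasis

variable {k : Type*} [Field k] {H : Type*} [AddCommGroup H] [Module k H]
  {ι : Type*} [DecidableEq ι]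

/-- A family of subspaces of `H` together with coordinates on `H` that are adapted to it: the
coordinates separate points, the dual vectors are homogeneous, and the coordinate with index `t`
vanishes on all pieces except that of degree `deg t`. -/
structure GradedDualBasis (𝓗 : ℤ → Submodule k H) (Λ : H →ₗ[k] (ι → k)) (deg : ι → ℤ)
    (v : ι → H) : Prop where
  injective : ∀ h, Λ h = 0 → h = 0
  mem : ∀ t, v t ∈ 𝓗 (deg t)
  dual : ∀ t, Λ (v t) = Pi.single t 1
  vanish : ∀ j, ∀ h ∈ 𝓗 j, ∀ t, j ≠ deg t → Λ h t = 0

namespace GradedDualBasis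

variable {𝓗 : ℤ → Submodule k H} {Λ : H →ₗ[k] (ι → k)} {deg : ι → ℤ} {v : ι → H}

theorem eq_sum [Fintype ι] (hb : GradedDualBasis 𝓗 Λ deg v) (h : H) : h = ∑ t, Λ h t • v t := by
  rw [← sub_eq_zero]
  apply hb.injective
  funext s
  simp [map_sum, hb.dual, Pi.single_apply]

theorem linearIndependent [Fintype ι] (hb : GradedDualBasis 𝓗 Λ deg v) : LinearIndependent k v := by
  rw [Fintype.linearIndependent_iff]
  intro g hg t
  have := congrFun (congrArg Λ hg) t
  simpa [map_sum, hb.dual, Pi.single_apply] using this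

theorem span_eq_top [Fintype ι] (hb : GradedDualBasis 𝓗 Λ deg v) : Submodule.span k (Set.range v) = ⊤ := by
  rw [eq_top_iff]
  intro h _
  rw [hb.eq_sum h]
  exact Submodule.sum_mem _ fun t _ =>
    Submodule.smul_mem _ _ (Submodule.subset_span (Set.mem_range_self t))

theorem isInternal [Fintype ι] (hb : GradedDualBasis 𝓗 Λ deg v) : DirectSum.IsInternal 𝓗 := by
  rw [DirectSum.isInternal_submodule_iff_iSupIndep_and_iSup_eq_top]
  constructor
  · intro j
    rw [Submodule.disjoint_def]
    intro h hj hs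
    apply hb.injective
    funext t
    by_cases ht : j = deg t
    · have hle : (⨆ i, ⨆ (_ : i ≠ j), 𝓗 i) ≤ LinearMap.ker (LinearMap.proj t ∘ₗ Λ) := by
        refine iSup₂_le fun i hi x hx => ?_
        exact hb.vanish i x hx t (fun h => hi (h.trans ht.symm))
      exact hle hs
    · exact hb.vanish j h hj t ht
  · rw [eq_top_iff, ← hb.span_eq_top, Submodule.span_le]
    rintro _ ⟨t, rfl⟩
    exact Submodule.mem_iSup_of_mem (deg t) (hb.mem t)

theorem eq_bot (hb : GradedDualBasis 𝓗 Λ deg v) {j : ℤ} (hj : ∀ t, j ≠ deg t) : 𝓗 j = ⊥ := by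
  rw [eq_bot_iff]
  intro h hh
  exact hb.injective h (funext fun t => hb.vanish j h hh t (hj t))

theorem equiv_of_injective (hb : GradedDualBasis 𝓗 Λ deg v) (hinj : Function.Injective deg)
    (t : ι) : Nonempty (𝓗 (deg t) ≃ₗ[k] k) := by
  refine ⟨LinearEquiv.ofBijective ((LinearMap.proj t ∘ₗ Λ).domRestrict (𝓗 (deg t))) ⟨?_, ?_⟩⟩
  · rw [← LinearMap.ker_eq_bot, LinearMap.ker_eq_bot']
    rintro ⟨h, hh⟩ h0
    apply Subtype.ext
    apply hb.injective
    funext s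
    by_cases hs : t = s
    · subst hs; exact h0
    · exact hb.vanish _ h hh s (fun h' => hs (hinj h'))
  · intro c
    refine ⟨⟨c • v t, Submodule.smul_mem _ _ (hb.mem t)⟩, ?_⟩
    simp [LinearMap.domRestrict_apply, hb.dual]

theorem equiv_of_const [Fintype ι] (hb : GradedDualBasis 𝓗 Λ deg v) {d : ℤ} (hd : ∀ t, deg t = d) :
    Nonempty (𝓗 d ≃ₗ[k] (ι → k)) := by
  refine ⟨LinearEquiv.ofBijective (Λ.domRestrict (𝓗 d)) ⟨?_, ?_⟩⟩
  · rw [← LinearMap.ker_eq_bot, LinearMap.ker_eq_bot']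
    rintro ⟨h, hh⟩ h0
    exact Subtype.ext (hb.injective h h0)
  · intro c
    refine ⟨⟨∑ t, c t • v t, Submodule.sum_mem _ fun t _ =>
      Submodule.smul_mem _ _ (hd t ▸ hb.mem t)⟩, ?_⟩
    funext s
    simp [LinearMap.domRestrict_apply, map_sum, hb.dual, Pi.single_apply]

end GradedDualBasis

end GradedDualBasis

/-! ### The path-length grading -/

section Grading

variable (k : Type u) [Field k] (n : ℕ)

section Ext

variable {k n} {M : Type*} [AddCommGroup M] [Module k M]

theorem linearMap_ext_valley {f g : AShriek k n →ₗ[k] M}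
    (h : ∀ x l y, l + x < n → l + y < n → f (valley k n x l y) = g (valley k n x l y)) :
    f = g := by
  refine (valleyBasis k n).ext fun t => ?_
  rw [valleyBasis_apply]
  exact h _ _ _ (by have := t.2.1.2; omega) (by have := t.2.2.2; omega)

/-- The linear map with prescribed values on the valleys. -/
def valleyMap (F : ℕ → ℕ → ℕ → M) : AShriek k n →ₗ[k] M :=
  (valleyBasis k n).constr k fun t => F t.2.1 t.1 t.2.2

theorem valleyMap_valley (F : ℕ → ℕ → ℕ → M) {x l y : ℕ} (hx : l + x < n) (hy : l + y < n) :
    valleyMap F (valley k n x l y) = F x l y := by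
  have := (valleyBasis k n).constr_basis k (fun t : ValleyIdx n => F t.2.1 t.1 t.2.2)
    ⟨⟨l, by omega⟩, ⟨x, by simp only; omega⟩, ⟨y, by simp only; omega⟩⟩
  rwa [valleyBasis_apply] at this

theorem valley_induction {p : AShriek k n → Prop}
    (h : ∀ x l y, l + x < n → l + y < n → p (valley k n x l y)) (h0 : p 0)
    (hadd : ∀ a b, p a → p b → p (a + b)) (hsmul : ∀ (c : k) a, p a → p (c • a)) (a) : p a := by
  have : a ∈ Submodule.span k (Set.range (valleyVec k n)) := by
    rw [span_valleyVec]; trivial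
  induction this using Submodule.span_induction with
  | mem z hz =>
    obtain ⟨t, rfl⟩ := hz
    exact h _ _ _ (by have := t.2.1.2; omega) (by have := t.2.2.2; omega)
  | zero => exact h0
  | add x y _ _ hx hy => exact hadd _ _ hx hy
  | smul c x _ hx => exact hsmul _ _ hx

theorem dN_mul_valley_cases (q x l y : ℕ) :
    (∃ x' l' y', x' + y' = x + y + 1 ∧ dN k n q * valley k n x l y = valley k n x' l' y') ∨
      dN k n q * valley k n x l y = 0 := by
  by_cases hq : q + 1 = l + x
  · by_cases hn : q + 1 < n
    · rcases l with _ | l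
      · obtain rfl : x = q + 1 := by omega
        exact Or.inr (dN_mul_valley_zero k n q y)
      · obtain rfl : q = l + x := by omega
        exact Or.inl ⟨x, l, y + 1, by omega, dN_mul_valley k n x l y hn⟩
    · exact Or.inr (by rw [dN_of_le k n (by omega), zero_mul])
  · exact Or.inr (dN_mul_valley_of_ne k n hq)

end Ext

/-- The span of the valleys of length `d`. -/
def valleySpan (d : ℤ) : Submodule k (AShriek k n) :=
  Submodule.span k {a | ∃ x l y : ℕ, (x + y : ℤ) = d ∧ a = valley k n x l y}

variable {k n}

theorem valley_mem_valleySpan {x l y : ℕ} {d : ℤ} (h : (x + y : ℤ) = d) :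
    valley k n x l y ∈ valleySpan k n d := Submodule.subset_span ⟨x, l, y, h, rfl⟩

theorem mul_mem_valleySpan {a : AShriek k n} {d r : ℤ}
    (h : ∀ x l y : ℕ, (x + y : ℤ) = d → a * valley k n x l y ∈ valleySpan k n (r + d))
    {b : AShriek k n} (hb : b ∈ valleySpan k n d) : a * b ∈ valleySpan k n (r + d) := by
  induction hb using Submodule.span_induction with
  | mem z hz => obtain ⟨x, l, y, hd, rfl⟩ := hz; exact h x l y hd
  | zero => simp
  | add x y _ _ hx hy => rw [mul_add]; exact Submodule.add_mem _ hx hy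
  | smul c x _ hx => rw [mul_smul_comm]; exact Submodule.smul_mem _ _ hx

theorem eN_mul_mem_valleySpan (q : ℕ) {d : ℤ} {b : AShriek k n} (hb : b ∈ valleySpan k n d) :
    eN k n q * b ∈ valleySpan k n (0 + d) := by
  refine mul_mem_valleySpan (fun x l y h => ?_) hb
  rw [eN_mul_valley']
  split_ifs
  · exact valley_mem_valleySpan (by omega)
  · exact Submodule.zero_mem _

theorem uN_mul_mem_valleySpan (q : ℕ) {d : ℤ} {b : AShriek k n} (hb : b ∈ valleySpan k n d) :
    uN k n q * b ∈ valleySpan k n (1 + d) := by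
  refine mul_mem_valleySpan (fun x l y h => ?_) hb
  by_cases hq : q = l + x
  · rw [hq, uN_mul_valley]; exact valley_mem_valleySpan (by push_cast; omega)
  · rw [uN_mul_valley_of_ne k n hq]; exact Submodule.zero_mem _

theorem dN_mul_mem_valleySpan (q : ℕ) {d : ℤ} {b : AShriek k n} (hb : b ∈ valleySpan k n d) :
    dN k n q * b ∈ valleySpan k n (1 + d) := by
  refine mul_mem_valleySpan (fun x l y h => ?_) hb
  rcases dN_mul_valley_cases (k := k) (n := n) q x l y with ⟨x', l', y', h', h''⟩ | h''
  · rw [h'']; exact valley_mem_valleySpan (by omega)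
  · rw [h'']; exact Submodule.zero_mem _

theorem upPath_mul_mem_valleySpan (x l : ℕ) {d : ℤ} {b : AShriek k n}
    (hb : b ∈ valleySpan k n d) : upPath k n x l * b ∈ valleySpan k n (x + d) := by
  induction x with
  | zero => exact_mod_cast eN_mul_mem_valleySpan l hb
  | succ x ih =>
    rw [upPath, mul_assoc]
    convert uN_mul_mem_valleySpan (l + x) ih using 1
    push_cast; congr 1; ring

theorem downPath_mul_mem_valleySpan (y l : ℕ) {d : ℤ} {b : AShriek k n}
    (hb : b ∈ valleySpan k n d) : downPath k n y l * b ∈ valleySpan k n (y + d) := by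
  induction y generalizing l with
  | zero => exact_mod_cast eN_mul_mem_valleySpan l hb
  | succ y ih =>
    rw [downPath_succ', mul_assoc]
    convert dN_mul_mem_valleySpan l (ih (l + 1)) using 1
    push_cast; congr 1; ring

theorem valleySpan_mul {d d' : ℤ} {a b : AShriek k n} (ha : a ∈ valleySpan k n d)
    (hb : b ∈ valleySpan k n d') : a * b ∈ valleySpan k n (d + d') := by
  induction ha using Submodule.span_induction with
  | mem z hz =>
    obtain ⟨x, l, y, hd, rfl⟩ := hz
    rw [valley, mul_assoc]
    convert upPath_mul_mem_valleySpan x l (downPath_mul_mem_valleySpan y l hb) using 1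
    rw [← hd, add_assoc]
  | zero => simp
  | add x y _ _ hx hy => rw [add_mul]; exact Submodule.add_mem _ hx hy
  | smul c x _ hx => rw [smul_mul_assoc]; exact Submodule.smul_mem _ _ hx

theorem eN_mem_valleySpan (q : ℕ) : eN k n q ∈ valleySpan k n 0 := by
  rw [← valley_zero_zero]; exact valley_mem_valleySpan (by simp)

theorem uN_mem_valleySpan (q : ℕ) : uN k n q ∈ valleySpan k n 1 := by
  have := uN_mul_mem_valleySpan q (eN_mem_valleySpan (k := k) (n := n) q)
  rwa [uN_mul_eN] at this

theorem dN_mem_valleySpan (q : ℕ) : dN k n q ∈ valleySpan k n 1 := by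
  have := dN_mul_mem_valleySpan q (eN_mem_valleySpan (k := k) (n := n) (q + 1))
  rwa [dN_mul_eN] at this

theorem vertSpan_eq : vertSpan k n = valleySpan k n 0 := by
  apply le_antisymm
  · rw [vertSpan, Submodule.span_le]
    rintro _ ⟨i, rfl⟩
    rw [← eN_val]
    exact eN_mem_valleySpan _
  · rw [valleySpan, Submodule.span_le]
    rintro _ ⟨x, l, y, h, rfl⟩
    obtain ⟨rfl, rfl⟩ : x = 0 ∧ y = 0 := by omega
    rw [valley_zero_zero]
    by_cases hl : l < n
    · exact Submodule.subset_span ⟨⟨l, hl⟩, (eN_val k _).symm⟩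
    · rw [eN_of_le k n (by omega)]; exact Submodule.zero_mem _

theorem uN_mem_arrowSpan (q : ℕ) : uN k n q ∈ arrowSpan k n := by
  by_cases h : q + 1 < n
  · exact Submodule.subset_span (Or.inl ⟨⟨q, by omega⟩, (uN_val k _).symm⟩)
  · rw [uN_of_le k n (by omega)]; exact Submodule.zero_mem _

theorem dN_mem_arrowSpan (q : ℕ) : dN k n q ∈ arrowSpan k n := by
  by_cases h : q + 1 < n
  · exact Submodule.subset_span (Or.inr ⟨⟨q, by omega⟩, (dN_val k _).symm⟩)
  · rw [dN_of_le k n (by omega)]; exact Submodule.zero_mem _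

theorem arrowSpan_le : arrowSpan k n ≤ valleySpan k n 1 := by
  rw [arrowSpan, Submodule.span_le]
  rintro _ (⟨i, rfl⟩ | ⟨i, rfl⟩)
  · rw [← uN_val]; exact uN_mem_valleySpan _
  · rw [← dN_val]; exact dN_mem_valleySpan _

theorem one_mem_vertSpan : (1 : AShriek k n) ∈ vertSpan k n := by
  rw [vertSpan_eq, ← sum_eN]
  exact Submodule.sum_mem _ fun i _ => eN_mem_valleySpan i

theorem arrowSpan_le_vertSpan_mul : arrowSpan k n ≤ vertSpan k n * arrowSpan k n := by
  intro a ha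
  rw [← one_mul a]
  exact Submodule.mul_mem_mul one_mem_vertSpan ha

theorem arrowSpan_mul_vertSpan_le :
    arrowSpan k n * vertSpan k n ≤ vertSpan k n * arrowSpan k n := by
  refine le_trans ?_ arrowSpan_le_vertSpan_mul
  rw [Submodule.mul_le]
  intro a ha e he
  rw [arrowSpan] at ha
  rw [vertSpan] at he
  induction he using Submodule.span_induction with
  | zero => simp
  | add x y _ _ hx hy => rw [mul_add]; exact Submodule.add_mem _ hx hy
  | smul c x _ hx => rw [mul_smul_comm]; exact Submodule.smul_mem _ _ hx
  | mem z hz =>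
    obtain ⟨i, rfl⟩ := hz
    rw [← eN_val]
    induction ha using Submodule.span_induction with
    | zero => simp
    | add x y _ _ hx hy => rw [add_mul]; exact Submodule.add_mem _ hx hy
    | smul c x _ hx => rw [smul_mul_assoc]; exact Submodule.smul_mem _ _ hx
    | mem z hz =>
      rcases hz with ⟨q, rfl⟩ | ⟨q, rfl⟩
      · rw [← uN_val]
        by_cases h : q.val = i.val
        · rw [← h, uN_mul_eN]; exact uN_mem_arrowSpan _
        · rw [uN_mul_eN_of_ne k n h]; exact Submodule.zero_mem _
      · rw [← dN_val]
        by_cases h : q.val + 1 = i.val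
        · rw [← h, dN_mul_eN]; exact dN_mem_arrowSpan _
        · rw [dN_mul_eN_of_ne k n h]; exact Submodule.zero_mem _

theorem valleySpan_succ_le (d : ℕ) :
    valleySpan k n (d + 1) ≤ arrowSpan k n * valleySpan k n d := by
  rw [valleySpan, Submodule.span_le]
  rintro _ ⟨x, l, y, h, rfl⟩
  rcases x with _ | x
  · obtain rfl : y = d + 1 := by omega
    rw [valley_x_zero, downPath_succ', ← valley_x_zero]
    exact Submodule.mul_mem_mul (dN_mem_arrowSpan l) (valley_mem_valleySpan (by simp))
  · rw [← uN_mul_valley]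
    exact Submodule.mul_mem_mul (uN_mem_arrowSpan _) (valley_mem_valleySpan (by omega))

theorem vertSpan_mul_arrowSpan_pow (d : ℕ) :
    vertSpan k n * arrowSpan k n ^ d = valleySpan k n d := by
  induction d with
  | zero => rw [pow_zero, mul_one, vertSpan_eq, Nat.cast_zero]
  | succ d ih =>
    apply le_antisymm
    · rw [pow_succ, ← mul_assoc, ih, Submodule.mul_le]
      intro a ha b hb
      push_cast
      exact valleySpan_mul ha (arrowSpan_le hb)
    · push_cast
      refine (valleySpan_succ_le d).trans ?_
      rw [← ih, pow_succ', ← mul_assoc, ← mul_assoc]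
      exact mul_le_mul' arrowSpan_mul_vertSpan_le le_rfl

theorem pathGrading_eq (d : ℤ) : pathGrading k n d = valleySpan k n d := by
  rw [pathGrading]
  split_ifs with h
  · rw [vertSpan_mul_arrowSpan_pow, Int.toNat_of_nonneg h]
  · symm
    rw [eq_bot_iff, valleySpan, Submodule.span_le]
    rintro _ ⟨x, l, y, h', rfl⟩
    omega

theorem valley_mem_pathGrading {x l y : ℕ} {d : ℤ} (h : (x + y : ℤ) = d) :
    valley k n x l y ∈ pathGrading k n d := by
  rw [pathGrading_eq]; exact valley_mem_valleySpan h

theorem pathGrading_mul {d d' : ℤ} {a b : AShriek k n} (ha : a ∈ pathGrading k n d)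
    (hb : b ∈ pathGrading k n d') : a * b ∈ pathGrading k n (d + d') := by
  rw [pathGrading_eq] at *; exact valleySpan_mul ha hb

theorem valleyCoef_valley {x l y : ℕ} (hx : l + x < n) (hy : l + y < n) (t : ValleyIdx n) :
    valleyCoef k n t (valley k n x l y) =
      if t = ⟨⟨l, by omega⟩, ⟨x, by simp only; omega⟩, ⟨y, by simp only; omega⟩⟩ then 1 else 0 :=
  valleyCoef_valleyVec k n t ⟨⟨l, by omega⟩, ⟨x, by simp only; omega⟩, ⟨y, by simp only; omega⟩⟩

theorem valleyCoef_eq_zero {d : ℤ} {a : AShriek k n} (ha : a ∈ pathGrading k n d)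
    (t : ValleyIdx n) (h : d ≠ (t.2.1 + t.2.2 : ℤ)) : valleyCoef k n t a = 0 := by
  rw [pathGrading_eq] at ha
  induction ha using Submodule.span_induction with
  | zero => simp
  | add x y _ _ hx hy => rw [map_add, hx, hy, add_zero]
  | smul c x _ hx => rw [map_smul, hx, smul_zero]
  | mem z hz =>
    obtain ⟨x, l, y, hd, rfl⟩ := hz
    by_cases hx : l + x < n
    · by_cases hy : l + y < n
      · rw [valleyCoef_valley hx hy, if_neg]
        rintro rfl
        simp at h; omega
      · rw [valley_of_le_right k n (by omega), map_zero]
    · rw [valley_of_le_left k n (by omega), map_zero]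

variable (k n) in
theorem pathGrading_dualBasis : GradedDualBasis (pathGrading k n)
    (LinearMap.pi (valleyCoef k n)) (fun t => (t.2.1 + t.2.2 : ℤ)) (valleyVec k n) where
  injective a ha := by
    rw [← (valleyBasis k n).sum_repr a] at ha ⊢
    refine Finset.sum_eq_zero fun t _ => ?_
    have := congrFun ha t
    simp [map_sum, valleyCoef_valleyVec] at this
    rw [this, zero_smul]
  mem t := valley_mem_pathGrading rfl
  dual t := by
    funext s
    simp [valleyCoef_valleyVec, Pi.single_apply]
  vanish j a ha t h := valleyCoef_eq_zero ha t h

end Grading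

/-! ### The central element and one-sided division by arrows -/

section Center

variable (k : Type u) [Field k] (n : ℕ)

theorem centralC_eq : centralC k n = ∑ q ∈ Finset.range (n - 1), uN k n q * dN k n q := by
  rw [centralC, Finset.sum_range]
  exact Finset.sum_congr rfl fun i _ => by rw [uN_val, dN_val]

theorem centralC_mul_eN_succ (v : ℕ) :
    centralC k n * eN k n (v + 1) = uN k n v * dN k n v := by
  rw [centralC_eq, Finset.sum_mul]
  by_cases h : v + 1 < n
  · rw [Finset.sum_eq_single v]
    · rw [mul_assoc, dN_mul_eN]
    · intro q _ hq
      rw [mul_assoc, dN_mul_eN_of_ne k n (by omega), mul_zero]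
    · intro hv; exact absurd (Finset.mem_range.2 (by omega)) hv
  · rw [uN_of_le k n (by omega), zero_mul]
    refine Finset.sum_eq_zero fun q hq => ?_
    rw [eN_of_le k n (by omega), mul_zero]

theorem centralC_mul_eN_zero : centralC k n * eN k n 0 = 0 := by
  rw [centralC_eq, Finset.sum_mul]
  refine Finset.sum_eq_zero fun q _ => ?_
  rw [mul_assoc, dN_mul_eN_of_ne k n (by omega), mul_zero]

theorem centralC_mul_valley_succ (x l y : ℕ) :
    centralC k n * valley k n x (l + 1) y = valley k n (x + 1) l (y + 1) := by
  rw [← eN_mul_valley, ← mul_assoc, show l + 1 + x = l + x + 1 by omega, centralC_mul_eN_succ,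
    mul_assoc]
  by_cases h : l + x + 1 < n
  · rw [dN_mul_valley k n x l y h, uN_mul_valley]
  · rw [uN_of_le k n (by omega), zero_mul, valley_of_le_left k n (by omega)]

theorem centralC_mul_valley_zero (x y : ℕ) : centralC k n * valley k n x 0 y = 0 := by
  rw [← eN_mul_valley, ← mul_assoc]
  rcases x with _ | x
  · rw [zero_add, centralC_mul_eN_zero, zero_mul]
  · rw [zero_add, centralC_mul_eN_succ, mul_assoc, dN_mul_valley_zero, mul_zero]

theorem centralC_pow_mul_valley (m x l y : ℕ) :
    centralC k n ^ m * valley k n x (l + m) y = valley k n (x + m) l (y + m) := by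
  induction m generalizing x l y with
  | zero => simp
  | succ m ih =>
    rw [pow_succ, mul_assoc, ← add_assoc, centralC_mul_valley_succ, ih]
    congr 1 <;> omega

theorem centralC_pow_mul_valley_of_lt {m l : ℕ} (h : l < m) (x y : ℕ) :
    centralC k n ^ m * valley k n x l y = 0 := by
  induction m generalizing x l y with
  | zero => omega
  | succ m ih =>
    rw [pow_succ, mul_assoc]
    rcases l with _ | l
    · rw [centralC_mul_valley_zero, mul_zero]
    · rw [centralC_mul_valley_succ, ih (by omega)]

theorem centralC_commute (a : AShriek k n) : centralC k n * a = a * centralC k n := by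
  have key : ∀ b : AShriek k n, (∀ x l y, centralC k n * (b * valley k n x l y) =
      b * (centralC k n * valley k n x l y)) → centralC k n * b = b * centralC k n := by
    intro b hb
    have : ∀ a : AShriek k n, centralC k n * (b * a) = b * (centralC k n * a) := by
      intro a
      induction a using valley_induction with
      | h x l y hx hy => exact hb x l y
      | h0 => simp
      | hadd a b ha hb => simp only [mul_add, ha, hb]
      | hsmul c a ha => simp only [mul_smul_comm, ha]
    simpa using this 1
  refine AShriek.commute_of_arrows _ (fun i => ?_) (fun i => ?_) (fun i => ?_) a
  · rw [← eN_val]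
    refine key _ fun x l y => ?_
    rcases l with _ | l
    · rw [eN_mul_valley', centralC_mul_valley_zero, mul_zero]
      split_ifs <;> simp [centralC_mul_valley_zero]
    · rw [eN_mul_valley', centralC_mul_valley_succ, eN_mul_valley']
      split_ifs <;> first | omega | simp [centralC_mul_valley_succ]
  · rw [← uN_val]
    refine key _ fun x l y => ?_
    rcases l with _ | l
    · rw [centralC_mul_valley_zero, mul_zero]
      by_cases h : i.val = 0 + x
      · rw [h, uN_mul_valley, centralC_mul_valley_zero]
      · rw [uN_mul_valley_of_ne k n h, mul_zero]
    · rw [centralC_mul_valley_succ]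
      by_cases h : i.val = l + 1 + x
      · rw [h, uN_mul_valley, centralC_mul_valley_succ,
          show l + 1 + x = l + (x + 1) by omega, uN_mul_valley]
      · rw [uN_mul_valley_of_ne k n h, uN_mul_valley_of_ne k n (by omega), mul_zero]
  · rw [← dN_val]
    have hi := i.2
    refine key _ fun x l y => ?_
    by_cases h : i.val + 1 = l + x
    · rcases l with _ | _ | l
      · obtain rfl : x = i.val + 1 := by omega
        rw [dN_mul_valley_zero, centralC_mul_valley_zero, mul_zero, mul_zero]
      · obtain rfl : x = i.val := by omega
        have h1 := dN_mul_valley k n i.val 0 y (by omega)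
        rw [zero_add] at h1
        rw [h1, centralC_mul_valley_zero, centralC_mul_valley_succ, dN_mul_valley_zero]
      · have h1 : i.val = (l + 1) + x := by omega
        rw [centralC_mul_valley_succ, h1, dN_mul_valley k n x (l + 1) y (by omega),
          centralC_mul_valley_succ, show l + 1 + x = l + (x + 1) by omega,
          dN_mul_valley k n (x + 1) l (y + 1) (by omega)]
    · rw [dN_mul_valley_of_ne k n h, mul_zero]
      rcases l with _ | l
      · rw [centralC_mul_valley_zero, mul_zero]
      · rw [centralC_mul_valley_succ, dN_mul_valley_of_ne k n (by omega)]

theorem centralC_pow_commute (m : ℕ) (a : AShriek k n) :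
    centralC k n ^ m * a = a * centralC k n ^ m :=
  (Commute.pow_left (centralC_commute k n a) m)

theorem centralC_pow_eq_sum (m : ℕ) :
    centralC k n ^ m = ∑ v ∈ Finset.range n, centralC k n ^ m * eN k n v := by
  rw [← Finset.mul_sum, sum_eN, mul_one]

theorem centralC_pow_mul_eN (m v : ℕ) :
    centralC k n ^ m * eN k n v = if m ≤ v then valley k n m (v - m) m else 0 := by
  rw [← valley_zero_zero]
  split_ifs with h
  · obtain ⟨l, rfl⟩ := Nat.exists_eq_add_of_le' h
    rw [centralC_pow_mul_valley, Nat.add_sub_cancel, zero_add]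
  · exact centralC_pow_mul_valley_of_lt k n (by omega) _ _

theorem centralC_pow_mem (m : ℕ) : centralC k n ^ m ∈ pathGrading k n (2 * m) := by
  rw [centralC_pow_eq_sum]
  refine Submodule.sum_mem _ fun v _ => ?_
  rw [centralC_pow_mul_eN]
  split_ifs
  · exact valley_mem_pathGrading (by omega)
  · exact Submodule.zero_mem _

theorem centralC_pow_self : centralC k n ^ n = 0 := by
  rw [centralC_pow_eq_sum]
  refine Finset.sum_eq_zero fun v hv => ?_
  rw [centralC_pow_mul_eN, if_neg (by have := Finset.mem_range.1 hv; omega)]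

/-- Left division by a downward arrow: it strips the first step down from the left of a path,
after the climb is moved up by one vertex, and kills the paths without a step down. -/
def divL : AShriek k n →ₗ[k] AShriek k n :=
  valleyMap fun x l y => if y = 0 then 0 else valley k n x (l + 1) (y - 1)

/-- Right division by a downward arrow. -/
def divR : AShriek k n →ₗ[k] AShriek k n :=
  valleyMap fun x l y => if y = 0 then 0 else valley k n x l (y - 1)

variable {k n}

theorem divL_valley (x l y : ℕ) :
    divL k n (valley k n x l y) = if y = 0 then 0 else valley k n x (l + 1) (y - 1) := by
  by_cases hx : l + x < n
  · by_cases hy : l + y < n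
    · exact valleyMap_valley _ hx hy
    · rw [valley_of_le_right k n (by omega), map_zero]
      split_ifs
      · rfl
      · rw [valley_of_le_right k n (by omega)]
  · rw [valley_of_le_left k n (by omega), map_zero, valley_of_le_left k n (by omega), ite_self]

theorem divL_mul_eN (a : AShriek k n) (i : ℕ) : divL k n a * eN k n i = divL k n (a * eN k n i) := by
  induction a using valley_induction with
  | h x l y hx hy =>
    rw [divL_valley, valley_mul_eN']
    rcases y with _ | y
    · rw [if_pos rfl]; split_ifs <;> simp [divL_valley]
    · rw [if_neg (by omega), valley_mul_eN', Nat.add_sub_cancel]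
      split_ifs <;> first | omega | simp [divL_valley]
  | h0 => simp
  | hadd a b ha hb => simp only [add_mul, map_add, ha, hb]
  | hsmul c a ha => simp only [smul_mul_assoc, map_smul, ha]

theorem eN_mul_divL (a : AShriek k n) (i : ℕ) :
    eN k n (i + 1) * divL k n a = divL k n (eN k n i * a) := by
  induction a using valley_induction with
  | h x l y hx hy =>
    rw [divL_valley, eN_mul_valley']
    rcases y with _ | y
    · rw [if_pos rfl]; split_ifs <;> simp [divL_valley]
    · rw [if_neg (by omega), eN_mul_valley', Nat.add_sub_cancel]
      split_ifs <;> first | omega | simp [divL_valley]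
  | h0 => simp
  | hadd a b ha hb => simp only [mul_add, map_add, ha, hb]
  | hsmul c a ha => simp only [mul_smul_comm, map_smul, ha]

/-- A path that reaches `p` from a higher vertex is divisible on the left by the arrow from
`p + 1` to `p`. -/
theorem dN_mul_divL {p : ℕ} (hp : p + 1 < n) (a : AShriek k n) :
    dN k n p * divL k n (eN k n p * a * eN k n (p + 1)) = eN k n p * a * eN k n (p + 1) := by
  induction a using valley_induction with
  | h x l y hx hy =>
    rw [eN_mul_valley']
    split_ifs with h
    · rw [valley_mul_eN']
      split_ifs with h'
      · rcases y with _ | y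
        · omega
        · rw [divL_valley, if_neg (by omega), Nat.add_sub_cancel, h, dN_mul_valley k n _ _ _ (by omega)]
      · simp
    · simp
  | h0 => simp
  | hadd a b ha hb => simp only [add_mul, mul_add, map_add, ha, hb]
  | hsmul c a ha => simp only [smul_mul_assoc, mul_smul_comm, map_smul, ha]

/-- Right multiplication by the arrow from `p + 1` to `p` is injective on paths from `p`. -/
theorem divR_mul_dN {p : ℕ} (hp : p + 1 < n) (a : AShriek k n) :
    divR k n (a * eN k n p * dN k n p) = a * eN k n p := by
  induction a using valley_induction with
  | h x l y hx hy =>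
    rw [valley_mul_eN']
    split_ifs with h
    · rw [← h, valley_mul_dN, divR, valleyMap_valley _ hx (by omega), if_neg (by omega),
        Nat.add_sub_cancel]
    · simp
  | h0 => simp
  | hadd a b ha hb => simp only [add_mul, map_add, ha, hb]
  | hsmul c a ha => simp only [smul_mul_assoc, map_smul, ha]

theorem eq_zero_of_mul_dN {p : ℕ} (hp : p + 1 < n) {a : AShriek k n} (ha : a * eN k n p = a)
    (h : a * dN k n p = 0) : a = 0 := by
  have := divR_mul_dN hp a
  rw [ha, h, map_zero] at this
  exact this.symm

theorem augmentation_aRep (p : Fin n) :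
    ARep (fun i : Fin n => if i = p then (1 : k) else 0) (fun _ => 0) (fun _ => 0) where
  idem i := by simp
  orth i j h := by
    by_cases hi : i = p
    · subst hi; simp [Ne.symm h]
    · simp [hi]
  one := by simp
  up_target i := by simp
  up_source i := by simp
  down_target i := by simp
  down_source i := by simp
  loop_first i h := by simp
  loop i j h := by simp

/-- The one-dimensional representation at the vertex `p`: the coefficient of `(p)`. -/
def augmentation (p : Fin n) : AShriek k n →ₐ[k] k := (augmentation_aRep p).lift

@[simp] theorem augmentation_eN (p : Fin n) (i : ℕ) :
    augmentation p (eN k n i) = if i = p.val then 1 else 0 := by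
  by_cases h : i < n
  · simp [eN, h, augmentation, Fin.ext_iff]
  · rw [eN_of_le k n (by omega), map_zero, if_neg (by omega)]

@[simp] theorem augmentation_uN (p : Fin n) (i : ℕ) : augmentation p (uN k n i) = 0 := by
  by_cases h : i + 1 < n
  · simp [uN, h, augmentation]
  · rw [uN_of_le k n (by omega), map_zero]

@[simp] theorem augmentation_dN (p : Fin n) (i : ℕ) : augmentation p (dN k n i) = 0 := by
  by_cases h : i + 1 < n
  · simp [dN, h, augmentation]
  · rw [dN_of_le k n (by omega), map_zero]

theorem augmentation_valley (p : Fin n) (x l y : ℕ) :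
    augmentation p (valley k n x l y) = if x = 0 ∧ y = 0 ∧ l = p.val then 1 else 0 := by
  rcases x with _ | x
  · rcases y with _ | y
    · simp
    · rw [valley, downPath]; simp
  · rw [valley, upPath]; simp

theorem augmentation_eq_zero (p : Fin n) {d : ℤ} (hd : d ≠ 0) {a : AShriek k n}
    (ha : a ∈ pathGrading k n d) : augmentation p a = 0 := by
  rw [pathGrading_eq] at ha
  induction ha using Submodule.span_induction with
  | zero => simp
  | add x y _ _ hx hy => rw [map_add, hx, hy, add_zero]
  | smul c x _ hx => rw [map_smul, hx, smul_zero]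
  | mem z hz =>
    obtain ⟨x, l, y, h, rfl⟩ := hz
    rw [augmentation_valley, if_neg (by omega)]

/-- A loop at `p` without constant term is divisible on the left by the arrow from `p + 1`
to `p`. -/
theorem dN_mul_divL_loop (p : Fin n) (hp : p.val + 1 < n) (a : AShriek k n) :
    dN k n p * divL k n (eN k n p * a * eN k n p) =
      eN k n p * a * eN k n p - augmentation p a • eN k n p := by
  induction a using valley_induction with
  | h x l y hx hy =>
    rw [eN_mul_valley', augmentation_valley]
    split_ifs with h h' h'
    · obtain ⟨rfl, rfl, h'⟩ := h'
      have h0 := divL_valley (k := k) (n := n) 0 l 0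
      rw [valley_zero_zero, if_pos rfl] at h0
      rw [valley_zero_zero, ← h', eN_mul_self, h0, mul_zero, one_smul, sub_self]
    · rw [valley_mul_eN']
      split_ifs with h''
      · rcases y with _ | y
        · omega
        · rw [divL_valley, if_neg (by omega), Nat.add_sub_cancel, h,
            dN_mul_valley k n _ _ _ (by omega), zero_smul, sub_zero]
      · simp
    · omega
    · simp
  | h0 => simp
  | hadd a b ha hb => simp only [add_mul, mul_add, map_add, ha, hb, add_smul]; abel
  | hsmul c a ha =>
    simp only [smul_mul_assoc, mul_smul_comm, map_smul, ha, smul_sub, smul_eq_mul, mul_smul]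

theorem dN_mul_divL_of_augmentation {p : ℕ} (hp : p + 1 < n) {a : AShriek k n}
    (hl : eN k n p * a = a) (hr : a * eN k n p = a)
    (h : augmentation ⟨p, by omega⟩ a = 0) : dN k n p * divL k n a = a := by
  have := dN_mul_divL_loop ⟨p, by omega⟩ hp a
  rwa [h, zero_smul, sub_zero, hl, hr] at this

end Center

/-! ### Hochschild cohomology in low degrees -/

section LowDegree

variable {k : Type u} [Field k] {A : Type v} [Ring A] [Algebra k A]

theorem hochschildD_one_apply (f : Cochain k A 1) (a b : A) :
    hochschildD k A 1 f ![a, b] = a * f ![b] - f ![a * b] + f ![a] * b := by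
  have h1 : Fin.contractNth (α := A) (0 : Fin 2) (· * ·) ![a, b] = ![a * b] := by
    funext i; fin_cases i; rfl
  have h2 : Fin.init (α := fun _ => A) ![a, b] = ![a] := by
    funext i; fin_cases i; rfl
  simp [hochschildD, leftCochain_apply, rightCochain_apply, contractCochain_apply, h1, h2,
    sub_eq_add_neg, Fin.last]

theorem hochschildD_two_apply (f : Cochain k A 2) (a b c : A) :
    hochschildD k A 2 f ![a, b, c] =
      a * f ![b, c] - f ![a * b, c] + f ![a, b * c] - f ![a, b] * c := by
  have h1 : Fin.contractNth (α := A) (0 : Fin 3) (· * ·) ![a, b, c] = ![a * b, c] := by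
    funext i; fin_cases i <;> rfl
  have h3 : Fin.contractNth (α := A) (1 : Fin 3) (· * ·) ![a, b, c] = ![a, b * c] := by
    funext i; fin_cases i <;> rfl
  have h2 : Fin.init (α := fun _ => A) ![a, b, c] = ![a, b] := by
    funext i; fin_cases i <;> rfl
  have h4 : Fin.tail (α := fun _ => A) ![a, b, c] = ![b, c] := by
    funext i; fin_cases i <;> rfl
  simp [hochschildD, leftCochain_apply, rightCochain_apply, contractCochain_apply, h1, h2, h3, h4,
    sub_eq_add_neg, Fin.sum_univ_two, Fin.last, pow_succ]
  abel

theorem hochschildD_zero_apply (f : Cochain k A 0) (a : A) :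
    hochschildD k A 0 f ![a] = a * f ![] - f ![] * a := by
  have h1 : Fin.tail (α := fun _ => A) ![a] = ![] := Subsingleton.elim _ _
  have h2 : Fin.init (α := fun _ => A) ![a] = ![] := Subsingleton.elim _ _
  simp [hochschildD, leftCochain_apply, rightCochain_apply, h1, h2, sub_eq_add_neg]

theorem mem_cocycles_one {f : Cochain k A 1} :
    f ∈ cocycles k A 1 ↔ ∀ a b, f ![a * b] = a * f ![b] + f ![a] * b := by
  rw [cocycles, LinearMap.mem_ker]
  constructor
  · intro h a b
    have := hochschildD_one_apply f a b
    rw [h, zero_apply] at this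
    rw [← sub_eq_zero, ← neg_eq_zero, this]; abel
  · intro h
    ext g
    have hg : g = ![g 0, g 1] := by funext i; fin_cases i <;> rfl
    rw [hg, hochschildD_one_apply, h, zero_apply]; abel

theorem mem_cocycles_two {f : Cochain k A 2} :
    f ∈ cocycles k A 2 ↔
      ∀ a b c, a * f ![b, c] - f ![a * b, c] + f ![a, b * c] - f ![a, b] * c = 0 := by
  rw [cocycles, LinearMap.mem_ker]
  constructor
  · intro h a b c
    rw [← hochschildD_two_apply, h, zero_apply]
  · intro h
    ext g
    have hg : g = ![g 0, g 1, g 2] := by funext i; fin_cases i <;> rfl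
    rw [hg, hochschildD_two_apply, h, zero_apply]

variable (k) in
/-- The `1`-cochain of a linear map. -/
def cochainOfLinear (g : A →ₗ[k] A) : Cochain k A 1 :=
  g.compMultilinearMap (MultilinearMap.ofSubsingleton k A A (0 : Fin 1) LinearMap.id)

/-- The linear map of a `1`-cochain. -/
def linearOfCochain (f : Cochain k A 1) : A →ₗ[k] A where
  toFun a := f ![a]
  map_add' a b := by
    have h : ∀ x, Function.update ![a] 0 x = ![x] := fun x => by funext i; fin_cases i; rfl
    simpa only [h] using f.map_update_add ![a] 0 a b
  map_smul' c a := by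
    have h : ∀ x, Function.update ![a] 0 x = ![x] := fun x => by funext i; fin_cases i; rfl
    simpa only [h, RingHom.id_apply] using f.map_update_smul ![a] 0 c a

theorem mem_coboundaries_one {f : Cochain k A 1} :
    f ∈ coboundaries k A 1 ↔ ∃ z, ∀ a, f ![a] = a * z - z * a := by
  constructor
  · rintro ⟨g, rfl⟩
    exact ⟨g ![], fun a => hochschildD_zero_apply g a⟩
  · rintro ⟨z, hz⟩
    refine ⟨MultilinearMap.constOfIsEmpty k _ z, ?_⟩
    ext g
    have hg : g = ![g 0] := by funext i; fin_cases i; rfl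
    rw [hg, hochschildD_zero_apply, hz]; rfl

theorem mem_coboundaries_two {f : Cochain k A 2} :
    f ∈ coboundaries k A 2 ↔
      ∃ g : A →ₗ[k] A, ∀ a b, f ![a, b] = a * g b - g (a * b) + g a * b := by
  constructor
  · rintro ⟨g, rfl⟩
    exact ⟨linearOfCochain g, fun a b => hochschildD_one_apply g a b⟩
  · rintro ⟨z, hz⟩
    refine ⟨cochainOfLinear k z, ?_⟩
    ext g
    have hg : g = ![g 0, g 1] := by funext i; fin_cases i <;> rfl
    rw [hg, hochschildD_one_apply, hz]; rfl

variable {ι : Type*}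

/-- The linear functionals on `HH^m` induced by functionals on cochains that vanish on
coboundaries. -/
def HH.functional {m : ℕ} (Λ : Cochain k A m →ₗ[k] (ι → k))
    (h : ∀ f ∈ coboundaries k A m, Λ f = 0) : HH k A m →ₗ[k] (ι → k) :=
  Submodule.liftQ _ (Λ ∘ₗ (cocycles k A m).subtype) (fun _ hf => h _ hf)

theorem HH.mk_eq_zero {m : ℕ} (f : Cochain k A m) (hf : f ∈ cocycles k A m) :
    HH.mk f hf = 0 ↔ f ∈ coboundaries k A m := by
  rw [HH.mk, Submodule.Quotient.mk_eq_zero]; rfl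

/-- Functionals on cochains that vanish on coboundaries, detect coboundaries among cocycles, and
are dual to homogeneous cocycles, give an adapted dual basis of `HH^m`. -/
theorem HH.gradedDualBasis [DecidableEq ι] {m : ℕ} (𝒜 : ℤ → Submodule k A) (Λ : Cochain k A m →ₗ[k] (ι → k))
    (h : ∀ f ∈ coboundaries k A m, Λ f = 0) (deg : ι → ℤ) (v : ι → Cochain k A m)
    (hv : ∀ t, v t ∈ cocycles k A m) (hdeg : ∀ t, v t ∈ homogeneousCochains 𝒜 m (deg t))
    (inj : ∀ f ∈ cocycles k A m, Λ f = 0 → f ∈ coboundaries k A m)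
    (dual : ∀ t, Λ (v t) = Pi.single t 1)
    (vanish : ∀ j, ∀ f ∈ cocycles k A m, f ∈ homogeneousCochains 𝒜 m j →
      ∀ t, j ≠ deg t → Λ f t = 0) :
    GradedDualBasis (HHgr 𝒜 m) (HH.functional Λ h) deg (fun t => HH.mk (v t) (hv t)) where
  injective c hc := by
    obtain ⟨⟨f, hf⟩, rfl⟩ := Submodule.Quotient.mk_surjective _ c
    exact (HH.mk_eq_zero f hf).2 (inj f hf hc)
  mem t := ⟨⟨v t, hv t⟩, hdeg t, rfl⟩
  dual := dual
  vanish := by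
    rintro j _ ⟨⟨f, hf⟩, hfj, rfl⟩ t ht
    exact vanish j f hf hfj t ht

end LowDegree

/-! ### The center -/

section HHZero

variable {k : Type u} [Field k] {n : ℕ}

/-- The coefficient of `c^m (n)`, the loop of length `2 m` at the last vertex. -/
def lastCoef (m : Fin n) : AShriek k n →ₗ[k] k :=
  valleyCoef k n ⟨⟨n - 1 - m, by omega⟩, ⟨m, by simp only; omega⟩, ⟨m, by simp only; omega⟩⟩

theorem lastCoef_valley (m : Fin n) {x l y : ℕ} (hx : l + x < n) (hy : l + y < n) :
    lastCoef (k := k) m (valley k n x l y) =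
      if x = m.val ∧ y = m.val ∧ l + m.val = n - 1 then 1 else 0 := by
  rw [lastCoef, valleyCoef_valley hx hy]
  refine if_congr ?_ rfl rfl
  constructor
  · intro h
    have h1 : n - 1 - m.val = l := congrArg (fun t : ValleyIdx n => t.1.val) h
    have h2 : m.val = x := congrArg (fun t : ValleyIdx n => t.2.1.val) h
    have h3 : m.val = y := congrArg (fun t : ValleyIdx n => t.2.2.val) h
    omega
  · rintro ⟨rfl, rfl, h⟩
    obtain rfl : l = n - 1 - m := by omega
    rfl

theorem lastCoef_corner (m : Fin n) (a : AShriek k n) :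
    lastCoef m (eN k n (n - 1) * a * eN k n (n - 1)) = lastCoef m a := by
  induction a using valley_induction with
  | h x l y hx hy =>
    rw [eN_mul_valley']
    split_ifs with h
    · rw [valley_mul_eN']
      split_ifs with h'
      · rfl
      · rw [map_zero, lastCoef_valley m hx hy, if_neg (by omega)]
    · rw [zero_mul, map_zero, lastCoef_valley m hx hy, if_neg (by omega)]
  | h0 => simp
  | hadd a b ha hb => simp only [add_mul, mul_add, map_add, ha, hb]
  | hsmul c a ha => simp only [smul_mul_assoc, mul_smul_comm, map_smul, ha]

theorem corner_eq_sum (a : AShriek k n) :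
    eN k n (n - 1) * a * eN k n (n - 1) =
      ∑ m : Fin n, lastCoef m a • valley k n m (n - 1 - m) m := by
  induction a using valley_induction with
  | h x l y hx hy =>
    rw [eN_mul_valley']
    split_ifs with h
    · rw [valley_mul_eN']
      split_ifs with h'
      · obtain rfl : x = y := by omega
        rw [Finset.sum_eq_single ⟨x, by omega⟩]
        · rw [lastCoef_valley _ hx hy, if_pos ⟨rfl, rfl, h.symm⟩, one_smul]
          congr 1; simp only; omega
        · intro m _ hm
          rw [lastCoef_valley _ hx hy, if_neg, zero_smul]
          rintro ⟨h1, -⟩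
          exact hm (Fin.ext h1.symm)
        · simp
      · symm
        refine Finset.sum_eq_zero fun m _ => ?_
        rw [lastCoef_valley _ hx hy, if_neg (by omega), zero_smul]
    · rw [zero_mul]
      symm
      refine Finset.sum_eq_zero fun m _ => ?_
      rw [lastCoef_valley _ hx hy, if_neg (by omega), zero_smul]
  | h0 => simp
  | hadd a b ha hb => simp only [add_mul, mul_add, map_add, ha, hb, add_smul, Finset.sum_add_distrib]
  | hsmul c a ha =>
    simp only [smul_mul_assoc, mul_smul_comm, map_smul, ha, Finset.smul_sum, smul_eq_mul, mul_smul]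

theorem corner_eq_zero {a : AShriek k n} (h : ∀ m : Fin n, lastCoef m a = 0) :
    eN k n (n - 1) * a * eN k n (n - 1) = 0 := by
  rw [corner_eq_sum]; exact Finset.sum_eq_zero fun m _ => by rw [h, zero_smul]

theorem lastCoef_eq_zero (m : Fin n) {d : ℤ} (hd : d ≠ 2 * m) {a : AShriek k n}
    (ha : a ∈ pathGrading k n d) : lastCoef m a = 0 :=
  valleyCoef_eq_zero ha _ (by simp only; omega)

theorem lastCoef_centralC_pow (m : Fin n) (m' : ℕ) :
    lastCoef m (centralC k n ^ m') = if m.val = m' then 1 else 0 := by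
  have hn : n - 1 < n := by have := m.2; omega
  rw [← lastCoef_corner, mul_assoc, centralC_pow_mul_eN]
  split_ifs with h h' h'
  · rw [eN_mul_valley', if_pos (by omega), lastCoef_valley _ (by omega) (by omega),
      if_pos (by omega)]
  · rw [eN_mul_valley', if_pos (by omega), lastCoef_valley _ (by omega) (by omega),
      if_neg (by omega)]
  · omega
  · simp

/-- A central element is determined by its component at the last vertex. -/
theorem central_eq_zero {z : AShriek k n} (hz : ∀ a, a * z = z * a)
    (h : eN k n (n - 1) * z = 0) : z = 0 := by
  have key : ∀ i, eN k n (n - 1 - i) * z = 0 := by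
    intro i
    induction i with
    | zero => exact h
    | succ i ih =>
      by_cases hi : n - 1 - i = 0
      · have : n - 1 - (i + 1) = n - 1 - i := by omega
        rw [this]; exact ih
      · obtain ⟨p, hp⟩ : ∃ p, n - 1 - i = p + 1 := ⟨n - 1 - i - 1, by omega⟩
        have hp' : n - 1 - (i + 1) = p := by omega
        rw [hp'] at *
        rw [hp] at ih
        refine eq_zero_of_mul_dN (p := p) (by omega) ?_ ?_
        · rw [mul_assoc, ← hz, ← mul_assoc, eN_mul_self]
        · rw [mul_assoc, ← hz, ← mul_assoc, eN_mul_dN, ← dN_mul_eN, mul_assoc, ih, mul_zero]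
  rw [← one_mul z, ← sum_eN, Finset.sum_mul]
  refine Finset.sum_eq_zero fun v hv => ?_
  have := key (n - 1 - v)
  have hv := Finset.mem_range.1 hv
  rwa [show n - 1 - (n - 1 - v) = v by omega] at this

theorem central_eq_sum {z : AShriek k n} (hz : ∀ a, a * z = z * a) :
    z = ∑ m : Fin n, lastCoef m z • centralC k n ^ m.val := by
  rw [← sub_eq_zero]
  have hc : ∀ a, a * (z - ∑ m : Fin n, lastCoef m z • centralC k n ^ m.val) =
      (z - ∑ m : Fin n, lastCoef m z • centralC k n ^ m.val) * a := by
    intro a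
    rw [mul_sub, sub_mul, hz, Finset.mul_sum, Finset.sum_mul]
    congr 1
    refine Finset.sum_congr rfl fun m _ => ?_
    rw [mul_smul_comm, smul_mul_assoc, centralC_pow_commute]
  refine central_eq_zero hc ?_
  rw [← eN_mul_self, mul_assoc, hc, ← mul_assoc]
  refine corner_eq_zero fun m => ?_
  simp [map_sum, lastCoef_centralC_pow, Fin.val_inj]

variable (k n) in
/-- The `0`-cochain `c^m`. -/
def powCochain (m : ℕ) : Cochain k (AShriek k n) 0 :=
  MultilinearMap.constOfIsEmpty k _ (centralC k n ^ m)

variable (k n) in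
/-- The coefficients of `c^m (n)`, as functionals on `0`-cochains. -/
def zeroFunctional : Cochain k (AShriek k n) 0 →ₗ[k] (Fin n → k) where
  toFun f m := lastCoef m (f 0)
  map_add' f g := by funext m; simp
  map_smul' c f := by funext m; simp

variable (k n) in
theorem zeroFunctional_coboundary (f) (hf : f ∈ coboundaries k (AShriek k n) 0) :
    zeroFunctional k n f = 0 := by
  rw [coboundaries, Submodule.mem_bot] at hf
  rw [hf, map_zero]

theorem powCochain_mem_cocycles (m : ℕ) : powCochain k n m ∈ cocycles k (AShriek k n) 0 := by
  rw [mem_cocycles_zero, Subalgebra.mem_center_iff]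
  intro a
  exact (centralC_pow_commute k n m a).symm

theorem powCochain_mem_homogeneous (m : ℕ) :
    powCochain k n m ∈ homogeneousCochains (pathGrading k n) 0 (2 * m) := by
  intro d a _
  simpa using! centralC_pow_mem k n m

variable (k n) in
/-- The classes of the powers of `c` form a basis of the center. -/
theorem HH_zero_dualBasis : GradedDualBasis (HHgr (pathGrading k n) 0)
    (HH.functional (zeroFunctional k n) (zeroFunctional_coboundary k n))
    (fun m : Fin n => 2 * (m.val : ℤ))
    (fun m => HH.mk (powCochain k n m) (powCochain_mem_cocycles m)) := by
  apply HH.gradedDualBasis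
  · exact fun t => powCochain_mem_homogeneous t
  · intro f hf h
    rw [mem_cocycles_zero, Subalgebra.mem_center_iff] at hf
    have h0 := central_eq_sum hf
    have : f 0 = 0 := by
      rw [h0]
      exact Finset.sum_eq_zero fun m _ => by
        rw [show lastCoef m (f 0) = 0 from congrFun h m, zero_smul]
    rw [coboundaries, Submodule.mem_bot]
    ext g
    rw [Subsingleton.elim g 0, this]; rfl
  · intro t
    funext m
    change lastCoef m (centralC k n ^ t.val) = _
    rw [lastCoef_centralC_pow, Pi.single_apply]
    simp [Fin.ext_iff]
  · intro j f _ hf t ht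
    have := hf ![] 0 (fun i => i.elim0)
    simp only [Finset.univ_eq_empty, Finset.sum_empty, zero_add] at this
    exact lastCoef_eq_zero t ht this

variable (k n) in
/-- The homomorphism `k[X] / (X ^ n) → Z(A)` with `X ↦ c`. -/
def truncatedToCenter : (Polynomial k ⧸ Ideal.span {(Polynomial.X : Polynomial k) ^ n}) →ₐ[k]
    Subalgebra.center k (AShriek k n) :=
  Ideal.Quotient.liftₐ _ (Polynomial.aeval ⟨centralC k n, by
    rw [Subalgebra.mem_center_iff]; exact fun a => (centralC_commute k n a).symm⟩) (by
    intro a ha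
    obtain ⟨b, rfl⟩ := Ideal.mem_span_singleton.1 ha
    rw [map_mul, map_pow, Polynomial.aeval_X]
    have : (⟨centralC k n, by
      rw [Subalgebra.mem_center_iff]; exact fun a => (centralC_commute k n a).symm⟩ :
        Subalgebra.center k (AShriek k n)) ^ n = 0 := Subtype.ext (centralC_pow_self k n)
    rw [this, zero_mul])

theorem truncatedToCenter_mk (p : Polynomial k) :
    (truncatedToCenter k n (Ideal.Quotient.mk _ p) : AShriek k n) =
      Polynomial.aeval (centralC k n) p := by
  change ((Polynomial.aeval (R := k) _ p : Subalgebra.center k (AShriek k n)) : AShriek k n) = _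
  exact (Polynomial.aeval_algHom_apply (Subalgebra.center k (AShriek k n)).val _ p).symm

theorem truncatedToCenter_bijective : Function.Bijective (truncatedToCenter k n) := by
  constructor
  · rw [injective_iff_map_eq_zero]
    intro q hq
    obtain ⟨p, rfl⟩ := Ideal.Quotient.mk_surjective q
    have h := congrArg Subtype.val hq
    rw [truncatedToCenter_mk, Polynomial.aeval_eq_sum_range] at h
    rw [Ideal.Quotient.eq_zero_iff_mem, Ideal.mem_span_singleton, Polynomial.X_pow_dvd_iff]
    intro d hd
    have h' := congrArg (lastCoef ⟨d, hd⟩) h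
    simp only [map_sum, map_smul, lastCoef_centralC_pow, smul_eq_mul, mul_ite, mul_one,
      mul_zero, Finset.sum_ite_eq, Finset.mem_range] at h'
    split_ifs at h' with h''
    · simpa using h'
    · exact Polynomial.coeff_eq_zero_of_natDegree_lt (by omega)
  · intro z
    refine ⟨Ideal.Quotient.mk _ (∑ m : Fin n, Polynomial.C (lastCoef m z.1) *
      Polynomial.X ^ m.val), Subtype.ext ?_⟩
    rw [truncatedToCenter_mk]
    conv_rhs => rw [central_eq_sum (Subalgebra.mem_center_iff.1 z.2)]
    simp [map_sum, Algebra.smul_def]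

end HHZero

/-! ### Derivations -/

section HHOne

variable {k : Type u} [Field k] {n : ℕ}

variable (k n) in
/-- The linear map that multiplies each path by its number of upward steps. -/
def countUp : AShriek k n →ₗ[k] AShriek k n := valleyMap fun x l y => (x : k) • valley k n x l y

theorem countUp_valley (x l y : ℕ) :
    countUp k n (valley k n x l y) = (x : k) • valley k n x l y := by
  by_cases hx : l + x < n
  · by_cases hy : l + y < n
    · exact valleyMap_valley _ hx hy
    · rw [valley_of_le_right k n (by omega), map_zero, smul_zero]
  · rw [valley_of_le_left k n (by omega), map_zero, smul_zero]

theorem countUp_eN_mul (i : ℕ) (b : AShriek k n) :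
    countUp k n (eN k n i * b) = eN k n i * countUp k n b := by
  induction b using valley_induction with
  | h x l y hx hy =>
    rw [countUp_valley, mul_smul_comm, eN_mul_valley']
    split_ifs
    · rw [countUp_valley]
    · simp
  | h0 => simp
  | hadd a b ha hb => simp only [mul_add, map_add, ha, hb]
  | hsmul c a ha => simp only [mul_smul_comm, map_smul, ha]

theorem countUp_uN_mul (i : ℕ) (b : AShriek k n) :
    countUp k n (uN k n i * b) = uN k n i * countUp k n b + uN k n i * b := by
  induction b using valley_induction with
  | h x l y hx hy =>
    rw [countUp_valley, mul_smul_comm]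
    by_cases h : i = l + x
    · rw [h, uN_mul_valley, countUp_valley]; push_cast; rw [add_smul, one_smul]
    · rw [uN_mul_valley_of_ne k n h]; simp
  | h0 => simp
  | hadd a b ha hb => simp only [mul_add, map_add, ha, hb]; abel
  | hsmul c a ha => simp only [mul_smul_comm, map_smul, ha, smul_add]

theorem countUp_dN_mul (i : ℕ) (b : AShriek k n) :
    countUp k n (dN k n i * b) = dN k n i * countUp k n b := by
  induction b using valley_induction with
  | h x l y hx hy =>
    rw [countUp_valley, mul_smul_comm]
    by_cases hi : i + 1 < n
    · by_cases h : i + 1 = l + x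
      · rcases l with _ | l
        · obtain rfl : x = i + 1 := by omega
          rw [dN_mul_valley_zero]; simp
        · obtain rfl : i = l + x := by omega
          rw [dN_mul_valley k n _ _ _ hi, countUp_valley]
      · rw [dN_mul_valley_of_ne k n h]; simp
    · rw [dN_of_le k n (by omega)]; simp
  | h0 => simp
  | hadd a b ha hb => simp only [mul_add, map_add, ha, hb]
  | hsmul c a ha => simp only [mul_smul_comm, map_smul, ha]

theorem countUp_one : countUp k n 1 = 0 := by
  rw [← sum_eN, map_sum]
  refine Finset.sum_eq_zero fun v _ => ?_
  rw [← valley_zero_zero, countUp_valley]; simp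

theorem countUp_mul (a b : AShriek k n) :
    countUp k n (a * b) = a * countUp k n b + countUp k n a * b := by
  let S : Submodule k (AShriek k n) :=
    { carrier := {a | ∀ b, countUp k n (a * b) = a * countUp k n b + countUp k n a * b}
      zero_mem' := fun b => by simp
      add_mem' := fun ha ha' b => by simp only [add_mul, map_add, ha b, ha' b]; abel
      smul_mem' := fun c a ha b => by
        simp only [smul_mul_assoc, map_smul, ha b, smul_add] }
  have h1 : (1 : AShriek k n) ∈ S := fun b => by simp [countUp_one]
  have := AShriek.mul_mem_of_arrows S (fun i s hs b => ?_) (fun i s hs b => ?_)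
    (fun i s hs b => ?_) a 1 h1
  · rw [mul_one] at this; exact this b
  · rw [← eN_val, mul_assoc, countUp_eN_mul, countUp_eN_mul, hs b]; noncomm_ring
  · rw [← uN_val, mul_assoc, countUp_uN_mul, countUp_uN_mul, hs b]; noncomm_ring
  · rw [← dN_val, mul_assoc, countUp_dN_mul, countUp_dN_mul, hs b]; noncomm_ring

theorem countUp_mem {d : ℤ} {a : AShriek k n} (ha : a ∈ pathGrading k n d) :
    countUp k n a ∈ pathGrading k n d := by
  rw [pathGrading_eq] at ha
  induction ha using Submodule.span_induction with
  | zero => simp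
  | add x y _ _ hx hy => rw [map_add]; exact Submodule.add_mem _ hx hy
  | smul c x _ hx => rw [map_smul]; exact Submodule.smul_mem _ _ hx
  | mem z hz =>
    obtain ⟨x, l, y, h, rfl⟩ := hz
    rw [countUp_valley]
    exact Submodule.smul_mem _ _ (valley_mem_pathGrading h)

end HHOne

section HHOneBasis

variable {k : Type u} [Field k] {n : ℕ}

/-- A derivation is determined by its values on vertices and arrows. -/
theorem derivation_eq_zero {D : AShriek k n →ₗ[k] AShriek k n}
    (hD : ∀ a b, D (a * b) = a * D b + D a * b) (he : ∀ i, D (eN k n i) = 0)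
    (hu : ∀ i, D (uN k n i) = 0) (hd : ∀ i, D (dN k n i) = 0) (a : AShriek k n) : D a = 0 := by
  have h1 : D 1 = 0 := by rw [← sum_eN, map_sum]; exact Finset.sum_eq_zero fun i _ => he i
  have := AShriek.mul_mem_of_arrows (LinearMap.ker D) (fun i s hs => ?_) (fun i s hs => ?_)
    (fun i s hs => ?_) a 1 h1
  · rwa [mul_one] at this
  · rw [LinearMap.mem_ker] at hs ⊢; rw [hD, hs, ← eN_val, he]; simp
  · rw [LinearMap.mem_ker] at hs ⊢; rw [hD, hs, ← uN_val, hu]; simp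
  · rw [LinearMap.mem_ker] at hs ⊢; rw [hD, hs, ← dN_val, hd]; simp

/-- A derivation that kills the vertices and the downward arrows, and kills the loop at the last
vertex, is zero. -/
theorem derivation_eq_zero_of_last {D : AShriek k n →ₗ[k] AShriek k n}
    (hD : ∀ a b, D (a * b) = a * D b + D a * b) (he : ∀ i, D (eN k n i) = 0)
    (hd : ∀ i, D (dN k n i) = 0) (hc : D (centralC k n * eN k n (n - 1)) = 0)
    (a : AShriek k n) : D a = 0 := by
  have hue : ∀ i, D (uN k n i) * eN k n i = D (uN k n i) := by
    intro i
    have := hD (uN k n i) (eN k n i)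
    rw [he, mul_zero, zero_add, uN_mul_eN] at this
    exact this.symm
  have hud : ∀ i, D (uN k n i * dN k n i) = D (uN k n i) * dN k n i := by
    intro i; rw [hD, hd, mul_zero, zero_add]
  have key : ∀ j i, i + j + 2 = n → D (uN k n i) = 0 := by
    intro j
    induction j with
    | zero =>
      intro i hi
      refine eq_zero_of_mul_dN (p := i) (by omega) (hue i) ?_
      rw [← hud, ← centralC_mul_eN_succ, show i + 1 = n - 1 by omega, hc]
    | succ j ih =>
      intro i hi
      refine eq_zero_of_mul_dN (p := i) (by omega) (hue i) ?_
      rw [← hud, ← dN_mul_uN_succ k n i (by omega), hD, ih (i + 1) (by omega), hd]; simp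
  refine derivation_eq_zero hD he (fun i => ?_) hd a
  by_cases hi : i + 1 < n
  · exact key (n - 2 - i) i (by omega)
  · rw [uN_of_le k n (by omega), map_zero]

/-- The potential whose inner derivation agrees with `D` on the downward arrows, built from the
first vertex upwards. -/
def potential (D : AShriek k n →ₗ[k] AShriek k n) : ℕ → AShriek k n
  | 0 => 0
  | p + 1 => divL k n (D (dN k n p) + potential D p * dN k n p)

/-- A derivation that kills the vertices agrees with an inner derivation on the downward arrows. The
loops that define the inner derivation are constructed upwards from the first vertex, by division by
downward arrows. -/
theorem exists_inner_of_vertices {D : AShriek k n →ₗ[k] AShriek k n}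
    (hD : ∀ a b, D (a * b) = a * D b + D a * b) (he : ∀ i, D (eN k n i) = 0) :
    ∃ w, (∀ i, eN k n i * w = w * eN k n i) ∧
      ∀ i, D (dN k n i) = dN k n i * w - w * dN k n i := by
  have hde : ∀ p, D (dN k n p) * eN k n (p + 1) = D (dN k n p) := by
    intro p
    have := hD (dN k n p) (eN k n (p + 1))
    rw [he, mul_zero, zero_add, dN_mul_eN] at this
    exact this.symm
  have hed : ∀ p, eN k n p * D (dN k n p) = D (dN k n p) := by
    intro p
    have := hD (eN k n p) (dN k n p)
    rw [he, zero_mul, add_zero, eN_mul_dN] at this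
    exact this.symm
  set w := potential D with hw
  have hwl : ∀ p, eN k n p * w p = w p := by
    intro p
    induction p with
    | zero => simp [hw, potential]
    | succ p ih => rw [hw, potential, ← hw, eN_mul_divL, mul_add, hed, ← mul_assoc, ih]
  have hwr : ∀ p, w p * eN k n p = w p := by
    intro p
    cases p with
    | zero => simp [hw, potential]
    | succ p => rw [hw, potential, divL_mul_eN, add_mul, hde, mul_assoc, dN_mul_eN]
  have hstep : ∀ p, p + 1 < n → dN k n p * w (p + 1) = D (dN k n p) + w p * dN k n p := by
    intro p hp
    have h := dN_mul_divL hp (D (dN k n p) + w p * dN k n p)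
    rwa [mul_add, add_mul, hed, hde, ← mul_assoc, hwl, mul_assoc _ _ (eN k n (p + 1)),
      dN_mul_eN] at h
  have hsl : ∀ i, eN k n i * ∑ v ∈ Finset.range n, w v = if i < n then w i else 0 := by
    intro i
    split_ifs with h
    · rw [Finset.mul_sum, Finset.sum_eq_single i, hwl]
      · intro v _ hv
        rw [← hwl, ← mul_assoc, eN_mul_of_ne k n hv.symm, zero_mul]
      · intro hi; exact absurd (Finset.mem_range.2 h) hi
    · rw [eN_of_le k n (by omega), zero_mul]
  have hsr : ∀ i, (∑ v ∈ Finset.range n, w v) * eN k n i = if i < n then w i else 0 := by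
    intro i
    split_ifs with h
    · rw [Finset.sum_mul, Finset.sum_eq_single i, hwr]
      · intro v _ hv
        rw [← hwr, mul_assoc, eN_mul_of_ne k n hv, mul_zero]
      · intro hi; exact absurd (Finset.mem_range.2 h) hi
    · rw [eN_of_le k n (by omega), mul_zero]
  refine ⟨∑ v ∈ Finset.range n, w v, fun i => by rw [hsl, hsr], fun i => ?_⟩
  by_cases hi : i + 1 < n
  · have h1 : dN k n i * ∑ v ∈ Finset.range n, w v = dN k n i * w (i + 1) := by
      rw [← dN_mul_eN, mul_assoc, hsl, if_pos hi, mul_assoc, hwl]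
    have h2 : (∑ v ∈ Finset.range n, w v) * dN k n i = w i * dN k n i := by
      rw [← eN_mul_dN, ← mul_assoc, hsr, if_pos (by omega), ← mul_assoc, hwr]
    rw [h1, h2, hstep i hi]; abel
  · rw [dN_of_le k n (by omega)]; simp

/-- Modulo inner derivations, a derivation kills the vertices. -/
theorem exists_inner_vertices {D : AShriek k n →ₗ[k] AShriek k n}
    (hD : ∀ a b, D (a * b) = a * D b + D a * b) :
    ∃ z, ∀ i, D (eN k n i) = eN k n i * z - z * eN k n i := by
  refine ⟨-∑ v ∈ Finset.range n, D (eN k n v) * eN k n v, fun i => ?_⟩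
  by_cases hi : i < n
  · have h1 : eN k n i * ∑ v ∈ Finset.range n, D (eN k n v) * eN k n v =
        D (eN k n i) * eN k n i - D (eN k n i) := by
      have : ∀ v, eN k n i * (D (eN k n v) * eN k n v) =
          D (eN k n i * eN k n v) * eN k n v - D (eN k n i) * eN k n v := by
        intro v; rw [hD, add_mul, mul_assoc (D _), eN_mul_self, mul_assoc]; abel
      rw [Finset.mul_sum, Finset.sum_congr rfl fun v _ => this v, Finset.sum_sub_distrib,
        ← Finset.mul_sum, sum_eN, mul_one, Finset.sum_eq_single i]
      · rw [eN_mul_self]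
      · intro v _ hv; rw [eN_mul_of_ne k n hv.symm]; simp
      · intro h; exact absurd (Finset.mem_range.2 hi) h
    have h2 : (∑ v ∈ Finset.range n, D (eN k n v) * eN k n v) * eN k n i =
        D (eN k n i) * eN k n i := by
      rw [Finset.sum_mul, Finset.sum_eq_single i]
      · rw [mul_assoc, eN_mul_self]
      · intro v _ hv; rw [mul_assoc, eN_mul_of_ne k n hv, mul_zero]
      · intro h; exact absurd (Finset.mem_range.2 hi) h
    rw [mul_neg, neg_mul, h1, h2]; abel
  · rw [eN_of_le k n (by omega)]; simp

theorem lastCoef_inner (m : Fin n) (z : AShriek k n) :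
    lastCoef m (centralC k n * eN k n (n - 1) * z - z * (centralC k n * eN k n (n - 1))) = 0 := by
  rw [← lastCoef_corner]
  have hc := centralC_commute k n
  have h1 : eN k n (n - 1) * (centralC k n * eN k n (n - 1) * z -
      z * (centralC k n * eN k n (n - 1))) * eN k n (n - 1) =
      centralC k n * (eN k n (n - 1) * z * eN k n (n - 1)) -
        (eN k n (n - 1) * z * eN k n (n - 1)) * centralC k n := by
    rw [mul_sub, sub_mul]
    congr 1
    · simp only [← mul_assoc]
      rw [← hc, mul_assoc (centralC k n), eN_mul_self]
    · simp only [mul_assoc]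
      rw [eN_mul_self, hc]
  rw [h1, hc, sub_self, map_zero]

/-- A derivation `D` is inner as soon as `D (c (n))` has no component among the loops at the last
vertex. -/
theorem derivation_inner {D : AShriek k n →ₗ[k] AShriek k n}
    (hD : ∀ a b, D (a * b) = a * D b + D a * b)
    (h : ∀ m : Fin n, 0 < m.val → lastCoef m (D (centralC k n * eN k n (n - 1))) = 0) :
    ∃ z, ∀ a, D a = a * z - z * a := by
  let inner : AShriek k n → AShriek k n →ₗ[k] AShriek k n := fun z =>
    LinearMap.mulRight k z - LinearMap.mulLeft k z
  have hin : ∀ z a, inner z a = a * z - z * a := fun z a => rfl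
  obtain ⟨z, hz⟩ := exists_inner_vertices hD
  have hD1 : ∀ a b, (D - inner z) (a * b) = a * (D - inner z) b + (D - inner z) a * b := by
    intro a b
    simp only [LinearMap.sub_apply, hD, hin]; noncomm_ring
  obtain ⟨w, hw, hwd⟩ := exists_inner_of_vertices hD1 (fun i => by
    rw [LinearMap.sub_apply, hin, hz, sub_self])
  have hD2 : ∀ a b, (D - inner (z + w)) (a * b) =
      a * (D - inner (z + w)) b + (D - inner (z + w)) a * b := by
    intro a b
    simp only [LinearMap.sub_apply, hD, hin]; noncomm_ring
  have he2 : ∀ i, (D - inner (z + w)) (eN k n i) = 0 := by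
    intro i
    rw [LinearMap.sub_apply, hin, hz, mul_add, add_mul, hw]; abel
  have hd2 : ∀ i, (D - inner (z + w)) (dN k n i) = 0 := by
    intro i
    have := hwd i
    rw [LinearMap.sub_apply, hin] at this
    rw [LinearMap.sub_apply, hin, mul_add, add_mul, ← sub_eq_zero.2 this]; abel
  refine ⟨z + w, fun a => ?_⟩
  rw [← sub_eq_zero]
  refine derivation_eq_zero_of_last hD2 he2 hd2 ?_ a
  -- The loop at the last vertex passes through a lower vertex, so the derivation kills the
  -- coefficient of the vertex itself; the other coefficients vanish by hypothesis.
  set E := D - inner (z + w) with hE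
  have hr : E (centralC k n * eN k n (n - 1)) * eN k n (n - 1) =
      E (centralC k n * eN k n (n - 1)) := by
    have := hD2 (centralC k n * eN k n (n - 1)) (eN k n (n - 1))
    rwa [he2, mul_zero, zero_add, mul_assoc, eN_mul_self, eq_comm] at this
  have hl : eN k n (n - 1) * E (centralC k n * eN k n (n - 1)) =
      E (centralC k n * eN k n (n - 1)) := by
    have := hD2 (eN k n (n - 1)) (centralC k n * eN k n (n - 1))
    rwa [he2, zero_mul, add_zero, ← mul_assoc, ← centralC_commute, mul_assoc, eN_mul_self,
      eq_comm] at this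
  rw [← hr, ← hl]
  refine corner_eq_zero fun m => ?_
  by_cases hm : m.val = 0
  · by_cases hn : n = 1
    · subst hn
      rw [show (1 : ℕ) - 1 = 0 from rfl, centralC_mul_eN_zero, map_zero, map_zero]
    · obtain ⟨N, rfl⟩ : ∃ N, n = N + 2 := ⟨n - 2, by have := m.2; omega⟩
      rw [show N + 2 - 1 = N + 1 from rfl, centralC_mul_eN_succ, hD2, hd2, mul_zero, zero_add]
      generalize E (uN k (N + 2) N) = b
      induction b using valley_induction with
      | h x l y hx hy =>
        by_cases hy' : N = l + y
        · subst hy'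
          rw [valley_mul_dN, lastCoef_valley m hx (by omega), if_neg (by omega)]
        · rw [← valley_mul_eN, mul_assoc, eN_mul_dN_of_ne _ _ (fun h => hy' h.symm)]; simp
      | h0 => simp
      | hadd a b ha hb => rw [add_mul, map_add, ha, hb, add_zero]
      | hsmul c a ha => rw [smul_mul_assoc, map_smul, ha, smul_zero]
  · rw [hE, LinearMap.sub_apply, map_sub, h m (by omega), hin, lastCoef_inner, sub_zero]

variable (k n) in
/-- The coefficients of `c^{t+1} (n)` in the value at `c (n)`, as functionals on `1`-cochains. -/
def oneFunctional : Cochain k (AShriek k n) 1 →ₗ[k] (Fin (n - 1) → k) where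
  toFun f t := lastCoef (hi t) (f ![centralC k n * eN k n (n - 1)])
  map_add' f g := by funext m; simp
  map_smul' c f := by funext m; simp

variable (k n) in
theorem oneFunctional_coboundary (f) (hf : f ∈ coboundaries k (AShriek k n) 1) :
    oneFunctional k n f = 0 := by
  obtain ⟨z, hz⟩ := mem_coboundaries_one.1 hf
  funext t
  change lastCoef _ _ = 0
  rw [hz, lastCoef_inner]

variable (k n) in
/-- The derivation `c^t · countUp` as a `1`-cochain. -/
def countUpCochain (t : ℕ) : Cochain k (AShriek k n) 1 :=
  cochainOfLinear k (LinearMap.mulLeft k (centralC k n ^ t) ∘ₗ countUp k n)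

theorem countUpCochain_mem_cocycles (t : ℕ) :
    countUpCochain k n t ∈ cocycles k (AShriek k n) 1 := by
  rw [mem_cocycles_one]
  intro a b
  change centralC k n ^ t * countUp k n (a * b) = a * (centralC k n ^ t * countUp k n b) +
    centralC k n ^ t * countUp k n a * b
  rw [countUp_mul, mul_add, ← mul_assoc a, ← centralC_pow_commute]
  simp only [mul_assoc]

theorem countUpCochain_mem_homogeneous (t : ℕ) :
    countUpCochain k n t ∈ homogeneousCochains (pathGrading k n) 1 (2 * t) := by
  intro d a ha
  have := pathGrading_mul (centralC_pow_mem k n t) (countUp_mem (ha 0))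
  rw [Fin.sum_univ_one, add_comm]
  exact this

variable (k n) in
/-- A derivation is inner once its functionals vanish, so the classes of the derivations
`c ^ t · (number of upward arrows)` form a basis of `HH^1`. -/
theorem HH_one_dualBasis : GradedDualBasis (HHgr (pathGrading k n) 1)
    (HH.functional (oneFunctional k n) (oneFunctional_coboundary k n))
    (fun t : Fin (n - 1) => 2 * (t.val : ℤ))
    (fun t => HH.mk (countUpCochain k n t) (countUpCochain_mem_cocycles t)) := by
  apply HH.gradedDualBasis
  · exact fun t => countUpCochain_mem_homogeneous t
  · intro f hf h
    rw [mem_cocycles_one] at hf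
    rw [mem_coboundaries_one]
    refine derivation_inner (D := linearOfCochain f) hf fun m hm => ?_
    have := congrFun h ⟨m.val - 1, by omega⟩
    have hm' : hi ⟨m.val - 1, by omega⟩ = m := Fin.ext (by simp only [hi]; omega)
    rw [← hm']
    exact this
  · intro t
    funext s
    change lastCoef (hi s) (centralC k n ^ t.val * countUp k n (centralC k n * eN k n (n - 1))) = _
    obtain ⟨N, rfl⟩ : ∃ N, n = N + 2 := ⟨n - 2, by have := t.2; omega⟩
    have ht : t.val < N + 1 := t.2
    have h1 : centralC k (N + 2) * eN k (N + 2) (N + 2 - 1) = valley k (N + 2) 1 N 1 := by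
      rw [← valley_zero_zero, show N + 2 - 1 = N + 1 from rfl, centralC_mul_valley_succ]
    obtain ⟨l, hl⟩ := Nat.exists_eq_add_of_le' (show t.val ≤ N by omega)
    rw [h1, countUp_valley, Nat.cast_one, one_smul]
    conv_lhs => rw [show valley k (N + 2) 1 N 1 = valley k (N + 2) 1 (l + t.val) 1 by rw [← hl]]
    rw [centralC_pow_mul_valley, lastCoef_valley _ (by omega) (by omega), Pi.single_apply]
    refine if_congr ?_ rfl rfl
    simp only [hi, Fin.ext_iff]
    omega
  · intro j f _ hf t ht
    have hc : centralC k n * eN k n (n - 1) ∈ pathGrading k n 2 := by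
      have h1 := centralC_pow_mem k n 1
      have h2 := valley_mem_pathGrading (k := k) (n := n) (x := 0) (l := n - 1) (y := 0) rfl
      rw [valley_zero_zero] at h2
      have := pathGrading_mul h1 h2
      simpa using this
    have := hf ![2] ![_] (fun i => by fin_cases i; exact hc)
    refine lastCoef_eq_zero (hi t) ?_ this
    simp [hi]; omega

end HHOneBasis

/-! ### Square-zero extensions and second cohomology -/

section SqExt

variable {k : Type u} [Field k] {A : Type v} [Ring A] [Algebra k A]

/-- The condition that a bilinear map is a Hochschild `2`-cocycle. -/
def IsTwoCocycle (F : A →ₗ[k] A →ₗ[k] A) : Prop :=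
  ∀ a b c, a * F b c - F (a * b) c + F a (b * c) - F a b * c = 0

/-- The bilinear map of a `2`-cochain. -/
def bilinOfCochain (f : Cochain k A 2) : A →ₗ[k] A →ₗ[k] A :=
  have h0 : ∀ a b x : A, Function.update ![a, b] 0 x = ![x, b] := fun a b x => by
    funext i; fin_cases i <;> rfl
  have h1 : ∀ a b x : A, Function.update ![a, b] 1 x = ![a, x] := fun a b x => by
    funext i; fin_cases i <;> rfl
  LinearMap.mk₂ k (fun a b => f ![a, b])
    (fun a a' b => by simpa only [h0] using f.map_update_add ![a, b] 0 a a')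
    (fun c a b => by simpa only [h0] using f.map_update_smul ![a, b] 0 c a)
    (fun a b b' => by simpa only [h1] using f.map_update_add ![a, b] 1 b b')
    (fun c a b => by simpa only [h1] using f.map_update_smul ![a, b] 1 c b)

theorem bilinOfCochain_apply (f : Cochain k A 2) (a b : A) :
    bilinOfCochain f a b = f ![a, b] := rfl

/-- The square-zero extension of `A` by the bimodule `A` with product
`(a, m) (b, m') = (a b, a m' + m b + F(a, b))`. -/
structure SqExt (F : A →ₗ[k] A →ₗ[k] A) (hF : IsTwoCocycle F) where
  fst : A
  snd : A

namespace SqExt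

variable {F : A →ₗ[k] A →ₗ[k] A} {hF : IsTwoCocycle F}

@[ext] theorem ext' {x y : SqExt F hF} (h1 : x.fst = y.fst) (h2 : x.snd = y.snd) : x = y := by
  cases x; cases y; simp_all

/-- The underlying vector space is `A × A`. -/
def equivProd : SqExt F hF ≃ A × A where
  toFun x := (x.fst, x.snd)
  invFun x := ⟨x.1, x.2⟩

instance : AddCommGroup (SqExt F hF) := equivProd.addCommGroup
instance : Module k (SqExt F hF) := equivProd.module k

@[simp] theorem fst_zero : (0 : SqExt F hF).fst = 0 := rfl
@[simp] theorem snd_zero : (0 : SqExt F hF).snd = 0 := rfl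
@[simp] theorem fst_add (x y : SqExt F hF) : (x + y).fst = x.fst + y.fst := rfl
@[simp] theorem snd_add (x y : SqExt F hF) : (x + y).snd = x.snd + y.snd := rfl
@[simp] theorem fst_smul (c : k) (x : SqExt F hF) : (c • x).fst = c • x.fst := rfl
@[simp] theorem snd_smul (c : k) (x : SqExt F hF) : (c • x).snd = c • x.snd := rfl

instance : Mul (SqExt F hF) :=
  ⟨fun x y => ⟨x.fst * y.fst, x.fst * y.snd + x.snd * y.fst + F x.fst y.fst⟩⟩

/-- The unit of the square-zero extension; the cocycle is not assumed to be normalized. -/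
instance : One (SqExt F hF) := ⟨⟨1, -F 1 1⟩⟩

@[simp] theorem fst_mul (x y : SqExt F hF) : (x * y).fst = x.fst * y.fst := rfl
@[simp] theorem snd_mul (x y : SqExt F hF) :
    (x * y).snd = x.fst * y.snd + x.snd * y.fst + F x.fst y.fst := rfl
@[simp] theorem fst_one : (1 : SqExt F hF).fst = 1 := rfl
@[simp] theorem snd_one : (1 : SqExt F hF).snd = -F 1 1 := rfl

instance : Ring (SqExt F hF) :=
  { (inferInstance : AddCommGroup (SqExt F hF)), (inferInstance : Mul (SqExt F hF)),
    (inferInstance : One (SqExt F hF)) with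
    mul_assoc := fun x y z => by
      ext
      · simp [mul_assoc]
      · have := hF x.fst y.fst z.fst
        simp only [snd_mul, fst_mul, mul_add, add_mul, mul_assoc]
        rw [← sub_eq_zero, ← neg_eq_zero, ← this]
        abel
    one_mul := fun x => by
      ext
      · simp
      · have := hF 1 1 x.fst
        simp only [one_mul] at this
        simp only [snd_mul, fst_one, snd_one, one_mul, neg_mul]
        rw [← sub_eq_zero, ← this]; abel
    mul_one := fun x => by
      ext
      · simp
      · have := hF x.fst 1 1
        simp only [mul_one] at this
        simp only [snd_mul, fst_one, snd_one, mul_one, mul_neg]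
        rw [← sub_eq_zero, ← neg_eq_zero, ← this]; abel
    left_distrib := fun x y z => by
      ext
      · simp [mul_add]
      · simp only [snd_mul, fst_add, snd_add, mul_add, map_add]; abel
    right_distrib := fun x y z => by
      ext
      · simp [add_mul]
      · simp only [snd_mul, fst_add, snd_add, add_mul, map_add, LinearMap.add_apply]; abel
    zero_mul := fun x => by ext <;> simp
    mul_zero := fun x => by ext <;> simp }

instance : Algebra k (SqExt F hF) := Algebra.ofModule
  (fun c x y => by ext <;> simp [smul_add])
  (fun c x y => by ext <;> simp [smul_add])

variable (F hF) in
/-- The projection of the extension onto `A`. -/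
def fstHom : SqExt F hF →ₐ[k] A :=
  AlgHom.ofLinearMap { toFun := fst, map_add' := fst_add, map_smul' := fst_smul } rfl fst_mul

theorem fstHom_apply (x : SqExt F hF) : fstHom F hF x = x.fst := rfl

@[simp] theorem fst_sub (x y : SqExt F hF) : (x - y).fst = x.fst - y.fst :=
  map_sub (fstHom F hF) x y

variable (F hF) in
/-- The inclusion of the square-zero ideal. -/
def inr : A →+ SqExt F hF where
  toFun m := ⟨0, m⟩
  map_zero' := rfl
  map_add' a b := by ext <;> simp

@[simp] theorem fst_inr (m : A) : (inr F hF m).fst = 0 := rfl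
@[simp] theorem snd_inr (m : A) : (inr F hF m).snd = m := rfl

theorem mul_inr (x : SqExt F hF) (m : A) : x * inr F hF m = inr F hF (x.fst * m) := by
  ext <;> simp

theorem inr_mul (x : SqExt F hF) (m : A) : inr F hF m * x = inr F hF (m * x.fst) := by
  ext <;> simp

theorem eq_inr {x : SqExt F hF} (h : x.fst = 0) : x = inr F hF x.snd := by
  ext <;> simp [h]

theorem isNilpotent_of_mem_ker (x : SqExt F hF) (hx : x ∈ RingHom.ker (fstHom F hF).toRingHom) :
    IsNilpotent x := by
  have h : x.fst = 0 := hx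
  refine ⟨2, ?_⟩
  rw [pow_two, eq_inr h, mul_inr, fst_inr, zero_mul, map_zero]

end SqExt

/-- A `2`-cocycle whose square-zero extension splits is a coboundary. -/
theorem exists_of_section {F : A →ₗ[k] A →ₗ[k] A} {hF : IsTwoCocycle F} (σ : A →ₐ[k] SqExt F hF)
    (hσ : ∀ a, (σ a).fst = a) : ∃ g : A →ₗ[k] A, ∀ a b, F a b = a * g b - g (a * b) + g a * b := by
  refine ⟨-{
    toFun := fun a => (σ a).snd
    map_add' := fun a b => by simp
    map_smul' := fun c a => by simp }, fun a b => ?_⟩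
  have := congrArg SqExt.snd (map_mul σ a b)
  rw [SqExt.snd_mul, hσ, hσ] at this
  simp only [LinearMap.neg_apply, LinearMap.coe_mk, AddHom.coe_mk, this]
  noncomm_ring

end SqExt

section HHTwo

variable {k : Type u} [Field k] {n : ℕ}

/-- The value of a bilinear map on the relation at the vertex `p`. -/
def relationValue (F : AShriek k n →ₗ[k] AShriek k n →ₗ[k] AShriek k n) : ℕ → AShriek k n
  | 0 => F (dN k n 0) (uN k n 0)
  | p + 1 => F (dN k n (p + 1)) (uN k n (p + 1)) - F (uN k n p) (dN k n p)

/-- The corrections of the upward arrows that make the relations with defects `ρ` hold, built from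
the first vertex upwards. -/
def correction (ρ : ℕ → AShriek k n) : ℕ → AShriek k n
  | 0 => divL k n (-ρ 0)
  | p + 1 => divL k n (correction ρ p * dN k n p - ρ (p + 1))

/-- A `2`-cocycle is a coboundary if its values on the relations have no constant terms: in the
square-zero extension the vertices lift to orthogonal idempotents, and the lifts of the upward
arrows can be corrected so that all relations hold. -/
theorem twoCocycle_coboundary {F : AShriek k n →ₗ[k] AShriek k n →ₗ[k] AShriek k n}
    (hF : IsTwoCocycle F)
    (h : ∀ p (hp : p + 1 < n), augmentation ⟨p, by omega⟩ (relationValue F p) = 0) :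
    ∃ g : AShriek k n →ₗ[k] AShriek k n, ∀ a b, F a b = a * g b - g (a * b) + g a * b := by
  have hcoi : CompleteOrthogonalIdempotents (vert k (n := n)) :=
    ⟨⟨(aRep_self k n).idem, fun i j hij => (aRep_self k n).orth i j hij⟩, (aRep_self k n).one⟩
  -- The vertices lift to complete orthogonal idempotents along the square-zero extension.
  obtain ⟨e', he', hfe⟩ := CompleteOrthogonalIdempotents.lift_of_isNilpotent_ker
    (SqExt.fstHom F hF).toRingHom SqExt.isNilpotent_of_mem_ker hcoi
    (fun i => ⟨⟨vert k i, 0⟩, rfl⟩)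
  have hfe' : ∀ i, (e' i).fst = vert k i := fun i => congrFun hfe i
  let E : ℕ → SqExt F hF := fun i => if h : i < n then e' ⟨i, h⟩ else 0
  have hE : ∀ i : Fin n, E i = e' i := fun i => by simp [E]
  have hEE : ∀ i, E i * E i = E i := by
    intro i; simp only [E]; split_ifs
    · exact he'.idem _
    · simp
  have hEfst : ∀ i, (E i).fst = eN k n i := by
    intro i; simp only [E, eN]; split_ifs
    · exact hfe' _
    · rfl
  -- The arrows lift to elements with the right end points.
  let U : ℕ → SqExt F hF := fun p => E (p + 1) * ⟨uN k n p, 0⟩ * E p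
  let D : ℕ → SqExt F hF := fun p => E p * ⟨dN k n p, 0⟩ * E (p + 1)
  have hUfst : ∀ p, (U p).fst = uN k n p := fun p => by simp [U, hEfst]
  have hDfst : ∀ p, (D p).fst = dN k n p := fun p => by simp [D, hEfst]
  have hEU : ∀ p, E (p + 1) * U p = U p := fun p => by simp only [U, ← mul_assoc, hEE]
  have hUE : ∀ p, U p * E p = U p := fun p => by simp only [U, mul_assoc, hEE]
  have hED : ∀ p, E p * D p = D p := fun p => by simp only [D, ← mul_assoc, hEE]
  have hDE : ∀ p, D p * E (p + 1) = D p := fun p => by simp only [D, mul_assoc, hEE]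
  -- The defects of the relations lie in the square-zero ideal; their second components are `ρ`.
  let R : ℕ → SqExt F hF := fun p => match p with
    | 0 => D 0 * U 0
    | p + 1 => D (p + 1) * U (p + 1) - U p * D p
  have hER : ∀ p, E p * R p = R p := by
    intro p
    cases p with
    | zero => simp only [R, ← mul_assoc, hED]
    | succ p => simp only [R, mul_sub, ← mul_assoc, hED, hEU]
  have hRE : ∀ p, R p * E p = R p := by
    intro p
    cases p with
    | zero => simp only [R, mul_assoc, hUE]
    | succ p => simp only [R, sub_mul, mul_assoc, hDE, hUE]
  have hRfst : ∀ p, p + 1 < n → (R p).fst = 0 := by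
    intro p hp
    cases p with
    | zero => simp only [R, SqExt.fst_mul, hUfst, hDfst, dN_mul_uN_zero]
    | succ p =>
      simp only [R, SqExt.fst_sub, SqExt.fst_mul, hUfst, hDfst, dN_mul_uN_succ k n p hp, sub_self]
  let ρ : ℕ → AShriek k n := fun p => (R p).snd
  have hR : ∀ p, p + 1 < n → R p = SqExt.inr F hF (ρ p) := fun p hp => SqExt.eq_inr (hRfst p hp)
  have heρ : ∀ p, p + 1 < n → eN k n p * ρ p = ρ p := by
    intro p hp
    have := hER p
    rw [hR p hp, SqExt.mul_inr, hEfst] at this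
    exact congrArg SqExt.snd this
  have hρe : ∀ p, p + 1 < n → ρ p * eN k n p = ρ p := by
    intro p hp
    have := hRE p
    rw [hR p hp, SqExt.inr_mul, hEfst] at this
    exact congrArg SqExt.snd this
  -- The arrows have no constant terms, so those of `ρ` come from the values of the cocycle.
  have hχρ : ∀ p (hp : p + 1 < n), augmentation ⟨p, by omega⟩ (ρ p) = 0 := by
    intro p hp
    rw [← h p hp]
    cases p with
    | zero =>
      simp only [ρ, R, SqExt.snd_mul, hUfst, hDfst, relationValue, map_add, map_mul,
        augmentation_uN, augmentation_dN, zero_mul, mul_zero, zero_add]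
    | succ p =>
      have hsub : ∀ x y : SqExt F hF, (x - y).snd = x.snd - y.snd := fun x y => by
        rw [eq_sub_iff_add_eq, ← SqExt.snd_add, sub_add_cancel]
      simp only [ρ, R, hsub, SqExt.snd_mul, hUfst, hDfst, relationValue, map_add, map_sub,
        map_mul, augmentation_uN, augmentation_dN, zero_mul, mul_zero, zero_add]
  -- Adding `α` to the upward arrows cancels the defects, because loops without constant terms are
  -- divisible by the downward arrows.
  set α := correction ρ with hα
  have hα0 : α 0 = divL k n (-ρ 0) := rfl
  have hαs : ∀ p, α (p + 1) = divL k n (α p * dN k n p - ρ (p + 1)) := fun p => rfl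
  have hαl : ∀ p, p + 1 < n → eN k n (p + 1) * α p = α p := by
    intro p
    induction p with
    | zero => intro hp; rw [hα0, eN_mul_divL, mul_neg, heρ 0 hp]
    | succ p ih =>
      intro hp
      rw [hαs, eN_mul_divL, mul_sub, heρ _ hp, ← mul_assoc, ih (by omega)]
  have hαr : ∀ p, p + 1 < n → α p * eN k n p = α p := by
    intro p hp
    cases p with
    | zero => rw [hα0, divL_mul_eN, neg_mul, hρe 0 hp]
    | succ p => rw [hαs, divL_mul_eN, sub_mul, hρe _ hp, mul_assoc, dN_mul_eN]
  have hα0' : 1 < n → dN k n 0 * α 0 + ρ 0 = 0 := by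
    intro hp
    rw [hα0, dN_mul_divL_of_augmentation (p := 0) hp]
    · simp
    · rw [mul_neg, heρ 0 hp]
    · rw [neg_mul, hρe 0 hp]
    · rw [map_neg, hχρ 0 hp, neg_zero]
  have hαs' : ∀ p, p + 2 < n → dN k n (p + 1) * α (p + 1) + ρ (p + 1) = α p * dN k n p := by
    intro p hp
    rw [hαs, dN_mul_divL_of_augmentation (p := p + 1) hp]
    · simp
    · rw [mul_sub, heρ _ hp, ← mul_assoc, hαl p (by omega)]
    · rw [sub_mul, hρe _ hp, mul_assoc, dN_mul_eN]
    · rw [map_sub, hχρ _ hp, map_mul, augmentation_dN, mul_zero, sub_zero]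
  let U' : ℕ → SqExt F hF := fun p => U p + SqExt.inr F hF (α p)
  have rep : ARep e' (fun p : Fin (n - 1) => U' p) (fun p : Fin (n - 1) => D p) :=
    { idem := he'.idem
      orth := fun i j hij => he'.ortho hij
      one := he'.complete
      up_target := fun i => by
        rw [← hE]
        change E (i.val + 1) * (U i + _) = U i + _
        rw [mul_add, hEU, SqExt.mul_inr, hEfst, hαl _ (by have := i.2; omega)]
      up_source := fun i => by
        rw [← hE]
        change (U i + _) * E i.val = U i + _
        rw [add_mul, hUE, SqExt.inr_mul, hEfst, hαr _ (by have := i.2; omega)]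
      down_target := fun i => by rw [← hE]; exact hED _
      down_source := fun i => by rw [← hE]; exact hDE _
      loop_first := fun i hi => by
        have h1 : 0 + 1 < n := by have := i.2; omega
        have hR0 : D 0 * U 0 = SqExt.inr F hF (ρ 0) := hR 0 h1
        change D i * (U i + SqExt.inr F hF (α i)) = 0
        rw [hi, mul_add, SqExt.mul_inr, hDfst, hR0, ← map_add, add_comm, hα0' h1, map_zero]
      loop := fun i j hij => by
        have h1 : i.val + 1 + 1 < n := by have := j.2; omega
        have hRs : D (i.val + 1) * U (i.val + 1) - U i * D i =
          SqExt.inr F hF (ρ (i.val + 1)) := hR _ h1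
        change (U i + SqExt.inr F hF (α i)) * D i = D j * (U j + SqExt.inr F hF (α j))
        rw [← hij, add_mul, mul_add, SqExt.mul_inr, SqExt.inr_mul, hDfst, hDfst, ← hαs' _ h1,
          map_add, ← hRs]
        abel }
  -- The corrected lifts define an algebra section, whose second component is the cochain sought.
  refine exists_of_section (hF := hF) rep.lift fun a => ?_
  have : (SqExt.fstHom F hF).comp rep.lift = AlgHom.id k _ := by
    apply AShriek.algHom_ext
    · intro i; simp [SqExt.fstHom_apply, hfe']
    · intro i; simp [SqExt.fstHom_apply, U', hUfst, uN_val]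
    · intro i; simp [SqExt.fstHom_apply, hDfst, dN_val]
  exact DFunLike.congr_fun this a

/-- The constant term of the value on the relation at the vertex `p`. -/
def relationCoef (f : Cochain k (AShriek k n) 2) (p : ℕ) : k :=
  if h : p < n then augmentation ⟨p, h⟩ (relationValue (bilinOfCochain f) p) else 0

theorem bilinOfCochain_add (f g : Cochain k (AShriek k n) 2) :
    bilinOfCochain (f + g) = bilinOfCochain f + bilinOfCochain g := rfl

theorem bilinOfCochain_smul (c : k) (f : Cochain k (AShriek k n) 2) :
    bilinOfCochain (c • f) = c • bilinOfCochain f := rfl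

variable (k n) in
/-- The functionals on `2`-cochains that are dual to the cocycles `μ_i`: the sums of the constant
terms of the values on the relations up to a given vertex, with the opposite sign. -/
def twoFunctional : Cochain k (AShriek k n) 2 →ₗ[k] (Fin (n - 1) → k) where
  toFun f t := -∑ p ∈ Finset.range (t.val + 1), relationCoef f p
  map_add' f g := by
    funext t
    rw [Pi.add_apply, ← neg_add, ← Finset.sum_add_distrib]
    congr 1
    refine Finset.sum_congr rfl fun p _ => ?_
    rw [relationCoef, relationCoef, relationCoef, bilinOfCochain_add]
    split_ifs
    · rw [← map_add]
      cases p with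
      | zero => rfl
      | succ p => simp only [relationValue, LinearMap.add_apply]; congr 1; abel
    · simp
  map_smul' c f := by
    funext t
    rw [RingHom.id_apply, Pi.smul_apply, smul_neg, Finset.smul_sum]
    congr 1
    refine Finset.sum_congr rfl fun p _ => ?_
    rw [relationCoef, relationCoef, bilinOfCochain_smul]
    split_ifs
    · rw [← map_smul]
      cases p with
      | zero => rfl
      | succ p => simp only [relationValue, LinearMap.smul_apply, smul_sub]
    · simp

variable (k n) in
theorem twoFunctional_coboundary (f) (hf : f ∈ coboundaries k (AShriek k n) 2) :
    twoFunctional k n f = 0 := by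
  obtain ⟨g, hg⟩ := mem_coboundaries_two.1 hf
  funext t
  change -_ = 0
  rw [neg_eq_zero]
  refine Finset.sum_eq_zero fun p hp => ?_
  have hp' : p + 1 < n := by have := Finset.mem_range.1 hp; omega
  rw [relationCoef, dif_pos (by omega)]
  cases p with
  | zero =>
    rw [relationValue, bilinOfCochain_apply, hg, dN_mul_uN_zero]
    simp
  | succ p =>
    rw [relationValue, bilinOfCochain_apply, bilinOfCochain_apply, hg, hg,
      dN_mul_uN_succ k n p hp']
    simp

theorem mem_coboundaries_of_twoFunctional {f : Cochain k (AShriek k n) 2}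
    (hf : f ∈ cocycles k (AShriek k n) 2) (h : twoFunctional k n f = 0) :
    f ∈ coboundaries k (AShriek k n) 2 := by
  rw [mem_coboundaries_two]
  have hs : ∀ t, t + 1 < n → ∑ p ∈ Finset.range (t + 1), relationCoef f p = 0 := by
    intro t ht
    exact neg_eq_zero.1 (congrFun h ⟨t, by omega⟩)
  refine twoCocycle_coboundary (F := bilinOfCochain f) (mem_cocycles_two.1 hf) fun p hp => ?_
  have hrc : relationCoef f p = 0 := by
    cases p with
    | zero => simpa using hs 0 hp
    | succ p =>
      have h1 := hs (p + 1) hp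
      rw [Finset.sum_range_succ, hs p (by omega), zero_add] at h1
      exact h1
  rwa [relationCoef, dif_pos (by omega)] at hrc

/-- The relations have degree `2`, so constant terms occur only for cochains of degree `-2`. -/
theorem twoFunctional_eq_zero {f : Cochain k (AShriek k n) 2} {j : ℤ} (hj : j ≠ -2)
    (hf : f ∈ homogeneousCochains (pathGrading k n) 2 j) : twoFunctional k n f = 0 := by
  funext t
  change -_ = 0
  rw [neg_eq_zero]
  refine Finset.sum_eq_zero fun p _ => ?_
  have key : ∀ a b : AShriek k n, a ∈ pathGrading k n 1 → b ∈ pathGrading k n 1 →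
      f ![a, b] ∈ pathGrading k n (2 + j) := by
    intro a b ha hb
    have := hf ![1, 1] ![a, b] (fun i => by fin_cases i <;> assumption)
    simpa using this
  have hu : ∀ i, uN k n i ∈ pathGrading k n 1 := fun i => by
    rw [pathGrading_eq]; exact uN_mem_valleySpan i
  have hd : ∀ i, dN k n i ∈ pathGrading k n 1 := fun i => by
    rw [pathGrading_eq]; exact dN_mem_valleySpan i
  rw [relationCoef]
  split_ifs
  · refine augmentation_eq_zero _ (d := 2 + j) (by omega) ?_
    cases p with
    | zero => exact key _ _ (hd _) (hu _)
    | succ p => exact Submodule.sub_mem _ (key _ _ (hd _) (hu _)) (key _ _ (hu _) (hd _))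
  · rfl

/-- The value of `μ_i` on the relation at a vertex has constant term `-1` at the lower end and `1` at
the upper end of its arrow, if the relation exists there; the partial sums isolate one arrow. -/
theorem twoFunctional_isMu {p : Fin (n - 1)} {μ : Cochain k (AShriek k n) 2} (hμ : IsMu k p μ) :
    twoFunctional k n μ = Pi.single p 1 := by
  have hdu : ∀ q, q + 1 < n → μ ![dN k n q, uN k n q] = if q = p.val then -eN k n q else 0 := by
    intro q hq
    have := hμ.down_up ⟨q, by omega⟩ ⟨q, by omega⟩
    rw [← uN_val, ← dN_val] at this
    rw [this, ← eN_val]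
    simp only [and_self, Fin.ext_iff]
    split_ifs with h
    · rw [h]; rfl
    · rfl
  have hud : ∀ q, q + 1 < n →
      μ ![uN k n q, dN k n q] = if q = p.val then -eN k n (q + 1) else 0 := by
    intro q hq
    have := hμ.up_down ⟨q, by omega⟩ ⟨q, by omega⟩
    rw [← uN_val, ← dN_val] at this
    rw [this, ← eN_val]
    simp only [and_self, Fin.ext_iff]
    split_ifs with h
    · rw [h]; rfl
    · rfl
  have hr : ∀ q, q + 1 < n → relationCoef μ q =
      (if q = p.val then -1 else 0) - (if q = p.val + 1 then -1 else 0) := by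
    intro q hq
    rw [relationCoef, dif_pos (by omega)]
    cases q with
    | zero =>
      rw [relationValue, bilinOfCochain_apply, hdu 0 hq]
      split_ifs <;> first | contradiction | omega | simp
    | succ q =>
      rw [relationValue, bilinOfCochain_apply, bilinOfCochain_apply, hdu _ hq, hud q (by omega)]
      split_ifs <;> first | omega | simp
  have hs : ∀ t, t + 1 < n → ∑ q ∈ Finset.range (t + 1), relationCoef μ q =
      if t = p.val then -1 else 0 := by
    intro t
    induction t with
    | zero =>
      intro ht
      rw [zero_add, Finset.sum_range_one, hr 0 ht]
      simp
    | succ t ih =>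
      intro ht
      rw [Finset.sum_range_succ, ih (by omega), hr _ ht]
      split_ifs <;> first | omega | simp
  funext t
  change -_ = _
  rw [hs t (by have := t.2; omega), Pi.single_apply]
  simp only [Fin.ext_iff]
  split_ifs <;> simp

/-- The classes of the cocycles `μ_i` are dual to the functionals that classify `HH²`. -/
theorem HH_two_dualBasis (μ : Fin (n - 1) → Cochain k (AShriek k n) 2)
    (hμ : ∀ p, IsMu k p (μ p)) : GradedDualBasis (HHgr (pathGrading k n) 2)
    (HH.functional (twoFunctional k n) (twoFunctional_coboundary k n))
    (fun _ => -2) (fun p => HH.mk (μ p) (hμ p).cocycle) := by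
  apply HH.gradedDualBasis
  · exact fun t => (hμ t).degree
  · exact fun f hf h => mem_coboundaries_of_twoFunctional hf h
  · exact fun t => twoFunctional_isMu (hμ t)
  · intro j f _ hf t ht
    exact congrFun (twoFunctional_eq_zero ht hf) t

end HHTwo

/-! ### Hochschild cochains with coefficients and dimension shifting -/

section Coefficients

variable {k : Type u} [Field k] {A : Type u} [Ring A] [Algebra k A]

variable (k A) in
/-- Commuting left and right actions of `A` on a vector space. The unit of `A` need not act as the
identity on the right: the twisted action on `Hom_k(A, N)` below does not have this property. -/
structure TwoSided (N : Type*) [AddCommGroup N] [Module k N] where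
  /-- The left action. -/
  l : A →ₗ[k] N →ₗ[k] N
  /-- The right action, `r a x = x a`. -/
  r : A →ₗ[k] N →ₗ[k] N
  l_mul : ∀ a b x, l (a * b) x = l a (l b x)
  r_mul : ∀ a b x, r (a * b) x = r b (r a x)
  l_r : ∀ a b x, l a (r b x) = r b (l a x)

namespace TwoSided

variable {N : Type*} [AddCommGroup N] [Module k N]

variable (k A) in
/-- `A` as a bimodule over itself. -/
def regular : TwoSided k A A where
  l := LinearMap.mul k A
  r := (LinearMap.mul k A).flip
  l_mul a b x := by simp [mul_assoc]
  r_mul a b x := by simp [mul_assoc]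
  l_r a b x := by simp [mul_assoc]

/-- The Hochschild differential of a cochain with coefficients in `N`. -/
def d (S : TwoSided k A N) {m : ℕ} (f : MultilinearMap k (fun _ : Fin m => A) N)
    (g : Fin (m + 1) → A) : N :=
  S.l (g 0) (f (Fin.tail g)) +
    ∑ i : Fin m, (-1 : k) ^ (i.val + 1) • f (Fin.contractNth i.castSucc (· * ·) g) +
    (-1 : k) ^ (m + 1) • S.r (g (Fin.last m)) (f (Fin.init g))

theorem regular_d {m : ℕ} (f : Cochain k A m) (g : Fin (m + 1) → A) :
    (regular k A).d f g = hochschildD k A m f g := by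
  simp [d, regular, hochschildD, leftCochain_apply, rightCochain_apply, contractCochain_apply]

/-- The action on `Hom_k(A, N)` with `(a φ) x = a (φ x)` and `(φ b) x = φ (b x) - (φ b) x`. -/
def twist (S : TwoSided k A N) : TwoSided k A (A →ₗ[k] N) where
  l := LinearMap.mk₂ k (fun a φ => S.l a ∘ₗ φ)
    (fun a b φ => by ext; simp) (fun c a φ => by ext; simp)
    (fun a φ ψ => by ext; simp) (fun c a φ => by ext; simp)
  r := LinearMap.mk₂ k (fun b φ => φ ∘ₗ LinearMap.mulLeft k b - S.r.flip (φ b))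
    (fun a b φ => by ext; simp [add_mul]; abel)
    (fun c a φ => by ext; simp [smul_sub])
    (fun a φ ψ => by ext; simp; abel)
    (fun c a φ => by ext; simp [smul_sub])
  l_mul a b φ := by ext; simp [S.l_mul]
  r_mul a b φ := by ext; simp [S.r_mul]
  l_r a b φ := by ext; simp [S.l_r]

theorem twist_l (S : TwoSided k A N) (a : A) (φ : A →ₗ[k] N) (x : A) :
    S.twist.l a φ x = S.l a (φ x) := rfl

theorem twist_r (S : TwoSided k A N) (b : A) (φ : A →ₗ[k] N) (x : A) :
    S.twist.r b φ x = φ (b * x) - S.r x (φ b) := rfl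

/-- Currying the last variable turns the differential into that of the twisted coefficients. -/
theorem d_snoc (S : TwoSided k A N) {m : ℕ} (f : MultilinearMap k (fun _ : Fin m => A) (A →ₗ[k] N))
    (g : Fin (m + 1) → A) (x : A) :
    S.d (MultilinearMap.uncurryRight (M := fun _ : Fin (m + 1) => A) f)
      (Fin.snoc (α := fun _ => A) g x) = S.twist.d f g x := by
  have htail : Fin.tail (Fin.snoc (α := fun _ : Fin (m + 2) => A) g x) =
      Fin.snoc (α := fun _ : Fin (m + 1) => A) (Fin.tail g) x := by
    funext i
    refine Fin.lastCases ?_ (fun j => ?_) i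
    · rw [Fin.tail, Fin.succ_last, Fin.snoc_last, Fin.snoc_last]
    · rw [Fin.tail, Fin.succ_castSucc, Fin.snoc_castSucc, Fin.snoc_castSucc, Fin.tail]
  have hcon : ∀ i : Fin m, Fin.contractNth i.castSucc.castSucc (· * ·)
      (Fin.snoc (α := fun _ : Fin (m + 2) => A) g x) =
      Fin.snoc (α := fun _ : Fin (m + 1) => A) (Fin.contractNth i.castSucc (· * ·) g) x := by
    intro i
    funext j
    refine Fin.lastCases ?_ (fun j => ?_) j
    · rw [Fin.contractNth_apply_of_gt _ _ _ _ (by simp), Fin.succ_last, Fin.snoc_last,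
        Fin.snoc_last]
    · rw [Fin.snoc_castSucc]
      rcases lt_trichotomy j.val i.val with h | h | h
      · rw [Fin.contractNth_apply_of_lt _ _ _ _ (by simpa using h),
          Fin.contractNth_apply_of_lt _ _ _ _ (by simpa using h), Fin.snoc_castSucc]
      · rw [Fin.contractNth_apply_of_eq _ _ _ _ (by simpa using h),
          Fin.contractNth_apply_of_eq _ _ _ _ (by simpa using h), Fin.snoc_castSucc,
          Fin.succ_castSucc, Fin.snoc_castSucc]
      · rw [Fin.contractNth_apply_of_gt _ _ _ _ (by simpa using h),
          Fin.contractNth_apply_of_gt _ _ _ _ (by simpa using h), Fin.succ_castSucc,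
          Fin.snoc_castSucc]
  have hlast : Fin.contractNth (Fin.last m).castSucc (· * ·)
      (Fin.snoc (α := fun _ : Fin (m + 2) => A) g x) =
      Fin.snoc (α := fun _ : Fin (m + 1) => A) (Fin.init g) (g (Fin.last m) * x) := by
    funext j
    refine Fin.lastCases ?_ (fun j => ?_) j
    · rw [Fin.contractNth_apply_of_eq _ _ _ _ (by simp), Fin.succ_last, Fin.snoc_last,
        Fin.snoc_last, Fin.snoc_castSucc]
    · rw [Fin.contractNth_apply_of_lt _ _ _ _ (by simp), Fin.snoc_castSucc,
        Fin.snoc_castSucc, Fin.init]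
  have h0 : Fin.snoc (α := fun _ : Fin (m + 2) => A) g x 0 = g 0 := by
    rw [← Fin.castSucc_zero, Fin.snoc_castSucc]
  rw [d, d, Fin.sum_univ_castSucc, htail, hlast, h0, Fin.snoc_last, Fin.init_snoc]
  simp only [hcon, MultilinearMap.uncurryRight_apply, Fin.snoc_last, Fin.init_snoc,
    LinearMap.add_apply, LinearMap.sum_apply, LinearMap.smul_apply, twist_l, twist_r,
    Fin.val_castSucc, Fin.val_last, smul_sub]
  rw [pow_succ (-1 : k) (m + 1)]
  simp only [mul_neg, mul_one, neg_smul]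
  abel

/-- Every `m`-cocycle with coefficients in `N` is a coboundary of an `(m-1)`-cochain. -/
def Acyclic (S : TwoSided k A N) (m : ℕ) : Prop :=
  ∀ f : MultilinearMap k (fun _ : Fin (m + 1) => A) N, (∀ g, S.d f g = 0) →
    ∃ w : MultilinearMap k (fun _ : Fin m => A) N, ∀ g, f g = S.d w g

theorem acyclic_succ (S : TwoSided k A N) {m : ℕ} (h : S.twist.Acyclic m) :
    S.Acyclic (m + 1) := by
  intro f hf
  obtain ⟨w, hw⟩ := h f.curryRight (fun g => by
    ext x
    rw [← d_snoc, MultilinearMap.uncurry_curryRight, hf]; rfl)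
  refine ⟨MultilinearMap.uncurryRight (M := fun _ : Fin (m + 1) => A) w, fun g => ?_⟩
  have := DFunLike.congr_fun (hw (Fin.init g)) (g (Fin.last _))
  rw [← d_snoc, MultilinearMap.curryRight_apply, Fin.snoc_init_self] at this
  exact this

/-- The condition that a trilinear map is a `3`-cocycle. -/
def IsThreeCocycle (S : TwoSided k A N) (F : A →ₗ[k] A →ₗ[k] A →ₗ[k] N) : Prop :=
  ∀ a b x y, S.l a (F b x y) - F (a * b) x y + F a (b * x) y - F a b (x * y) +
    S.r y (F a b x) = 0

/-- The condition that every `3`-cocycle, as a trilinear map, is a coboundary. -/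
def ThreeAcyclic (S : TwoSided k A N) : Prop :=
  ∀ F : A →ₗ[k] A →ₗ[k] A →ₗ[k] N, S.IsThreeCocycle F → ∃ W : A →ₗ[k] A →ₗ[k] N,
    ∀ a x y, F a x y = S.l a (W x y) - W (a * x) y + W a (x * y) - S.r y (W a x)

/-- A `3`-cocycle with coefficients in `N`, curried twice, is a `1`-cocycle with the twice twisted
coefficients. -/
theorem ThreeAcyclic.acyclic {S : TwoSided k A N} (h : S.ThreeAcyclic) :
    S.twist.twist.Acyclic 0 := by
  intro f hf
  let F : A →ₗ[k] A →ₗ[k] A →ₗ[k] N := (MultilinearMap.ofSubsingleton k A _ (0 : Fin 1)).symm f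
  have hF : ∀ a, F a = f ![a] := fun a => by
    change f (fun _ => a) = _
    congr 1
    funext i; fin_cases i; rfl
  have hcoc : S.IsThreeCocycle F := by
    intro a b x y
    have h1 : Fin.contractNth (α := A) (0 : Fin 2) (· * ·) ![a, b] = ![a * b] := by
      funext i; fin_cases i; rfl
    have h2 : Fin.init (α := fun _ => A) ![a, b] = ![a] := by
      funext i; fin_cases i; rfl
    have h3 : Fin.tail (α := fun _ => A) ![a, b] = ![b] := by
      funext i; fin_cases i; rfl
    have hs : ∑ i : Fin (0 + 1), (-1 : k) ^ (i.val + 1) •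
        f (Fin.contractNth i.castSucc (· * ·) ![a, b]) = -f ![a * b] := by
      rw [← h1]
      refine (Fin.sum_univ_one _).trans ?_
      ext x y
      simp
    have h4 := DFunLike.congr_fun (DFunLike.congr_fun (hf ![a, b]) x) y
    simp only [d, h2, h3, hs, Fin.last, LinearMap.add_apply,
      LinearMap.smul_apply, twist_l, twist_r, LinearMap.sub_apply, LinearMap.zero_apply] at h4
    rw [hF, hF, hF, ← h4]
    simp
    abel
  obtain ⟨W, hW⟩ := h F hcoc
  refine ⟨MultilinearMap.constOfIsEmpty k _ W, fun g => ?_⟩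
  have hg : g = ![g 0] := by funext i; fin_cases i; rfl
  ext x y
  conv_lhs => rw [hg, ← hF, hW]
  simp [d, twist_l, twist_r]
  abel

end TwoSided

/-- If `3`-cocycles with arbitrary coefficients are coboundaries, then so are all cocycles of
degree at least `3`. -/
theorem acyclic_of_threeAcyclic
    (h : ∀ (N : Type u) [AddCommGroup N] [Module k N] (S : TwoSided k A N), S.ThreeAcyclic)
    (m : ℕ) : ∀ (N : Type u) [AddCommGroup N] [Module k N] (S : TwoSided k A N),
      S.Acyclic (m + 2) := by
  have key : ∀ m, ∀ (N : Type u) [AddCommGroup N] [Module k N] (S : TwoSided k A N),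
      S.twist.twist.Acyclic m := by
    intro m
    induction m with
    | zero => exact fun N _ _ S => (h N S).acyclic
    | succ m ih => exact fun N _ _ S => S.twist.twist.acyclic_succ (ih _ S.twist)
  exact fun N _ _ S => S.acyclic_succ (S.twist.acyclic_succ (key m N S))

theorem subsingleton_HH_of_threeAcyclic
    (h : ∀ (N : Type u) [AddCommGroup N] [Module k N] (S : TwoSided k A N), S.ThreeAcyclic)
    (m : ℕ) (hm : 3 ≤ m) : Subsingleton (HH k A m) := by
  obtain ⟨m, rfl⟩ := Nat.exists_eq_add_of_le' hm
  refine subsingleton_of_forall_eq 0 fun c => ?_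
  obtain ⟨⟨f, hf⟩, rfl⟩ := Submodule.Quotient.mk_surjective _ c
  refine (HH.mk_eq_zero f hf).2 ?_
  obtain ⟨w, hw⟩ := acyclic_of_threeAcyclic h m A (TwoSided.regular k A) f (fun g => by
    rw [TwoSided.regular_d, show hochschildD k A _ f = 0 from hf]; rfl)
  refine ⟨w, ?_⟩
  ext g
  rw [← TwoSided.regular_d, hw]

end Coefficients

/-! ### Contractible resolutions of length two -/

section Chase

variable {k : Type u} [Field k] {n : ℕ}

theorem actL_mul (a b : AShriek k n) : actL k (a * b) = actL k a * actL k b := by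
  simp [actL]

theorem actR_mul (a b : AShriek k n) : actR k (a * b) = actR k b * actR k a := by
  simp [actR]

theorem actL_actR (a b : AShriek k n) : actL k a * actR k b = actR k b * actL k a := by
  simp [actL, actR]

theorem actR_mul_actL (a b : AShriek k n) : actR k b * actL k a = a ⊗ₜ[k] op b := by
  simp [actL, actR]

theorem actL_smul_actR_smul {Q : Type*} [AddCommGroup Q] [Module (Env k n) Q] (a b : AShriek k n)
    (z : Q) : actL k a • actR k b • z = actR k b • actL k a • z := by
  rw [← mul_smul, ← mul_smul, actL_actR]

theorem actL_smul_smul {Q : Type*} [AddCommGroup Q] [Module (Env k n) Q] [Module k Q]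
    [IsScalarTower k (Env k n) Q] (c : k) (a : AShriek k n) (z : Q) :
    actL k (c • a) • z = c • actL k a • z := by
  rw [← smul_assoc, actL, actL, TensorProduct.smul_tmul']

instance : IsScalarTower k (Env k n) (AShriek k n) :=
  IsScalarTower.of_algebraMap_smul (R := k) (A := Env k n) (M := AShriek k n) fun c x => by
    rw [Algebra.TensorProduct.algebraMap_apply, ← op_one, env_smul, mul_one, Algebra.smul_def]

variable {N : Type*} [AddCommGroup N] [Module k N] (S : TwoSided k (AShriek k n) N)

/-- The linear map `x ⊗ y ↦ (φ x) y` on the enveloping algebra. -/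
def evalEnv : (AShriek k n →ₗ[k] N) →ₗ[k] Env k n →ₗ[k] N where
  toFun φ := TensorProduct.lift
    ((S.r ∘ₗ (opLinearEquiv k).symm.toLinearMap).flip ∘ₗ φ)
  map_add' φ ψ := by ext; simp
  map_smul' c φ := by ext; simp

theorem evalEnv_tmul (φ : AShriek k n →ₗ[k] N) (x y : AShriek k n) :
    evalEnv S φ (x ⊗ₜ[k] op y) = S.r y (φ x) := rfl

variable {P : Type*} [AddCommGroup P] [Module (Env k n) P] [Module k P]
  [IsScalarTower k (Env k n) P] {ι : Type*} [Fintype ι] (g : ι → P)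
  (c : ι → P →ₗ[Env k n] Env k n)

/-- The map `σ Φ` with `(σ Φ) ((x ⊗ y) g_i) = (Φ(x) g_i) y`, for a bimodule with generators `g_i`
and coordinates `c_i`. -/
def sigma : (AShriek k n →ₗ[k] P →ₗ[k] N) →ₗ[k] P →ₗ[k] N where
  toFun Φ := ∑ i, evalEnv S (Φ.flip (g i)) ∘ₗ (c i).restrictScalars k
  map_add' Φ Ψ := by
    ext z
    simp only [LinearMap.sum_apply, LinearMap.add_apply, ← Finset.sum_add_distrib]
    refine Finset.sum_congr rfl fun i _ => ?_
    rw [show (Φ + Ψ).flip (g i) = Φ.flip (g i) + Ψ.flip (g i) from rfl, map_add]; rfl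
  map_smul' a Φ := by
    ext z
    simp only [LinearMap.sum_apply, LinearMap.smul_apply, RingHom.id_apply, Finset.smul_sum]
    refine Finset.sum_congr rfl fun i _ => ?_
    rw [show (a • Φ).flip (g i) = a • Φ.flip (g i) from rfl, map_smul]; rfl

theorem sigma_apply (Φ : AShriek k n →ₗ[k] P →ₗ[k] N) (z : P) :
    sigma S g c Φ z = ∑ i, evalEnv S (Φ.flip (g i)) (c i z) := by
  simp [sigma]

/-- Linearity with respect to the right action of `A_n^!`. -/
def IsRight (φ : P →ₗ[k] N) : Prop := ∀ b z, φ (actR k b • z) = S.r b (φ z)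

theorem evalEnv_actR (φ : AShriek k n →ₗ[k] N) (b : AShriek k n) (t : Env k n) :
    evalEnv S φ (actR k b * t) = S.r b (evalEnv S φ t) := by
  induction t using TensorProduct.induction_on with
  | zero => simp
  | add x y hx hy => rw [mul_add, map_add, hx, hy, map_add, map_add]
  | tmul x y =>
    rw [← op_unop y, actR, Algebra.TensorProduct.tmul_mul_tmul, one_mul, ← op_mul, evalEnv_tmul,
      evalEnv_tmul, S.r_mul]

theorem sigma_isRight (Φ : AShriek k n →ₗ[k] P →ₗ[k] N) : IsRight S (sigma S g c Φ) := by
  intro b z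
  rw [sigma_apply, sigma_apply, map_sum]
  exact Finset.sum_congr rfl fun i _ => by rw [map_smul, smul_eq_mul, evalEnv_actR]

/-- The contracting homotopy property of `sigma`: an identity between the values at elements of
`A` carries over. -/
theorem sigma_relation (hgc : ∀ z, ∑ i, c i z • g i = z) (a b : AShriek k n)
    (Φ₁ Φ₂ Φ₃ : AShriek k n →ₗ[k] P →ₗ[k] N) (Θ : P →ₗ[k] N) (hΘ : IsRight S Θ)
    (h : ∀ x z, S.l a (Φ₁ x z) + Φ₂ x z + Φ₃ (b * x) z + Θ (actL k x • z) = 0) (z : P) :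
    S.l a (sigma S g c Φ₁ z) + sigma S g c Φ₂ z + sigma S g c Φ₃ (actL k b • z) + Θ z = 0 := by
  have key : ∀ i (t : Env k n), S.l a (evalEnv S (Φ₁.flip (g i)) t) +
      evalEnv S (Φ₂.flip (g i)) t + evalEnv S (Φ₃.flip (g i)) (actL k b * t) +
      Θ (t • g i) = 0 := by
    intro i t
    induction t using TensorProduct.induction_on with
    | zero =>
      rw [mul_zero]
      simp only [map_zero, zero_add]
      exact (congrArg Θ (zero_smul (Env k n) (g i))).trans (map_zero Θ)
    | add x y hx hy =>
      rw [mul_add, add_smul]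
      simp only [map_add]
      rw [← add_zero (0 : N)]
      nth_rewrite 1 [← hx]
      rw [← hy]
      abel
    | tmul x y =>
      rw [← op_unop y]
      generalize unop y = y
      have h1 : Θ ((x ⊗ₜ[k] op y : Env k n) • g i) = S.r y (Θ (actL k x • g i)) := by
        rw [← hΘ, ← mul_smul, actR_mul_actL]
      have h2 : (actL k b * x ⊗ₜ[k] op y : Env k n) = (b * x) ⊗ₜ[k] op y := by
        simp [actL]
      rw [h1, h2, evalEnv_tmul, evalEnv_tmul, evalEnv_tmul, S.l_r, ← map_add, ← map_add,
        ← map_add]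
      have := h x (g i)
      simp only [LinearMap.flip_apply]
      rw [this, map_zero]
  have hz : Θ z = ∑ i, Θ (c i z • g i) := by rw [← map_sum, hgc]
  rw [sigma_apply, sigma_apply, sigma_apply, hz, map_sum, ← Finset.sum_add_distrib,
    ← Finset.sum_add_distrib, ← Finset.sum_add_distrib]
  exact Finset.sum_eq_zero fun i _ => by rw [map_smul, smul_eq_mul]; exact key i _

end Chase

section Vanishing

variable {k : Type u} [Field k] {n : ℕ}
variable {N : Type*} [AddCommGroup N] [Module k N]

/-- If `A_n^!` has a resolution of length two by finitely generated projective bimodules that is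
contractible as a complex of right modules, then `3`-cocycles with arbitrary coefficients are
coboundaries: the cocycle is pushed along the resolution, and the contractions of the cochains with
values in the coinduced coefficients `Hom(P_q, N)` push it back. -/
theorem threeAcyclic_of_resolution
    {Q₀ Q₁ Q₂ : Type*} [AddCommGroup Q₀] [Module (Env k n) Q₀] [Module k Q₀]
    [IsScalarTower k (Env k n) Q₀] [AddCommGroup Q₁] [Module (Env k n) Q₁] [Module k Q₁]
    [IsScalarTower k (Env k n) Q₁] [AddCommGroup Q₂] [Module (Env k n) Q₂] [Module k Q₂]
    [IsScalarTower k (Env k n) Q₂]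
    {ι₀ ι₁ ι₂ : Type*} [Fintype ι₀] [Fintype ι₁] [Fintype ι₂]
    {g₀ : ι₀ → Q₀} {c₀ : ι₀ → Q₀ →ₗ[Env k n] Env k n} (hg₀ : ∀ z, ∑ i, c₀ i z • g₀ i = z)
    {g₁ : ι₁ → Q₁} {c₁ : ι₁ → Q₁ →ₗ[Env k n] Env k n} (hg₁ : ∀ z, ∑ i, c₁ i z • g₁ i = z)
    {g₂ : ι₂ → Q₂} {c₂ : ι₂ → Q₂ →ₗ[Env k n] Env k n} (hg₂ : ∀ z, ∑ i, c₂ i z • g₂ i = z)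
    (ε : Q₀ →ₗ[Env k n] AShriek k n) (f₁ : Q₁ →ₗ[Env k n] Q₀) (f₂ : Q₂ →ₗ[Env k n] Q₁)
    (hεf : ∀ z, ε (f₁ z) = 0) (hff : ∀ z, f₁ (f₂ z) = 0)
    (o : Q₀) (h₀ : Q₀ →ₗ[k] Q₁) (h₁ : Q₁ →ₗ[k] Q₂) (ho : ε o = 1)
    (h₀r : ∀ (b : AShriek k n) z, h₀ (actR k b • z) = actR k b • h₀ z)
    (h₁r : ∀ (b : AShriek k n) z, h₁ (actR k b • z) = actR k b • h₁ z)
    (hom₀ : ∀ z, actR k (ε z) • o + f₁ (h₀ z) = z)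
    (hom₁ : ∀ z, h₀ (f₁ z) + f₂ (h₁ z) = z) (hom₂ : ∀ z, h₁ (f₂ z) = z)
    (S : TwoSided k (AShriek k n) N) : S.ThreeAcyclic := by
  intro F hF
  have εL : ∀ (a : AShriek k n) z, ε (actL k a • z) = a * ε z := fun a z => by
    rw [map_smul, actL, ← op_one, env_smul, mul_one]
  have εR : ∀ (b : AShriek k n) z, ε (actR k b • z) = ε z * b := fun b z => by
    rw [map_smul, actR, env_smul, one_mul]
  -- the cocycle, with values in the coinduced module of `Q₀`
  let Φ : AShriek k n →ₗ[k] AShriek k n →ₗ[k] AShriek k n →ₗ[k] Q₀ →ₗ[k] N :=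
    (LinearMap.compRight k ((LinearMap.compRight k
      ((LinearMap.lcomp k N (ε.restrictScalars k)) ∘ₗ S.r.flip)))) ∘ₗ F
  have hΦ : ∀ a b x z, Φ a b x z = S.r (ε z) (F a b x) := fun a b x z => rfl
  let g : AShriek k n →ₗ[k] AShriek k n →ₗ[k] Q₀ →ₗ[k] N :=
    (LinearMap.compRight k (sigma S g₀ c₀)) ∘ₗ Φ
  have hgr : ∀ a b, IsRight S (g a b) := fun a b => sigma_isRight S g₀ c₀ _
  have hg : ∀ a b x z, S.l a (g b x z) - g (a * b) x z + g a (b * x) z -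
      g a b (actL k x • z) + S.r (ε z) (F a b x) = 0 := by
    intro a b x z
    have := sigma_relation S g₀ c₀ hg₀ a x (Φ b x) (Φ a (b * x) - Φ (a * b) x) (-Φ a b)
      (Φ a b x) (fun y z => by rw [hΦ, hΦ, εR, S.r_mul]) (fun y z => by
        simp only [LinearMap.sub_apply, LinearMap.neg_apply, hΦ, εL, S.r_mul, S.l_r]
        rw [← map_zero (S.r (ε z)), ← hF a b x y]
        simp only [map_add, map_sub]
        abel) z
    rw [map_neg, map_sub, LinearMap.neg_apply, LinearMap.sub_apply, hΦ] at this
    rw [← this]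
    change S.l a (sigma S g₀ c₀ (Φ b x) z) - sigma S g₀ c₀ (Φ (a * b) x) z +
      sigma S g₀ c₀ (Φ a (b * x)) z - sigma S g₀ c₀ (Φ a b) (actL k x • z) + _ = _
    abel
  -- its restriction to `Q₁` is a cocycle with values in the coinduced module of `Q₁`
  let g1 : AShriek k n →ₗ[k] AShriek k n →ₗ[k] Q₁ →ₗ[k] N :=
    (LinearMap.compRight k (LinearMap.lcomp k N (f₁.restrictScalars k))) ∘ₗ g
  have hg1 : ∀ a b z, g1 a b z = g a b (f₁ z) := fun a b z => rfl
  let g2 : AShriek k n →ₗ[k] Q₁ →ₗ[k] N := sigma S g₁ c₁ ∘ₗ g1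
  have hg2r : ∀ a, IsRight S (g2 a) := fun a => sigma_isRight S g₁ c₁ _
  have hg2 : ∀ a b z, S.l a (g2 b z) - g2 (a * b) z + g2 a (actL k b • z) = g1 a b z := by
    intro a b z
    have := sigma_relation S g₁ c₁ hg₁ a b (g1 b) (-g1 (a * b)) (g1 a) (-g1 a b)
      (fun y z => by
        rw [LinearMap.neg_apply, LinearMap.neg_apply, hg1, hg1, map_smul, hgr, map_neg])
      (fun y z => by
        have h := hg a b y (f₁ z)
        rw [hεf, map_zero, LinearMap.zero_apply, add_zero] at h
        simp only [LinearMap.neg_apply, hg1, map_smul]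
        rw [← h]; abel) z
    rw [map_neg, LinearMap.neg_apply, LinearMap.neg_apply, add_neg_eq_zero] at this
    rw [← this]
    change S.l a (sigma S g₁ c₁ (g1 b) z) - sigma S g₁ c₁ (g1 (a * b)) z +
      sigma S g₁ c₁ (g1 a) (actL k b • z) = _
    abel
  let g3 : AShriek k n →ₗ[k] Q₂ →ₗ[k] N := LinearMap.lcomp k N (f₂.restrictScalars k) ∘ₗ g2
  have hg3 : ∀ a z, g3 a z = g2 a (f₂ z) := fun a z => rfl
  let g4 : Q₂ →ₗ[k] N := sigma S g₂ c₂ g3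
  have hg4r : IsRight S g4 := sigma_isRight S g₂ c₂ _
  have hg4 : ∀ a z, g3 a z = g4 (actL k a • z) - S.l a (g4 z) := by
    intro a z
    have := sigma_relation S g₂ c₂ hg₂ a a g3 0 (-g3) (g3 a)
      (fun y z => by rw [hg3, hg3, map_smul, hg2r])
      (fun y z => by
        have h := hg2 a y (f₂ z)
        rw [hg1, hff, map_zero] at h
        simp only [LinearMap.neg_apply, LinearMap.zero_apply, hg3, map_smul, add_zero]
        rw [← h]; abel) z
    rw [map_zero, LinearMap.zero_apply, map_neg, LinearMap.neg_apply, add_zero] at this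
    rw [← sub_eq_zero, ← this]
    change _ - (g4 _ - S.l a (g4 z)) = S.l a (g4 z) + -g4 _ + _
    abel
  -- the corrections, on the way back along the homotopies
  let t : Q₁ →ₗ[k] N := g4 ∘ₗ h₁
  have htr : ∀ b z, t (actR k b • z) = S.r b (t z) := fun b z => by
    change g4 (h₁ _) = S.r b (g4 (h₁ z)); rw [h₁r, hg4r]
  let g2' : AShriek k n → Q₁ → N := fun a z => g2 a z - (t (actL k a • z) - S.l a (t z))
  have hg2' : ∀ a b z, S.l a (g2' b z) - g2' (a * b) z + g2' a (actL k b • z) = g1 a b z := by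
    intro a b z
    simp only [g2', ← hg2 a b z, map_sub, S.l_mul, actL_mul, mul_smul]; abel
  have hg2f : ∀ a z, g2' a (f₂ z) = 0 := by
    intro a z
    have h1 : ∀ z, t (f₂ z) = g4 z := fun z => congrArg g4 (hom₂ z)
    simp only [g2', ← map_smul, h1]
    rw [← hg3, hg4, sub_self]
  have hg2'r : ∀ a b z, g2' a (actR k b • z) = S.r b (g2' a z) := by
    intro a b z
    simp only [g2']
    rw [hg2r, actL_smul_actR_smul, htr, htr, S.l_r, map_sub, map_sub]
  have hg2'h : ∀ a z, g2' a (h₀ (f₁ z)) = g2' a z := by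
    intro a z
    have hadd : ∀ z z', g2' a (z + z') = g2' a z + g2' a z' := fun z z' => by
      simp only [g2', smul_add, map_add]; abel
    conv_rhs => rw [← hom₁ z, hadd, hg2f, add_zero]
  let g' : AShriek k n → AShriek k n → Q₀ → N := fun a b z =>
    g a b z - (S.l a (g2' b (h₀ z)) - g2' (a * b) (h₀ z) + g2' a (h₀ (actL k b • z)))
  have hg'f : ∀ a b z, g' a b (f₁ z) = 0 := by
    intro a b z
    simp only [g', ← map_smul, hg2'h]
    rw [hg2', hg1, sub_self]
  have hg'r : ∀ a b y z, g' a b (actR k y • z) = S.r y (g' a b z) := by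
    intro a b y z
    simp only [g', hgr a b y z, actL_smul_actR_smul, h₀r, hg2'r, S.l_r, map_sub, map_add]
  have hg' : ∀ a b x z, S.l a (g' b x z) - g' (a * b) x z + g' a (b * x) z -
      g' a b (actL k x • z) + S.r (ε z) (F a b x) = 0 := by
    intro a b x z
    rw [← hg a b x z]
    simp only [g', map_sub, map_add, S.l_mul, actL_mul, mul_smul, mul_assoc]; abel
  have hg'z : ∀ a b z, g' a b z = S.r (ε z) (g' a b o) := by
    intro a b z
    have hadd : ∀ z z', g' a b (z + z') = g' a b z + g' a b z' := fun z z' => by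
      simp only [g', g2', smul_add, map_add, map_sub]; abel
    conv_lhs => rw [← hom₀ z, hadd, hg'f, add_zero, hg'r]
  -- the result bounds the part of the cocycle on which `1` acts as the identity on the right
  have hw : ∀ a b x, S.l a (g' b x o) - g' (a * b) x o + g' a (b * x) o - S.r x (g' a b o) =
      -S.r 1 (F a b x) := by
    intro a b x
    have h := hg' a b x o
    rw [hg'z a b (actL k x • o), εL, ho, mul_one] at h
    exact eq_neg_of_add_eq_zero_left h
  let G : AShriek k n →ₗ[k] AShriek k n →ₗ[k] N := LinearMap.mk₂ k (fun a b => g' a b o)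
    (fun a a' b => by
      simp only [g', g2', map_add, LinearMap.add_apply, add_mul, actL, TensorProduct.add_tmul,
        add_smul, map_sub]; abel)
    (fun s a b => by
      simp only [g', g2', map_smul, LinearMap.smul_apply, smul_mul_assoc,
        actL_smul_smul, smul_sub, smul_add, map_sub])
    (fun a b b' => by
      simp only [g', g2', map_add, LinearMap.add_apply, mul_add, actL, TensorProduct.add_tmul,
        add_smul, smul_add, map_sub]; abel)
    (fun s a b => by
      simp only [g', g2', map_smul, LinearMap.smul_apply, mul_smul_comm,
        actL_smul_smul, smul_sub, smul_add, map_sub]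
      rw [smul_comm (actL k a) s, t.map_smul])
  let V : AShriek k n →ₗ[k] AShriek k n →ₗ[k] N :=
    LinearMap.compRight k ((LinearMap.id - S.r 1) ∘ₗ LinearMap.id) ∘ₗ
      (LinearMap.mk₂ k (fun a b => F a b 1) (fun a a' b => by simp) (fun s a b => by simp)
        (fun a b b' => by simp) (fun s a b => by simp))
  have hV : ∀ a b, V a b = F a b 1 - S.r 1 (F a b 1) := fun a b => rfl
  refine ⟨V - G, fun a x y => ?_⟩
  have h1 := hF a x y 1
  have h11 : S.r 1 (S.r 1 (F a x y)) = S.r 1 (F a x y) := by rw [← S.r_mul, one_mul]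
  have h2 := congrArg (S.r 1) h1
  simp only [map_add, map_sub, map_zero, h11, mul_one, ← S.l_r] at h2
  rw [mul_one] at h1
  have h3 : S.r y (V a x) = 0 := by
    rw [hV, map_sub, ← S.r_mul, one_mul, sub_self]
  have h4 := hw a x y
  have h5 : ∀ a b, G a b = g' a b o := fun a b => rfl
  simp only [LinearMap.sub_apply, map_sub, h3, h5, zero_sub]
  simp only [hV, map_sub]
  have h6 : F a x y = (S.l a (F x y 1) - F (a * x) y 1 + F a (x * y) 1) + S.r 1 (F a x y) := by
    rw [← sub_eq_zero, ← neg_eq_zero, ← h1]; abel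
  have h7 : S.l a (S.r 1 (F x y 1)) - S.r 1 (F (a * x) y 1) + S.r 1 (F a (x * y) 1) = 0 := by
    rw [← h2]; abel
  have h8 : S.r 1 (F a x y) = -(S.l a (g' x y o) - g' (a * x) y o + g' a (x * y) o -
      S.r y (g' a x o)) := by rw [h4, neg_neg]
  rw [h6, h8, ← sub_zero (S.l a (F x y 1) - _ + _ + _), ← h7]
  abel

end Vanishing

/-! ### The terms and the maps of the resolution -/

section Coordinates

variable {R : Type*} [Semiring R] {P M : Type*} [AddCommMonoid P] [Module R P] [AddCommMonoid M]
  [Module R M] {ι : Type*}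

/-- The linear map `z ↦ ∑ i, c_i(z) m_i`. -/
def combine [Fintype ι] (c : ι → P →ₗ[R] R) (m : ι → M) : P →ₗ[R] M :=
  ∑ i, LinearMap.toSpanSingleton R M (m i) ∘ₗ c i

theorem combine_apply [Fintype ι] (c : ι → P →ₗ[R] R) (m : ι → M) (z : P) :
    combine c m z = ∑ i, c i z • m i := by
  simp [combine]

theorem combine_of_absorb [Fintype ι] {c : ι → P →ₗ[R] R} {m : ι → M} {z : P} {i : ι} {t : R}
    (hi : c i z = t) (hne : ∀ j, j ≠ i → c j z = 0) (ht : t • m i = m i) :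
    combine c m z = m i := by
  rw [combine_apply, Finset.sum_eq_single i, hi, ht]
  · intro j _ hj
    rw [hne j hj, zero_smul]
  · exact fun h => absurd (Finset.mem_univ i) h

theorem projective_of_coordinates [Fintype ι] {g : ι → P} {c : ι → P →ₗ[R] R}
    (h : ∀ z, ∑ i, c i z • g i = z) : Module.Projective R P :=
  Module.Projective.of_split (M := ι → R) (LinearMap.pi c) (combine (fun i => LinearMap.proj i) g)
    (by ext z; simp [combine_apply, h])

theorem smul_piSingle [DecidableEq ι] {X : ι → Type*} [∀ i, AddCommMonoid (X i)]
    [∀ i, Module R (X i)] (r : R) (i : ι) {x y : X i} (h : r • x = y) :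
    r • (Pi.single i x : ∀ i, X i) = Pi.single i y := by
  rw [← h, Pi.single_smul]

end Coordinates

section Terms

variable {k : Type u} [Field k] {n : ℕ}

/-! The scalar multiplications on the terms of the resolution are those of their module structures;
instance search would otherwise find them through the multiplication of the enveloping algebra. -/

variable (k n) in
/-- The scalar multiplication of a module over the enveloping algebra. -/
abbrev smulOfModule (P : Type*) [AddCommMonoid P] [Module (Env k n) P] : SMul (Env k n) P :=
  inferInstance

local instance bimodSMul (i j : Fin n) : SMul (Env k n) (bimod k i j) := smulOfModule k n _

local instance smulP0 : SMul (Env k n) (P0 k n) := smulOfModule k n _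

local instance smulP1 : SMul (Env k n) (P1 k n) := smulOfModule k n _

local instance smulP2 : SMul (Env k n) (P2 k n) := smulOfModule k n _

theorem bimod_mul_gen {i j : Fin n} (z : bimod k i j) :
    (z : Env k n) * (vert k i ⊗ₜ[k] op (vert k j)) = z := by
  obtain ⟨c, hc⟩ := Submodule.mem_span_singleton.1 z.2
  rw [← hc, smul_eq_mul, mul_assoc, Algebra.TensorProduct.tmul_mul_tmul, ← op_mul,
    (aRep_self k n).idem, (aRep_self k n).idem]

theorem bimod_smul_gen {i j : Fin n} (z : bimod k i j) : (z : Env k n) • gen k i j = z :=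
  Subtype.ext (bimod_mul_gen z)

theorem actL_smul_gen (i j : Fin n) : actL k (vert k i) • gen k i j = gen k i j := by
  apply Subtype.ext
  change actL k (vert k i) * (vert k i ⊗ₜ[k] op (vert k j)) = vert k i ⊗ₜ[k] op (vert k j)
  rw [actL, Algebra.TensorProduct.tmul_mul_tmul, one_mul, (aRep_self k n).idem]

theorem actR_smul_gen (i j : Fin n) : actR k (vert k j) • gen k i j = gen k i j := by
  apply Subtype.ext
  change actR k (vert k j) * (vert k i ⊗ₜ[k] op (vert k j)) = vert k i ⊗ₜ[k] op (vert k j)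
  rw [actR, Algebra.TensorProduct.tmul_mul_tmul, one_mul, ← op_mul, (aRep_self k n).idem]

variable (k n)

/-- The coordinates of `P0` in the enveloping algebra. -/
def coord0 (i : Fin n) : P0 k n →ₗ[Env k n] Env k n :=
  (bimod k i i).subtype ∘ₗ LinearMap.proj i

/-- The coordinates of `P1` in the enveloping algebra. -/
def coord1 : Fin (n - 1) ⊕ Fin (n - 1) → P1 k n →ₗ[Env k n] Env k n
  | .inl i => (bimod k (hi i) (lo i)).subtype ∘ₗ LinearMap.proj i ∘ₗ LinearMap.fst _ _ _
  | .inr i => (bimod k (lo i) (hi i)).subtype ∘ₗ LinearMap.proj i ∘ₗ LinearMap.snd _ _ _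

/-- The coordinates of `P2` in the enveloping algebra. -/
def coord2 (i : Fin (n - 1)) : P2 k n →ₗ[Env k n] Env k n :=
  (bimod k (lo i) (lo i)).subtype ∘ₗ LinearMap.proj i

/-- The generators of `P1`. -/
def gens1 : Fin (n - 1) ⊕ Fin (n - 1) → P1 k n := Sum.elim (genUp k) (genDown k)

variable {k n}

theorem coord0_sum (z : P0 k n) : ∑ i, coord0 k n i z • gen0 k i = z := by
  conv_rhs => rw [← Finset.univ_sum_single z]
  refine Finset.sum_congr rfl fun i _ => ?_
  exact smul_piSingle _ i (bimod_smul_gen (z i))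

theorem coord2_sum (z : P2 k n) : ∑ i, coord2 k n i z • gen2 k i = z := by
  conv_rhs => rw [← Finset.univ_sum_single z]
  refine Finset.sum_congr rfl fun i _ => ?_
  exact smul_piSingle _ i (bimod_smul_gen (z i))

theorem coord1_sum (z : P1 k n) : ∑ i, coord1 k n i z • gens1 k n i = z := by
  rw [Fintype.sum_sum_type]
  have h1 : ∀ i, coord1 k n (Sum.inl i) z • gens1 k n (Sum.inl i) = (Pi.single i (z.1 i), 0) := by
    intro i
    change (z.1 i : Env k n) • genUp k i = _
    exact Prod.ext (smul_piSingle _ i (bimod_smul_gen (z.1 i))) (smul_zero _)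
  have h2 : ∀ i, coord1 k n (Sum.inr i) z • gens1 k n (Sum.inr i) = (0, Pi.single i (z.2 i)) := by
    intro i
    change (z.2 i : Env k n) • genDown k i = _
    exact Prod.ext (smul_zero _) (smul_piSingle _ i (bimod_smul_gen (z.2 i)))
  simp only [h1, h2]
  apply Prod.ext
  · simp only [Prod.fst_add, Prod.fst_sum, Finset.sum_const_zero, add_zero]
    exact Finset.univ_sum_single z.1
  · simp only [Prod.snd_add, Prod.snd_sum, Finset.sum_const_zero, zero_add]
    exact Finset.univ_sum_single z.2

variable (k n)

/-- The generator `(i) ⊗ (i)` of `P0`; zero if there is no such vertex. -/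
def g0N (i : ℕ) : P0 k n := if h : i < n then gen0 k ⟨i, h⟩ else 0

/-- The generator `(q + 1) ⊗ (q)` of `P1`; zero if there are no such vertices. -/
def gUN (q : ℕ) : P1 k n := if h : q + 1 < n then genUp k ⟨q, by omega⟩ else 0

/-- The generator `(q) ⊗ (q + 1)` of `P1`; zero if there are no such vertices. -/
def gDN (q : ℕ) : P1 k n := if h : q + 1 < n then genDown k ⟨q, by omega⟩ else 0

/-- The generator `(q) ⊗ (q)` of `P2`; zero if there is no vertex `q + 1`. -/
def g2N (q : ℕ) : P2 k n := if h : q + 1 < n then gen2 k ⟨q, by omega⟩ else 0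

variable {n}

theorem g0N_val (i : Fin n) : g0N k n i = gen0 k i := by simp [g0N]
theorem gUN_val (q : Fin (n - 1)) : gUN k n q = genUp k q := by
  have : q.val + 1 < n := by omega
  simp [gUN, this]
theorem gDN_val (q : Fin (n - 1)) : gDN k n q = genDown k q := by
  have : q.val + 1 < n := by omega
  simp [gDN, this]
theorem g2N_val (q : Fin (n - 1)) : g2N k n q = gen2 k q := by
  have : q.val + 1 < n := by omega
  simp [g2N, this]

variable (n)

theorem gUN_of_le {i : ℕ} (h : n ≤ i + 1) : gUN k n i = 0 := by simp [gUN, h]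
theorem gDN_of_le {i : ℕ} (h : n ≤ i + 1) : gDN k n i = 0 := by simp [gDN, h]

theorem actL_g0N (i : ℕ) : actL k (eN k n i) • g0N k n i = g0N k n i := by
  unfold g0N eN
  split_ifs
  · exact smul_piSingle _ _ (actL_smul_gen _ _)
  · simp
theorem actR_g0N (i : ℕ) : actR k (eN k n i) • g0N k n i = g0N k n i := by
  unfold g0N eN
  split_ifs
  · exact smul_piSingle _ _ (actR_smul_gen _ _)
  · simp
theorem actL_gUN (i : ℕ) : actL k (eN k n (i + 1)) • gUN k n i = gUN k n i := by
  unfold gUN eN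
  split_ifs
  · exact Prod.ext (smul_piSingle _ _ (actL_smul_gen _ _)) (smul_zero _)
  · simp
theorem actR_gUN (i : ℕ) : actR k (eN k n i) • gUN k n i = gUN k n i := by
  unfold gUN eN
  split_ifs
  · exact Prod.ext (smul_piSingle _ _ (actR_smul_gen _ _)) (smul_zero _)
  · simp
  · omega
  · simp
theorem actL_gDN (i : ℕ) : actL k (eN k n i) • gDN k n i = gDN k n i := by
  unfold gDN eN
  split_ifs
  · exact Prod.ext (smul_zero _) (smul_piSingle _ _ (actL_smul_gen _ _))
  · simp
  · omega
  · simp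
theorem actR_gDN (i : ℕ) : actR k (eN k n (i + 1)) • gDN k n i = gDN k n i := by
  unfold gDN eN
  split_ifs
  · exact Prod.ext (smul_zero _) (smul_piSingle _ _ (actR_smul_gen _ _))
  · simp
theorem actL_g2N (i : ℕ) : actL k (eN k n i) • g2N k n i = g2N k n i := by
  unfold g2N eN
  split_ifs
  · exact smul_piSingle _ _ (actL_smul_gen _ _)
  · simp
  · omega
  · simp
theorem actR_g2N (i : ℕ) : actR k (eN k n i) • g2N k n i = g2N k n i := by
  unfold g2N eN
  split_ifs
  · exact smul_piSingle _ _ (actR_smul_gen _ _)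
  · simp
  · omega
  · simp

variable {k n}

section Actions

variable {P : Type*} [AddCommGroup P] [Module (Env k n) P]

theorem actL_smul_actL_smul (a b : AShriek k n) (z : P) :
    actL k a • actL k b • z = actL k (a * b) • z := by rw [actL_mul, mul_smul]

theorem actR_smul_actR_smul (a b : AShriek k n) (z : P) :
    actR k a • actR k b • z = actR k (b * a) • z := by rw [actR_mul, mul_smul]

theorem actL_zero : actL k (0 : AShriek k n) = 0 := TensorProduct.zero_tmul _ _
theorem actR_zero : actR k (0 : AShriek k n) = 0 := by simp [actR]

theorem actL_zero_smul (z : P) : actL k (0 : AShriek k n) • z = 0 := by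
  rw [actL_zero]; exact zero_smul (Env k n) z
theorem actR_zero_smul (z : P) : actR k (0 : AShriek k n) • z = 0 := by
  rw [actR_zero]; exact zero_smul (Env k n) z

theorem actL_add (a b : AShriek k n) : actL k (a + b) = actL k a + actL k b :=
  TensorProduct.add_tmul _ _ _

theorem actR_smul_of_absorb {e b : AShriek k n} {z : P} (hz : actR k e • z = z)
    (hb : e * b = 0) : actR k b • z = 0 := by
  rw [← hz, actR_smul_actR_smul, hb, actR_zero_smul]

theorem tmul_smul (a b : AShriek k n) (z : P) :
    (a ⊗ₜ[k] op b : Env k n) • z = actR k b • actL k a • z := by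
  rw [← mul_smul, actR_mul_actL]

theorem tmul_smul_sub {x y a b : AShriek k n} {z w : P} (ha : x * a = a) (hb : b * y = b)
    (hz : actR k y • z = z) (hw : actL k x • w = w) :
    (x ⊗ₜ[k] op y : Env k n) • (actL k a • z - actR k b • w) = actL k a • z - actR k b • w := by
  rw [tmul_smul, smul_sub, smul_sub, actL_smul_actL_smul, ha, actL_smul_actR_smul, hw,
    actR_smul_actR_smul, hb, ← actL_smul_actR_smul, hz]

theorem tmul_smul_add {x y a b : AShriek k n} {z w : P} (ha : x * a = a) (hb : b * y = b)
    (hz : actR k y • z = z) (hw : actL k x • w = w) :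
    (x ⊗ₜ[k] op y : Env k n) • (actL k a • z + actR k b • w) = actL k a • z + actR k b • w := by
  rw [tmul_smul, smul_add, smul_add, actL_smul_actL_smul, ha, actL_smul_actR_smul, hw,
    actR_smul_actR_smul, hb, ← actL_smul_actR_smul, hz]

theorem actL_smul_sub_actR_smul_zero (z w : P) :
    actL k (0 : AShriek k n) • z - actR k (0 : AShriek k n) • w = 0 := by
  rw [actL_zero_smul, actR_zero_smul, sub_zero]

theorem env_smul_zero (t : Env k n) : t • (0 : P) = 0 := smul_zero t

theorem env_zero_smul (z : P) : (0 : Env k n) • z = 0 := zero_smul (Env k n) z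

theorem env_smul_sub {t : Env k n} {z w : P} (hz : t • z = z) (hw : t • w = w) :
    t • (z - w) = z - w := by rw [smul_sub, hz, hw]

end Actions

variable (k n)

/-- The values of `f₁` on the generators. -/
def f1value : Fin (n - 1) ⊕ Fin (n - 1) → P0 k n
  | .inl p => actL k (up k p) • gen0 k (lo p) - actR k (up k p) • gen0 k (hi p)
  | .inr p => actL k (down k p) • gen0 k (hi p) - actR k (down k p) • gen0 k (lo p)

/-- The augmentation `(i) ⊗ (i) ↦ (i)`. -/
def resEps : P0 k n →ₗ[Env k n] AShriek k n := combine (coord0 k n) (vert k)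

/-- The map `f₁`. -/
def resF1 : P1 k n →ₗ[Env k n] P0 k n := combine (coord1 k n) (f1value k n)

/-- The map `f₂`. -/
def resF2 : P2 k n →ₗ[Env k n] P1 k n := combine (coord2 k n) (f2value k)

theorem piSingle_coe {ι : Type*} [DecidableEq ι] {X : ι → Submodule (Env k n) (Env k n)} {i j : ι}
    (h : j ≠ i) (x : X i) : ((Pi.single i x : ∀ i, X i) j : Env k n) = 0 := by
  rw [Pi.single_eq_of_ne h]; rfl

theorem piSingle_coe_same {ι : Type*} [DecidableEq ι] {X : ι → Submodule (Env k n) (Env k n)}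
    {i : ι} (x : X i) : ((Pi.single i x : ∀ i, X i) i : Env k n) = x := by
  rw [Pi.single_eq_same]

theorem gen_coe (i j : Fin n) : (gen k i j : Env k n) = eN k n i ⊗ₜ[k] op (eN k n j) := by
  rw [eN_val, eN_val, gen]

theorem resEps_gen0 (i : Fin n) : resEps k n (gen0 k i) = vert k i := by
  refine combine_of_absorb (piSingle_coe_same k n _) (fun j hj => piSingle_coe k n hj _) ?_
  rw [gen, env_smul, (aRep_self k n).idem, (aRep_self k n).idem]

theorem f1value_inl (p : Fin (n - 1)) : f1value k n (.inl p) =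
    actL k (uN k n p) • g0N k n p - actR k (uN k n p) • g0N k n (p + 1) := by
  rw [f1value, uN_val, ← g0N_val, ← g0N_val]; rfl

theorem f1value_inr (p : Fin (n - 1)) : f1value k n (.inr p) =
    actL k (dN k n p) • g0N k n (p + 1) - actR k (dN k n p) • g0N k n p := by
  rw [f1value, dN_val, ← g0N_val, ← g0N_val]; rfl

theorem resF1_gUN (q : ℕ) : resF1 k n (gUN k n q) =
    actL k (uN k n q) • g0N k n q - actR k (uN k n q) • g0N k n (q + 1) := by
  by_cases hq : q + 1 < n
  · obtain ⟨p, rfl⟩ : ∃ p : Fin (n - 1), q = p.val := ⟨⟨q, by omega⟩, rfl⟩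
    rw [gUN_val, ← f1value_inl]
    refine combine_of_absorb (i := Sum.inl p)
      ((piSingle_coe_same k n _).trans (gen_coe k n _ _)) ?_ ?_
    · rintro (j | j) hj
      · exact piSingle_coe k n (fun h => hj (congrArg _ h)) _
      · rfl
    · rw [f1value_inl]
      exact tmul_smul_sub (P := P0 k n) (eN_mul_uN k n p) (uN_mul_eN k n p) (actR_g0N k n p)
        (actL_g0N k n (p + 1))
  · rw [gUN_of_le k n (by omega), uN_of_le k n (by omega), map_zero]
    exact (actL_smul_sub_actR_smul_zero (P := P0 k n) _ _).symm

theorem resF1_gDN (q : ℕ) : resF1 k n (gDN k n q) =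
    actL k (dN k n q) • g0N k n (q + 1) - actR k (dN k n q) • g0N k n q := by
  by_cases hq : q + 1 < n
  · obtain ⟨p, rfl⟩ : ∃ p : Fin (n - 1), q = p.val := ⟨⟨q, by omega⟩, rfl⟩
    rw [gDN_val, ← f1value_inr]
    refine combine_of_absorb (i := Sum.inr p)
      ((piSingle_coe_same k n _).trans (gen_coe k n _ _)) ?_ ?_
    · rintro (j | j) hj
      · rfl
      · exact piSingle_coe k n (fun h => hj (congrArg _ h)) _
    · rw [f1value_inr]
      exact tmul_smul_sub (P := P0 k n) (eN_mul_dN k n p) (dN_mul_eN k n p) (actR_g0N k n (p + 1))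
        (actL_g0N k n p)
  · rw [gDN_of_le k n (by omega), dN_of_le k n (by omega), map_zero]
    exact (actL_smul_sub_actR_smul_zero (P := P0 k n) _ _).symm

/-- The arrow from `q` to `q - 1`; zero at the first vertex. -/
def dPrev : ℕ → AShriek k n
  | 0 => 0
  | q + 1 => dN k n q

/-- The terms of `f₂` at the vertex `q` that pass through `q - 1`; zero at the first vertex. -/
def f2prev : ℕ → P1 k n
  | 0 => 0
  | q + 1 => actR k (dN k n q) • gUN k n q + actL k (uN k n q) • gDN k n q

theorem f2value_eq (p : Fin (n - 1)) : f2value k p =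
    actL k (dN k n p) • gUN k n p + actR k (uN k n p) • gDN k n p - f2prev k n p := by
  rw [f2value, uN_val, dN_val, gUN_val, gDN_val]
  congr 1
  obtain ⟨p, hp⟩ := p
  rcases p with _ | p
  · exact Finset.sum_eq_zero fun q _ => if_neg (by simp)
  · rw [Finset.sum_eq_single (⟨p, by omega⟩ : Fin (n - 1))]
    · rw [if_pos rfl, f2prev, ← uN_val, ← dN_val, ← gUN_val, ← gDN_val]
    · intro q _ hq
      refine if_neg fun h => hq (Fin.ext ?_)
      simpa using h
    · simp

theorem tmul_smul_f2prev (q : ℕ) :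
    (eN k n q ⊗ₜ[k] op (eN k n q) : Env k n) • f2prev k n q = f2prev k n q := by
  rcases q with _ | q
  · exact env_smul_zero (P := P1 k n) _
  · rw [f2prev, add_comm (actR k _ • _)]
    exact tmul_smul_add (P := P1 k n) (eN_mul_uN k n q) (dN_mul_eN k n q) (actR_gDN k n q) (actL_gUN k n q)

theorem resF2_g2N (q : ℕ) (hq : q + 1 < n) : resF2 k n (g2N k n q) =
    actL k (dN k n q) • gUN k n q + actR k (uN k n q) • gDN k n q - f2prev k n q := by
  obtain ⟨p, rfl⟩ : ∃ p : Fin (n - 1), q = p.val := ⟨⟨q, by omega⟩, rfl⟩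
  rw [g2N_val, ← f2value_eq]
  refine combine_of_absorb ((piSingle_coe_same k n _).trans (gen_coe k n _ _))
    (fun j hj => piSingle_coe k n hj _) ?_
  rw [f2value_eq]
  exact env_smul_sub (P := P1 k n) (tmul_smul_add (P := P1 k n) (eN_mul_dN k n p)
    (uN_mul_eN k n p) (actR_gUN k n p) (actL_gDN k n p)) (tmul_smul_f2prev k n p)

theorem resF2_gen2 (p : Fin (n - 1)) : resF2 k n (gen2 k p) = f2value k p := by
  rw [← g2N_val, resF2_g2N k n p (by omega), f2value_eq]

theorem resF1_genUp (p : Fin (n - 1)) : resF1 k n (genUp k p) =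
    actL k (up k p) • gen0 k (lo p) - actR k (up k p) • gen0 k (hi p) := by
  rw [← gUN_val, resF1_gUN, ← f1value_inl]; rfl

theorem resF1_genDown (p : Fin (n - 1)) : resF1 k n (genDown k p) =
    actL k (down k p) • gen0 k (hi p) - actR k (down k p) • gen0 k (lo p) := by
  rw [← gDN_val, resF1_gDN, ← f1value_inr]; rfl

theorem resEps_g0N (i : ℕ) : resEps k n (g0N k n i) = eN k n i := by
  unfold g0N eN
  split_ifs
  · exact resEps_gen0 k n _
  · exact map_zero _

end Terms

section Degrees

variable {k : Type u} [Field k] {n : ℕ}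

theorem envGrading_mul {d d' : ℤ} {z w : Env k n} (hz : z ∈ envGrading k n d)
    (hw : w ∈ envGrading k n d') : z * w ∈ envGrading k n (d + d') := by
  induction hz using Submodule.span_induction with
  | zero => rw [zero_mul]; exact Submodule.zero_mem _
  | add x y _ _ hx hy => rw [add_mul]; exact Submodule.add_mem _ hx hy
  | smul c x _ hx => rw [smul_mul_assoc]; exact Submodule.smul_mem _ _ hx
  | mem z hz =>
    obtain ⟨s, t, a, b, hst, ha, hb, rfl⟩ := hz
    induction hw using Submodule.span_induction with
    | zero => rw [mul_zero]; exact Submodule.zero_mem _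
    | add x y _ _ hx hy => rw [mul_add]; exact Submodule.add_mem _ hx hy
    | smul c x _ hx => rw [mul_smul_comm]; exact Submodule.smul_mem _ _ hx
    | mem w hw =>
      obtain ⟨s', t', a', b', hst', ha', hb', rfl⟩ := hw
      refine Submodule.subset_span ⟨s + s', t' + t, a * a', b' * b, by omega,
        pathGrading_mul ha ha', pathGrading_mul hb' hb, ?_⟩
      rw [Algebra.TensorProduct.tmul_mul_tmul, op_mul]

theorem vert_mem_pathGrading (i : Fin n) : vert k i ∈ pathGrading k n 0 := by
  rw [pathGrading_eq, ← eN_val]; exact eN_mem_valleySpan _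

theorem one_mem_pathGrading : (1 : AShriek k n) ∈ pathGrading k n 0 := by
  rw [pathGrading_eq, ← vertSpan_eq]; exact one_mem_vertSpan

theorem actL_mem_envGrading {d : ℤ} {a : AShriek k n} (ha : a ∈ pathGrading k n d) :
    actL k a ∈ envGrading k n d :=
  Submodule.subset_span ⟨d, 0, a, 1, add_zero d, ha, one_mem_pathGrading, rfl⟩

theorem actR_mem_envGrading {d : ℤ} {a : AShriek k n} (ha : a ∈ pathGrading k n d) :
    actR k a ∈ envGrading k n d :=
  Submodule.subset_span ⟨0, d, 1, a, zero_add d, one_mem_pathGrading, ha, rfl⟩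

theorem up_mem_pathGrading (p : Fin (n - 1)) : up k p ∈ pathGrading k n 1 := by
  rw [pathGrading_eq, ← uN_val]; exact uN_mem_valleySpan _

theorem down_mem_pathGrading (p : Fin (n - 1)) : down k p ∈ pathGrading k n 1 := by
  rw [pathGrading_eq, ← dN_val]; exact dN_mem_valleySpan _

theorem gen_mem_envGrading (i j : Fin n) : (gen k i j : Env k n) ∈ envGrading k n 0 :=
  Submodule.subset_span ⟨0, 0, vert k i, vert k j, rfl, vert_mem_pathGrading i,
    vert_mem_pathGrading j, rfl⟩

variable {P Q : Type*} [AddCommGroup P] [Module (Env k n) P] [AddCommGroup Q] [Module (Env k n) Q]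
  {ι κ : Type*}

/-- All coordinates of `z` have degree `d`. -/
def HasDegree (c : ι → P →ₗ[Env k n] Env k n) (d : ℤ) (z : P) : Prop :=
  ∀ i, c i z ∈ envGrading k n d

namespace HasDegree

variable {c : ι → P →ₗ[Env k n] Env k n} {d d' : ℤ} {z w : P}

theorem zero : HasDegree c d 0 := fun i => by rw [map_zero]; exact Submodule.zero_mem _

theorem add (hz : HasDegree c d z) (hw : HasDegree c d w) : HasDegree c d (z + w) := fun i => by
  rw [map_add]; exact Submodule.add_mem _ (hz i) (hw i)

theorem sub (hz : HasDegree c d z) (hw : HasDegree c d w) : HasDegree c d (z - w) := fun i => by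
  rw [map_sub]; exact Submodule.sub_mem _ (hz i) (hw i)

theorem sum {α : Type*} (s : Finset α) (f : α → P) (h : ∀ a ∈ s, HasDegree c d (f a)) :
    HasDegree c d (∑ a ∈ s, f a) := fun i => by
  rw [map_sum]; exact Submodule.sum_mem _ fun a ha => h a ha i

theorem smul {t : Env k n} (ht : t ∈ envGrading k n d') (hz : HasDegree c d z) :
    HasDegree c (d' + d) (t • z) := fun i => by
  rw [map_smul, smul_eq_mul]; exact envGrading_mul ht (hz i)

theorem combine [Fintype ι] {c' : κ → Q →ₗ[Env k n] Env k n} {m : ι → Q}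
    (hz : HasDegree c d z) (hm : ∀ i, HasDegree c' d' (m i)) :
    HasDegree c' (d + d') (combine c m z) := by
  rw [combine_apply]
  exact sum _ _ fun i _ => (hm i).smul (hz i)

end HasDegree

theorem gen0_hasDegree (i : Fin n) : HasDegree (coord0 k n) 0 (gen0 k i) := fun j => by
  change (((Pi.single i (gen k i i) : P0 k n) j : bimod k j j) : Env k n) ∈ _
  by_cases h : j = i
  · subst h; rw [Pi.single_eq_same]; exact gen_mem_envGrading _ _
  · rw [Pi.single_eq_of_ne h]; exact Submodule.zero_mem _

theorem genUp_hasDegree (p : Fin (n - 1)) : HasDegree (coord1 k n) 0 (genUp k p)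
  | .inr j => Submodule.zero_mem _
  | .inl j => by
    change (((Pi.single p (gen k (hi p) (lo p)) : (i : Fin (n - 1)) → bimod k (hi i) (lo i)) j :
      bimod k _ _) : Env k n) ∈ _
    by_cases h : j = p
    · subst h; rw [Pi.single_eq_same]; exact gen_mem_envGrading _ _
    · rw [Pi.single_eq_of_ne h]; exact Submodule.zero_mem _

theorem genDown_hasDegree (p : Fin (n - 1)) : HasDegree (coord1 k n) 0 (genDown k p)
  | .inl j => Submodule.zero_mem _
  | .inr j => by
    change (((Pi.single p (gen k (lo p) (hi p)) : (i : Fin (n - 1)) → bimod k (lo i) (hi i)) j :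
      bimod k _ _) : Env k n) ∈ _
    by_cases h : j = p
    · subst h; rw [Pi.single_eq_same]; exact gen_mem_envGrading _ _
    · rw [Pi.single_eq_of_ne h]; exact Submodule.zero_mem _

theorem f1value_hasDegree : ∀ p, HasDegree (coord0 k n) 1 (f1value k n p)
  | .inl p => ((gen0_hasDegree _).smul (actL_mem_envGrading (up_mem_pathGrading p))).sub
      ((gen0_hasDegree _).smul (actR_mem_envGrading (up_mem_pathGrading p)))
  | .inr p => ((gen0_hasDegree _).smul (actL_mem_envGrading (down_mem_pathGrading p))).sub
      ((gen0_hasDegree _).smul (actR_mem_envGrading (down_mem_pathGrading p)))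

theorem f2value_hasDegree (p : Fin (n - 1)) : HasDegree (coord1 k n) 1 (f2value k p) := by
  refine (((genUp_hasDegree _).smul (actL_mem_envGrading (down_mem_pathGrading p))).add
    ((genDown_hasDegree _).smul (actR_mem_envGrading (up_mem_pathGrading p)))).sub
    (HasDegree.sum _ _ fun q _ => ?_)
  split_ifs
  · exact ((genUp_hasDegree _).smul (actR_mem_envGrading (down_mem_pathGrading q))).add
      ((genDown_hasDegree _).smul (actL_mem_envGrading (up_mem_pathGrading q)))
  · exact HasDegree.zero

theorem resEps_mem {d : ℤ} {z : P0 k n} (hz : HasDegree (coord0 k n) d z) :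
    resEps k n z ∈ pathGrading k n d := by
  rw [resEps, combine_apply]
  refine Submodule.sum_mem _ fun i _ => ?_
  have key : ∀ t ∈ envGrading k n d, t • vert k i ∈ pathGrading k n d := by
    intro t ht
    induction ht using Submodule.span_induction with
    | zero =>
      rw [show (0 : Env k n) • vert k i = 0 from env_zero_smul _]
      exact Submodule.zero_mem _
    | add x y _ _ hx hy => rw [add_smul]; exact Submodule.add_mem _ hx hy
    | smul c x _ hx => rw [smul_assoc]; exact Submodule.smul_mem _ _ hx
    | mem z hz =>
      obtain ⟨s, t, a, b, hst, ha, hb, rfl⟩ := hz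
      rw [env_smul, ← hst]
      have := pathGrading_mul (pathGrading_mul ha (vert_mem_pathGrading i)) hb
      rwa [add_zero] at this
  exact key _ (hz i)

end Degrees

/-! ### The contracting homotopies -/

section Homotopies

variable {k : Type u} [Field k] {n : ℕ}

section EnvAction

variable {P : Type*} [AddCommGroup P] [Module (Env k n) P] [Module k P]
  [IsScalarTower k (Env k n) P]

theorem actR_add (a b : AShriek k n) : actR k (a + b) = actR k a + actR k b := by
  rw [actR, op_add, TensorProduct.tmul_add]; rfl

theorem actR_smul_smul (c : k) (a : AShriek k n) (z : P) :
    actR k (c • a) • z = c • actR k a • z := by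
  rw [← smul_assoc, actR, actR, op_smul, TensorProduct.tmul_smul]

variable (P) in
/-- The two actions of `A_n^!` on a module over the enveloping algebra. -/
def envAction : TwoSided k (AShriek k n) P where
  l := LinearMap.mk₂ k (fun a z => actL k a • z)
    (fun a b z => by rw [actL_add, add_smul]) (fun c a z => actL_smul_smul c a z)
    (fun a z w => smul_add _ _ _) (fun c a z => smul_comm _ _ _)
  r := LinearMap.mk₂ k (fun a z => actR k a • z)
    (fun a b z => by rw [actR_add, add_smul]) (fun c a z => actR_smul_smul c a z)
    (fun a z w => smul_add _ _ _) (fun c a z => smul_comm _ _ _)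
  l_mul a b z := (actL_smul_actL_smul a b z).symm
  r_mul a b z := (actR_smul_actR_smul b a z).symm
  l_r a b z := actL_smul_actR_smul a b z

theorem envAction_r (b : AShriek k n) (z : P) : (envAction P).r b z = actR k b • z := rfl

/-- Two maps that are linear for the right action agree if they agree on the elements `a g_i`. -/
theorem rightLinear_ext {N : Type*} [AddCommGroup N] [Module k N]
    {S : TwoSided k (AShriek k n) N} {ι : Type*} [Fintype ι] {g : ι → P}
    {c : ι → P →ₗ[Env k n] Env k n} (hgc : ∀ z, ∑ i, c i z • g i = z) {T T' : P →ₗ[k] N}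
    (hT : IsRight S T) (hT' : IsRight S T')
    (h : ∀ i (a : AShriek k n), T (actL k a • g i) = T' (actL k a • g i)) (z : P) : T z = T' z := by
  have key : ∀ i (t : Env k n), T (t • g i) = T' (t • g i) := by
    intro i t
    induction t using TensorProduct.induction_on with
    | zero => rw [show (0 : Env k n) • g i = 0 from env_zero_smul _, map_zero, map_zero]
    | add x y hx hy => rw [add_smul, map_add, map_add, hx, hy]
    | tmul a b =>
      rw [← op_unop b, tmul_smul, hT, hT', h]
  rw [← hgc z, map_sum, map_sum]
  exact Finset.sum_congr rfl fun i _ => key i _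

end EnvAction

variable (k n) in
/-- The data of the resolution: modules with generators at the vertices and the arrows, and the
maps between them. The generators are indexed by natural numbers. -/
structure VertexResolution (Q₀ Q₁ Q₂ : Type*) [AddCommGroup Q₀] [Module (Env k n) Q₀]
    [AddCommGroup Q₁] [Module (Env k n) Q₁] [AddCommGroup Q₂] [Module (Env k n) Q₂] where
  /-- The generator `(i) ⊗ (i)`. -/
  g0 : ℕ → Q₀
  /-- The generator `(q + 1) ⊗ (q)`. -/
  gU : ℕ → Q₁
  /-- The generator `(q) ⊗ (q + 1)`. -/
  gD : ℕ → Q₁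
  /-- The generator `(q) ⊗ (q)` in homological degree two. -/
  g2 : ℕ → Q₂
  actL_g0 : ∀ i, actL k (eN k n i) • g0 i = g0 i
  actR_g0 : ∀ i, actR k (eN k n i) • g0 i = g0 i
  actL_gU : ∀ i, actL k (eN k n (i + 1)) • gU i = gU i
  actR_gU : ∀ i, actR k (eN k n i) • gU i = gU i
  actL_gD : ∀ i, actL k (eN k n i) • gD i = gD i
  actR_gD : ∀ i, actR k (eN k n (i + 1)) • gD i = gD i
  actL_g2 : ∀ i, actL k (eN k n i) • g2 i = g2 i
  actR_g2 : ∀ i, actR k (eN k n i) • g2 i = g2 i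
  gD_of_le : ∀ i, n ≤ i + 1 → gD i = 0
  /-- The coordinates on `Q₀`. -/
  c0 : Fin n → Q₀ →ₗ[Env k n] Env k n
  /-- The coordinates on the first half of `Q₁`. -/
  cU : Fin (n - 1) → Q₁ →ₗ[Env k n] Env k n
  /-- The coordinates on the second half of `Q₁`. -/
  cD : Fin (n - 1) → Q₁ →ₗ[Env k n] Env k n
  /-- The coordinates on `Q₂`. -/
  c2 : Fin (n - 1) → Q₂ →ₗ[Env k n] Env k n
  sum0 : ∀ z, ∑ i, c0 i z • g0 i = z
  sum1 : ∀ z, ∑ i, Sum.elim cU cD i z • Sum.elim (fun i : Fin (n - 1) => gU i)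
    (fun i : Fin (n - 1) => gD i) i = z
  sum2 : ∀ z, ∑ i, c2 i z • g2 i = z
  c0_g0 : ∀ i : Fin n, c0 i (g0 i) = eN k n i ⊗ₜ[k] op (eN k n i)
  c0_g0_of_ne : ∀ i j : Fin n, j ≠ i → c0 j (g0 i) = 0
  cU_gU : ∀ i : Fin (n - 1), cU i (gU i) = eN k n (i + 1) ⊗ₜ[k] op (eN k n i)
  cU_gU_of_ne : ∀ i j : Fin (n - 1), j ≠ i → cU j (gU i) = 0
  cU_gD : ∀ i j : Fin (n - 1), cU j (gD i) = 0
  /-- The augmentation. -/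
  ε : Q₀ →ₗ[Env k n] AShriek k n
  /-- The first differential. -/
  f₁ : Q₁ →ₗ[Env k n] Q₀
  /-- The second differential. -/
  f₂ : Q₂ →ₗ[Env k n] Q₁
  ε_g0 : ∀ i, ε (g0 i) = eN k n i
  f₁_gU : ∀ q, f₁ (gU q) = actL k (uN k n q) • g0 q - actR k (uN k n q) • g0 (q + 1)
  f₁_gD : ∀ q, f₁ (gD q) = actL k (dN k n q) • g0 (q + 1) - actR k (dN k n q) • g0 q
  f₂_g2_zero : 1 < n → f₂ (g2 0) = actL k (dN k n 0) • gU 0 + actR k (uN k n 0) • gD 0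
  f₂_g2_succ : ∀ r, r + 2 < n → f₂ (g2 (r + 1)) =
    actL k (dN k n (r + 1)) • gU (r + 1) + actR k (uN k n (r + 1)) • gD (r + 1) -
      (actR k (dN k n r) • gU r + actL k (uN k n r) • gD r)

namespace VertexResolution

variable {Q₀ Q₁ Q₂ : Type*} [AddCommGroup Q₀] [Module (Env k n) Q₀]
    [AddCommGroup Q₁] [Module (Env k n) Q₁] [AddCommGroup Q₂] [Module (Env k n) Q₂]
    (D : VertexResolution k n Q₀ Q₁ Q₂)

theorem ε_actL (a : AShriek k n) (z : Q₀) : D.ε (actL k a • z) = a * D.ε z := by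
  rw [map_smul, actL, ← op_one, env_smul, mul_one]

theorem ε_actR (b : AShriek k n) (z : Q₀) : D.ε (actR k b • z) = D.ε z * b := by
  rw [map_smul, actR, env_smul, one_mul]

theorem ε_f₁ (z : Q₁) : D.ε (D.f₁ z) = 0 := by
  conv_lhs => rw [← D.sum1 z]
  rw [map_sum, map_sum]
  refine Finset.sum_eq_zero fun i _ => ?_
  rw [map_smul, map_smul]
  have : D.ε (D.f₁ (Sum.elim (fun i : Fin (n - 1) => D.gU i) (fun i : Fin (n - 1) => D.gD i) i))
      = 0 := by
    rcases i with i | i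
    · simp only [Sum.elim_inl, D.f₁_gU, map_sub, ε_actL, ε_actR, D.ε_g0, uN_mul_eN, eN_mul_uN,
        sub_self]
    · simp only [Sum.elim_inr, D.f₁_gD, map_sub, ε_actL, ε_actR, D.ε_g0, dN_mul_eN, eN_mul_dN,
        sub_self]
  rw [this, smul_zero]

theorem f₁_f₂ (z : Q₂) : D.f₁ (D.f₂ z) = 0 := by
  conv_lhs => rw [← D.sum2 z]
  rw [map_sum, map_sum]
  refine Finset.sum_eq_zero fun i _ => ?_
  rw [map_smul, map_smul]
  have : D.f₁ (D.f₂ (D.g2 i)) = 0 := by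
    obtain ⟨i, hi⟩ := i
    rcases i with _ | r
    · simp only [D.f₂_g2_zero (by omega), map_add, map_smul, D.f₁_gU, D.f₁_gD, smul_sub,
        actL_smul_actL_smul, actR_smul_actR_smul, actL_smul_actR_smul, dN_mul_uN_zero,
        actL_zero_smul, actR_zero_smul]
      abel
    · simp only [D.f₂_g2_succ r (by omega), map_add, map_sub, map_smul, D.f₁_gU, D.f₁_gD, smul_sub,
        actL_smul_actL_smul, actR_smul_actR_smul, actL_smul_actR_smul,
        dN_mul_uN_succ k n r (by omega)]
      abel
  rw [this, smul_zero]

/-- The element on which `ε` takes the value `1`. -/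
def unit : Q₀ := ∑ i ∈ Finset.range n, D.g0 i

theorem ε_unit : D.ε D.unit = 1 := by
  rw [unit, map_sum, ← sum_eN]
  exact Finset.sum_congr rfl fun i _ => D.ε_g0 i

theorem surjective_ε : Function.Surjective D.ε := fun b =>
  ⟨actR k b • D.unit, by rw [D.ε_actR, D.ε_unit, one_mul]⟩

theorem actR_unit {i : ℕ} (h : i < n) : actR k (eN k n i) • D.unit = D.g0 i := by
  rw [unit, Finset.smul_sum, Finset.sum_eq_single i]
  · exact D.actR_g0 i
  · intro j _ hj
    exact actR_smul_of_absorb (D.actR_g0 j) (eN_mul_of_ne k n hj)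
  · intro h'; exact absurd (Finset.mem_range.2 h) h'

/-- The values of the first homotopy on climbs. -/
def climb0 : ℕ → ℕ → Q₁
  | 0, _ => 0
  | x + 1, l => actL k (upPath k n x (l + 1)) • D.gU l + actR k (uN k n l) • climb0 x (l + 1)

/-- The values of the first homotopy on the basis. -/
def phi0 (x l : ℕ) : ℕ → Q₁
  | 0 => D.climb0 x l
  | y + 1 => actL k (valley k n x l y) • D.gD (l + y) + actR k (dN k n (l + y)) • phi0 x l y

/-- The values of the second homotopy on the basis. -/
def phi1 (x l : ℕ) : ℕ → Q₂
  | 0 => 0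
  | y + 1 => actL k (valley k n x l y) • D.g2 (l + y) + actR k (dPrev k n (l + y)) • phi1 x l y

theorem actR_climb0 (x l : ℕ) : actR k (eN k n l) • D.climb0 x l = D.climb0 x l := by
  rcases x with _ | x
  · exact smul_zero _
  · rw [climb0, smul_add, ← actL_smul_actR_smul, D.actR_gU, actR_smul_actR_smul, uN_mul_eN]

theorem actR_phi0 (x l y : ℕ) : actR k (eN k n (l + y)) • D.phi0 x l y = D.phi0 x l y := by
  rcases y with _ | y
  · exact D.actR_climb0 x l
  · rw [phi0, smul_add, ← actL_smul_actR_smul, ← add_assoc, D.actR_gD, actR_smul_actR_smul,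
      dN_mul_eN]

theorem dPrev_mul_eN (q : ℕ) : dPrev k n q * eN k n q = dPrev k n q := by
  rcases q with _ | q
  · exact zero_mul _
  · exact dN_mul_eN k n q

theorem actR_phi1 (x l y : ℕ) : actR k (eN k n (l + y - 1)) • D.phi1 x l y = D.phi1 x l y := by
  rcases y with _ | y
  · exact smul_zero _
  · rw [phi1, smul_add, ← actL_smul_actR_smul, show l + (y + 1) - 1 = l + y by omega, D.actR_g2,
      actR_smul_actR_smul, dPrev_mul_eN]

variable [Module k Q₁]

/-- The first homotopy on `A (i) ⊗ (i)`. -/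
def hom0 : AShriek k n →ₗ[k] Q₁ := valleyMap D.phi0

theorem hom0_eN (l : ℕ) : D.hom0 (eN k n l) = 0 := by
  by_cases h : l < n
  · rw [← valley_zero_zero, hom0, valleyMap_valley _ h h, phi0, climb0]
  · rw [eN_of_le k n (by omega), map_zero]

theorem hom0_upPath (x q : ℕ) : D.hom0 (upPath k n (x + 1) q) =
    actL k (upPath k n x (q + 1)) • D.gU q +
      actR k (uN k n q) • D.hom0 (upPath k n x (q + 1)) := by
  by_cases h : q + (x + 1) < n
  · rw [← valley_y_zero, ← valley_y_zero, hom0, valleyMap_valley _ h (by omega),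
      valleyMap_valley _ (by omega) (by omega), phi0, phi0, climb0, valley_y_zero]
  · rw [← valley_y_zero, ← valley_y_zero, valley_of_le_left k n (by omega),
      valley_of_le_left k n (by omega), map_zero, actL_zero_smul, smul_zero, add_zero]

variable [IsScalarTower k (Env k n) Q₁]

theorem hom0_mul_dN (r : ℕ) (a : AShriek k n) : D.hom0 (a * dN k n r) =
    actL k a • D.gD r + actR k (dN k n r) • D.hom0 (a * eN k n r) := by
  induction a using valley_induction with
  | h x l y hx hy =>
    by_cases h : l + y = r
    · subst h
      by_cases hr : l + y + 1 < n
      · rw [valley_mul_dN, valley_mul_eN, hom0, valleyMap_valley _ hx hr, valleyMap_valley _ hx hy,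
          phi0]
      · rw [dN_of_le k n (by omega), D.gD_of_le _ (by omega), mul_zero, map_zero, smul_zero,
          actR_zero_smul, add_zero]
    · rw [← D.actL_gD, actL_smul_actL_smul, valley_mul_eN', if_neg h, actL_zero_smul, map_zero,
        smul_zero, add_zero, ← eN_mul_dN, ← mul_assoc, valley_mul_eN', if_neg h, zero_mul, map_zero]
  | h0 => rw [zero_mul, zero_mul, map_zero, actL_zero_smul, smul_zero, add_zero]
  | hadd a b ha hb =>
    rw [add_mul, add_mul, map_add, map_add, ha, hb, actL_add, add_smul, smul_add]; abel
  | hsmul c a ha =>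
    rw [smul_mul_assoc, smul_mul_assoc, map_smul, map_smul, ha, actL_smul_smul, smul_add,
      smul_comm (actR k _) c]

theorem actR_hom0 (j : ℕ) (a : AShriek k n) :
    actR k (eN k n j) • D.hom0 (a * eN k n j) = D.hom0 (a * eN k n j) := by
  induction a using valley_induction with
  | h x l y hx hy =>
    rw [valley_mul_eN']
    split_ifs with h
    · rw [hom0, valleyMap_valley _ hx hy, ← h, D.actR_phi0]
    · rw [map_zero, smul_zero]
  | h0 => rw [zero_mul, map_zero, smul_zero]
  | hadd a b ha hb => rw [add_mul, map_add, smul_add, ha, hb]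
  | hsmul c a ha => rw [smul_mul_assoc, map_smul, smul_comm (actR k _) c, ha]

variable [Module k Q₂]

/-- The second homotopy on `A (i + 1) ⊗ (i)`. -/
def hom1 : AShriek k n →ₗ[k] Q₂ := valleyMap D.phi1

theorem hom1_upPath (x l : ℕ) : D.hom1 (upPath k n x l) = 0 := by
  by_cases h : l + x < n
  · rw [← valley_y_zero, hom1, valleyMap_valley _ h (by omega), phi1]
  · rw [← valley_y_zero, valley_of_le_left k n (by omega), map_zero]

variable [IsScalarTower k (Env k n) Q₂]

theorem hom1_mul_dN {r : ℕ} (hr : r + 1 < n) (a : AShriek k n) : D.hom1 (a * dN k n r) =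
    actL k a • D.g2 r + actR k (dPrev k n r) • D.hom1 (a * eN k n r) := by
  induction a using valley_induction with
  | h x l y hx hy =>
    by_cases h : l + y = r
    · subst h
      rw [valley_mul_dN, valley_mul_eN, hom1, valleyMap_valley _ hx hr, valleyMap_valley _ hx hy,
        phi1]
    · rw [← D.actL_g2, actL_smul_actL_smul, valley_mul_eN', if_neg h, actL_zero_smul, map_zero,
        smul_zero, add_zero, ← eN_mul_dN, ← mul_assoc, valley_mul_eN', if_neg h, zero_mul, map_zero]
  | h0 => rw [zero_mul, zero_mul, map_zero, actL_zero_smul, smul_zero, add_zero]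
  | hadd a b ha hb =>
    rw [add_mul, add_mul, map_add, map_add, ha, hb, actL_add, add_smul, smul_add]; abel
  | hsmul c a ha =>
    rw [smul_mul_assoc, smul_mul_assoc, map_smul, map_smul, ha, actL_smul_smul, smul_add,
      smul_comm (actR k _) c]

theorem actR_hom1 (q : ℕ) (a : AShriek k n) :
    actR k (eN k n q) • D.hom1 (a * eN k n (q + 1)) = D.hom1 (a * eN k n (q + 1)) := by
  induction a using valley_induction with
  | h x l y hx hy =>
    rw [valley_mul_eN']
    split_ifs with h
    · rw [hom1, valleyMap_valley _ hx hy, show q = l + y - 1 by omega, D.actR_phi1]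
    · rw [map_zero, smul_zero]
  | h0 => rw [zero_mul, map_zero, smul_zero]
  | hadd a b ha hb => rw [add_mul, map_add, smul_add, ha, hb]
  | hsmul c a ha => rw [smul_mul_assoc, map_smul, smul_comm (actR k _) c, ha]

/-- The first homotopy inverts `f₁` up to the augmentation. -/
theorem f₁_hom0_valley (x l y : ℕ) (hx : l + x < n) (hy : l + y < n) :
    D.f₁ (D.hom0 (valley k n x l y)) =
      actL k (valley k n x l y) • D.g0 (l + y) - actR k (valley k n x l y) • D.unit := by
  induction y with
  | zero =>
    rw [valley_y_zero, add_zero]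
    induction x generalizing l with
    | zero => rw [upPath, D.hom0_eN, map_zero, D.actL_g0, D.actR_unit (by omega), sub_self]
    | succ x ih =>
      rw [D.hom0_upPath, map_add, map_smul, map_smul, ih _ (by omega) (by omega), D.f₁_gU,
        upPath_succ']
      simp only [smul_sub, actL_smul_actL_smul, actR_smul_actR_smul, actL_smul_actR_smul]
      abel
  | succ y ih =>
    rw [← valley_mul_dN, D.hom0_mul_dN, valley_mul_eN, map_add, map_smul, map_smul,
      ih (by omega), D.f₁_gD, ← add_assoc]
    simp only [smul_sub, actL_smul_actL_smul, actR_smul_actR_smul, actL_smul_actR_smul]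
    abel

/-- The identity of `hom0_hom1` on the basis of valleys. -/
theorem hom0_hom1_valley (x l y q : ℕ) (hy : l + y = q + 1) (hq : q + 1 < n) :
    D.hom0 (valley k n x l y * uN k n q) - actR k (uN k n q) • D.hom0 (valley k n x l y) +
      D.f₂ (D.hom1 (valley k n x l y)) = actL k (valley k n x l y) • D.gU q := by
  induction y generalizing q with
  | zero =>
    obtain rfl : l = q + 1 := hy
    rw [valley_y_zero, ← upPath_succ', D.hom0_upPath, D.hom1_upPath, map_zero, add_zero,
      add_sub_cancel_right]
  | succ y ih =>
    obtain rfl : q = l + y := by omega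
    have hd : D.hom1 (valley k n x l y * dN k n (l + y)) = _ := D.hom1_mul_dN hq _
    have h0 : D.hom0 (valley k n x l y * dN k n (l + y)) = _ := D.hom0_mul_dN _ _
    rw [valley_mul_eN] at hd h0
    rw [← valley_mul_dN, hd, h0, mul_assoc]
    obtain h | ⟨r, hr⟩ : l + y = 0 ∨ ∃ r, l + y = r + 1 := by
      rcases h : l + y with _ | r
      · exact Or.inl rfl
      · exact Or.inr ⟨r, rfl⟩
    · rw [h, dN_mul_uN_zero, mul_zero, map_zero, map_add, map_smul, map_smul,
        D.f₂_g2_zero (by omega)]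
      simp only [smul_add, actL_smul_actL_smul, actR_smul_actR_smul, actL_smul_actR_smul,
        dN_mul_uN_zero, actR_zero_smul, dPrev]
      abel
    · have hi := ih r hr (by omega)
      rw [hr] at hq ⊢
      have hu : D.hom0 (valley k n x l y * uN k n r) = actL k (valley k n x l y) • D.gU r +
          actR k (uN k n r) • D.hom0 (valley k n x l y) -
            D.f₂ (D.hom1 (valley k n x l y)) := by
        rw [← hi]; abel
      rw [dN_mul_uN_succ k n r (by omega), ← mul_assoc, D.hom0_mul_dN, mul_assoc _ _ (eN k n r),
        uN_mul_eN, hu, map_add, map_smul, map_smul, D.f₂_g2_succ r (by omega)]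
      simp only [smul_sub, smul_add, actL_smul_actL_smul, actR_smul_actR_smul, actL_smul_actR_smul,
        dN_mul_uN_succ k n r (by omega), dPrev]
      abel

/-- The two homotopies on the part of the resolution generated by the elements
`(q + 1) ⊗ (q)`. -/
theorem hom0_hom1 {q : ℕ} (hq : q + 1 < n) (a : AShriek k n) :
    D.hom0 (a * uN k n q) - actR k (uN k n q) • D.hom0 (a * eN k n (q + 1)) +
      D.f₂ (D.hom1 (a * eN k n (q + 1))) = actL k a • D.gU q := by
  induction a using valley_induction with
  | h x l y hx hy =>
    by_cases h : l + y = q + 1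
    · rw [← h, valley_mul_eN, D.hom0_hom1_valley x l y q h hq]
    · rw [← D.actL_gU, actL_smul_actL_smul, ← eN_mul_uN, ← mul_assoc, valley_mul_eN', if_neg h,
        zero_mul, map_zero, map_zero, map_zero, smul_zero, actL_zero_smul, sub_zero, add_zero]
  | h0 => simp only [zero_mul, map_zero, smul_zero, actL_zero_smul, sub_zero, add_zero]
  | hadd a b ha hb =>
    simp only [add_mul, map_add, smul_add, actL_add, add_smul, ← ha, ← hb]; abel
  | hsmul c a ha =>
    rw [actL_smul_smul, ← ha, smul_mul_assoc, smul_mul_assoc, map_smul, map_smul, map_smul,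
      smul_comm (actR k _) c, smul_add, smul_sub]
    congr 1
    exact (D.f₂.restrictScalars k).map_smul c _

variable [Module k Q₀] [IsScalarTower k (Env k n) Q₀]

/-- The first contracting homotopy. -/
def h₀ : Q₀ →ₗ[k] Q₁ := ∑ i, evalEnv (envAction Q₁) D.hom0 ∘ₗ (D.c0 i).restrictScalars k

/-- The second contracting homotopy, which vanishes on the generators `(q) ⊗ (q + 1)`. -/
def h₁ : Q₁ →ₗ[k] Q₂ := ∑ i, evalEnv (envAction Q₂) D.hom1 ∘ₗ (D.cU i).restrictScalars k

theorem h₀_apply (z : Q₀) : D.h₀ z = ∑ i, evalEnv (envAction Q₁) D.hom0 (D.c0 i z) := by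
  simp [h₀]

theorem h₁_apply (z : Q₁) : D.h₁ z = ∑ i, evalEnv (envAction Q₂) D.hom1 (D.cU i z) := by
  simp [h₁]

theorem h₀_actR (b : AShriek k n) (z : Q₀) : D.h₀ (actR k b • z) = actR k b • D.h₀ z := by
  rw [h₀_apply, h₀_apply, Finset.smul_sum]
  exact Finset.sum_congr rfl fun i _ => by
    rw [map_smul, smul_eq_mul, evalEnv_actR, envAction_r]

theorem h₁_actR (b : AShriek k n) (z : Q₁) : D.h₁ (actR k b • z) = actR k b • D.h₁ z := by
  rw [h₁_apply, h₁_apply, Finset.smul_sum]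
  exact Finset.sum_congr rfl fun i _ => by
    rw [map_smul, smul_eq_mul, evalEnv_actR, envAction_r]

theorem evalEnv_actL_mul {P : Type*} [AddCommGroup P] [Module (Env k n) P] [Module k P]
    [IsScalarTower k (Env k n) P] (φ : AShriek k n →ₗ[k] P) (a e e' : AShriek k n) :
    evalEnv (envAction P) φ (actL k a * e ⊗ₜ[k] op e') = actR k e' • φ (a * e) := by
  rw [actL, Algebra.TensorProduct.tmul_mul_tmul, one_mul, evalEnv_tmul, envAction_r]

theorem h₀_g0 {i : ℕ} (hi : i < n) (a : AShriek k n) :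
    D.h₀ (actL k a • D.g0 i) = D.hom0 (a * eN k n i) := by
  rw [h₀_apply, Finset.sum_eq_single ⟨i, hi⟩]
  · rw [map_smul, smul_eq_mul, D.c0_g0 ⟨i, hi⟩, evalEnv_actL_mul, D.actR_hom0]
  · intro j _ hj
    rw [map_smul, D.c0_g0_of_ne ⟨i, hi⟩ j hj]
    exact (congrArg _ (mul_zero (actL k a))).trans (map_zero _)
  · exact fun h => absurd (Finset.mem_univ _) h

theorem h₁_gU {q : ℕ} (hq : q + 1 < n) (a : AShriek k n) :
    D.h₁ (actL k a • D.gU q) = D.hom1 (a * eN k n (q + 1)) := by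
  obtain ⟨p, rfl⟩ : ∃ p : Fin (n - 1), q = p.val := ⟨⟨q, by omega⟩, rfl⟩
  rw [h₁_apply, Finset.sum_eq_single p]
  · rw [map_smul, smul_eq_mul, D.cU_gU, evalEnv_actL_mul, D.actR_hom1]
  · intro j _ hj
    rw [map_smul, D.cU_gU_of_ne p j hj]
    exact (congrArg _ (mul_zero (actL k a))).trans (map_zero _)
  · exact fun h => absurd (Finset.mem_univ _) h

theorem h₁_gD {q : ℕ} (hq : q + 1 < n) (a : AShriek k n) :
    D.h₁ (actL k a • D.gD q) = 0 := by
  obtain ⟨p, rfl⟩ : ∃ p : Fin (n - 1), q = p.val := ⟨⟨q, by omega⟩, rfl⟩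
  rw [h₁_apply]
  refine Finset.sum_eq_zero fun i _ => ?_
  rw [map_smul, D.cU_gD]
  exact (congrArg _ (mul_zero (actL k a))).trans (map_zero _)

theorem homotopy_zero (z : Q₀) : actR k (D.ε z) • D.unit + D.f₁ (D.h₀ z) = z := by
  let T : Q₀ →ₗ[k] Q₀ := (envAction Q₀).r.flip D.unit ∘ₗ D.ε.restrictScalars k +
    D.f₁.restrictScalars k ∘ₗ D.h₀
  refine rightLinear_ext (S := envAction Q₀) D.sum0 (T := T) (T' := LinearMap.id) ?_
    (fun b z => rfl) ?_ z
  · intro b z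
    change actR k (D.ε (actR k b • z)) • D.unit + D.f₁ (D.h₀ (actR k b • z)) =
      actR k b • (actR k (D.ε z) • D.unit + D.f₁ (D.h₀ z))
    rw [D.ε_actR, D.h₀_actR, map_smul, smul_add, actR_smul_actR_smul]
  · intro i a
    change actR k (D.ε (actL k a • D.g0 i)) • D.unit + D.f₁ (D.h₀ (actL k a • D.g0 i)) =
      actL k a • D.g0 i
    rw [D.h₀_g0 i.2, D.ε_actL, D.ε_g0]
    induction a using valley_induction with
    | h x l y hx hy =>
      by_cases h : l + y = i
      · rw [← h, valley_mul_eN, D.f₁_hom0_valley x l y hx hy, add_sub_cancel]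
      · rw [← D.actL_g0, actL_smul_actL_smul, valley_mul_eN', if_neg h, map_zero, map_zero,
          actL_zero_smul, actR_zero_smul, add_zero]
    | h0 => simp only [zero_mul, map_zero, actL_zero_smul, actR_zero_smul, add_zero]
    | hadd a b ha hb =>
      simp only [add_mul, map_add, actL_add, actR_add, add_smul, ← ha, ← hb]; abel
    | hsmul c a ha =>
      rw [actL_smul_smul, ← ha, smul_mul_assoc, map_smul, actR_smul_smul, smul_add]
      congr 1
      exact (D.f₁.restrictScalars k).map_smul c _

theorem homotopy_one (z : Q₁) : D.h₀ (D.f₁ z) + D.f₂ (D.h₁ z) = z := by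
  let T : Q₁ →ₗ[k] Q₁ := D.h₀ ∘ₗ D.f₁.restrictScalars k + D.f₂.restrictScalars k ∘ₗ D.h₁
  refine rightLinear_ext (S := envAction Q₁) D.sum1 (T := T) (T' := LinearMap.id) ?_
    (fun b z => rfl) ?_ z
  · intro b z
    change D.h₀ (D.f₁ (actR k b • z)) + D.f₂ (D.h₁ (actR k b • z)) =
      actR k b • (D.h₀ (D.f₁ z) + D.f₂ (D.h₁ z))
    rw [D.h₁_actR, D.f₁.map_smul, D.h₀_actR, D.f₂.map_smul, smul_add]
  · rintro (i | i) a
    · change D.h₀ (D.f₁ (actL k a • D.gU i)) + D.f₂ (D.h₁ (actL k a • D.gU i)) =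
        actL k a • D.gU i
      rw [D.h₁_gU (by omega), map_smul, D.f₁_gU, smul_sub, map_sub, actL_smul_actL_smul,
        actL_smul_actR_smul, D.h₀_actR, D.h₀_g0 (by omega), D.h₀_g0 (by omega), mul_assoc,
        uN_mul_eN, D.hom0_hom1 (by omega)]
    · change D.h₀ (D.f₁ (actL k a • D.gD i)) + D.f₂ (D.h₁ (actL k a • D.gD i)) =
        actL k a • D.gD i
      rw [D.h₁_gD (by omega), map_zero, add_zero, map_smul, D.f₁_gD, smul_sub, map_sub,
        actL_smul_actL_smul, actL_smul_actR_smul, D.h₀_actR, D.h₀_g0 (by omega),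
        D.h₀_g0 (by omega), mul_assoc, dN_mul_eN, D.hom0_mul_dN, add_sub_cancel_right]

theorem homotopy_two (z : Q₂) : D.h₁ (D.f₂ z) = z := by
  let T : Q₂ →ₗ[k] Q₂ := D.h₁ ∘ₗ D.f₂.restrictScalars k
  refine rightLinear_ext (S := envAction Q₂) D.sum2 (T := T) (T' := LinearMap.id) ?_
    (fun b z => rfl) ?_ z
  · intro b z
    change D.h₁ (D.f₂ (actR k b • z)) = actR k b • D.h₁ (D.f₂ z)
    rw [map_smul, D.h₁_actR]
  · rintro ⟨i, hi⟩ a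
    change D.h₁ (D.f₂ (actL k a • D.g2 i)) = actL k a • D.g2 i
    have hin : i + 1 < n := by omega
    have h1 : D.hom1 (a * dN k n i) = _ := D.hom1_mul_dN hin a
    rcases i with _ | r
    · rw [map_smul, D.f₂_g2_zero hin, smul_add, map_add, actL_smul_actL_smul, actL_smul_actR_smul,
        D.h₁_actR, D.h₁_gU hin, D.h₁_gD hin, smul_zero, add_zero, mul_assoc, dN_mul_eN, h1, dPrev,
        actR_zero_smul, add_zero]
    · simp only [map_smul, D.f₂_g2_succ r hin, smul_add, smul_sub, map_add, map_sub,
        actL_smul_actL_smul, actL_smul_actR_smul, D.h₁_actR, D.h₁_gU hin, D.h₁_gD hin,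
        D.h₁_gU (show r + 1 < n by omega), D.h₁_gD (show r + 1 < n by omega), smul_zero, add_zero,
        mul_assoc, dN_mul_eN, h1, dPrev, add_sub_cancel_right]

theorem exact_f₂_f₁ : Function.Exact D.f₂ D.f₁ := by
  intro z
  refine ⟨fun h => ⟨D.h₁ z, ?_⟩, ?_⟩
  · have := D.homotopy_one z
    rwa [h, map_zero, zero_add] at this
  · rintro ⟨w, rfl⟩
    exact D.f₁_f₂ w

theorem exact_f₁_ε : Function.Exact D.f₁ D.ε := by
  intro z
  refine ⟨fun h => ⟨D.h₀ z, ?_⟩, ?_⟩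
  · have := D.homotopy_zero z
    rwa [h, actR_zero_smul, zero_add] at this
  · rintro ⟨w, rfl⟩
    exact D.ε_f₁ w

theorem injective_f₂ : Function.Injective D.f₂ :=
  Function.LeftInverse.injective D.homotopy_two

theorem threeAcyclic (D : VertexResolution k n Q₀ Q₁ Q₂) {N : Type*} [AddCommGroup N] [Module k N]
    (S : TwoSided k (AShriek k n) N) : S.ThreeAcyclic :=
  threeAcyclic_of_resolution D.sum0 D.sum1 D.sum2 D.ε D.f₁ D.f₂ D.ε_f₁ D.f₁_f₂ D.unit D.h₀ D.h₁
    D.ε_unit D.h₀_actR D.h₁_actR D.homotopy_zero D.homotopy_one D.homotopy_two S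

end VertexResolution
end Homotopies

/-! ### The bimodule resolution -/

section Resolution

variable (k : Type u) [Field k] (n : ℕ)

/-- The resolution of `A_n^!` by the bimodules `A(i) ⊗ (j)A`. -/
def stdResolution : VertexResolution k n (P0 k n) (P1 k n) (P2 k n) where
  g0 := g0N k n
  gU := gUN k n
  gD := gDN k n
  g2 := g2N k n
  actL_g0 := actL_g0N k n
  actR_g0 := actR_g0N k n
  actL_gU := actL_gUN k n
  actR_gU := actR_gUN k n
  actL_gD := actL_gDN k n
  actR_gD := actR_gDN k n
  actL_g2 := actL_g2N k n
  actR_g2 := actR_g2N k n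
  gD_of_le _ h := gDN_of_le k n h
  c0 := coord0 k n
  cU i := coord1 k n (.inl i)
  cD i := coord1 k n (.inr i)
  c2 := coord2 k n
  sum0 z := by simp only [g0N_val]; exact coord0_sum z
  sum1 z := by
    simp only [gUN_val, gDN_val]
    have h := coord1_sum z
    rw [Fintype.sum_sum_type] at h ⊢
    exact h
  sum2 z := by simp only [g2N_val]; exact coord2_sum z
  c0_g0 i := by rw [g0N_val]; exact (piSingle_coe_same k n _).trans (gen_coe k n _ _)
  c0_g0_of_ne i j h := by rw [g0N_val]; exact piSingle_coe k n h _
  cU_gU i := by rw [gUN_val]; exact (piSingle_coe_same k n _).trans (gen_coe k n _ _)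
  cU_gU_of_ne i j h := by rw [gUN_val]; exact piSingle_coe k n h _
  cU_gD i j := by rw [gDN_val]; rfl
  ε := resEps k n
  f₁ := resF1 k n
  f₂ := resF2 k n
  ε_g0 := resEps_g0N k n
  f₁_gU := resF1_gUN k n
  f₁_gD := resF1_gDN k n
  f₂_g2_zero h := (resF2_g2N k n 0 h).trans (sub_zero (G := P1 k n) _)
  f₂_g2_succ r h := resF2_g2N k n (r + 1) h

theorem bimodule_resolution :
    ∃ (f₂ : P2 k n →ₗ[Env k n] P1 k n) (f₁ : P1 k n →ₗ[Env k n] P0 k n)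
        (ε : P0 k n →ₗ[Env k n] AShriek k n),
      (∀ p, f₂ (gen2 k p) = f2value k p) ∧
      (∀ p, f₁ (genUp k p) = actL k (up k p) • gen0 k (lo p) - actR k (up k p) • gen0 k (hi p)) ∧
      (∀ p, f₁ (genDown k p) =
        actL k (down k p) • gen0 k (hi p) - actR k (down k p) • gen0 k (lo p)) ∧
      (∀ i, ε (gen0 k i) = vert k i) ∧
      Module.Projective (Env k n) (P2 k n) ∧ Module.Projective (Env k n) (P1 k n) ∧
      Module.Projective (Env k n) (P0 k n) ∧
      Function.Injective f₂ ∧ Function.Exact f₂ f₁ ∧ Function.Exact f₁ ε ∧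
      Function.Surjective ε ∧
      -- with generators in degrees 2, 1 and 0 the maps preserve degrees
      (∀ (d : ℤ) (z : P2 k n), (∀ i, (z i : Env k n) ∈ envGrading k n d) →
        (∀ i, ((f₂ z).1 i : Env k n) ∈ envGrading k n (d + 1)) ∧
        (∀ i, ((f₂ z).2 i : Env k n) ∈ envGrading k n (d + 1))) ∧
      (∀ (d : ℤ) (z : P1 k n), (∀ i, (z.1 i : Env k n) ∈ envGrading k n d) →
        (∀ i, (z.2 i : Env k n) ∈ envGrading k n d) →
        ∀ i, (f₁ z i : Env k n) ∈ envGrading k n (d + 1)) ∧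
      (∀ (d : ℤ) (z : P0 k n), (∀ i, (z i : Env k n) ∈ envGrading k n d) →
        ε z ∈ pathGrading k n d) :=
  ⟨resF2 k n, resF1 k n, resEps k n, resF2_gen2 k n, resF1_genUp k n, resF1_genDown k n,
    resEps_gen0 k n, projective_of_coordinates coord2_sum, projective_of_coordinates coord1_sum,
    projective_of_coordinates coord0_sum, (stdResolution k n).injective_f₂,
    (stdResolution k n).exact_f₂_f₁, (stdResolution k n).exact_f₁_ε,
    (stdResolution k n).surjective_ε,
    fun d z hz => by
      have h : HasDegree (coord2 k n) d z := hz
      have := h.combine (c' := coord1 k n) (m := f2value k) f2value_hasDegree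
      exact ⟨fun i => this (.inl i), fun i => this (.inr i)⟩,
    fun d z hz hz' => by
      have h : HasDegree (coord1 k n) d z := by rintro (i | i) <;> [exact hz i; exact hz' i]
      exact h.combine (c' := coord0 k n) (m := f1value k n) f1value_hasDegree,
    fun d z hz => resEps_mem hz⟩

theorem subsingleton_HH (m : ℕ) (hm : 3 ≤ m) : Subsingleton (HH k (AShriek k n) m) :=
  subsingleton_HH_of_threeAcyclic (fun _ _ _ S => (stdResolution k n).threeAcyclic S) m hm

end Resolution

/-! ### A presentation of `W(n,1)` by vertices, arrows and central elements -/

section Deformed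

variable {k : Type u} [Field k] (n : ℕ) {B : Type v} [Ring B] [Algebra k B]

/-- The relations of `A_n^!` deformed by elements `X_0, X_1, …` that commute with the vertices and
arrows: the loops at a vertex differ by multiples of the vertex. The elements are indexed by natural
numbers; vertices and arrows that do not exist are zero. -/
structure WRep (E U D X : ℕ → B) : Prop where
  E_of_le : ∀ i, n ≤ i → E i = 0
  U_of_le : ∀ q, n ≤ q + 1 → U q = 0
  D_of_le : ∀ q, n ≤ q + 1 → D q = 0
  E_mul : ∀ i j, E i * E j = if i = j then E j else 0
  one : ∑ i ∈ Finset.range n, E i = 1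
  E_U : ∀ q, E (q + 1) * U q = U q
  U_E : ∀ q, U q * E q = U q
  E_D : ∀ q, E q * D q = D q
  D_E : ∀ q, D q * E (q + 1) = D q
  X_E : ∀ i j, X i * E j = E j * X i
  X_U : ∀ i q, X i * U q = U q * X i
  X_D : ∀ i q, X i * D q = D q * X i
  X_X : ∀ i j, X i * X j = X j * X i
  D_U_zero : 1 < n → D 0 * U 0 = (X 0 - X 1) * E 0
  D_U_succ : ∀ r, r + 2 < n →
    D (r + 1) * U (r + 1) = U r * D r + (X (r + 1) - X (r + 2)) * E (r + 1)

namespace WRep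

/-- The black dot at a vertex, expressed through the arrows. -/
def dotBlack (E U D X : ℕ → B) : ℕ → B
  | 0 => X 0 * E 0
  | v + 1 => U v * D v + X (v + 1) * E (v + 1)

/-- The image of `e_p`: position `p + 1` of the black strand is the vertex `p`. -/
def idemVal (E : ℕ → B) : ℕ → B
  | 0 => 0
  | v + 1 => E v

/-- The image of `ψ_j`. -/
def crossVal (U D : ℕ → B) : ℕ → B
  | 0 => 0
  | q + 1 => U q + D q

/-- The part of the image of `y_s` at the vertex `v`: a dot on the black strand if `s = v + 1`, and
a dot on a red strand otherwise. -/
def dotAt (E U D X : ℕ → B) (s v : ℕ) : B :=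
  if s = v + 1 then dotBlack E U D X v else X (if s ≤ v then s else s - 1) * E v

/-- The image of `y_s`. -/
def dotVal (E U D X : ℕ → B) (s : ℕ) : B := ∑ v ∈ Finset.range n, dotAt E U D X s v

variable {n} {E U D X : ℕ → B} (h : WRep n E U D X)
include h

theorem E_self (i : ℕ) : E i * E i = E i := by rw [h.E_mul, if_pos rfl]

theorem E_of_ne {i j : ℕ} (hij : i ≠ j) : E i * E j = 0 := by rw [h.E_mul, if_neg hij]

theorem U_E_of_ne {q j : ℕ} (hq : q ≠ j) : U q * E j = 0 := by
  rw [← h.U_E, mul_assoc, h.E_of_ne hq, mul_zero]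

theorem D_E_of_ne {q j : ℕ} (hq : q + 1 ≠ j) : D q * E j = 0 := by
  rw [← h.D_E, mul_assoc, h.E_of_ne hq, mul_zero]

theorem E_U_of_ne {q j : ℕ} (hq : j ≠ q + 1) : E j * U q = 0 := by
  rw [← h.E_U, ← mul_assoc, h.E_of_ne hq, zero_mul]

theorem E_D_of_ne {q j : ℕ} (hq : j ≠ q) : E j * D q = 0 := by
  rw [← h.E_D, ← mul_assoc, h.E_of_ne hq, zero_mul]

theorem dotBlack_E (v : ℕ) : dotBlack E U D X v * E v = dotBlack E U D X v := by
  rcases v with _ | v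
  · rw [dotBlack, mul_assoc, h.E_self]
  · rw [dotBlack, add_mul, mul_assoc, h.D_E, mul_assoc, h.E_self]

theorem E_dotBlack (v : ℕ) : E v * dotBlack E U D X v = dotBlack E U D X v := by
  rcases v with _ | v
  · rw [dotBlack, ← mul_assoc, ← h.X_E, mul_assoc, h.E_self]
  · rw [dotBlack, mul_add, ← mul_assoc, h.E_U, ← mul_assoc, ← h.X_E, mul_assoc, h.E_self]

/-- The black dot at `v`, through the arrows to the next vertex. -/
theorem dotBlack_eq {v : ℕ} (hv : v + 1 < n) :
    dotBlack E U D X v = D v * U v + X (v + 1) * E v := by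
  rcases v with _ | v
  · rw [dotBlack, h.D_U_zero hv, sub_mul, sub_add_cancel]
  · rw [dotBlack, h.D_U_succ v hv, sub_mul]; abel

theorem X_dotBlack (i v : ℕ) : X i * dotBlack E U D X v = dotBlack E U D X v * X i := by
  rcases v with _ | v
  · rw [dotBlack, mul_assoc, ← h.X_E, ← mul_assoc, ← mul_assoc, h.X_X]
  · rw [dotBlack, mul_add, add_mul, ← mul_assoc, h.X_U, mul_assoc, h.X_D, ← mul_assoc,
      mul_assoc (X (v + 1)), ← h.X_E, ← mul_assoc, ← mul_assoc, h.X_X]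

theorem U_dotBlack (q : ℕ) (hq : q + 1 < n) :
    U q * dotBlack E U D X q = dotBlack E U D X (q + 1) * U q := by
  rw [h.dotBlack_eq hq, dotBlack, mul_add, add_mul, mul_assoc, ← mul_assoc (U q) (X _), ← h.X_U,
    mul_assoc, h.U_E, mul_assoc, h.E_U]

theorem D_dotBlack (q : ℕ) (hq : q + 1 < n) :
    D q * dotBlack E U D X (q + 1) = dotBlack E U D X q * D q := by
  rw [h.dotBlack_eq hq, dotBlack, mul_add, add_mul, mul_assoc, ← mul_assoc (D q) (X _), ← h.X_D,
    mul_assoc, h.D_E, mul_assoc, h.E_D]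

theorem dotAt_E (s v : ℕ) : dotAt E U D X s v * E v = dotAt E U D X s v := by
  unfold dotAt
  split_ifs
  · exact h.dotBlack_E v
  · rw [mul_assoc, h.E_self]
  · rw [mul_assoc, h.E_self]

theorem E_dotAt (s v : ℕ) : E v * dotAt E U D X s v = dotAt E U D X s v := by
  unfold dotAt
  split_ifs
  · exact h.E_dotBlack v
  · rw [← mul_assoc, ← h.X_E, mul_assoc, h.E_self]
  · rw [← mul_assoc, ← h.X_E, mul_assoc, h.E_self]

theorem dotVal_E (s v : ℕ) : dotVal n E U D X s * E v = dotAt E U D X s v := by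
  rw [dotVal, Finset.sum_mul, Finset.sum_eq_single v]
  · exact h.dotAt_E s v
  · intro w _ hw
    rw [← h.dotAt_E, mul_assoc, h.E_of_ne hw, mul_zero]
  · intro hv
    rw [h.E_of_le v (by simpa using hv), mul_zero]

theorem E_dotVal (s v : ℕ) : E v * dotVal n E U D X s = dotAt E U D X s v := by
  rw [dotVal, Finset.mul_sum, Finset.sum_eq_single v]
  · exact h.E_dotAt s v
  · intro w _ hw
    rw [← h.E_dotAt, ← mul_assoc, h.E_of_ne hw.symm, zero_mul]
  · intro hv
    rw [h.E_of_le v (by simpa using hv), zero_mul]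

theorem dotAt_mul_comm (s t v : ℕ) :
    dotAt E U D X s v * dotAt E U D X t v = dotAt E U D X t v * dotAt E U D X s v := by
  have key : ∀ i, X i * E v * dotBlack E U D X v = dotBlack E U D X v * (X i * E v) := by
    intro i
    rw [mul_assoc, h.E_dotBlack, h.X_dotBlack, h.X_E, ← mul_assoc, h.dotBlack_E]
  have key' : ∀ i j, X i * E v * (X j * E v) = X j * E v * (X i * E v) := by
    intro i j
    rw [mul_assoc, ← mul_assoc (E v), ← h.X_E, ← mul_assoc, ← mul_assoc, h.X_X, mul_assoc (X j),
      mul_assoc (X j), h.X_E i, mul_assoc, mul_assoc, h.X_E i]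
  unfold dotAt
  split_ifs <;> first | rfl | exact key _ | exact (key _).symm | exact key' _ _

theorem dotVal_mul_comm (s t : ℕ) : dotVal n E U D X s * dotVal n E U D X t =
    dotVal n E U D X t * dotVal n E U D X s := by
  have key : ∀ s t, dotVal n E U D X s * dotVal n E U D X t =
      ∑ v ∈ Finset.range n, dotAt E U D X s v * dotAt E U D X t v := by
    intro s t
    rw [← mul_one (_ * _), ← h.one, Finset.mul_sum]
    refine Finset.sum_congr rfl fun v _ => ?_
    rw [mul_assoc, h.dotVal_E, ← h.E_dotAt t, ← mul_assoc, h.dotVal_E, h.E_dotAt]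
  rw [key, key]
  exact Finset.sum_congr rfl fun v _ => h.dotAt_mul_comm s t v

theorem idemVal_mul (p q : ℕ) :
    idemVal E p * idemVal E q = if p = q then idemVal E q else 0 := by
  rcases p with _ | p <;> rcases q with _ | q
  · simp [idemVal]
  · simp [idemVal]
  · simp [idemVal]
  · simp [idemVal, h.E_mul]

theorem idemVal_sum : ∑ p : Fin (n + 1), idemVal E p = 1 := by
  rw [Fin.sum_univ_succ, ← h.one, Finset.sum_range]
  simp [idemVal]

theorem dotVal_idemVal (s p : ℕ) :
    dotVal n E U D X s * idemVal E p = idemVal E p * dotVal n E U D X s := by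
  rcases p with _ | p
  · simp [idemVal]
  · rw [idemVal, h.dotVal_E, h.E_dotVal]

/-- The composite of a crossing with an idempotent is an arrow, or zero. -/
theorem crossVal_idemVal (j p : ℕ) : crossVal U D j * idemVal E p =
    if j = 0 then 0 else if p = j then U (j - 1) else if p = j + 1 then D (j - 1) else 0 := by
  rcases j with _ | q
  · simp [crossVal]
  rcases p with _ | p
  · simp [idemVal]
  rw [crossVal, idemVal, add_mul, if_neg (by omega)]
  by_cases h1 : p = q
  · subst h1
    rw [h.U_E, h.D_E_of_ne (by omega), add_zero, if_pos rfl]; rfl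
  rw [h.U_E_of_ne (Ne.symm h1), zero_add, if_neg (by omega)]
  by_cases h2 : p = q + 1
  · subst h2
    rw [h.D_E, if_pos rfl]; rfl
  · rw [h.D_E_of_ne (Ne.symm h2), if_neg (by omega)]

theorem idemVal_crossVal (j p : ℕ) : idemVal E p * crossVal U D j =
    if j = 0 then 0 else if p = j + 1 then U (j - 1) else if p = j then D (j - 1) else 0 := by
  rcases j with _ | q
  · simp [crossVal]
  rcases p with _ | p
  · simp [idemVal]
  rw [crossVal, idemVal, mul_add, if_neg (by omega)]
  by_cases h1 : p = q + 1
  · subst h1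
    rw [h.E_U, h.E_D_of_ne (by omega), add_zero, if_pos rfl]; rfl
  rw [h.E_U_of_ne h1, zero_add, if_neg (by omega)]
  by_cases h2 : p = q
  · subst h2
    rw [h.E_D, if_pos rfl]; rfl
  · rw [h.E_D_of_ne h2, if_neg (by omega)]

end WRep

end Deformed

section Lift

variable {k : Type u} [Field k] {n : ℕ} {B : Type v} [Ring B] [Algebra k B]

theorem swap_castSucc_succ_val (j : Fin n) (p : Fin (n + 1)) :
    (Equiv.swap j.castSucc j.succ p).val =
      if p.val = j.val then j.val + 1 else if p.val = j.val + 1 then j.val else p.val := by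
  rw [Equiv.swap_apply_def]
  simp only [Fin.ext_iff, Fin.val_castSucc, Fin.val_succ]
  split_ifs <;> simp

namespace WRep

variable {E U D X : ℕ → B} (h : WRep n E U D X)
include h

theorem crossVal_idemVal_eq_zero {j p : ℕ} (h1 : p ≠ j) (h2 : p ≠ j + 1) :
    crossVal U D j * idemVal E p = 0 := by
  rw [h.crossVal_idemVal, if_neg h1, if_neg h2, ite_self]

theorem crossVal_idemVal_swap (j p : ℕ) : crossVal U D j * idemVal E p =
    idemVal E (if p = j then j + 1 else if p = j + 1 then j else p) * crossVal U D j := by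
  rw [h.crossVal_idemVal, h.idemVal_crossVal]
  split_ifs <;> first | rfl | omega

theorem U_mul_self (q : ℕ) : U q * U q = 0 := by
  nth_rw 2 [← h.E_U]
  rw [← mul_assoc, h.U_E_of_ne (by omega), zero_mul]

theorem D_mul_self (q : ℕ) : D q * D q = 0 := by
  nth_rw 2 [← h.E_D]
  rw [← mul_assoc, h.D_E_of_ne (by omega), zero_mul]

omit h in
theorem dotAt_black (v : ℕ) : dotAt E U D X (v + 1) v = dotBlack E U D X v := if_pos rfl

omit h in
theorem dotAt_self (v : ℕ) : dotAt E U D X v v = X v * E v := by simp [dotAt]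

omit h in
theorem dotAt_add_two (v : ℕ) : dotAt E U D X (v + 2) v = X (v + 1) * E v := by simp [dotAt]

theorem cross_cross {j l : ℕ} (hjl : j + 1 < l ∨ l + 1 < j) (p : ℕ) :
    crossVal U D j * crossVal U D l * idemVal E p = 0 := by
  rw [mul_assoc]
  by_cases hp : p = l ∨ p = l + 1
  · rw [h.crossVal_idemVal_swap, ← mul_assoc, h.crossVal_idemVal_eq_zero, zero_mul] <;>
      split_ifs <;> omega
  · rw [h.crossVal_idemVal_eq_zero (by omega) (by omega), mul_zero]

theorem braid {j l : ℕ} (hjl : j + 1 = l ∨ l + 1 = j) (p : ℕ) :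
    crossVal U D j * crossVal U D l * crossVal U D j * idemVal E p = 0 := by
  rw [mul_assoc]
  by_cases hp : p = j ∨ p = j + 1
  · rw [h.crossVal_idemVal_swap, mul_assoc, ← mul_assoc (crossVal U D l),
      h.crossVal_idemVal_swap l]
    by_cases hp' : (p = j ∧ j + 1 = l) ∨ (p = j + 1 ∧ l + 1 = j)
    · rw [mul_assoc, ← mul_assoc (crossVal U D j), h.crossVal_idemVal_eq_zero, zero_mul] <;>
        split_ifs <;> omega
    · rw [← h.crossVal_idemVal_swap l, h.crossVal_idemVal_eq_zero, zero_mul, mul_zero] <;>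
        split_ifs <;> omega
  · rw [h.crossVal_idemVal_eq_zero (by omega) (by omega), mul_zero]

theorem cross_dot_far {j l : ℕ} (hl : l ≠ j) (hl' : l ≠ j + 1) (p : ℕ) :
    crossVal U D j * idemVal E p * (dotVal n E U D X l * idemVal E p) =
      dotVal n E U D X l * idemVal E (if p = j then j + 1 else if p = j + 1 then j else p) *
        (crossVal U D j * idemVal E p) := by
  rw [h.crossVal_idemVal]
  rcases j with _ | q
  · simp
  rw [if_neg (by omega)]
  split_ifs with h1 h2
  · subst h1
    simp only [Nat.add_sub_cancel, idemVal]
    rw [h.dotVal_E, h.dotVal_E, dotAt, dotAt, if_neg hl, if_neg hl', ← mul_assoc, ← h.X_U,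
      mul_assoc, h.U_E, mul_assoc, h.E_U]
    congr 2
    split_ifs <;> omega
  · subst h2
    simp only [Nat.add_sub_cancel, idemVal]
    rw [h.dotVal_E, h.dotVal_E, dotAt, dotAt, if_neg hl, if_neg hl', ← mul_assoc, ← h.X_D,
      mul_assoc, h.D_E, mul_assoc, h.E_D]
    congr 2
    split_ifs <;> omega
  · simp

theorem cross_dot {j : ℕ} (hj : j < n) (p : ℕ) :
    crossVal U D j * dotVal n E U D X j * idemVal E p =
      dotVal n E U D X (j + 1) * crossVal U D j * idemVal E p := by
  rw [mul_assoc, h.dotVal_idemVal, ← mul_assoc, mul_assoc _ _ (idemVal E p), h.crossVal_idemVal]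
  rcases j with _ | q
  · simp
  rw [if_neg (by omega)]
  split_ifs with h1 h2
  · simp only [Nat.add_sub_cancel]
    rw [← h.U_E, mul_assoc, h.E_dotVal, dotAt_black, h.U_dotBlack q hj, h.U_E, ← h.E_U, ← mul_assoc, ← mul_assoc,
      h.dotBlack_E, h.dotVal_E, dotAt_black]
  · simp only [Nat.add_sub_cancel]
    rw [← h.D_E, mul_assoc, h.E_dotVal, dotAt_self, ← mul_assoc, ← h.X_D, mul_assoc, h.D_E,
      ← h.E_D, ← mul_assoc (dotVal n E U D X _), h.dotVal_E, dotAt_add_two, mul_assoc]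
  · simp

theorem dot_cross {j : ℕ} (hj : j < n) (p : ℕ) :
    dotVal n E U D X j * crossVal U D j * idemVal E p =
      crossVal U D j * dotVal n E U D X (j + 1) * idemVal E p := by
  rw [mul_assoc (crossVal U D j), h.dotVal_idemVal, ← mul_assoc (crossVal U D j),
    mul_assoc _ _ (idemVal E p), h.crossVal_idemVal]
  rcases j with _ | q
  · simp
  rw [if_neg (by omega)]
  split_ifs with h1 h2
  · simp only [Nat.add_sub_cancel]
    rw [← h.E_U, ← mul_assoc, h.dotVal_E, dotAt_self, mul_assoc, h.E_U, h.X_U, ← h.U_E,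
      mul_assoc _ _ (dotVal n E U D X _), h.E_dotVal, dotAt_add_two, h.X_E, ← mul_assoc]
  · simp only [Nat.add_sub_cancel]
    rw [← h.E_D, ← mul_assoc, h.dotVal_E, dotAt_black, ← h.D_dotBlack q hj, h.E_D, ← h.D_E,
      mul_assoc _ _ (dotVal n E U D X _), h.E_dotVal, dotAt_black, mul_assoc, h.E_dotBlack]
  · simp

theorem cross_sq_black_red {j : ℕ} (hj : j < n) :
    crossVal U D j * crossVal U D j * idemVal E j =
      (dotVal n E U D X j - dotVal n E U D X (j + 1)) * idemVal E j := by
  rcases j with _ | q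
  · simp [idemVal]
  rw [mul_assoc, h.crossVal_idemVal, if_neg (by omega), if_pos rfl, Nat.add_sub_cancel, idemVal,
    sub_mul, h.dotVal_E, h.dotVal_E, dotAt, dotAt, if_pos rfl, if_neg (by omega),
    if_neg (by omega), h.dotBlack_eq hj, Nat.add_sub_cancel, add_sub_cancel_right, crossVal,
    add_mul, h.U_mul_self, zero_add]

theorem cross_sq_red_black (j : ℕ) :
    crossVal U D j * crossVal U D j * idemVal E (j + 1) =
      (-dotVal n E U D X j + dotVal n E U D X (j + 1)) * idemVal E (j + 1) := by
  rw [idemVal, add_mul, neg_mul, h.dotVal_E, h.dotVal_E, dotAt, dotAt, if_pos rfl,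
    if_neg (by omega), if_pos le_rfl]
  rcases j with _ | q
  · simp [crossVal, dotBlack]
  have key := h.crossVal_idemVal (q + 1) (q + 2)
  rw [if_neg (by omega), if_neg (by omega), if_pos rfl, Nat.add_sub_cancel, idemVal] at key
  rw [mul_assoc, key, dotBlack, crossVal, add_mul, h.D_mul_self, add_zero]
  abel

/-- The values of the homomorphism on the generators of `W(n,1)`. -/
def genMap (n : ℕ) (E U D X : ℕ → B) : WGen n → B
  | WGen.idem p => idemVal E p
  | WGen.dot s => dotVal n E U D X s
  | WGen.cross j => crossVal U D j

omit h in
/-- The homomorphism out of `W(n,1)` with given values on vertices, arrows and red dots. -/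
def lift (h : WRep n E U D X) : Web k n →ₐ[k] B :=
  RingQuot.liftAlgHom k ⟨FreeAlgebra.lift k (genMap n E U D X), by
    intro x y r
    induction r with
    | idem p => simpa [genMap] using (h.idemVal_mul p p).trans (if_pos rfl)
    | orth p q hpq =>
      simpa [genMap] using (h.idemVal_mul p q).trans (if_neg fun e => hpq (Fin.ext e))
    | one => simpa [genMap] using h.idemVal_sum
    | dot_idem j p => simpa [genMap] using h.dotVal_idemVal j p
    | cross_idem j p =>
      simpa [genMap, swap_castSucc_succ_val] using h.crossVal_idemVal_swap j p
    | cross_red_red j p hp hp' =>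
      simpa [genMap] using h.crossVal_idemVal_eq_zero (j := j) (p := p)
        (fun e => hp (Fin.ext e)) (fun e => hp' (Fin.ext e))
    | cross_cross j l p hjl =>
      simpa [genMap] using (h.cross_cross hjl p).trans (h.cross_cross hjl.symm p).symm
    | cross_dot_far j l p hl hl' =>
      simpa [genMap, swap_castSucc_succ_val] using h.cross_dot_far (j := j) (l := l)
        (fun e => hl (Fin.ext e)) (fun e => hl' (Fin.ext e)) p
    | dot_dot j l => simpa [genMap] using h.dotVal_mul_comm j l
    | cross_dot j p => simpa [genMap] using h.cross_dot j.isLt p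
    | dot_cross j p => simpa [genMap] using h.dot_cross j.isLt p
    | cross_sq_black_red j => simpa [genMap] using h.cross_sq_black_red j.isLt
    | cross_sq_red_black j => simpa [genMap] using h.cross_sq_red_black j
    | braid j l p hjl =>
      simpa [genMap] using (h.braid (Or.inl hjl) p).trans (h.braid (Or.inr hjl) p).symm
    | cyclotomic => simp [genMap, idemVal]⟩

theorem lift_mk (x : FreeAlgebra k (WGen n)) :
    h.lift (Web.mk k n x) = FreeAlgebra.lift k (genMap n E U D X) x :=
  RingQuot.liftAlgHom_mkAlgHom_apply k _ _ _

theorem lift_wIdem (p : Fin (n + 1)) : h.lift (wIdem k p) = idemVal E p := by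
  rw [wIdem, h.lift_mk, FreeAlgebra.lift_ι_apply, genMap]

theorem lift_wDot (s : Fin (n + 1)) : h.lift (wDot k s) = dotVal n E U D X s := by
  rw [wDot, h.lift_mk, FreeAlgebra.lift_ι_apply, genMap]

theorem lift_wCross (j : Fin n) : h.lift (wCross k j) = crossVal U D j := by
  rw [wCross, h.lift_mk, FreeAlgebra.lift_ι_apply, genMap]

theorem lift_wX (l : Fin n) : h.lift (wX k l) = X l := by
  rw [wX, map_sum, Fin.sum_univ_succ, map_mul, h.lift_wIdem]
  simp only [Fin.val_zero, idemVal, mul_zero, zero_add]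
  rw [← mul_one (X l), ← h.one, Finset.sum_range, Finset.mul_sum]
  refine Finset.sum_congr rfl fun v _ => ?_
  rw [map_mul, h.lift_wIdem, h.lift_wDot, Fin.val_succ, idemVal, h.dotVal_E, dotAt]
  have hs : (v.succ.succAbove l).val = if l.val ≤ v.val then l.val else l.val + 1 := by
    rw [Fin.succAbove]
    simp only [Fin.lt_def, Fin.val_castSucc, Fin.val_succ, Nat.lt_succ_iff]
    split_ifs <;> rfl
  rw [hs, if_neg (by split_ifs <;> omega)]
  congr 2
  split_ifs <;> omega

theorem lift_up {q : ℕ} (hq : q + 1 < n) :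
    h.lift (wCross k ⟨q + 1, hq⟩ * wIdem k ⟨q + 1, by omega⟩) = U q := by
  rw [map_mul, h.lift_wCross, h.lift_wIdem, h.crossVal_idemVal, if_neg (by simp), if_pos rfl]
  rfl

theorem lift_down {q : ℕ} (hq : q + 1 < n) :
    h.lift (wCross k ⟨q + 1, hq⟩ * wIdem k ⟨q + 2, by omega⟩) = D q := by
  rw [map_mul, h.lift_wCross, h.lift_wIdem, h.crossVal_idemVal, if_neg (by simp),
    if_neg (by simp), if_pos rfl]
  rfl

end WRep

end Lift

/-! ### The generators of `W(n,1)` -/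

section WebGenerators

variable {k : Type u} [Field k] {n : ℕ}

theorem Web.mk_surjective : Function.Surjective (Web.mk k n) :=
  RingQuot.mkAlgHom_surjective k _

theorem Web.mk_rel {x y : FreeAlgebra k (WGen n)} (h : WRel k n x y) :
    Web.mk k n x = Web.mk k n y := RingQuot.mkAlgHom_rel k h

theorem wIdem_mul_self (p : Fin (n + 1)) : wIdem k p * wIdem k p = wIdem k p := by
  simpa [wIdem] using Web.mk_rel (WRel.idem (k := k) p)

theorem wIdem_mul_of_ne {p q : Fin (n + 1)} (h : p ≠ q) : wIdem k p * wIdem k q = 0 := by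
  simpa [wIdem] using Web.mk_rel (WRel.orth (k := k) p q h)

theorem sum_wIdem : ∑ p : Fin (n + 1), wIdem k p = 1 := by
  simpa [wIdem] using Web.mk_rel (WRel.one (k := k) (n := n))

theorem wDot_mul_wIdem (j p : Fin (n + 1)) : wDot k j * wIdem k p = wIdem k p * wDot k j := by
  simpa [wIdem, wDot] using Web.mk_rel (WRel.dot_idem (k := k) j p)

theorem wDot_mul_wDot (j l : Fin (n + 1)) : wDot k j * wDot k l = wDot k l * wDot k j := by
  simpa [wDot] using Web.mk_rel (WRel.dot_dot (k := k) j l)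

theorem wCross_mul_wIdem (j : Fin n) (p : Fin (n + 1)) :
    wCross k j * wIdem k p = wIdem k (Equiv.swap j.castSucc j.succ p) * wCross k j := by
  simpa [wIdem, wCross] using Web.mk_rel (WRel.cross_idem (k := k) j p)

theorem wCross_mul_wIdem_eq_zero {j : Fin n} {p : Fin (n + 1)} (h : p ≠ j.castSucc)
    (h' : p ≠ j.succ) : wCross k j * wIdem k p = 0 := by
  simpa [wIdem, wCross] using Web.mk_rel (WRel.cross_red_red (k := k) j p h h')

theorem wIdem_zero : wIdem k (0 : Fin (n + 1)) = 0 := by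
  simpa [wIdem] using Web.mk_rel (WRel.cyclotomic (k := k) (n := n))

theorem wCross_sq_castSucc (j : Fin n) : wCross k j * wCross k j * wIdem k j.castSucc =
    (wDot k j.castSucc - wDot k j.succ) * wIdem k j.castSucc := by
  simpa [wIdem, wCross, wDot] using Web.mk_rel (WRel.cross_sq_black_red (k := k) j)

theorem wCross_sq_succ (j : Fin n) : wCross k j * wCross k j * wIdem k j.succ =
    (-wDot k j.castSucc + wDot k j.succ) * wIdem k j.succ := by
  simpa [wIdem, wCross, wDot] using Web.mk_rel (WRel.cross_sq_red_black (k := k) j)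

theorem wX_mul_wIdem (l : Fin n) (p : Fin (n + 1)) :
    wX k l * wIdem k p = wDot k (p.succAbove l) * wIdem k p := by
  rw [wX, Finset.sum_mul, Finset.sum_eq_single p]
  · rw [mul_assoc, wIdem_mul_self]
  · intro q _ hq
    rw [mul_assoc, wIdem_mul_of_ne hq, mul_zero]
  · simp

theorem wX_mul_wIdem_comm (l : Fin n) (p : Fin (n + 1)) :
    wX k l * wIdem k p = wIdem k p * wX k l := by
  rw [wX_mul_wIdem, wDot_mul_wIdem, wX, Finset.mul_sum, Finset.sum_eq_single p]
  · rw [wDot_mul_wIdem, ← mul_assoc, wIdem_mul_self]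
  · intro q _ hq
    rw [wDot_mul_wIdem, ← mul_assoc, wIdem_mul_of_ne hq.symm, zero_mul]
  · simp

theorem web_ext_right {x y : Web k n} (h : ∀ p, x * wIdem k p = y * wIdem k p) : x = y := by
  rw [← mul_one x, ← mul_one y, ← sum_wIdem, Finset.mul_sum, Finset.mul_sum]
  exact Finset.sum_congr rfl fun p _ => h p

theorem wX_mul_wDot (l : Fin n) (s : Fin (n + 1)) : wX k l * wDot k s = wDot k s * wX k l := by
  refine web_ext_right fun p => ?_
  rw [mul_assoc, wDot_mul_wIdem, ← mul_assoc, wX_mul_wIdem, mul_assoc, ← wDot_mul_wIdem,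
    ← mul_assoc, wDot_mul_wDot, mul_assoc, mul_assoc, wX_mul_wIdem]

theorem succAbove_val (p : Fin (n + 1)) (l : Fin n) :
    (p.succAbove l).val = if l.val < p.val then l.val else l.val + 1 := by
  rw [Fin.succAbove]
  simp only [Fin.lt_def, Fin.val_castSucc]
  split_ifs <;> rfl

/-- The dot on the `l`-th red strand slides along its strand through a crossing, also when
the crossing moves that strand past the black one and so changes its position. -/
theorem wX_mul_wCross (l j : Fin n) : wX k l * wCross k j = wCross k j * wX k l := by
  refine web_ext_right fun p => ?_
  have h1 : wX k l * wCross k j * wIdem k p =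
      wDot k ((Equiv.swap j.castSucc j.succ p).succAbove l) * wCross k j * wIdem k p := by
    rw [mul_assoc, wCross_mul_wIdem, ← mul_assoc, wX_mul_wIdem, mul_assoc, ← wCross_mul_wIdem,
      mul_assoc]
  have h2 : wCross k j * wX k l * wIdem k p =
      wCross k j * wDot k (p.succAbove l) * wIdem k p := by
    rw [mul_assoc, wX_mul_wIdem, mul_assoc]
  rw [h1, h2]
  have hs := swap_castSucc_succ_val j p
  have hp := succAbove_val p l
  have hp' := succAbove_val (Equiv.swap j.castSucc j.succ p) l
  by_cases hpj : p = j.castSucc ∨ p = j.succ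
  · by_cases hlj : l = j
    · subst hlj
      rcases hpj with hp0 | hp0
      · subst hp0
        have e1 : l.castSucc.succAbove l = l.succ := Fin.ext (by simp)
        have e2 : (Equiv.swap l.castSucc l.succ l.castSucc).succAbove l = l.castSucc :=
          Fin.ext (by rw [hp', hs]; simp)
        rw [e1, e2]
        simpa [wIdem, wCross, wDot] using Web.mk_rel (WRel.dot_cross (k := k) l l.castSucc)
      · subst hp0
        have e1 : l.succ.succAbove l = l.castSucc := Fin.ext (by simp)
        have e2 : (Equiv.swap l.castSucc l.succ l.succ).succAbove l = l.succ :=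
          Fin.ext (by rw [hp', hs]; simp)
        rw [e1, e2]
        simpa [wIdem, wCross, wDot] using
          (Web.mk_rel (WRel.cross_dot (k := k) l l.succ)).symm
    · have hlj' : l.val ≠ j.val := fun e => hlj (Fin.ext e)
      have hpv : p.val = j.val ∨ p.val = j.val + 1 := by
        rcases hpj with rfl | rfl <;> simp
      have e : (Equiv.swap j.castSucc j.succ p).succAbove l = p.succAbove l := by
        apply Fin.ext
        rw [hp, hp', hs]
        split_ifs <;> omega
      have f1 : p.succAbove l ≠ j.castSucc := by
        intro e; have := congrArg Fin.val e; rw [hp, Fin.val_castSucc] at this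
        split_ifs at this <;> omega
      have f2 : p.succAbove l ≠ j.succ := by
        intro e; have := congrArg Fin.val e; rw [hp, Fin.val_succ] at this
        split_ifs at this <;> omega
      have := Web.mk_rel (WRel.cross_dot_far (k := k) j (p.succAbove l) p f1 f2)
      simp only [map_mul] at this
      change wCross k j * wIdem k p * (wDot k _ * wIdem k p) =
        wDot k _ * wIdem k _ * (wCross k j * wIdem k p) at this
      rw [e, mul_assoc (wCross k j), wDot_mul_wIdem, ← mul_assoc]
      rw [wDot_mul_wIdem, mul_assoc (wCross k j), ← mul_assoc (wIdem k p), wIdem_mul_self,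
        ← mul_assoc, mul_assoc (wDot k _), wCross_mul_wIdem, ← mul_assoc (wIdem k _),
        wIdem_mul_self, ← wCross_mul_wIdem, ← mul_assoc] at this
      exact this.symm
  · push Not at hpj
    rw [mul_assoc, wCross_mul_wIdem_eq_zero hpj.1 hpj.2, mul_assoc, wDot_mul_wIdem, ← mul_assoc,
      wCross_mul_wIdem_eq_zero hpj.1 hpj.2, mul_zero, zero_mul]

/-- A dot on a red strand is central: it slides along its strand through every crossing. -/
theorem wX_central (l : Fin n) (w : Web k n) : wX k l * w = w * wX k l :=
  commute_of_generators (Web.mk k n) Web.mk_surjective (wX k l)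
    (fun x => by
      cases x <;> [exact wX_mul_wIdem_comm l _; exact wX_mul_wDot l _; exact wX_mul_wCross l _]) w

variable (k n)

/-- The vertex `i` of `W(n,1)`, with vertices as in `A_n^!`; zero if `n ≤ i`. -/
def wE (i : ℕ) : Web k n := if h : i < n then wIdem k (Fin.succ ⟨i, h⟩) else 0

/-- The crossing from the vertex `q` to the vertex `q + 1`; zero if `n ≤ q + 1`. -/
def wU (q : ℕ) : Web k n :=
  if h : q + 1 < n then wCross k ⟨q + 1, h⟩ * wIdem k (Fin.castSucc ⟨q + 1, h⟩) else 0

/-- The crossing from the vertex `q + 1` to the vertex `q`; zero if `n ≤ q + 1`. -/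
def wD (q : ℕ) : Web k n :=
  if h : q + 1 < n then wCross k ⟨q + 1, h⟩ * wIdem k (Fin.succ ⟨q + 1, h⟩) else 0

/-- The central element `x_i`; zero if `n ≤ i`. -/
def wXN (i : ℕ) : Web k n := if h : i < n then wX k ⟨i, h⟩ else 0

variable {k n}

theorem wE_of_lt {i : ℕ} (h : i < n) : wE k n i = wIdem k (Fin.succ ⟨i, h⟩) := dif_pos h

theorem wU_of_lt {q : ℕ} (h : q + 1 < n) :
    wU k n q = wCross k ⟨q + 1, h⟩ * wIdem k (Fin.castSucc ⟨q + 1, h⟩) := dif_pos h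

theorem wD_of_lt {q : ℕ} (h : q + 1 < n) :
    wD k n q = wCross k ⟨q + 1, h⟩ * wIdem k (Fin.succ ⟨q + 1, h⟩) := dif_pos h

theorem wXN_of_lt {i : ℕ} (h : i < n) : wXN k n i = wX k ⟨i, h⟩ := dif_pos h

theorem wXN_central (i : ℕ) (w : Web k n) : wXN k n i * w = w * wXN k n i := by
  unfold wXN
  split_ifs
  · exact wX_central _ w
  · simp

theorem wE_mul_wU {q : ℕ} : wE k n (q + 1) * wU k n q = wU k n q := by
  by_cases h : q + 1 < n
  · rw [wE_of_lt h, wU_of_lt h, wCross_mul_wIdem, Equiv.swap_apply_left, ← mul_assoc,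
      wIdem_mul_self]
  · simp [wU, h]

theorem wU_mul_wE {q : ℕ} : wU k n q * wE k n q = wU k n q := by
  by_cases h : q + 1 < n
  · have e : Fin.castSucc (⟨q + 1, h⟩ : Fin n) = Fin.succ ⟨q, by omega⟩ := rfl
    rw [wE_of_lt (by omega), wU_of_lt h, e, mul_assoc, wIdem_mul_self]
  · simp [wU, h]

theorem wE_mul_wD {q : ℕ} : wE k n q * wD k n q = wD k n q := by
  by_cases h : q + 1 < n
  · have e : Fin.castSucc (⟨q + 1, h⟩ : Fin n) = Fin.succ ⟨q, by omega⟩ := rfl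
    rw [wE_of_lt (by omega), wD_of_lt h, wCross_mul_wIdem, Equiv.swap_apply_right, e, ← mul_assoc,
      wIdem_mul_self]
  · simp [wD, h]

theorem wD_mul_wE {q : ℕ} : wD k n q * wE k n (q + 1) = wD k n q := by
  by_cases h : q + 1 < n
  · rw [wE_of_lt h, wD_of_lt h, mul_assoc, wIdem_mul_self]
  · simp [wD, h]

theorem wU_mul_wD {q : ℕ} (h : q + 1 < n) : wU k n q * wD k n q =
    (-wDot k (Fin.castSucc ⟨q + 1, h⟩) + wDot k (Fin.succ ⟨q + 1, h⟩)) *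
      wIdem k (Fin.succ ⟨q + 1, h⟩) := by
  rw [← wCross_sq_succ, wU_of_lt h, wD_of_lt h, mul_assoc, wCross_mul_wIdem ⟨q + 1, h⟩ (Fin.succ _),
    Equiv.swap_apply_right, ← mul_assoc (wIdem k _), wIdem_mul_self, mul_assoc (wCross k _),
    wCross_mul_wIdem ⟨q + 1, h⟩ (Fin.succ _), Equiv.swap_apply_right]

theorem wD_mul_wU {q : ℕ} (h : q + 1 < n) : wD k n q * wU k n q =
    (wDot k (Fin.castSucc ⟨q + 1, h⟩) - wDot k (Fin.succ ⟨q + 1, h⟩)) *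
      wIdem k (Fin.castSucc ⟨q + 1, h⟩) := by
  rw [← wCross_sq_castSucc, wU_of_lt h, wD_of_lt h, mul_assoc,
    wCross_mul_wIdem ⟨q + 1, h⟩ (Fin.castSucc _),
    Equiv.swap_apply_left, ← mul_assoc (wIdem k _), wIdem_mul_self, mul_assoc (wCross k _),
    wCross_mul_wIdem ⟨q + 1, h⟩ (Fin.castSucc _), Equiv.swap_apply_left]

theorem wXN_mul_wE {i v : ℕ} (hi : i < n) (hv : v < n) : wXN k n i * wE k n v =
    wDot k ⟨if i ≤ v then i else i + 1, by split_ifs <;> omega⟩ * wE k n v := by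
  rw [wXN_of_lt hi, wE_of_lt hv, wX_mul_wIdem]
  congr 2
  apply Fin.ext
  rw [succAbove_val]
  simp only [Fin.val_succ, Nat.lt_succ_iff]

theorem wCross_zero (h : 0 < n) : wCross k (⟨0, h⟩ : Fin n) = 0 := by
  refine web_ext_right fun p => ?_
  rw [zero_mul]
  have e : Fin.castSucc (⟨0, h⟩ : Fin n) = 0 := rfl
  by_cases h1 : p = 0
  · rw [h1, wIdem_zero, mul_zero]
  · by_cases h2 : p = Fin.succ ⟨0, h⟩
    · rw [h2, wCross_mul_wIdem, Equiv.swap_apply_right, e, wIdem_zero, zero_mul]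
    · exact wCross_mul_wIdem_eq_zero h1 h2

variable (k n) in
/-- The generators of `W(n,1)` satisfy the relations of the presentation by vertices, arrows and
central elements. -/
theorem wRep_web : WRep n (wE k n) (wU k n) (wD k n) (wXN k n) where
  E_of_le i hi := dif_neg (by omega)
  U_of_le q hq := dif_neg (by omega)
  D_of_le q hq := dif_neg (by omega)
  E_mul i j := by
    by_cases hi : i < n
    · by_cases hj : j < n
      · rw [wE_of_lt hi, wE_of_lt hj]
        split_ifs with hij
        · subst hij; exact wIdem_mul_self _
        · exact wIdem_mul_of_ne (by simpa [Fin.ext_iff] using hij)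
      · simp [wE, hj]
    · simp only [wE, hi, dif_neg, not_false_iff, zero_mul]
      split_ifs <;> first | rfl | omega
  one := by
    rw [← sum_wIdem, Fin.sum_univ_succ, wIdem_zero, zero_add, Finset.sum_range]
    exact Finset.sum_congr rfl fun i _ => wE_of_lt i.isLt
  E_U _ := wE_mul_wU
  U_E _ := wU_mul_wE
  E_D _ := wE_mul_wD
  D_E _ := wD_mul_wE
  X_E i _ := wXN_central i _
  X_U i _ := wXN_central i _
  X_D i _ := wXN_central i _
  X_X i _ := wXN_central i _
  D_U_zero h := by
    have h0 := wCross_sq_succ (k := k) (⟨0, by omega⟩ : Fin n)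
    rw [wCross_zero, zero_mul, zero_mul, add_mul, neg_mul] at h0
    have h0 := (neg_add_eq_zero.1 h0.symm).symm
    rw [wD_mul_wU h, sub_mul, sub_mul, wXN_mul_wE (by omega) (by omega),
      wXN_mul_wE (by omega) (by omega), wE_of_lt (by omega)]
    exact congrArg₂ (· - ·) h0 rfl
  D_U_succ r h := by
    rw [wD_mul_wU h, wU_mul_wD (by omega), sub_mul, sub_mul, wXN_mul_wE (by omega) (by omega),
      wXN_mul_wE (by omega) (by omega), wE_of_lt (by omega)]
    simp only [le_refl, if_true, if_neg (show ¬ (r + 2 ≤ r + 1) by omega)]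
    rw [add_mul, neg_mul]
    change wDot k (⟨r + 2, _⟩ : Fin (n + 1)) * wIdem k (⟨r + 2, _⟩ : Fin (n + 1)) -
      wDot k (⟨r + 3, _⟩ : Fin (n + 1)) * wIdem k (⟨r + 2, _⟩ : Fin (n + 1)) =
      -(wDot k (⟨r + 1, _⟩ : Fin (n + 1)) * wIdem k (⟨r + 2, _⟩ : Fin (n + 1))) +
      wDot k (⟨r + 2, _⟩ : Fin (n + 1)) * wIdem k (⟨r + 2, _⟩ : Fin (n + 1)) +
      (wDot k (⟨r + 1, _⟩ : Fin (n + 1)) * wIdem k (⟨r + 2, _⟩ : Fin (n + 1)) -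
      wDot k (⟨r + 3, _⟩ : Fin (n + 1)) * wIdem k (⟨r + 2, _⟩ : Fin (n + 1)))
    abel

theorem wIdem_eq (p : Fin (n + 1)) : wIdem k p = WRep.idemVal (wE k n) p := by
  cases p using Fin.cases with
  | zero => exact wIdem_zero
  | succ i => exact (wE_of_lt i.isLt).symm

theorem wCross_eq (j : Fin n) : wCross k j = WRep.crossVal (wU k n) (wD k n) j := by
  refine web_ext_right fun p => ?_
  rw [wIdem_eq, (wRep_web k n).crossVal_idemVal, ← wIdem_eq]
  obtain ⟨j, hj⟩ := j
  rcases j with _ | q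
  · simp [wCross_zero]
  rw [if_neg (by simp)]
  split_ifs with h1 h2
  · rw [Nat.add_sub_cancel, wU_of_lt hj]
    congr 2
    exact Fin.ext h1
  · rw [Nat.add_sub_cancel, wD_of_lt hj]
    congr 2
    exact Fin.ext h2
  · exact wCross_mul_wIdem_eq_zero (fun e => h1 (congrArg Fin.val e))
      (fun e => h2 (congrArg Fin.val e))

theorem wDot_eq (s : Fin (n + 1)) :
    wDot k s = WRep.dotVal n (wE k n) (wU k n) (wD k n) (wXN k n) s := by
  refine web_ext_right fun p => ?_
  cases p using Fin.cases with
  | zero => simp [wIdem_zero]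
  | succ v =>
    obtain ⟨v, hv⟩ := v
    rw [← wE_of_lt hv, (wRep_web k n).dotVal_E, WRep.dotAt]
    split_ifs with h1 h2
    · rcases v with _ | q
      · have h0 := wCross_sq_succ (k := k) (⟨0, by omega⟩ : Fin n)
        rw [wCross_zero, zero_mul, zero_mul, add_mul, neg_mul] at h0
        have h0 := (neg_add_eq_zero.1 h0.symm).symm
        rw [WRep.dotBlack, wXN_mul_wE (by omega) (by omega), wE_of_lt hv]
        refine Eq.trans ?_ h0
        congr 2
        exact Fin.ext h1
      · rw [WRep.dotBlack, wXN_mul_wE (by omega) (by omega), wU_mul_wD hv, add_mul, neg_mul,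
          wE_of_lt hv]
        have e : s = Fin.succ ⟨q + 1, hv⟩ := Fin.ext h1
        rw [e]
        simp only [le_refl, if_true]
        change _ = -(wDot k (⟨q + 1, _⟩ : Fin (n + 1)) * _) + _ + wDot k (⟨q + 1, _⟩ : Fin (n + 1)) * _
        abel
    · rw [wXN_mul_wE (by omega) hv]
      congr 2
      apply Fin.ext
      simp [h2]
    · rw [wXN_mul_wE (by omega) hv]
      congr 2
      apply Fin.ext
      simp only
      split_ifs <;> omega

/-- A subspace that is stable under vertices, arrows and red dots is a left ideal. -/
theorem web_mul_mem (S : Submodule k (Web k n)) (hE : ∀ i, ∀ s ∈ S, wE k n i * s ∈ S)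
    (hU : ∀ q, ∀ s ∈ S, wU k n q * s ∈ S) (hD : ∀ q, ∀ s ∈ S, wD k n q * s ∈ S)
    (hX : ∀ i, ∀ s ∈ S, wXN k n i * s ∈ S) (w : Web k n) : ∀ s ∈ S, w * s ∈ S := by
  refine mul_mem_of_generators (Web.mk k n) Web.mk_surjective S (fun x => ?_) w
  have hB : ∀ v, ∀ s ∈ S, WRep.dotBlack (wE k n) (wU k n) (wD k n) (wXN k n) v * s ∈ S := by
    intro v s hs
    rcases v with _ | v
    · rw [WRep.dotBlack, mul_assoc]; exact hX _ _ (hE _ _ hs)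
    · rw [WRep.dotBlack, add_mul, mul_assoc, mul_assoc]
      exact S.add_mem (hU _ _ (hD _ _ hs)) (hX _ _ (hE _ _ hs))
  cases x with
  | idem p =>
    intro s hs
    change wIdem k p * s ∈ S
    rw [wIdem_eq]
    rcases p.val with _ | i
    · simp [WRep.idemVal]
    · exact hE i s hs
  | dot j =>
    intro s hs
    change wDot k j * s ∈ S
    rw [wDot_eq, WRep.dotVal, Finset.sum_mul]
    refine S.sum_mem fun v _ => ?_
    rw [WRep.dotAt]
    split_ifs
    · exact hB v s hs
    · rw [mul_assoc]; exact hX _ _ (hE _ _ hs)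
    · rw [mul_assoc]; exact hX _ _ (hE _ _ hs)
  | cross j =>
    intro s hs
    change wCross k j * s ∈ S
    rw [wCross_eq]
    rcases j.val with _ | q
    · simp [WRep.crossVal]
    · rw [WRep.crossVal, add_mul]
      exact S.add_mem (hU _ _ hs) (hD _ _ hs)

end WebGenerators

/-! ### Paths in `W(n,1)` -/

section WebPaths

variable {k : Type u} [Field k] {n : ℕ} {B : Type v} [Ring B]

/-- The path that goes up from `l` to `l + x`. -/
def pathUp (E U : ℕ → B) : ℕ → ℕ → B
  | 0, l => E l
  | x + 1, l => U (l + x) * pathUp E U x l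

/-- The path that goes down from `l + y` to `l`. -/
def pathDown (E D : ℕ → B) : ℕ → ℕ → B
  | 0, l => E l
  | y + 1, l => pathDown E D y l * D (l + y)

namespace WRep

variable {E U D X : ℕ → B} (h : WRep n E U D X)
include h

theorem E_pathUp (x l : ℕ) : E (l + x) * pathUp E U x l = pathUp E U x l := by
  cases x with
  | zero => exact h.E_self l
  | succ x => rw [pathUp, ← mul_assoc, ← add_assoc, h.E_U]

theorem pathDown_E (y l : ℕ) : pathDown E D y l * E (l + y) = pathDown E D y l := by
  cases y with
  | zero => exact h.E_self l
  | succ y => rw [pathDown, mul_assoc, ← add_assoc, h.D_E]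

theorem pathDown_succ' (y l : ℕ) :
    pathDown E D (y + 1) l = D l * pathDown E D y (l + 1) := by
  induction y with
  | zero => rw [pathDown, pathDown, pathDown, add_zero, h.E_D, h.D_E]
  | succ y ih => rw [pathDown, ih, pathDown, mul_assoc]; congr 3; omega

/-- A step down commutes with a climb up to a correction by a shorter climb. If `x = 0`, the
correction vanishes because its coefficient does. -/
theorem D_pathUp (x l : ℕ) (hx : l + x + 1 < n) :
    D (l + x) * pathUp E U x (l + 1) =
      pathUp E U x l * D l + (X (l + 1) - X (l + x + 1)) * pathUp E U (x - 1) (l + 1) := by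
  induction x with
  | zero => simp [pathUp, h.E_D, h.D_E]
  | succ x ih =>
    have e : l + 1 + x = l + x + 1 := by omega
    have e' : D (l + x + 1) * U (l + x + 1) = _ := h.D_U_succ (l + x) (by omega)
    have key : U (l + x) * ((X (l + 1) - X (l + x + 1)) * pathUp E U (x - 1) (l + 1)) =
        (X (l + 1) - X (l + x + 1)) * pathUp E U x (l + 1) := by
      rcases x with _ | x
      · simp
      · rw [← mul_assoc, mul_sub, ← h.X_U, ← h.X_U, ← sub_mul, mul_assoc, Nat.add_sub_cancel,
          pathUp]
        congr 3; omega
    have hE := h.E_pathUp x (l + 1)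
    rw [e] at hE
    rw [pathUp, pathUp, ← mul_assoc, e, ← add_assoc l x 1, e', add_mul, mul_assoc, ih (by omega),
      mul_add, key, mul_assoc, hE, Nat.add_sub_cancel, ← mul_assoc, add_assoc, ← add_mul]
    congr 2
    abel

theorem D_pathUp_zero (x : ℕ) (hx : x + 1 < n) :
    D x * pathUp E U (x + 1) 0 = (X 0 - X (x + 1)) * pathUp E U x 0 := by
  induction x with
  | zero =>
    rw [pathUp, pathUp, ← mul_assoc, add_zero, h.D_U_zero hx, mul_assoc, pathUp, h.E_self]
  | succ x ih =>
    have hE := h.E_pathUp (x + 1) 0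
    rw [zero_add] at hE
    rw [pathUp, ← mul_assoc, zero_add, h.D_U_succ x hx, add_mul, mul_assoc, ih (by omega),
      ← mul_assoc, mul_sub, ← h.X_U, ← h.X_U, ← sub_mul, mul_assoc, mul_assoc, hE, pathUp,
      zero_add, ← add_mul]
    congr 1
    abel

end WRep

variable (k n)

/-- The lift to `W(n,1)` of a basis path of `A_n^!` by the path of the same name. -/
def webPath (x l y : ℕ) : Web k n := pathUp (wE k n) (wU k n) x l * pathDown (wE k n) (wD k n) y l

/-- The section on the basis of `A_n^!`. A loop of length two lifts to a dot on the black strand;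
all other basis paths lift to the path of the same name. -/
def webSec (x l y : ℕ) : Web k n :=
  if x = 1 ∧ y = 1 then webPath k n 1 l 1 + wXN k n (l + 1) * wE k n (l + 1)
  else webPath k n x l y

/-- The linear section of the projection of `W(n,1)` onto `A_n^!`. -/
def webSection : AShriek k n →ₗ[k] Web k n := valleyMap (webSec k n)

variable {k n}

theorem webPath_zero (l : ℕ) : webPath k n 0 l 0 = wE k n l := by
  rw [webPath, pathUp, pathDown, (wRep_web k n).E_self]

theorem wE_mul_webPath (x l y : ℕ) : wE k n (l + x) * webPath k n x l y = webPath k n x l y := by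
  rw [webPath, ← mul_assoc, (wRep_web k n).E_pathUp]

theorem webPath_mul_wE (x l y : ℕ) : webPath k n x l y * wE k n (l + y) = webPath k n x l y := by
  rw [webPath, mul_assoc, (wRep_web k n).pathDown_E]

theorem webPath_of_le {x l y : ℕ} (h : n ≤ l + x ∨ n ≤ l + y) : webPath k n x l y = 0 := by
  rcases h with h | h
  · rw [← wE_mul_webPath, (wRep_web k n).E_of_le _ h, zero_mul]
  · rw [← webPath_mul_wE, (wRep_web k n).E_of_le _ h, mul_zero]

theorem wU_mul_webPath (x l y : ℕ) :
    wU k n (l + x) * webPath k n x l y = webPath k n (x + 1) l y := by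
  rw [webPath, webPath, pathUp, mul_assoc]

theorem wD_mul_webPath_succ (x l y : ℕ) (h : l + x + 1 < n) :
    wD k n (l + x) * webPath k n x (l + 1) y = webPath k n x l (y + 1) +
      (wXN k n (l + 1) - wXN k n (l + x + 1)) * webPath k n (x - 1) (l + 1) y := by
  rw [webPath, ← mul_assoc, (wRep_web k n).D_pathUp x l h, add_mul, webPath, webPath,
    (wRep_web k n).pathDown_succ', mul_assoc, mul_assoc]

theorem wD_mul_webPath_zero (x y : ℕ) (h : x + 1 < n) :
    wD k n x * webPath k n (x + 1) 0 y =
      (wXN k n 0 - wXN k n (x + 1)) * webPath k n x 0 y := by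
  rw [webPath, ← mul_assoc, (wRep_web k n).D_pathUp_zero x h, webPath, mul_assoc]

theorem webSec_of_ne {x l y : ℕ} (h : ¬ (x = 1 ∧ y = 1)) : webSec k n x l y = webPath k n x l y :=
  if_neg h

theorem webSec_one_one (l : ℕ) :
    webSec k n 1 l 1 = webPath k n 1 l 1 + wXN k n (l + 1) * wE k n (l + 1) := if_pos ⟨rfl, rfl⟩

/-! The monomials in the central elements. -/

/-- The central element `x_l`, as an element of the center. -/
def centralVar (l : Fin n) : Subalgebra.center k (Web k n) :=
  ⟨wX k l, Subalgebra.mem_center_iff.2 fun w => (wX_central l w).symm⟩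

theorem wMonomial_eq (α : Fin n →₀ ℕ) :
    wMonomial k α = ((∏ l, centralVar (k := k) l ^ α l : Subalgebra.center k (Web k n)) :
      Web k n) := by
  rw [wMonomial, ← List.prod_ofFn]
  change _ = (Subalgebra.center k (Web k n)).val _
  rw [map_list_prod, List.map_ofFn]
  rfl

theorem wMonomial_central (α : Fin n →₀ ℕ) (w : Web k n) :
    wMonomial k α * w = w * wMonomial k α := by
  rw [wMonomial_eq]
  exact (Subalgebra.mem_center_iff.1 (Subtype.property _) w).symm

theorem wMonomial_zero : wMonomial k (0 : Fin n →₀ ℕ) = 1 := by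
  rw [wMonomial_eq]; simp

theorem wMonomial_add (α β : Fin n →₀ ℕ) :
    wMonomial k (α + β) = wMonomial k α * wMonomial k β := by
  simp only [wMonomial_eq, Finsupp.add_apply, pow_add, Finset.prod_mul_distrib]
  rfl

theorem wMonomial_single (i : Fin n) : wMonomial k (Finsupp.single i 1) = wX k i := by
  rw [wMonomial_eq, Finset.prod_eq_single i]
  · simp [centralVar]
  · intro j _ hj
    rw [Finsupp.single_eq_of_ne hj, pow_zero]
  · simp

/-! The grading of `W(n,1)`, with `x_l` in degree `2`. -/

variable (k n) in
/-- The span of the products of monomials in the `x_l` and lifts of basis paths of total degree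
`d`. -/
def webSpan (d : ℤ) : Submodule k (Web k n) :=
  Submodule.span k {z | ∃ (α : Fin n →₀ ℕ) (x l y : ℕ), l + x < n ∧ l + y < n ∧
    (2 * α.degree + x + y : ℤ) = d ∧ z = wMonomial k α * webSec k n x l y}

theorem webSec_mem_webSpan {x l y : ℕ} (hx : l + x < n) (hy : l + y < n) :
    webSec k n x l y ∈ webSpan k n (x + y) :=
  Submodule.subset_span ⟨0, x, l, y, hx, hy, by simp, by rw [wMonomial_zero, one_mul]⟩

theorem wMonomial_mul_mem (β : Fin n →₀ ℕ) {d d' : ℤ} {z : Web k n} (hz : z ∈ webSpan k n d)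
    (hd : 2 * β.degree + d = d') : wMonomial k β * z ∈ webSpan k n d' := by
  induction hz using Submodule.span_induction with
  | mem z hz =>
    obtain ⟨α, x, l, y, hx, hy, hαd, rfl⟩ := hz
    refine Submodule.subset_span ⟨β + α, x, l, y, hx, hy, ?_, ?_⟩
    · rw [map_add]; push_cast; linarith
    · rw [wMonomial_add, mul_assoc]
  | zero => rw [mul_zero]; exact Submodule.zero_mem _
  | add x y _ _ hx hy => rw [mul_add]; exact Submodule.add_mem _ hx hy
  | smul c x _ hx => rw [mul_smul_comm]; exact Submodule.smul_mem _ _ hx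

theorem wXN_mul_mem (i : ℕ) {d d' : ℤ} {z : Web k n} (hz : z ∈ webSpan k n d) (hd : d + 2 = d') :
    wXN k n i * z ∈ webSpan k n d' := by
  by_cases hi : i < n
  · rw [wXN_of_lt hi, ← wMonomial_single]
    exact wMonomial_mul_mem _ hz (by rw [Finsupp.degree_single]; push_cast; linarith)
  · rw [wXN, dif_neg hi, zero_mul]; exact Submodule.zero_mem _

theorem wE_mem_webSpan (i : ℕ) : wE k n i ∈ webSpan k n 0 := by
  by_cases hi : i < n
  · have := webSec_mem_webSpan (k := k) (x := 0) (l := i) (y := 0) hi hi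
    rwa [webSec_of_ne (by simp), webPath_zero] at this
  · rw [(wRep_web k n).E_of_le i (by omega)]; exact Submodule.zero_mem _

theorem webPath_mem_webSpan {x l y : ℕ} {d : ℤ} (hd : (x + y : ℤ) = d) :
    webPath k n x l y ∈ webSpan k n d := by
  subst hd
  by_cases h : l + x < n ∧ l + y < n
  · by_cases h1 : x = 1 ∧ y = 1
    · obtain ⟨rfl, rfl⟩ := h1
      have := webSec_mem_webSpan (k := k) h.1 h.2
      rw [webSec_one_one] at this
      exact (Submodule.add_mem_iff_left _
        (wXN_mul_mem (l + 1) (wE_mem_webSpan (l + 1)) (by norm_num))).1 this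
    · rw [← webSec_of_ne h1]
      exact webSec_mem_webSpan h.1 h.2
  · rw [webPath_of_le (by omega)]; exact Submodule.zero_mem _

/-- An element that multiplies paths into the span, raising degrees by `c`, multiplies the whole
span into itself. -/
theorem mul_mem_webSpan {a : Web k n} {c : ℤ}
    (ha : ∀ x l y : ℕ, a * webPath k n x l y ∈ webSpan k n (c + (x + y))) {d d' : ℤ} {z : Web k n}
    (hz : z ∈ webSpan k n d) (hd : c + d = d') : a * z ∈ webSpan k n d' := by
  subst hd
  induction hz using Submodule.span_induction with
  | mem z hz =>
    obtain ⟨α, x, l, y, hx, hy, rfl, rfl⟩ := hz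
    rw [← mul_assoc, ← wMonomial_central, mul_assoc]
    refine wMonomial_mul_mem α (d := c + (x + y)) ?_ (by ring)
    by_cases h1 : x = 1 ∧ y = 1
    · obtain ⟨rfl, rfl⟩ := h1
      rw [webSec_one_one, mul_add, ← webPath_zero, ← mul_assoc, ← wXN_central, mul_assoc]
      refine Submodule.add_mem _ (ha _ _ _) (wXN_mul_mem _ (ha _ _ _) ?_)
      push_cast; ring
    · rw [webSec_of_ne h1]; exact ha _ _ _
  | zero => rw [mul_zero]; exact Submodule.zero_mem _
  | add x y _ _ hx hy => rw [mul_add]; exact Submodule.add_mem _ hx hy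
  | smul c x _ hx => rw [mul_smul_comm]; exact Submodule.smul_mem _ _ hx

theorem wE_mul_mem (i : ℕ) {d : ℤ} {z : Web k n} (hz : z ∈ webSpan k n d) :
    wE k n i * z ∈ webSpan k n d := by
  refine mul_mem_webSpan (c := 0) (fun x l y => ?_) hz (zero_add d)
  rw [← wE_mul_webPath, ← mul_assoc, (wRep_web k n).E_mul]
  split_ifs with h
  · rw [wE_mul_webPath]; exact webPath_mem_webSpan (by ring)
  · rw [zero_mul]; exact Submodule.zero_mem _

theorem wU_mul_mem (q : ℕ) {d d' : ℤ} {z : Web k n} (hz : z ∈ webSpan k n d) (hd : d + 1 = d') :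
    wU k n q * z ∈ webSpan k n d' := by
  refine mul_mem_webSpan (c := 1) (fun x l y => ?_) hz (by linarith)
  by_cases h : q = l + x
  · subst h
    rw [wU_mul_webPath]; exact webPath_mem_webSpan (by push_cast; ring)
  · rw [← wE_mul_webPath, ← mul_assoc, (wRep_web k n).U_E_of_ne h, zero_mul]
    exact Submodule.zero_mem _

theorem wD_mul_mem (q : ℕ) {d d' : ℤ} {z : Web k n} (hz : z ∈ webSpan k n d) (hd : d + 1 = d') :
    wD k n q * z ∈ webSpan k n d' := by
  refine mul_mem_webSpan (c := 1) (fun x l y => ?_) hz (by linarith)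
  by_cases hq : q + 1 < n
  swap
  · rw [(wRep_web k n).D_of_le q (by omega), zero_mul]; exact Submodule.zero_mem _
  by_cases h : q + 1 = l + x
  swap
  · rw [← wE_mul_webPath, ← mul_assoc, (wRep_web k n).D_E_of_ne h, zero_mul]
    exact Submodule.zero_mem _
  rcases l with _ | l
  · obtain rfl : x = q + 1 := by omega
    rw [wD_mul_webPath_zero q y hq, sub_mul]
    refine Submodule.sub_mem _ ?_ ?_ <;>
      exact wXN_mul_mem _ (webPath_mem_webSpan rfl) (by push_cast; ring)
  · obtain rfl : q = l + x := by omega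
    rw [wD_mul_webPath_succ x l y hq]
    refine Submodule.add_mem _ (webPath_mem_webSpan (by push_cast; ring)) ?_
    rcases x with _ | x
    · rw [add_zero, sub_self, zero_mul]; exact Submodule.zero_mem _
    · rw [sub_mul]
      refine Submodule.sub_mem _ ?_ ?_ <;>
        exact wXN_mul_mem _ (webPath_mem_webSpan rfl) (by push_cast; ring)

theorem pathUp_mul_mem (x l : ℕ) {d d' : ℤ} {z : Web k n} (hz : z ∈ webSpan k n d)
    (hd : x + d = d') : pathUp (wE k n) (wU k n) x l * z ∈ webSpan k n d' := by
  induction x generalizing d' with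
  | zero =>
    obtain rfl : d = d' := by simpa using hd
    exact wE_mul_mem l hz
  | succ x ih =>
    rw [pathUp, mul_assoc]
    exact wU_mul_mem _ (ih rfl) (by rw [← hd]; push_cast; ring)

theorem pathDown_mul_mem (y l : ℕ) {d d' : ℤ} {z : Web k n} (hz : z ∈ webSpan k n d)
    (hd : y + d = d') : pathDown (wE k n) (wD k n) y l * z ∈ webSpan k n d' := by
  induction y generalizing d' l with
  | zero =>
    obtain rfl : d = d' := by simpa using hd
    exact wE_mul_mem l hz
  | succ y ih =>
    rw [(wRep_web k n).pathDown_succ', mul_assoc]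
    exact wD_mul_mem _ (ih (l + 1) rfl) (by rw [← hd]; push_cast; ring)

theorem webSec_mul_mem (x l y : ℕ) {d : ℤ} {z : Web k n} (hz : z ∈ webSpan k n d) :
    webSec k n x l y * z ∈ webSpan k n (x + y + d) := by
  have key : webPath k n x l y * z ∈ webSpan k n (x + y + d) := by
    rw [webPath, mul_assoc]
    exact pathUp_mul_mem x l (pathDown_mul_mem y l hz rfl) (by ring)
  by_cases h1 : x = 1 ∧ y = 1
  · obtain ⟨rfl, rfl⟩ := h1
    rw [webSec_one_one, add_mul, mul_assoc]
    exact Submodule.add_mem _ key (wXN_mul_mem _ (wE_mul_mem _ hz) (by push_cast; ring))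
  · rwa [webSec_of_ne h1]

variable (k n) in
/-- The products of monomials in the `x_l` and lifts of basis paths span `W(n,1)`. -/
theorem iSup_webSpan : ⨆ d, webSpan k n d = ⊤ := by
  rw [eq_top_iff]
  intro w _
  have key : ∀ (a : Web k n) (c : ℤ), (∀ d, ∀ z ∈ webSpan k n d, a * z ∈ webSpan k n (d + c)) →
      ∀ z ∈ ⨆ d, webSpan k n d, a * z ∈ ⨆ d, webSpan k n d := by
    intro a c ha z hz
    induction hz using Submodule.iSup_induction' with
    | mem d z hz => exact Submodule.mem_iSup_of_mem _ (ha d z hz)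
    | zero => rw [mul_zero]; exact Submodule.zero_mem _
    | add x y _ _ hx hy => rw [mul_add]; exact Submodule.add_mem _ hx hy
  rw [← mul_one w]
  refine web_mul_mem _ (fun i => key _ 0 fun d z hz => ?_) (fun q => key _ 1 fun d z hz => ?_)
    (fun q => key _ 1 fun d z hz => ?_) (fun i => key _ 2 fun d z hz => ?_) w 1 ?_
  · rw [add_zero]; exact wE_mul_mem i hz
  · exact wU_mul_mem q hz rfl
  · exact wD_mul_mem q hz rfl
  · exact wXN_mul_mem i hz rfl
  · rw [← (wRep_web k n).one]
    exact Submodule.sum_mem _ fun i _ => Submodule.mem_iSup_of_mem 0 (wE_mem_webSpan i)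

end WebPaths

/-! ### Polynomial representations of `W(n,1)` -/

section PolynomialRep

variable (k : Type u) [Field k] (n : ℕ)

/-- The variable `x_i`; zero if `n ≤ i`. -/
def varN (i : ℕ) : MvPolynomial (Fin n) k := if h : i < n then MvPolynomial.X ⟨i, h⟩ else 0

variable (r : ℕ)

/-- The vertices from `r` on. -/
abbrev FromIdx : Type := {v : ℕ // r ≤ v ∧ v < n}

/-- Endomorphisms of the polynomial-valued functions on the vertices from `r` on. -/
abbrev FromEnd : Type u :=
  Module.End (MvPolynomial (Fin n) k) (FromIdx n r → MvPolynomial (Fin n) k)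

/-- The action of a vertex. -/
def fromE (q : ℕ) : FromEnd k n r where
  toFun f p := if q = p.1 then f p else 0
  map_add' f g := by ext1 p; simp; split_ifs <;> simp
  map_smul' c f := by ext1 p; simp

/-- The action of an upward arrow: multiplication by a difference of two variables. -/
def fromU (q : ℕ) : FromEnd k n r where
  toFun f p := if h : q + 1 = p.1 ∧ r ≤ q then
    (varN k n r - varN k n (q + 1)) * f ⟨q, by have := p.2; omega⟩ else 0
  map_add' f g := by ext1 p; simp; split_ifs <;> simp [mul_add]
  map_smul' c f := by ext1 p; simp; split_ifs <;> simp [mul_left_comm]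

/-- The action of a downward arrow. -/
def fromD (q : ℕ) : FromEnd k n r where
  toFun f p := if h : q = p.1 ∧ q + 1 < n then f ⟨q + 1, by have := p.2; omega⟩ else 0
  map_add' f g := by ext1 p; simp; split_ifs <;> simp
  map_smul' c f := by ext1 p; simp

/-- The action of a red dot. -/
def fromX (i : ℕ) : FromEnd k n r := algebraMap _ _ (varN k n i)

theorem fromX_apply (i : ℕ) (f : FromIdx n r → MvPolynomial (Fin n) k) (p : FromIdx n r) :
    fromX k n r i f p = varN k n i * f p := rfl

/-- In this representation the composites of opposite arrows are the multiplications by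
`x_r - x_{q+1}`, so that the relations telescope. -/
theorem wRep_from : WRep n (fromE k n r) (fromU k n r) (fromD k n r) (fromX k n r) where
  E_of_le i hi := by
    refine LinearMap.ext fun f => funext fun p => ?_
    have := p.2
    exact if_neg (by omega)
  U_of_le q hq := by
    refine LinearMap.ext fun f => funext fun p => ?_
    have := p.2
    exact dif_neg (by omega)
  D_of_le q hq := by
    refine LinearMap.ext fun f => funext fun p => ?_
    exact dif_neg (by omega)
  E_mul i j := by
    refine LinearMap.ext fun f => funext fun p => ?_
    by_cases hij : i = j
    · subst hij
      rw [if_pos rfl]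
      simp only [fromE, Module.End.mul_apply, LinearMap.coe_mk, AddHom.coe_mk]
      split_ifs <;> rfl
    · rw [if_neg hij]
      simp only [fromE, Module.End.mul_apply, LinearMap.coe_mk, AddHom.coe_mk, LinearMap.zero_apply,
        Pi.zero_apply]
      split_ifs <;> first | omega | rfl
  one := by
    refine LinearMap.ext fun f => funext fun p => ?_
    simp only [fromE, LinearMap.sum_apply, LinearMap.coe_mk, AddHom.coe_mk, Finset.sum_apply,
      Module.End.one_apply]
    rw [Finset.sum_eq_single p.1]
    · simp
    · intro b _ hb; exact if_neg hb
    · intro hp; exact absurd (Finset.mem_range.2 p.2.2) hp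
  E_U q := by
    refine LinearMap.ext fun f => funext fun p => ?_
    simp only [fromE, fromU, Module.End.mul_apply, LinearMap.coe_mk, AddHom.coe_mk]
    split_ifs <;> first | omega | rfl
  U_E q := by
    refine LinearMap.ext fun f => funext fun p => ?_
    simp only [fromE, fromU, Module.End.mul_apply, LinearMap.coe_mk, AddHom.coe_mk]
    split_ifs <;> first | omega | rfl
  E_D q := by
    refine LinearMap.ext fun f => funext fun p => ?_
    simp only [fromE, fromD, Module.End.mul_apply, LinearMap.coe_mk, AddHom.coe_mk]
    split_ifs <;> first | omega | rfl
  D_E q := by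
    refine LinearMap.ext fun f => funext fun p => ?_
    simp only [fromE, fromD, Module.End.mul_apply, LinearMap.coe_mk, AddHom.coe_mk]
    split_ifs <;> first | omega | rfl
  X_E i j := Algebra.commutes _ _
  X_U i q := Algebra.commutes _ _
  X_D i q := Algebra.commutes _ _
  X_X i j := Algebra.commutes _ _
  D_U_zero h := by
    refine LinearMap.ext fun f => funext fun p => ?_
    have := p.2
    simp only [Module.End.mul_apply, LinearMap.sub_apply, Pi.sub_apply, fromX_apply, fromE, fromU,
      fromD, LinearMap.coe_mk, AddHom.coe_mk, true_and]
    by_cases hp : 0 = p.1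
    · obtain rfl : r = 0 := by omega
      rw [dif_pos ⟨hp, h⟩, dif_pos le_rfl, if_pos hp, sub_mul]
      congr 2 <;> exact congrArg f (Subtype.ext hp)
    · rw [dif_neg (by omega), if_neg hp]; simp
  D_U_succ q h := by
    refine LinearMap.ext fun f => funext fun p => ?_
    have := p.2
    simp only [Module.End.mul_apply, LinearMap.sub_apply, Pi.sub_apply, LinearMap.add_apply,
      Pi.add_apply, fromX_apply, fromE, fromU, fromD, LinearMap.coe_mk,
      AddHom.coe_mk, true_and]
    by_cases hp : q + 1 = p.1
    · have e : ∀ hq, f ⟨q + 1, hq⟩ = f p := fun hq => congrArg f (Subtype.ext hp)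
      rw [dif_pos ⟨hp, h⟩, dif_pos (by omega), if_pos hp, e]
      by_cases hr : r ≤ q
      · rw [dif_pos ⟨hp, hr⟩, dif_pos (by omega), e]; ring
      · obtain rfl : r = q + 1 := by omega
        rw [dif_neg (by omega)]; ring
    · rw [dif_neg (by omega), dif_neg (by omega), if_neg hp]; simp

theorem pathDown_from_apply (y l : ℕ) (h : l + y < n) (f : FromIdx n r → MvPolynomial (Fin n) k)
    (p : FromIdx n r) : pathDown (fromE k n r) (fromD k n r) y l f p =
      if h' : l = p.1 then f ⟨l + y, by have := p.2; omega⟩ else 0 := by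
  induction y generalizing f with
  | zero =>
    simp only [pathDown, fromE, LinearMap.coe_mk, AddHom.coe_mk]
    split_ifs with h'
    · exact congrArg f (Subtype.ext h'.symm)
    · rfl
  | succ y ih =>
    rw [pathDown, Module.End.mul_apply, ih (by omega)]
    simp only [fromD, LinearMap.coe_mk, AddHom.coe_mk, true_and]
    split_ifs <;> first | omega | rfl

theorem pathUp_from_apply (x l : ℕ) (f : FromIdx n r → MvPolynomial (Fin n) k)
    (p : FromIdx n r) : pathUp (fromE k n r) (fromU k n r) x l f p =
      if h' : l + x = p.1 ∧ r ≤ l then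
        (∏ i ∈ Finset.range x, (varN k n r - varN k n (l + i + 1))) *
          f ⟨l, by have := p.2; omega⟩ else 0 := by
  induction x generalizing p with
  | zero =>
    have := p.2
    simp only [pathUp, fromE, LinearMap.coe_mk, AddHom.coe_mk]
    by_cases h' : l = p.1
    · rw [if_pos h', dif_pos ⟨h', by omega⟩, Finset.prod_range_zero, one_mul]
      exact congrArg f (Subtype.ext h'.symm)
    · rw [if_neg h', dif_neg (by omega)]
  | succ x ih =>
    rw [pathUp, Module.End.mul_apply]
    simp only [fromU, LinearMap.coe_mk, AddHom.coe_mk, ih, true_and]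
    split_ifs <;> first | omega | rfl | exact mul_zero _ | skip
    rw [Finset.prod_range_succ]
    ring

/-- The representation of `W(n,1)` on the polynomial-valued functions on the vertices from `r`
on. -/
def fromRep : Web k n →ₐ[k] FromEnd k n r := (wRep_from k n r).lift

variable {k n} in
theorem fromRep_wXN (i : ℕ) : fromRep k n r (wXN k n i) = fromX k n r i := by
  by_cases hi : i < n
  · rw [wXN_of_lt hi, fromRep, WRep.lift_wX]
  · rw [wXN, dif_neg hi, map_zero, fromX, varN, dif_neg hi, map_zero]

end PolynomialRep

namespace WRep

variable {k : Type u} [Field k] {n : ℕ} {B : Type v} [Ring B] [Algebra k B] {E U D X : ℕ → B}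
  (h : WRep n E U D X)
include h

theorem lift_wE (i : ℕ) : h.lift (wE k n i) = E i := by
  by_cases hi : i < n
  · rw [wE_of_lt hi, h.lift_wIdem]; rfl
  · rw [(wRep_web k n).E_of_le i (by omega), h.E_of_le i (by omega), map_zero]

theorem lift_wU (q : ℕ) : h.lift (wU k n q) = U q := by
  by_cases hq : q + 1 < n
  · rw [wU_of_lt hq]; exact h.lift_up hq
  · rw [(wRep_web k n).U_of_le q (by omega), h.U_of_le q (by omega), map_zero]

theorem lift_wD (q : ℕ) : h.lift (wD k n q) = D q := by
  by_cases hq : q + 1 < n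
  · rw [wD_of_lt hq]; exact h.lift_down hq
  · rw [(wRep_web k n).D_of_le q (by omega), h.D_of_le q (by omega), map_zero]

theorem lift_webPath (x l y : ℕ) :
    h.lift (webPath k n x l y) = pathUp E U x l * pathDown E D y l := by
  have h1 : ∀ x, h.lift (pathUp (wE k n) (wU k n) x l) = pathUp E U x l := by
    intro x
    induction x with
    | zero => exact h.lift_wE l
    | succ x ih => rw [pathUp, map_mul, ih, h.lift_wU, pathUp]
  have h2 : ∀ y, h.lift (pathDown (wE k n) (wD k n) y l) = pathDown E D y l := by
    intro y
    induction y with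
    | zero => exact h.lift_wE l
    | succ y ih => rw [pathDown, map_mul, ih, h.lift_wD, pathDown]
  rw [webPath, map_mul, h1, h2]

end WRep

section Independence

variable {k : Type u} [Field k] {n : ℕ}

theorem varN_ne {i j : ℕ} (hi : i < n) (hj : j < n) (hij : i ≠ j) : varN k n i - varN k n j ≠ 0 := by
  rw [varN, varN, dif_pos hi, dif_pos hj, sub_ne_zero]
  intro e
  exact hij (congrArg Fin.val (MvPolynomial.X_injective e))

/-- The matrix entry of the `r`-th representation at the vertices `a` and `b`. -/
def entry (r : ℕ) (a b : FromIdx n r) : Web k n →ₗ[k] MvPolynomial (Fin n) k where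
  toFun w := fromRep k n r w (Pi.single b 1) a
  map_add' w w' := by simp
  map_smul' c w := by simp

theorem entry_wMonomial_mul (r : ℕ) (a b : FromIdx n r) (α : Fin n →₀ ℕ) (w : Web k n) :
    entry r a b (wMonomial k α * w) = MvPolynomial.monomial α 1 * entry r a b w := by
  have h1 : ∀ l : Fin n, fromRep k n r (wX k l) =
      algebraMap _ (FromEnd k n r) (MvPolynomial.X l : MvPolynomial (Fin n) k) := by
    intro l
    have := fromRep_wXN (k := k) (n := n) r l.val
    rw [wXN_of_lt l.isLt, fromX, varN, dif_pos l.isLt] at this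
    exact this
  have h2 : fromRep k n r (wMonomial k α) =
      algebraMap _ (FromEnd k n r) (MvPolynomial.monomial α (1 : k)) := by
    rw [MvPolynomial.monomial_eq, map_one, one_mul, Finsupp.prod_fintype _ _ (by simp),
      ← List.prod_ofFn, map_list_prod, List.map_ofFn, wMonomial, map_list_prod, List.map_ofFn]
    congr 2
    funext l
    simp [h1]
  change fromRep k n r (wMonomial k α * w) _ _ = _ * fromRep k n r w _ _
  rw [map_mul, h2]
  rfl

theorem entry_webPath (r : ℕ) (a b : FromIdx n r) {x l y : ℕ} (hy : l + y < n) :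
    entry r a b (webPath k n x l y) = if l + x = a.1 ∧ l + y = b.1 ∧ r ≤ l then
      ∏ i ∈ Finset.range x, (varN k n r - varN k n (l + i + 1)) else 0 := by
  change fromRep k n r _ _ _ = _
  rw [fromRep, WRep.lift_webPath, Module.End.mul_apply, pathUp_from_apply]
  split_ifs with h1 h2 h2
  · rw [pathDown_from_apply k n r y l hy, dif_pos rfl, Pi.single_apply, if_pos (Subtype.ext h2.2.1),
      mul_one]
  · rw [pathDown_from_apply k n r y l hy, dif_pos rfl, Pi.single_apply, if_neg, mul_zero]
    intro e
    exact h2 ⟨h1.1, congrArg Subtype.val e, h1.2⟩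
  · omega
  · rfl

/-- A triangular system: the `r`-th equation involves only the unknowns from `r` on, and its first
coefficient is a product of differences of distinct variables. -/
theorem eq_zero_of_triangular {m a : ℕ} (ha : a < n) (p : ℕ → MvPolynomial (Fin n) k)
    (h : ∀ r ≤ m, (∑ l ∈ Finset.range (m + 1), if r ≤ l then
      p l * ∏ i ∈ Finset.range (a - l), (varN k n r - varN k n (l + i + 1)) else 0) = 0) :
    ∀ l ≤ m, p l = 0 := by
  have key : ∀ j l, l ≤ m → m < l + j → p l = 0 := by
    intro j
    induction j with
    | zero => intro l h1 h2; omega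
    | succ j ih =>
      intro l h1 h2
      have := h l h1
      rw [Finset.sum_eq_single l] at this
      · rw [if_pos le_rfl] at this
        refine (mul_eq_zero.1 this).resolve_right (Finset.prod_ne_zero_iff.2 fun i hi => ?_)
        rw [Finset.mem_range] at hi
        exact varN_ne (by omega) (by omega) (by omega)
      · intro l' hl' hne
        rw [Finset.mem_range] at hl'
        split_ifs with hll
        · rw [ih l' (by omega) (by omega), zero_mul]
        · rfl
      · intro hl; exact absurd (Finset.mem_range.2 (by omega)) hl
  exact fun l hl => key (m + 1) l hl (by omega)

variable (k n)

/-- The coefficient of `valley x l y`. -/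
def pathCoef (x l y : ℕ) : AShriek k n →ₗ[k] k :=
  valleyMap fun x' l' y' => if x' = x ∧ l' = l ∧ y' = y then 1 else 0

variable {k n}

theorem pathCoef_valley {x' l' y' : ℕ} (hx : l' + x' < n) (hy : l' + y' < n) (x l y : ℕ) :
    pathCoef k n x l y (valley k n x' l' y') = if x' = x ∧ l' = l ∧ y' = y then 1 else 0 :=
  valleyMap_valley _ hx hy

theorem eq_zero_of_pathCoef {a : AShriek k n}
    (h : ∀ x l y, l + x < n → l + y < n → pathCoef k n x l y a = 0) : a = 0 := by
  refine (valleyBasis k n).ext_elem fun t => ?_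
  have e : (valleyBasis k n).coord t = pathCoef k n t.2.1 t.1 t.2.2 := by
    refine (valleyBasis k n).ext fun t' => ?_
    rw [Module.Basis.coord_apply, Module.Basis.repr_self, valleyBasis_apply, valleyVec,
      pathCoef_valley (by have := t'.2.1.2; omega) (by have := t'.2.2.2; omega),
      Finsupp.single_apply]
    obtain ⟨l, x, y⟩ := t
    obtain ⟨l', x', y'⟩ := t'
    by_cases hl : l' = l
    · subst hl
      simp [Fin.ext_iff]
    · rw [if_neg (fun e => hl (congrArg Sigma.fst e)), if_neg]
      rintro ⟨-, e, -⟩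
      exact hl (Fin.ext e)
  have := h t.2.1 t.1 t.2.2 (by have := t.2.1.2; omega) (by have := t.2.2.2; omega)
  rw [← e, Module.Basis.coord_apply] at this
  rw [this, map_zero, Finsupp.zero_apply]

/-- A path from `b` to `a` with lowest vertex `l` acts on the functions on the vertices from `r` on
by the product of the factors picked up in its climb, and by zero if `l < r`. -/
theorem entry_pathSection (r : ℕ) (a b : FromIdx n r) (z : AShriek k n) :
    entry r a b (valleyMap (webPath k n) z) =
      ∑ l ∈ Finset.range (min a.1 b.1 + 1), if r ≤ l then
        MvPolynomial.C (pathCoef k n (a.1 - l) l (b.1 - l) z) *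
          ∏ i ∈ Finset.range (a.1 - l), (varN k n r - varN k n (l + i + 1)) else 0 := by
  induction z using valley_induction with
  | h x l y hx hy =>
    rw [valleyMap_valley _ hx hy, entry_webPath r a b hy]
    by_cases hl : l + x = a.1 ∧ l + y = b.1
    · rw [Finset.sum_eq_single l]
      · rw [pathCoef_valley hx hy,
          if_pos (show x = a.1 - l ∧ l = l ∧ y = b.1 - l by omega), map_one, one_mul,
          ← hl.1, ← hl.2, Nat.add_sub_cancel_left]
        simp
      · intro l' _ hne
        rw [pathCoef_valley hx hy,
          if_neg (fun e : x = a.1 - l' ∧ l = l' ∧ _ => hne e.2.1.symm), map_zero, zero_mul, ite_self]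
      · intro hl'; exact absurd (Finset.mem_range.2 (by omega)) hl'
    · rw [if_neg (by omega), Finset.sum_eq_zero]
      intro l' hl'
      rw [Finset.mem_range] at hl'
      rw [pathCoef_valley hx hy,
        if_neg (show ¬ (x = a.1 - l' ∧ l = l' ∧ y = b.1 - l') by omega), map_zero, zero_mul, ite_self]
  | h0 => simp
  | hadd z z' hz hz' =>
    rw [map_add, map_add, hz, hz', ← Finset.sum_add_distrib]
    refine Finset.sum_congr rfl fun l _ => ?_
    split_ifs
    · rw [map_add, map_add, add_mul]
    · rw [add_zero]
  | hsmul c z hz =>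
    rw [map_smul, map_smul, hz, Finset.smul_sum]
    refine Finset.sum_congr rfl fun l _ => ?_
    split_ifs
    · rw [map_smul, smul_eq_mul, map_mul, mul_assoc, MvPolynomial.smul_eq_C_mul]
    · rw [smul_zero]

/-- The map `f ⊗ a ↦ f s(a)` from `k[x_1, …, x_n] ⊗ A` to `W(n,1)`. -/
def freeMap (s : AShriek k n →ₗ[k] Web k n) :
    ((Fin n →₀ ℕ) →₀ AShriek k n) →ₗ[k] Web k n :=
  Finsupp.lsum k fun α => (LinearMap.mulLeft k (wMonomial k α)).comp s

theorem freeMap_apply (s : AShriek k n →ₗ[k] Web k n) (F : (Fin n →₀ ℕ) →₀ AShriek k n) :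
    freeMap s F = F.sum fun α a => wMonomial k α * s a := rfl

theorem freeMap_single (s : AShriek k n →ₗ[k] Web k n) (α : Fin n →₀ ℕ) (a : AShriek k n) :
    freeMap s (Finsupp.single α a) = wMonomial k α * s a := by
  rw [freeMap, Finsupp.lsum_single]; rfl

theorem freeMap_pathSection_injective :
    Function.Injective (freeMap (valleyMap (webPath k n))) := by
  rw [injective_iff_map_eq_zero]
  intro F hF
  let p : ℕ → ℕ → ℕ → MvPolynomial (Fin n) k := fun x l y =>
    F.sum fun α a => MvPolynomial.monomial α (pathCoef k n x l y a)
  have hp : ∀ a b : ℕ, a < n → b < n → ∀ l ≤ min a b, p (a - l) l (b - l) = 0 := by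
    intro a b ha hb
    refine eq_zero_of_triangular ha (fun l => p (a - l) l (b - l)) fun r hr => ?_
    have h0 := congrArg (entry r ⟨a, by omega, ha⟩ ⟨b, by omega, hb⟩) hF
    rw [map_zero, freeMap_apply, Finsupp.sum, map_sum] at h0
    refine Eq.trans ?_ h0
    have e : ∀ α, entry r ⟨a, by omega, ha⟩ ⟨b, by omega, hb⟩
        (wMonomial k α * valleyMap (webPath k n) (F α)) =
        ∑ l ∈ Finset.range (min a b + 1), if r ≤ l then
          MvPolynomial.monomial α (pathCoef k n (a - l) l (b - l) (F α)) *
          ∏ i ∈ Finset.range (a - l), (varN k n r - varN k n (l + i + 1)) else 0 := by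
      intro α
      rw [entry_wMonomial_mul, entry_pathSection, Finset.mul_sum]
      refine Finset.sum_congr rfl fun l _ => ?_
      split_ifs
      · rw [← mul_assoc, mul_comm (MvPolynomial.monomial α 1), MvPolynomial.C_mul_monomial, mul_one]
      · rw [mul_zero]
    simp only [e]
    rw [Finset.sum_comm]
    refine Finset.sum_congr rfl fun l _ => ?_
    split_ifs
    · rw [← Finset.sum_mul]; rfl
    · simp
  ext1 α
  rw [Finsupp.zero_apply]
  refine eq_zero_of_pathCoef fun x l y hx hy => ?_
  have h1 := hp (l + x) (l + y) hx hy l (by omega)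
  rw [Nat.add_sub_cancel_left, Nat.add_sub_cancel_left] at h1
  have h2 := congrArg (MvPolynomial.coeff α) h1
  simp only [p, Finsupp.sum, MvPolynomial.coeff_sum, MvPolynomial.coeff_monomial,
    MvPolynomial.coeff_zero] at h2
  rw [Finset.sum_ite_eq'] at h2
  split_ifs at h2 with h3
  · exact h2
  · rw [Finsupp.notMem_support_iff.1 h3, map_zero]

end Independence

/-! ### The deformation of `A_n^!` to `W(n,1)` -/

section Deformation

variable {k : Type u} [Field k] {n : ℕ}

theorem webSection_valley {x l y : ℕ} (hx : l + x < n) (hy : l + y < n) :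
    webSection k n (valley k n x l y) = webSec k n x l y := valleyMap_valley _ hx hy

theorem webSection_eN (i : ℕ) : webSection k n (eN k n i) = wE k n i := by
  by_cases hi : i < n
  · rw [← valley_zero_zero, webSection_valley hi hi, webSec_of_ne (by simp), webPath_zero]
  · rw [eN_of_le k n (by omega), (wRep_web k n).E_of_le i (by omega), map_zero]

theorem wX_mul_wE (i : Fin n) (v : ℕ) : wX k i * wE k n v = wXN k n i * wE k n v := by
  rw [wXN_of_lt i.isLt]

/-- The section differs from the lift of every path by the path of the same name by a square-zero
correction. -/
theorem webSection_eq (a : AShriek k n) : webSection k n a = valleyMap (webPath k n) a +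
    ∑ q : Fin (n - 1), wX k (hi q) * webSection k n (pathCoef k n 1 q 1 a • vert k (hi q)) := by
  have hv : ∀ q : Fin (n - 1), webSection k n (vert k (hi q)) = wE k n (q + 1) := fun q => by
    rw [← eN_val, webSection_eN]; rfl
  induction a using valley_induction with
  | h x l y hx hy =>
    rw [webSection_valley hx hy, valleyMap_valley _ hx hy]
    simp only [pathCoef_valley hx hy, map_smul, hv]
    by_cases h1 : x = 1 ∧ y = 1
    · obtain ⟨rfl, rfl⟩ := h1
      rw [webSec_one_one, Finset.sum_eq_single ⟨l, by omega⟩]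
      · rw [if_pos (by simp), one_smul, wX_mul_wE]; rfl
      · intro q _ hq
        rw [if_neg (fun e => hq (Fin.ext e.2.1.symm)), zero_smul, mul_zero]
      · simp
    · rw [webSec_of_ne h1, Finset.sum_eq_zero, add_zero]
      intro q _
      rw [if_neg (fun e => h1 ⟨e.1, e.2.2⟩), zero_smul, mul_zero]
  | h0 => simp
  | hadd a b ha hb =>
    simp only [map_add, add_smul, mul_add, Finset.sum_add_distrib]
    rw [ha, hb]; abel
  | hsmul c a ha =>
    simp only [map_smul, smul_assoc, mul_smul_comm, ← Finset.smul_sum]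
    rw [ha, smul_add]
    simp only [map_smul, mul_smul_comm]

theorem pathCoef_loop_vert (q p : Fin (n - 1)) : pathCoef k n 1 q 1 (vert k (hi p)) = 0 := by
  rw [← eN_val, ← valley_zero_zero, pathCoef_valley (x' := 0) (l' := (hi p).val) (y' := 0) (hi p).isLt (hi p).isLt]
  simp

variable (k n) in
/-- The correction term of the section, as an endomorphism of the source of `freeMap`. -/
def loopShift : ((Fin n →₀ ℕ) →₀ AShriek k n) →ₗ[k] ((Fin n →₀ ℕ) →₀ AShriek k n) :=
  Finsupp.lsum k fun α => ∑ q : Fin (n - 1), (Finsupp.lsingle (Finsupp.single (hi q) 1 + α)).comp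
    ((LinearMap.toSpanSingleton k (AShriek k n) (vert k (hi q))).comp (pathCoef k n 1 q 1))

theorem loopShift_single (α : Fin n →₀ ℕ) (a : AShriek k n) :
    loopShift k n (Finsupp.single α a) = ∑ q : Fin (n - 1),
      Finsupp.single (Finsupp.single (hi q) 1 + α) (pathCoef k n 1 q 1 a • vert k (hi q)) := by
  rw [loopShift, Finsupp.lsum_single]
  simp [LinearMap.sum_apply]

theorem loopShift_loopShift (F : (Fin n →₀ ℕ) →₀ AShriek k n) :
    loopShift k n (loopShift k n F) = 0 := by
  induction F using Finsupp.induction_linear with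
  | zero => simp
  | add f g hf hg => rw [map_add, map_add, hf, hg, add_zero]
  | single α a =>
    rw [loopShift_single, map_sum]
    refine Finset.sum_eq_zero fun q _ => ?_
    rw [loopShift_single]
    refine Finset.sum_eq_zero fun p _ => ?_
    rw [map_smul, pathCoef_loop_vert, smul_zero, zero_smul, Finsupp.single_zero]

theorem freeMap_webSection (F : (Fin n →₀ ℕ) →₀ AShriek k n) :
    freeMap (webSection k n) F = freeMap (valleyMap (webPath k n)) (F + loopShift k n F) := by
  induction F using Finsupp.induction_linear with
  | zero => simp
  | add f g hf hg => rw [map_add, hf, hg, ← map_add, map_add (loopShift k n)]; congr 1; abel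
  | single α a =>
    rw [map_add, freeMap_single, freeMap_single, loopShift_single, map_sum, webSection_eq, mul_add,
      Finset.mul_sum]
    congr 1
    refine Finset.sum_congr rfl fun q _ => ?_
    have e : webSection k n (vert k (hi q)) = valleyMap (webPath k n) (vert k (hi q)) := by
      rw [webSection_eq]
      simp [pathCoef_loop_vert]
    rw [freeMap_single, map_smul, map_smul, e, ← mul_assoc, wMonomial_add, wMonomial_single,
      wX_central]

theorem freeMap_injective : Function.Injective (freeMap (webSection k n)) := by
  rw [injective_iff_map_eq_zero]
  intro F hF
  rw [freeMap_webSection] at hF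
  have h1 : F + loopShift k n F = 0 :=
    (injective_iff_map_eq_zero _).1 freeMap_pathSection_injective _ hF
  have h2 := congrArg (loopShift k n) h1
  rw [map_add, loopShift_loopShift, add_zero, map_zero] at h2
  rwa [h2, add_zero] at h1

theorem freeMap_surjective : Function.Surjective (freeMap (webSection k n)) := by
  rw [← LinearMap.range_eq_top, eq_top_iff, ← iSup_webSpan, iSup_le_iff]
  intro d
  rw [webSpan, Submodule.span_le]
  rintro z ⟨α, x, l, y, hx, hy, -, rfl⟩
  exact ⟨Finsupp.single α (valley k n x l y), by rw [freeMap_single, webSection_valley hx hy]⟩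

theorem freeMap_bijective : Function.Bijective (freeMap (webSection k n)) :=
  ⟨freeMap_injective, freeMap_surjective⟩

/-! The projection onto `A_n^!`. -/

variable (k n) in
theorem wRep_aShriek : WRep n (eN k n) (uN k n) (dN k n) (fun _ => 0) where
  E_of_le _ := eN_of_le k n
  U_of_le _ := uN_of_le k n
  D_of_le _ := dN_of_le k n
  E_mul := eN_mul k n
  one := sum_eN k n
  E_U := eN_mul_uN k n
  U_E := uN_mul_eN k n
  E_D := eN_mul_dN k n
  D_E := dN_mul_eN k n
  X_E _ _ := by simp
  X_U _ _ := by simp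
  X_D _ _ := by simp
  X_X _ _ := rfl
  D_U_zero _ := by rw [dN_mul_uN_zero, sub_zero, zero_mul]
  D_U_succ r h := by rw [dN_mul_uN_succ k n r h, sub_zero, zero_mul, add_zero]

variable (k n) in
/-- The projection of `W(n,1)` onto `A_n^!`. -/
def webProj : Web k n →ₐ[k] AShriek k n := (wRep_aShriek k n).lift

theorem webProj_wX (l : Fin n) : webProj k n (wX k l) = 0 := (wRep_aShriek k n).lift_wX l

theorem webProj_webPath (x l y : ℕ) : webProj k n (webPath k n x l y) = valley k n x l y := by
  have h1 : ∀ x, pathUp (eN k n) (uN k n) x l = upPath k n x l := by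
    intro x
    induction x with
    | zero => rfl
    | succ x ih => rw [pathUp, ih, upPath]
  have h2 : ∀ y, pathDown (eN k n) (dN k n) y l = downPath k n y l := by
    intro y
    induction y with
    | zero => rfl
    | succ y ih => rw [pathDown, ih, downPath]
  rw [webProj, WRep.lift_webPath, h1, h2, valley]

theorem webProj_webSection (a : AShriek k n) : webProj k n (webSection k n a) = a := by
  have : (webProj k n).toLinearMap.comp (webSection k n) = LinearMap.id := by
    refine linearMap_ext_valley fun x l y hx hy => ?_
    change webProj k n (webSection k n _) = valley k n x l y
    rw [webSection_valley hx hy]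
    by_cases h1 : x = 1 ∧ y = 1
    · obtain ⟨rfl, rfl⟩ := h1
      rw [webSec_one_one, map_add, map_mul, wXN_of_lt hx, webProj_wX, zero_mul, add_zero,
        webProj_webPath]
    · rw [webSec_of_ne h1, webProj_webPath]
  exact LinearMap.congr_fun this a

/-- Modulo the ideal of the `x_i`, every element of `W(n,1)` is in the image of the section. -/
theorem web_induction {p : Web k n → Prop} (hs : ∀ a, p (webSection k n a))
    (hX : ∀ i w, p (wX k i * w)) (hadd : ∀ w w', p w → p w' → p (w + w')) (w : Web k n) : p w := by
  obtain ⟨F, rfl⟩ := freeMap_surjective w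
  induction F using Finsupp.induction_linear with
  | zero => rw [map_zero, ← map_zero (webSection k n)]; exact hs 0
  | add f g hf hg => rw [map_add]; exact hadd _ _ hf hg
  | single α a =>
    rw [freeMap_single]
    by_cases hα : α = 0
    · rw [hα, wMonomial_zero, one_mul]; exact hs a
    · obtain ⟨i, hi⟩ := Finsupp.ne_iff.1 hα
      have e : α = Finsupp.single i 1 + (α - Finsupp.single i 1) := by
        ext j
        by_cases hj : j = i
        · subst hj
          simp only [Finsupp.add_apply, Finsupp.tsub_apply, Finsupp.single_eq_same]
          simp only [Finsupp.zero_apply] at hi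
          omega
        · simp [Finsupp.single_eq_of_ne hj]
      rw [e, wMonomial_add, wMonomial_single, mul_assoc]
      exact hX _ _

/-! The first-order coefficients. -/

/-- The coefficient of `x_l` of an element of `W(n,1)`, written as a polynomial in the `x_i` with
coefficients in `A_n^!`. -/
def firstCoef (l : Fin n) : Web k n →ₗ[k] AShriek k n :=
  (Finsupp.lapply (Finsupp.single l 1)).comp
    (LinearEquiv.ofBijective _ (freeMap_bijective (k := k) (n := n))).symm.toLinearMap

theorem firstCoef_freeMap (l : Fin n) (F : (Fin n →₀ ℕ) →₀ AShriek k n) :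
    firstCoef l (freeMap (webSection k n) F) = F (Finsupp.single l 1) := by
  rw [firstCoef, LinearMap.comp_apply]
  have := (LinearEquiv.ofBijective _ (freeMap_bijective (k := k) (n := n))).symm_apply_apply F
  exact congrArg (fun G => G (Finsupp.single l 1)) this

theorem firstCoef_webSection (l : Fin n) (a : AShriek k n) :
    firstCoef l (webSection k n a) = 0 := by
  have := firstCoef_freeMap l (Finsupp.single 0 a)
  rw [freeMap_single, wMonomial_zero, one_mul] at this
  rw [this, Finsupp.single_eq_of_ne]
  simp

/-- The coefficient of `x_l` in `x_i w` only depends on the constant term of `w`. -/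
theorem firstCoef_wX_mul (l i : Fin n) (w : Web k n) :
    firstCoef l (wX k i * w) = if i = l then webProj k n w else 0 := by
  obtain ⟨F, rfl⟩ := freeMap_surjective w
  induction F using Finsupp.induction_linear with
  | zero => simp
  | add f g hf hg =>
    rw [map_add, mul_add, map_add, hf, hg, map_add]
    split_ifs <;> simp
  | single α a =>
    rw [freeMap_single, ← mul_assoc, ← wMonomial_single, ← wMonomial_add, ← freeMap_single,
      firstCoef_freeMap, Finsupp.single_apply, map_mul, webProj_webSection]
    by_cases hα : α = 0
    · subst hα
      rw [wMonomial_zero, map_one, one_mul, add_zero]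
      simp [Finsupp.single_left_inj]
    · rw [if_neg]
      · have h0 : webProj k n (wMonomial k α) = 0 := by
          obtain ⟨j, hj⟩ := Finsupp.ne_iff.1 hα
          rw [wMonomial, map_list_prod, List.map_ofFn]
          refine List.prod_eq_zero ?_
          rw [List.mem_ofFn]
          refine ⟨j, ?_⟩
          simp only [Function.comp_apply, map_pow, webProj_wX]
          exact zero_pow hj
        rw [h0, zero_mul, ite_self]
      · intro e
        have := congrArg Finsupp.degree e
        rw [map_add, Finsupp.degree_single, Finsupp.degree_single] at this
        exact hα ((Finsupp.degree_eq_zero_iff α).1 (by omega))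

/-- The `2`-cochain with the values of a bilinear map. -/
def cochainOfBilin {A : Type v} [Ring A] [Algebra k A] (F : A →ₗ[k] A →ₗ[k] A) : Cochain k A 2 :=
  MultilinearMap.mk' (fun g => F (g 0) (g 1))
    (fun g i x y => by fin_cases i <;> simp)
    (fun g i c x => by fin_cases i <;> simp)

variable (k) in
/-- The first-order terms of the product of `W(n,1)`. -/
def deformBilin (l : Fin n) : AShriek k n →ₗ[k] AShriek k n →ₗ[k] AShriek k n :=
  (LinearMap.mul k (Web k n)).compl₁₂ (webSection k n) (webSection k n) |>.compr₂ (firstCoef l)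

theorem deformBilin_apply (l : Fin n) (a b : AShriek k n) :
    deformBilin k l a b = firstCoef l (webSection k n a * webSection k n b) := rfl

/-- The coefficient of `x_l` is a derivation up to the first-order terms of the product. -/
theorem firstCoef_mul (l : Fin n) (u w : Web k n) : firstCoef l (u * w) =
    deformBilin k l (webProj k n u) (webProj k n w) + firstCoef l u * webProj k n w +
      webProj k n u * firstCoef l w := by
  induction u using web_induction with
  | hs a =>
    induction w using web_induction with
    | hs b =>
      rw [webProj_webSection, webProj_webSection, firstCoef_webSection, firstCoef_webSection,
        deformBilin_apply, zero_mul, mul_zero, add_zero, add_zero]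
    | hX i w =>
      rw [← mul_assoc, ← wX_central, mul_assoc, firstCoef_wX_mul, firstCoef_wX_mul, map_mul, map_mul,
        webProj_wX, zero_mul, map_zero, mul_zero, add_zero, zero_add]
      split_ifs <;> simp
    | hadd w w' hw hw' =>
      rw [mul_add, map_add, hw, hw']
      simp only [map_add, mul_add]
      abel
  | hX i u =>
    rw [mul_assoc, firstCoef_wX_mul, firstCoef_wX_mul, map_mul, map_mul,
      webProj_wX, zero_mul, map_zero, LinearMap.zero_apply, zero_mul, add_zero, zero_add]
    split_ifs <;> simp
  | hadd u u' hu hu' =>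
    rw [add_mul, map_add, hu, hu']
    simp only [map_add, add_mul, LinearMap.add_apply]
    abel

/-- The cocycle identity is the first-order part of associativity. -/
theorem isTwoCocycle_deformBilin (l : Fin n) : IsTwoCocycle (deformBilin k l) := by
  intro a b c
  have h := congrArg (firstCoef l)
    (mul_assoc (webSection k n a) (webSection k n b) (webSection k n c))
  rw [firstCoef_mul, firstCoef_mul l (webSection k n a) (_ * _)] at h
  simp only [map_mul, webProj_webSection, firstCoef_webSection, ← deformBilin_apply, mul_zero,
    zero_mul, add_zero] at h
  rw [← sub_eq_zero] at h
  rw [← neg_eq_zero, ← h]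
  abel

theorem webSection_mem_webSpan {a : AShriek k n} {d : ℤ} (ha : a ∈ pathGrading k n d) :
    webSection k n a ∈ webSpan k n d := by
  rw [pathGrading_eq] at ha
  induction ha using Submodule.span_induction with
  | mem z hz =>
    obtain ⟨x, l, y, rfl, rfl⟩ := hz
    by_cases h : l + x < n ∧ l + y < n
    · rw [webSection_valley h.1 h.2]; exact webSec_mem_webSpan h.1 h.2
    · by_cases h' : l + x < n
      · rw [valley_of_le_right k n (by omega), map_zero]; exact Submodule.zero_mem _
      · rw [valley_of_le_left k n (by omega), map_zero]; exact Submodule.zero_mem _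
  | zero => rw [map_zero]; exact Submodule.zero_mem _
  | add x y _ _ hx hy => rw [map_add]; exact Submodule.add_mem _ hx hy
  | smul c x _ hx => rw [map_smul]; exact Submodule.smul_mem _ _ hx

theorem webSection_mul_mem {a : AShriek k n} {d e : ℤ} (ha : a ∈ pathGrading k n d) {z : Web k n}
    (hz : z ∈ webSpan k n e) : webSection k n a * z ∈ webSpan k n (d + e) := by
  rw [pathGrading_eq] at ha
  induction ha using Submodule.span_induction with
  | mem a ha =>
    obtain ⟨x, l, y, rfl, rfl⟩ := ha
    by_cases h : l + x < n ∧ l + y < n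
    · rw [webSection_valley h.1 h.2]; exact webSec_mul_mem x l y hz
    · by_cases h' : l + x < n
      · rw [valley_of_le_right k n (by omega), map_zero, zero_mul]; exact Submodule.zero_mem _
      · rw [valley_of_le_left k n (by omega), map_zero, zero_mul]; exact Submodule.zero_mem _
  | zero => rw [map_zero, zero_mul]; exact Submodule.zero_mem _
  | add x y _ _ hx hy => rw [map_add, add_mul]; exact Submodule.add_mem _ hx hy
  | smul c x _ hx => rw [map_smul, smul_mul_assoc]; exact Submodule.smul_mem _ _ hx

theorem firstCoef_mem (l : Fin n) {d : ℤ} {z : Web k n} (hz : z ∈ webSpan k n d) :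
    firstCoef l z ∈ pathGrading k n (d - 2) := by
  induction hz using Submodule.span_induction with
  | mem z hz =>
    obtain ⟨α, x, y, m, hx, hy, rfl, rfl⟩ := hz
    rw [← webSection_valley hx hy, ← freeMap_single, firstCoef_freeMap, Finsupp.single_apply]
    split_ifs with h
    · subst h
      refine valley_mem_pathGrading ?_
      rw [Finsupp.degree_single]; push_cast; ring
    · exact Submodule.zero_mem _
  | zero => rw [map_zero]; exact Submodule.zero_mem _
  | add x y _ _ hx hy => rw [map_add]; exact Submodule.add_mem _ hx hy
  | smul c x _ hx => rw [map_smul]; exact Submodule.smul_mem _ _ hx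

end Deformation

section DeformationCocycles

variable {k : Type u} [Field k] {n : ℕ}

theorem wE_mul_webSection (i : ℕ) (a : AShriek k n) :
    wE k n i * webSection k n a = webSection k n (eN k n i * a) := by
  suffices h : (LinearMap.mulLeft k (wE k n i)).comp (webSection k n) =
      (webSection k n).comp (LinearMap.mulLeft k (eN k n i)) from LinearMap.congr_fun h a
  refine linearMap_ext_valley fun x l y hx hy => ?_
  change wE k n i * webSection k n _ = webSection k n (eN k n i * _)
  have key : wE k n (l + x) * webSec k n x l y = webSec k n x l y := by
    by_cases h1 : x = 1 ∧ y = 1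
    · obtain ⟨rfl, rfl⟩ := h1
      rw [webSec_one_one, mul_add, wE_mul_webPath, ← mul_assoc, ← wXN_central, mul_assoc,
        (wRep_web k n).E_self]
    · rw [webSec_of_ne h1, wE_mul_webPath]
  rw [eN_mul_valley', webSection_valley hx hy]
  split_ifs with h
  · rw [h, key, webSection_valley hx hy]
  · rw [← key, ← mul_assoc, (wRep_web k n).E_of_ne h, zero_mul, map_zero]

theorem webSection_mul_wE (i : ℕ) (a : AShriek k n) :
    webSection k n a * wE k n i = webSection k n (a * eN k n i) := by
  suffices h : (LinearMap.mulRight k (wE k n i)).comp (webSection k n) =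
      (webSection k n).comp (LinearMap.mulRight k (eN k n i)) from LinearMap.congr_fun h a
  refine linearMap_ext_valley fun x l y hx hy => ?_
  change webSection k n _ * wE k n i = webSection k n (_ * eN k n i)
  have key : webSec k n x l y * wE k n (l + y) = webSec k n x l y := by
    by_cases h1 : x = 1 ∧ y = 1
    · obtain ⟨rfl, rfl⟩ := h1
      rw [webSec_one_one, add_mul, webPath_mul_wE, mul_assoc, (wRep_web k n).E_self]
    · rw [webSec_of_ne h1, webPath_mul_wE]
  rw [valley_mul_eN', webSection_valley hx hy]
  split_ifs with h
  · rw [← h, key, webSection_valley hx hy]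
  · rw [← key, mul_assoc, (wRep_web k n).E_of_ne h, mul_zero, map_zero]

theorem webSection_vert (i : Fin n) : webSection k n (vert k i) = wE k n i := by
  rw [← eN_val, webSection_eN]

theorem webSection_up (q : Fin (n - 1)) : webSection k n (up k q) = wU k n q := by
  have hq : q.val + 1 < n := by omega
  have e : up k q = valley k n 1 q 0 := by
    rw [← uN_val, valley_y_zero, upPath, upPath, add_zero, uN_mul_eN]
  rw [e, webSection_valley hq (by omega), webSec_of_ne (by simp), webPath, pathUp, pathUp, pathDown,
    add_zero, wU_mul_wE, wU_mul_wE]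

theorem webSection_down (q : Fin (n - 1)) : webSection k n (down k q) = wD k n q := by
  have hq : q.val + 1 < n := by omega
  have e : down k q = valley k n 0 q 1 := by
    rw [← dN_val, valley_x_zero, downPath, downPath, add_zero, eN_mul_dN]
  rw [e, webSection_valley (by omega) hq, webSec_of_ne (by simp), webPath, pathUp, pathDown,
    pathDown, add_zero, wE_mul_wD, wE_mul_wD]

theorem wU_mul_wD_eq {q : ℕ} (hq : q + 1 < n) : wU k n q * wD k n q =
    webSection k n (valley k n 1 q 1) - wXN k n (q + 1) * wE k n (q + 1) := by
  rw [webSection_valley hq hq, webSec_one_one, add_sub_cancel_right, webPath, pathUp, pathUp,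
    pathDown, pathDown, add_zero, wE_mul_wD, wU_mul_wE]

theorem firstCoef_wXN_mul_wE (l : Fin n) {i : ℕ} (hi : i < n) (v : ℕ) :
    firstCoef l (wXN k n i * wE k n v) = if i = l.val then eN k n v else 0 := by
  rw [wXN_of_lt hi, firstCoef_wX_mul, ← webSection_eN, webProj_webSection]
  simp only [Fin.ext_iff]

/-- The degree of the first-order terms is `-2`, because the `x_l` have degree `2`. -/
theorem deformBilin_mem (l : Fin n) {a b : AShriek k n} {d e : ℤ} (ha : a ∈ pathGrading k n d)
    (hb : b ∈ pathGrading k n e) : deformBilin k l a b ∈ pathGrading k n (d + e + -2) :=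
  firstCoef_mem l (webSection_mul_mem ha (webSection_mem_webSpan hb))

variable (k) in
/-- The first-order cochains of the deformation. -/
def deformCochain (l : Fin n) : Cochain k (AShriek k n) 2 := cochainOfBilin (deformBilin k l)

theorem deformCochain_apply (l : Fin n) (a b : AShriek k n) :
    deformCochain k l ![a, b] = firstCoef l (webSection k n a * webSection k n b) := rfl

theorem isMu_deformCochain (p : Fin (n - 1)) : IsMu k p (deformCochain k (hi p)) where
  cocycle := mem_cocycles_two.2 (isTwoCocycle_deformBilin (hi p))
  degree d a ha := by
    rw [Fin.sum_univ_two]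
    exact deformBilin_mem (hi p) (ha 0) (ha 1)
  vert_left i x := by
    rw [deformCochain_apply, webSection_vert, wE_mul_webSection, firstCoef_webSection]
  vert_right i x := by
    rw [deformCochain_apply, webSection_vert, webSection_mul_wE, firstCoef_webSection]
  up_down q r := by
    have hq : q.val + 1 < n := by omega
    rw [deformCochain_apply, webSection_up, webSection_down]
    by_cases hqr : q = r
    · subst hqr
      rw [wU_mul_wD_eq hq, map_sub, firstCoef_webSection, firstCoef_wXN_mul_wE _ hq, zero_sub]
      by_cases hqp : q = p
      · subst hqp
        rw [if_pos (show q.val + 1 = (hi q).val from rfl), if_pos ⟨rfl, rfl⟩, ← eN_val]; rfl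
      · rw [if_neg (show q.val + 1 ≠ (hi p).val from fun e => hqp (Fin.ext (Nat.succ.inj e))),
          if_neg (fun e => hqp e.1), neg_zero]
    · rw [if_neg (fun e => hqr (e.1.trans e.2.symm)), ← wU_mul_wE, mul_assoc,
        (wRep_web k n).E_D_of_ne (fun e => hqr (Fin.ext e)), mul_zero, map_zero]
  down_up q r := by
    have hq : q.val + 1 < n := by omega
    rw [deformCochain_apply, webSection_up, webSection_down]
    by_cases hqr : q = r
    · subst hqr
      have key : firstCoef (hi p) (wD k n q * wU k n q) =
          -firstCoef (hi p) (wXN k n (q + 1) * wE k n q) := by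
        obtain ⟨q, hq'⟩ := q
        rcases q with _ | q
        · rw [(wRep_web k n).D_U_zero hq, sub_mul, map_sub, firstCoef_wXN_mul_wE _ (by omega),
            if_neg (by simp [hi]), zero_sub]
        · rw [(wRep_web k n).D_U_succ q hq, wU_mul_wD_eq (by omega), sub_mul, sub_add_sub_cancel,
            map_sub, firstCoef_webSection, zero_sub]
      rw [key, firstCoef_wXN_mul_wE _ hq]
      by_cases hqp : q = p
      · subst hqp
        rw [if_pos (show q.val + 1 = (hi q).val from rfl), if_pos ⟨rfl, rfl⟩, ← eN_val]; rfl
      · rw [if_neg (show q.val + 1 ≠ (hi p).val from fun e => hqp (Fin.ext (Nat.succ.inj e))),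
          if_neg (fun e => hqp e.1), neg_zero]
    · rw [if_neg (fun e => hqr (e.1.trans e.2.symm)), ← wD_mul_wE, mul_assoc,
        (wRep_web k n).E_U_of_ne (fun e => hqr (Fin.ext (by omega))), mul_zero, map_zero]
  up_up q r := by
    have hq : q.val + 1 < n := by omega
    rw [deformCochain_apply, webSection_up, webSection_up]
    by_cases hqr : q.val = r.val + 1
    · have e : wU k n q * wU k n r = webSection k n (valley k n 2 r 0) := by
        rw [webSection_valley (by omega) (by omega), webSec_of_ne (by simp), webPath, pathUp, pathUp,
          pathUp, pathDown, add_zero, wU_mul_wE, mul_assoc, wU_mul_wE, hqr]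
      rw [e, firstCoef_webSection]
    · rw [← wU_mul_wE, mul_assoc, (wRep_web k n).E_U_of_ne hqr, mul_zero, map_zero]
  down_down q r := by
    have hr : r.val + 1 < n := by omega
    rw [deformCochain_apply, webSection_down, webSection_down]
    by_cases hqr : q.val + 1 = r.val
    · have e : wD k n q * wD k n r = webSection k n (valley k n 0 q 2) := by
        rw [webSection_valley (by omega) (by omega), webSec_of_ne (by simp), webPath, pathUp,
          pathDown, pathDown, pathDown, add_zero, wE_mul_wD, ← mul_assoc, wE_mul_wD, hqr]
      rw [e, firstCoef_webSection]
    · rw [← wD_mul_wE, mul_assoc, (wRep_web k n).E_D_of_ne hqr, mul_zero, map_zero]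

theorem sub_webSection_mem (w : Web k n) : w - webSection k n (webProj k n w) ∈
    Ideal.span (Set.range (wX (n := n) k)) := by
  induction w using web_induction with
  | hs a => rw [webProj_webSection, sub_self]; exact Submodule.zero_mem _
  | hX i w =>
    rw [map_mul, webProj_wX, zero_mul, map_zero, sub_zero, wX_central]
    exact Ideal.mul_mem_left _ _ (Ideal.subset_span ⟨i, rfl⟩)
  | hadd w w' hw hw' =>
    rw [map_add, map_add, add_sub_add_comm]
    exact Submodule.add_mem _ hw hw'

/-- The first-order Taylor expansion of an element of `W(n,1)`. -/
theorem sub_firstOrder_mem (w : Web k n) :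
    w - webSection k n (webProj k n w) - ∑ l : Fin n, wX k l * webSection k n (firstCoef l w) ∈
      Ideal.span {w : Web k n | ∃ i j : Fin n, w = wX k i * wX k j} := by
  induction w using web_induction with
  | hs a =>
    simp only [webProj_webSection, sub_self, firstCoef_webSection, map_zero, mul_zero,
      Finset.sum_const_zero]
    exact Submodule.zero_mem _
  | hX i w =>
    rw [map_mul, webProj_wX, zero_mul, map_zero, sub_zero, Finset.sum_eq_single i]
    · rw [firstCoef_wX_mul, if_pos rfl, ← mul_sub]
      generalize hz : w - webSection k n (webProj k n w) = z
      have hm := sub_webSection_mem w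
      rw [hz] at hm
      clear hz
      induction hm using Submodule.span_induction with
      | mem z hz =>
        obtain ⟨j, rfl⟩ := hz
        exact Ideal.subset_span ⟨i, j, rfl⟩
      | zero => rw [mul_zero]; exact Submodule.zero_mem _
      | add x y _ _ hx hy => rw [mul_add]; exact Submodule.add_mem _ hx hy
      | smul c x _ hx =>
        rw [smul_eq_mul, ← mul_assoc, wX_central, mul_assoc]
        exact Ideal.mul_mem_left _ _ hx
    · intro j _ hj
      rw [firstCoef_wX_mul, if_neg hj.symm, map_zero, mul_zero]
    · simp
  | hadd w w' hw hw' =>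
    have := Submodule.add_mem _ hw hw'
    convert this using 1
    simp only [map_add, mul_add, Finset.sum_add_distrib]
    abel

theorem isDeformation_web :
    IsDeformation k (webProj k n) (webSection k n) (deformCochain k) where
  central := wX_central
  pi_idem v := by
    rw [← eN_val, webProj, WRep.lift_wIdem]; rfl
  pi_cross_up p := by
    rw [← uN_val]; exact (wRep_aShriek k n).lift_up (hi p).isLt
  pi_cross_down p := by
    rw [← dN_val]; exact (wRep_aShriek k n).lift_down (hi p).isLt
  pi_surjective a := ⟨_, webProj_webSection a⟩
  pi_ker w := by
    constructor
    · intro h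
      have := sub_webSection_mem w
      rwa [h, map_zero, sub_zero] at this
    · intro h
      have : Ideal.span (Set.range (wX (n := n) k)) ≤ RingHom.ker (webProj k n) := by
        rw [Ideal.span_le]
        rintro _ ⟨l, rfl⟩
        exact webProj_wX l
      exact this h
  pi_s := webProj_webSection
  s_free := freeMap_bijective
  first_order a b := by
    have := sub_firstOrder_mem (webSection k n a * webSection k n b)
    rwa [map_mul, webProj_webSection, webProj_webSection] at this

end DeformationCocycles

/-! ### The graded pieces of the Hochschild cohomology -/

section Graded

variable (k : Type u) [Field k] (n : ℕ)

theorem isInternal_of_subsingleton {H : Type*} [AddCommGroup H] [Module k H] [Subsingleton H]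
    (𝓗 : ℤ → Submodule k H) : DirectSum.IsInternal 𝓗 := by
  rw [DirectSum.isInternal_submodule_iff_iSupIndep_and_iSup_eq_top]
  exact ⟨fun _ => by rw [disjoint_iff]; exact Subsingleton.elim _ _, Subsingleton.elim _ _⟩

theorem isInternal_HHgr (m : ℕ) : DirectSum.IsInternal (HHgr (pathGrading k n) m) := by
  match m with
  | 0 => exact (HH_zero_dualBasis k n).isInternal
  | 1 => exact (HH_one_dualBasis k n).isInternal
  | 2 =>
    exact (HH_two_dualBasis (fun p => deformCochain k (hi p)) isMu_deformCochain).isInternal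
  | m + 3 =>
    have := subsingleton_HH k n (m + 3) (by omega)
    exact isInternal_of_subsingleton k _

theorem center_equiv : ∃ Φ : (Polynomial k ⧸ Ideal.span {(Polynomial.X : Polynomial k) ^ n}) ≃ₐ[k]
    Subalgebra.center k (AShriek k n),
    (Φ (Ideal.Quotient.mk _ Polynomial.X) : AShriek k n) = centralC k n ∧
    ∀ m : ℕ, (HHzeroEquiv k (AShriek k n)).symm (Φ (Ideal.Quotient.mk _ (Polynomial.X ^ m))) ∈
      HHgr (pathGrading k n) 0 (2 * m) := by
  refine ⟨AlgEquiv.ofBijective (truncatedToCenter k n) truncatedToCenter_bijective, ?_,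
    fun m => ?_⟩
  · rw [AlgEquiv.coe_ofBijective, truncatedToCenter_mk, Polynomial.aeval_X]
  · have e : (HHzeroEquiv k (AShriek k n)).symm
        (AlgEquiv.ofBijective (truncatedToCenter k n) truncatedToCenter_bijective
          (Ideal.Quotient.mk _ (Polynomial.X ^ m))) =
        HH.mk (powCochain k n m) (powCochain_mem_cocycles m) := by
      rw [LinearEquiv.symm_apply_eq]
      apply Subtype.ext
      rw [AlgEquiv.coe_ofBijective, truncatedToCenter_mk, map_pow, Polynomial.aeval_X]
      rfl
    rw [e]
    exact Submodule.mem_map_of_mem (powCochain_mem_homogeneous m)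

end Graded

end RedottedWebster

end

open RedottedWebster in
theorem mainTheorem7 (k : Type*) [Field k] (n : ℕ) (hn : 1 ≤ n) :
    -- the projective bimodule resolution of length two
    (∃ (f₂ : P2 k n →ₗ[Env k n] P1 k n) (f₁ : P1 k n →ₗ[Env k n] P0 k n)
        (ε : P0 k n →ₗ[Env k n] AShriek k n),
      (∀ p, f₂ (gen2 k p) = f2value k p) ∧
      (∀ p, f₁ (genUp k p) = actL k (up k p) • gen0 k (lo p) - actR k (up k p) • gen0 k (hi p)) ∧
      (∀ p, f₁ (genDown k p) =
        actL k (down k p) • gen0 k (hi p) - actR k (down k p) • gen0 k (lo p)) ∧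
      (∀ i, ε (gen0 k i) = vert k i) ∧
      Module.Projective (Env k n) (P2 k n) ∧ Module.Projective (Env k n) (P1 k n) ∧
      Module.Projective (Env k n) (P0 k n) ∧
      Function.Injective f₂ ∧ Function.Exact f₂ f₁ ∧ Function.Exact f₁ ε ∧
      Function.Surjective ε ∧
      -- with generators in degrees 2, 1 and 0 the maps preserve degrees
      (∀ (d : ℤ) (z : P2 k n), (∀ i, (z i : Env k n) ∈ envGrading k n d) →
        (∀ i, ((f₂ z).1 i : Env k n) ∈ envGrading k n (d + 1)) ∧
        (∀ i, ((f₂ z).2 i : Env k n) ∈ envGrading k n (d + 1))) ∧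
      (∀ (d : ℤ) (z : P1 k n), (∀ i, (z.1 i : Env k n) ∈ envGrading k n d) →
        (∀ i, (z.2 i : Env k n) ∈ envGrading k n d) →
        ∀ i, (f₁ z i : Env k n) ∈ envGrading k n (d + 1)) ∧
      (∀ (d : ℤ) (z : P0 k n), (∀ i, (z i : Env k n) ∈ envGrading k n d) →
        ε z ∈ pathGrading k n d)) ∧
    -- the algebra and its Hochschild cohomology are graded
    DirectSum.IsInternal (pathGrading k n) ∧
    (∀ m : ℕ, DirectSum.IsInternal (HHgr (pathGrading k n) m)) ∧
    -- vanishing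
    (∀ m : ℕ, 3 ≤ m → Subsingleton (HH k (AShriek k n) m)) ∧
    -- degree zero, as a graded algebra
    (∃ Φ : (Polynomial k ⧸ Ideal.span {(Polynomial.X : Polynomial k) ^ n}) ≃ₐ[k]
        Subalgebra.center k (AShriek k n),
      (Φ (Ideal.Quotient.mk _ Polynomial.X) : AShriek k n) = centralC k n ∧
      ∀ m : ℕ, (HHzeroEquiv k (AShriek k n)).symm (Φ (Ideal.Quotient.mk _ (Polynomial.X ^ m))) ∈
        HHgr (pathGrading k n) 0 (2 * m)) ∧
    (∀ m : ℕ, m < n → Nonempty (HHgr (pathGrading k n) 0 (2 * m) ≃ₗ[k] k)) ∧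
    (∀ j : ℤ, (¬ ∃ m : ℕ, m < n ∧ j = 2 * m) → HHgr (pathGrading k n) 0 j = ⊥) ∧
    -- degree one
    (∀ m : ℕ, m + 2 ≤ n → Nonempty (HHgr (pathGrading k n) 1 (2 * m) ≃ₗ[k] k)) ∧
    (∀ j : ℤ, (¬ ∃ m : ℕ, m + 2 ≤ n ∧ j = 2 * m) → HHgr (pathGrading k n) 1 j = ⊥) ∧
    -- degree two
    Nonempty (HHgr (pathGrading k n) 2 (-2) ≃ₗ[k] (Fin (n - 1) → k)) ∧
    (∀ j : ℤ, j ≠ -2 → HHgr (pathGrading k n) 2 j = ⊥) ∧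
    (∀ (μ : Fin (n - 1) → Cochain k (AShriek k n) 2) (hμ : ∀ p, IsMu k p (μ p)),
      LinearIndependent k (fun p => HH.mk (μ p) (hμ p).cocycle) ∧
      Submodule.span k (Set.range fun p => HH.mk (μ p) (hμ p).cocycle) = ⊤) ∧
    -- existence of the cocycles, and the deformation
    (∃ (π : Web k n →ₐ[k] AShriek k n) (s : AShriek k n →ₗ[k] Web k n)
        (μ : Fin n → Cochain k (AShriek k n) 2),
      IsDeformation k π s μ ∧ ∀ p : Fin (n - 1), IsMu k p (μ (hi p))) := by
  have hT := HH_two_dualBasis (fun p => deformCochain k (hi p)) (isMu_deformCochain (n := n))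
  refine ⟨bimodule_resolution k n, (pathGrading_dualBasis k n).isInternal, isInternal_HHgr k n,
    subsingleton_HH k n, center_equiv k n, fun m hm => ?_, fun j hj => ?_, fun m hm => ?_,
    fun j hj => ?_, hT.equiv_of_const fun _ => rfl, fun j hj => hT.eq_bot fun _ => hj,
    fun μ hμ => ⟨(HH_two_dualBasis μ hμ).linearIndependent, (HH_two_dualBasis μ hμ).span_eq_top⟩,
    webProj k n, webSection k n, deformCochain k, isDeformation_web, isMu_deformCochain⟩
  · exact (HH_zero_dualBasis k n).equiv_of_injective
      (fun s t h => Fin.ext (by simpa using h)) ⟨m, hm⟩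
  · exact (HH_zero_dualBasis k n).eq_bot fun t h => hj ⟨t, t.isLt, h⟩
  · exact (HH_one_dualBasis k n).equiv_of_injective
      (fun s t h => Fin.ext (by simpa using h)) ⟨m, by omega⟩
  · exact (HH_one_dualBasis k n).eq_bot fun t h => hj ⟨t, by omega, h⟩
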